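/- **Setting.** Fix $\varphi_0\in\mathscr S(\mathbb R^n)$ with $\operatorname{supp}\widehat{\varphi_0}\subset\{2^{-1}\le|\xi|\le 2\}$, $0\le\widehat{\varphi_0}\le 1$ and $\sum_{j\in\mathbb Z}\widehat{\varphi_0}(2^{-j}\xi)=1$ for $\xi\ne0$, and put $\Delta_jg=\mathscr F^{-1}[\widehat{\varphi_0}(2^{-j}\cdot)\widehat g]$. For $s\in\mathbb R$, let $\dot B^s_{p,q}(\mathbb R^n)$ be the space of all $g\in\mathscr S'(\mathbb R^n)/\mathscr P(\mathbb R^n)$ (tempered distributions modulo polynomials) with $\|g\|_{\dot B^s_{p,q}}=\big\|\{2^{sj}\|\Delta_jg\|_{L^p}\}_{j\in\mathbb Z}\big\|_{\ell^q}<\infty$. For an interval $I$ let $\|F\|_{\widetilde{L^\infty}(I;\dot B^s_{p,q})}=\big\|\{2^{sj}\|\Delta_jF\|_{L^\infty(I;L^p)}\}_{j\in\mathbb Z}\big\|_{\ell^q}$, and let $\widetilde C(I;\dot B^s_{p,q})$ be the space of all $F\in C(I;\dot B^s_{p,q})$ for which this norm is finite; when $q=\infty$ and $0 \in I=[0,\infty)$,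 continuity at the time $t=0$ is understood in the weak-$*$ sense (at $t>0$ it is always continuity in norm). All fields are $\mathbb R^n$-valued. With $\mathbb P=I+\nabla\operatorname{div}(-\Delta)^{-1}$, consider $$\partial_tu-\Delta u+\mathbb P\operatorname{div}(u\otimes u)=\mathbb Pf,\qquad \operatorname{div}u=0,\qquad u(0)=a \qquad (\ast)$$ on $(0,\infty)\times\mathbb R^n$. A solution is a divergence-free $u$ with $$u(t)=e^{t\Delta}a+\int_0^te^{(t-\tau)\Delta}\mathbb Pf(\tau)\,d\tau-\int_0^te^{(t-\tau)\Delta}\mathbb P\operatorname{div}(u\otimes u)(\tau)\,d\tau$$ in $\mathscr S'/\mathscr P$ for all $t\ge0$, where products are defined by the Littlewood–Paley decomposition, $gh=\lim_{N\to\infty}\big(\sum_{|k|\le N}\Delta_kg\big)\big(\sum_{|l|\le N}\Delta_lh\big)$ in $\mathscr S'$. **Proposition.** Let $n\ge3$, $1\le p<n$ and $1\le q\le\infty$. There exist constants $\varepsilon,C>0$, depending only on $n,p,q$ (and on the fixed $\varphi_0$), such that if $a\in\dot B^{n/p-1}_{p,q}(\mathbb R^n)$ with $\operatorname{div}a=0$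 and $f\in\widetilde C((0,\infty);\dot B^{n/p-3}_{p,q}(\mathbb R^n))$ satisfy $$\|a\|_{\dot B^{n/p-1}_{p,q}}+\|f\|_{\widetilde{L^\infty}(0,\infty;\dot B^{n/p-3}_{p,q})}\le\varepsilon,$$ then $(\ast)$ has a solution $u\in\widetilde C([0,\infty);\dot B^{n/p-1}_{p,q}(\mathbb R^n))$ with $$\|u\|_{\widetilde{L^\infty}(0,\infty;\dot B^{n/p-1}_{p,q})}\le C\Big(\|a\|_{\dot B^{n/p-1}_{p,q}}+\|f\|_{\widetilde{L^\infty}(0,\infty;\dot B^{n/p-3}_{p,q})}\Big),$$ and $u$ is the only solution in $\widetilde C([0,\infty);\dot B^{n/p-1}_{p,q}(\mathbb R^n))$ that satisfies this estimate; if $q<\infty$, it is the only solution in $\widetilde C([0,\infty);\dot B^{n/p-1}_{p,q}(\mathbb R^n))$ at all. If, moreover, $q<\infty$ and $\lim_{t\to\infty}\|f(t)\|_{\dot B^{n/p-3}_{p,q}}=0$, then $\lim_{t\to\infty}\|u(t)\|_{\dot B^{n/p-1}_{p,q}}=0$. -/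

import Mathlib

open MeasureTheory Filter Topology Set
open scoped ENNReal SchwartzMap ContDiff LineDeriv

noncomputable section

namespace ForcedNS

/-- The space `ℝⁿ` with its Euclidean norm. -/
abbrev Space (n : ℕ) : Type := EuclideanSpace ℝ (Fin n)

/-- Scalar tempered distributions on `ℝⁿ`. -/
abbrev TDist (n : ℕ) : Type := 𝓢'(Space n, ℂ)

/-- Vector fields on `ℝⁿ` whose components are tempered distributions. Elements of `𝓢'/𝓟` are
handled through representatives; every notion below is insensitive to adding polynomials. -/
abbrev VDist (n : ℕ) : Type := Fin n → TDist n

/-! ### Working modulo polynomials -/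

/-- The pairing `∫ P(x) φ(x) dx` of a polynomial with a Schwartz function. -/
def polyPairing {n : ℕ} (P : MvPolynomial (Fin n) ℂ) (φ : 𝓢(Space n, ℂ)) : ℂ :=
  ∫ x, MvPolynomial.eval (fun i => ((x i : ℝ) : ℂ)) P * φ x

/-- Equality in `𝓢'/𝓟`: the two distributions differ by a polynomial. -/
def EqModPoly {n : ℕ} (S T : TDist n) : Prop :=
  ∃ P : MvPolynomial (Fin n) ℂ, ∀ φ : 𝓢(Space n, ℂ), S φ - T φ = polyPairing P φ

/-- A class in `𝓢'/𝓟` is real if it has a real-valued representative, i.e. one that takes real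
values on real-valued test functions. -/
def IsRealModPoly {n : ℕ} (T : TDist n) : Prop :=
  ∃ S : TDist n, EqModPoly T S ∧
    ∀ φ : 𝓢(Space n, ℂ), (∀ x, (φ x).im = 0) → (S φ).im = 0

/-- `div v = 0` in `𝓢'/𝓟`. -/
def DivFree {n : ℕ} (v : VDist n) : Prop :=
  EqModPoly (∑ i, ∂_{(EuclideanSpace.single i (1 : ℝ) : Space n)} (v i)) 0

/-- Schwartz functions all of whose moments vanish (the test functions for `𝓢'/𝓟`). -/
def MomentFree {n : ℕ} (φ : 𝓢(Space n, ℂ)) : Prop :=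
  ∀ P : MvPolynomial (Fin n) ℂ, polyPairing P φ = 0

/-! ### Littlewood–Paley decomposition -/

/-- `ψ` is the Fourier transform `φ̂₀` of a Littlewood–Paley function `φ₀`. -/
structure IsLittlewoodPaley {n : ℕ} (ψ : Space n → ℝ) : Prop where
  smooth : ContDiff ℝ ∞ ψ
  support_subset : Function.support ψ ⊆ {ξ | 2⁻¹ ≤ ‖ξ‖ ∧ ‖ξ‖ ≤ 2}
  nonneg : ∀ ξ, 0 ≤ ψ ξ
  le_one : ∀ ξ, ψ ξ ≤ 1
  hasSum : ∀ ξ, ξ ≠ 0 → HasSum (fun j : ℤ => ψ ((2 : ℝ) ^ (-j) • ξ)) 1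

/-- The Fourier multiplier `T ↦ 𝓕⁻¹[m 𝓕 T]` on tempered distributions, for a real symbol. -/
def mult {n : ℕ} (m : Space n → ℝ) (T : TDist n) : TDist n :=
  TemperedDistribution.fourierMultiplierCLM ℂ (fun ξ => ((m ξ : ℝ) : ℂ)) T

/-- The dyadic block `Δ_j T = 𝓕⁻¹[ψ(2⁻ʲ ξ) 𝓕 T]`. -/
def block {n : ℕ} (ψ : Space n → ℝ) (j : ℤ) (T : TDist n) : TDist n :=
  mult (fun ξ => ψ ((2 : ℝ) ^ (-j) • ξ)) T

/-- The tempered distribution `T` is given by integration against the function `g`. -/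
def IsRep {n : ℕ} (T : TDist n) (g : Space n → ℂ) : Prop :=
  ∀ φ : 𝓢(Space n, ℂ), Integrable (fun x => g x * φ x) ∧ T φ = ∫ x, g x * φ x

/-- The `Lᵖ` norm of a tempered distribution (`∞` if it is not a function in `Lᵖ`; the
representing function is unique almost everywhere). -/
def distLpNorm {n : ℕ} (p : ℝ) (T : TDist n) : ℝ≥0∞ :=
  ⨅ (g : Space n → ℂ) (_ : IsRep T g), eLpNorm g (ENNReal.ofReal p) volume

/-- The `ℓ^q(ℤ)` norm of a sequence in `[0, ∞]`. -/
def lqNorm (q : ℝ≥0∞) (c : ℤ → ℝ≥0∞) : ℝ≥0∞ :=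
  if q = ⊤ then ⨆ j, c j else (∑' j, c j ^ q.toReal) ^ (1 / q.toReal)

/-- The weight `2^{sj}`. -/
def dyadicWeight (s : ℝ) (j : ℤ) : ℝ≥0∞ := ENNReal.ofReal ((2 : ℝ) ^ (s * (j : ℝ)))

/-- The norm of `Ḃ^s_{p,q}(ℝⁿ)`, for a scalar distribution. -/
def besovNorm {n : ℕ} (ψ : Space n → ℝ) (s p : ℝ) (q : ℝ≥0∞) (T : TDist n) : ℝ≥0∞ :=
  lqNorm q fun j => dyadicWeight s j * distLpNorm p (block ψ j T)

/-- The norm of `Ḃ^s_{p,q}(ℝⁿ)`, for a vector field (sum over the components). -/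
def vBesovNorm {n : ℕ} (ψ : Space n → ℝ) (s p : ℝ) (q : ℝ≥0∞) (v : VDist n) : ℝ≥0∞ :=
  ∑ i, besovNorm ψ s p q (v i)

/-- The norm of the Chemin–Lerner space `L̃^∞(I; Ḃ^s_{p,q}(ℝⁿ))`, for a vector field (sum over
the components). -/
def tildeNorm {n : ℕ} (ψ : Space n → ℝ) (I : Set ℝ) (s p : ℝ) (q : ℝ≥0∞) (F : ℝ → VDist n) :
    ℝ≥0∞ :=
  ∑ i, lqNorm q fun j =>
    dyadicWeight s j * essSup (fun t => distLpNorm p (block ψ j (F t i))) (volume.restrict I)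

/-- `F ∈ C̃(I; Ḃ^s_{p,q}) = C(I; Ḃ^s_{p,q}) ∩ L̃^∞(I; Ḃ^s_{p,q})`, with continuity for the norm. -/
structure MemTildeC {n : ℕ} (ψ : Space n → ℝ) (I : Set ℝ) (s p : ℝ) (q : ℝ≥0∞)
    (F : ℝ → VDist n) : Prop where
  mem : ∀ t ∈ I, vBesovNorm ψ s p q (F t) < ⊤
  continuous : ∀ t₀ ∈ I,
    Tendsto (fun t => vBesovNorm ψ s p q (F t - F t₀)) (𝓝[I] t₀) (𝓝 0)
  bounded : tildeNorm ψ I s p q F < ⊤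

/-- The space `C̃([0,∞); Ḃ^s_{p,q})`. For `q < ∞` this is `MemTildeC` on `[0,∞)`. For `q = ∞`,
where the heat semigroup is not strongly continuous at `t = 0`, continuity at the single time
`t = 0` is understood in the weak-* sense; it is for the norm at all positive times. -/
def MemTildeCZero {n : ℕ} (ψ : Space n → ℝ) (s p : ℝ) (q : ℝ≥0∞) (F : ℝ → VDist n) : Prop :=
  (q ≠ ⊤ → MemTildeC ψ (Ici 0) s p q F) ∧
  (q = ⊤ → MemTildeC ψ (Ioi 0) s p q F ∧ vBesovNorm ψ s p q (F 0) < ⊤ ∧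
    ∀ φ : 𝓢(Space n, ℂ), MomentFree φ →
      ∀ i, Tendsto (fun t => F t i φ) (𝓝[>] 0) (𝓝 (F 0 i φ)))

/-! ### The forced Navier–Stokes equations -/

/-- The partial sum `∑_{|j| ≤ N} Δ_j T`. -/
def partialSum {n : ℕ} (ψ : Space n → ℝ) (N : ℕ) (T : TDist n) : TDist n :=
  ∑ j ∈ Finset.Icc (-(N : ℤ)) (N : ℤ), block ψ j T

/-- `W` is the product `S T`, defined by Littlewood–Paley decomposition as
`∑_{k,l} Δ_k S Δ_l T`: the limit in `𝓢'` of the pointwise products of the (smooth) functions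
`∑_{|k| ≤ N} Δ_k S` and `∑_{|l| ≤ N} Δ_l T`. -/
def IsProduct {n : ℕ} (ψ : Space n → ℝ) (S T W : TDist n) : Prop :=
  ∃ g h : ℕ → Space n → ℂ,
    (∀ N, IsRep (partialSum ψ N S) (g N)) ∧ (∀ N, IsRep (partialSum ψ N T) (h N)) ∧
    ∀ φ : 𝓢(Space n, ℂ), (∀ N, Integrable (fun x => g N x * h N x * φ x)) ∧
      Tendsto (fun N => ∫ x, g N x * h N x * φ x) atTop (𝓝 (W φ))

/-- The heat semigroup `e^{tΔ}` (the symbol of `Δ` is `-(2π)²|ξ|²`). -/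
def heat {n : ℕ} (t : ℝ) (T : TDist n) : TDist n :=
  mult (fun ξ => Real.exp (-((2 * Real.pi) ^ 2 * t * ‖ξ‖ ^ 2))) T

/-- The dyadic block `Δ_j ℙ g` of the Helmholtz projection `ℙ = I + ∇ div (-Δ)⁻¹`, whose symbol is
`δ_{ik} - ξ_i ξ_k / |ξ|²`. -/
def lerayBlock {n : ℕ} (ψ : Space n → ℝ) (j : ℤ) (g : VDist n) : VDist n := fun i =>
  ∑ k, mult (fun ξ => ψ ((2 : ℝ) ^ (-j) • ξ) *
    ((if i = k then 1 else 0) - ξ i * ξ k / ‖ξ‖ ^ 2)) (g k)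

/-- The divergence of a matrix field, `(div W)_k = ∑_l ∂_l W_{kl}`. -/
def matDiv {n : ℕ} (W : Fin n → Fin n → TDist n) : VDist n := fun k =>
  ∑ l, ∂_{(EuclideanSpace.single l (1 : ℝ) : Space n)} (W k l)

/-- `u` is a (global, mild) real-valued solution to
`∂ₜu - Δu + ℙ div (u ⊗ u) = ℙ f`, `div u = 0`, `u(0) = a`, that is,
`u(t) = e^{tΔ} a + ∫₀ᵗ e^{(t-τ)Δ} ℙ (f - div (u ⊗ u))(τ) dτ` in `𝓢'/𝓟` for all `t ≥ 0`. The
identity in `𝓢'/𝓟` is expressed through its dyadic blocks, and the integral is taken in `𝓢'`. -/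
structure IsSolution {n : ℕ} (ψ : Space n → ℝ) (a : VDist n) (f u : ℝ → VDist n) : Prop where
  real : ∀ t, 0 ≤ t → ∀ i, IsRealModPoly (u t i)
  divFree : ∀ t, 0 ≤ t → DivFree (u t)
  initial : ∀ i, EqModPoly (u 0 i) (a i)
  mild : ∃ W : ℝ → Fin n → Fin n → TDist n,
    (∀ τ, 0 < τ → ∀ k l, IsProduct ψ (u τ k) (u τ l) (W τ k l)) ∧
    ∀ (j : ℤ) (t : ℝ), 0 ≤ t → ∀ (i : Fin n) (φ : 𝓢(Space n, ℂ)),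
      IntervalIntegrable
        (fun τ => heat (t - τ) (lerayBlock ψ j (f τ - matDiv (W τ)) i) φ) volume 0 t ∧
      block ψ j (u t i) φ = heat t (block ψ j (a i)) φ +
        ∫ τ in (0 : ℝ)..t, heat (t - τ) (lerayBlock ψ j (f τ - matDiv (W τ)) i) φ

end ForcedNS

end

noncomputable section

namespace ForcedNS

/-! ### The `ℓ^q` norm on `ℤ` -/

section SequenceNorm

variable {q : ℝ≥0∞}

/-! Everything is read off the weighted dyadic blocks u_j = 2^{(n/p-1)j} Δ_j u in L^p. A path in the
critical Besov space becomes a path of sequences, measured by the ℓ^q norm over j of suprema in time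
(`pathNorm`), and the mild equation becomes u_j(t) = A_j(t) - ∫₀ᵗ H_j(t-τ) M(u,u)_j(τ) dτ, where A
collects the heat flow of a and the Duhamel integral of f.

Two estimates carry the argument. First, H_j(σ) is 4^j times the Leray-projected heat operator near
frequency 2^j, the factor 4^j being the gap of two derivatives between the spaces of u and of f. Its
norm is at most C 4^j/(1+4^jσ)², whose integral in σ is at most C for every j. Hence the Duhamel
integral loses nothing in L^∞ in time (`DuhamelKernel.pathNorm_duhamel_le`). Second, M is div(u ⊗ v)
in weighted blocks, and its entry of output frequency j and input frequencies k, l is bounded by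
w(k-j) w(l-j) with w summable (`exists_trilinear_bound`). If one input frequency dominates, the
output is comparable to it and the lower one gains a factor 2 per octave by Bernstein's inequality;
if k and l are comparable, Hölder's and Bernstein's inequalities gain because n > 2 and n > p.
Young's inequality on ℤ then makes the quadratic term bounded, and Picard iteration gives small
solutions (`exists_quadratic_fixedPoint`).

Two small solutions agree by absorption (`pathNorm_sub_eq_zero_of_small`). For q < ∞ the difference
of two solutions tends to zero in norm at the first time of disagreement, by dominated convergence
in ℓ^q, so only one of them has to be small (`eq_of_initial_eq`). Decay as t → ∞ holds block by
block along the iteration and passes to the norm in the same way.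

The passage back to distributions rests on absolute convergence of the series of blocks in L²(|φ|
dx) for every Schwartz function φ (`IsAnnular.exists_tame`): it realizes sequences in 𝓢' itself and
identifies the Littlewood–Paley product with a pointwise product (`Tame.exists_realization`,
`Tame.exists_product`). Conversely, a distribution with vanishing blocks has its Fourier transform
supported at the origin and is a polynomial (`eqModPoly_zero_of_blocks`). The iteration carries
along the closed condition `RealBlocks`, which says that a sequence does come from a real
distribution; it is what identifies M(u,u) with the divergence of a genuine product. -/

theorem lqNorm_eq_eLpNorm (hq : 1 ≤ q) (c : ℤ → ℝ≥0∞) :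
    lqNorm q c = eLpNorm c q Measure.count := by
  have h0 : q ≠ 0 := (zero_lt_one.trans_le hq).ne'
  unfold lqNorm
  split_ifs with h
  · simp [h, eLpNorm_exponent_top]
  · rw [eLpNorm_eq_lintegral_rpow_enorm_toReal h0 h, lintegral_count]
    simp

theorem lqNorm_mono {c d : ℤ → ℝ≥0∞} (h : ∀ j, c j ≤ d j) : lqNorm q c ≤ lqNorm q d := by
  unfold lqNorm
  split_ifs
  · exact iSup_mono h
  · gcongr with j
    exact h j

theorem lqNorm_add_le (hq : 1 ≤ q) (c d : ℤ → ℝ≥0∞) :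
    lqNorm q (fun j => c j + d j) ≤ lqNorm q c + lqNorm q d := by
  simp only [lqNorm_eq_eLpNorm hq]
  exact eLpNorm_add_le (f := c) (g := d)
    (measurable_of_countable _).aestronglyMeasurable
    (measurable_of_countable _).aestronglyMeasurable hq

theorem lqNorm_zero (hq : 1 ≤ q) : lqNorm q (fun _ => 0) = 0 := by
  rw [lqNorm_eq_eLpNorm hq]
  exact eLpNorm_zero'

theorem le_lqNorm (hq : 1 ≤ q) (c : ℤ → ℝ≥0∞) (j : ℤ) : c j ≤ lqNorm q c := by
  rw [lqNorm_eq_eLpNorm hq]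
  exact enorm_le_eLpNorm_count c j (zero_lt_one.trans_le hq).ne'

theorem lqNorm_const_mul (hq : 1 ≤ q) (a : ℝ≥0∞) (c : ℤ → ℝ≥0∞) :
    lqNorm q (fun j => a * c j) = a * lqNorm q c := by
  unfold lqNorm
  split_ifs with h
  · exact (ENNReal.mul_iSup _ _).symm
  · have h1 : 0 < q.toReal := ENNReal.toReal_pos (zero_lt_one.trans_le hq).ne' h
    simp_rw [ENNReal.mul_rpow_of_nonneg _ _ h1.le]
    rw [ENNReal.tsum_mul_left, ENNReal.mul_rpow_of_nonneg _ _ (by positivity),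
      ← ENNReal.rpow_mul, mul_one_div_cancel h1.ne', ENNReal.rpow_one]

theorem lqNorm_shift (c : ℤ → ℝ≥0∞) (m : ℤ) : lqNorm q (fun j => c (j + m)) = lqNorm q c := by
  unfold lqNorm
  split_ifs with h
  · exact (Equiv.addRight m).iSup_comp (g := c)
  · rw [(Equiv.addRight m).tsum_eq (fun j => c j ^ q.toReal) |>.symm]
    rfl

theorem lqNorm_finset_sum_le (hq : 1 ≤ q) {ι : Type*} (s : Finset ι) (f : ι → ℤ → ℝ≥0∞) :
    lqNorm q (fun j => ∑ i ∈ s, f i j) ≤ ∑ i ∈ s, lqNorm q (f i) := by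
  classical
  induction s using Finset.induction_on with
  | empty => simp [lqNorm_zero hq]
  | insert a s ha ih =>
    simp only [Finset.sum_insert ha]
    exact (lqNorm_add_le hq _ _).trans (add_le_add le_rfl ih)

/-- Fatou's lemma for a general filter: an ℓ^q bound amounts to bounds on all finite partial sums of
q-th powers, or on all entries when q = ∞, and each of these is a closed condition. Applied to the
filter of finite sets it gives the infinite triangle inequality. -/
theorem lqNorm_le_of_tendsto {ι : Type*} {l : Filter ι} [l.NeBot] (hq : 1 ≤ q)
    {f : ι → ℤ → ℝ≥0∞} {c : ℤ → ℝ≥0∞} {B : ℝ≥0∞}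
    (hf : ∀ j, Tendsto (fun i => f i j) l (𝓝 (c j))) (hB : ∀ᶠ i in l, lqNorm q (f i) ≤ B) :
    lqNorm q c ≤ B := by
  by_cases h : q = ⊤
  · unfold lqNorm
    rw [if_pos h]
    refine iSup_le fun j => le_of_tendsto (hf j) ?_
    filter_upwards [hB] with i hi using (le_lqNorm hq (f i) j).trans hi
  · have h1 : 0 < q.toReal := ENNReal.toReal_pos (zero_lt_one.trans_le hq).ne' h
    have key : ∀ (d : ℤ → ℝ≥0∞), lqNorm q d ≤ B ↔ ∀ s : Finset ℤ,
        ∑ j ∈ s, d j ^ q.toReal ≤ B ^ q.toReal := by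
      intro d
      unfold lqNorm
      rw [if_neg h, one_div, ENNReal.rpow_inv_le_iff h1, ENNReal.tsum_eq_iSup_sum, iSup_le_iff]
    rw [key]
    intro s
    refine le_of_tendsto (tendsto_finsetSum s fun j _ =>
      ((ENNReal.continuous_rpow_const (y := q.toReal)).tendsto _).comp (hf j)) ?_
    filter_upwards [hB] with i hi using (key _).1 hi s

theorem lqNorm_tsum_le (hq : 1 ≤ q) {ι : Type*} (f : ι → ℤ → ℝ≥0∞) :
    lqNorm q (fun j => ∑' i, f i j) ≤ ∑' i, lqNorm q (f i) :=
  lqNorm_le_of_tendsto (l := atTop) (f := fun (s : Finset ι) j => ∑ i ∈ s, f i j) hq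
    (fun _ => ENNReal.summable.hasSum)
    (Eventually.of_forall fun s => (lqNorm_finset_sum_le hq s f).trans (ENNReal.sum_le_tsum s))

/-- Young's inequality ℓ¹ * ℓ^q ⊂ ℓ^q: the convolution is a superposition of shifts of c, shifts are
isometries, and Minkowski's inequality applies. -/
theorem lqNorm_conv_le (hq : 1 ≤ q) (w c : ℤ → ℝ≥0∞) :
    lqNorm q (fun j => ∑' k, w (k - j) * c k) ≤ (∑' m, w m) * lqNorm q c := by
  have h : ∀ j, ∑' k, w (k - j) * c k = ∑' m, w m * c (j + m) := by
    intro j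
    rw [← (Equiv.addLeft j).tsum_eq (fun k => w (k - j) * c k)]
    simp
  simp_rw [h]
  refine (lqNorm_tsum_le hq _).trans ?_
  rw [← ENNReal.tsum_mul_right]
  refine ENNReal.tsum_le_tsum fun m => ?_
  rw [lqNorm_const_mul hq, lqNorm_shift]

/-- Dominated convergence in `ℓ^q` for `q < ∞`. -/
theorem tendsto_lqNorm_zero {ι : Type*} {l : Filter ι} [l.IsCountablyGenerated]
    (hq : 1 ≤ q) (hq' : q ≠ ⊤)
    {f : ι → ℤ → ℝ≥0∞} {d : ℤ → ℝ≥0∞} (hd : lqNorm q d < ⊤)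
    (hfd : ∀ᶠ i in l, ∀ j, f i j ≤ d j)
    (hf : ∀ j, Tendsto (fun i => f i j) l (𝓝 0)) :
    Tendsto (fun i => lqNorm q (f i)) l (𝓝 0) := by
  have h1 : 0 < q.toReal := ENNReal.toReal_pos (zero_lt_one.trans_le hq).ne' hq'
  have hd' : ∑' j, d j ^ q.toReal ≠ ⊤ := by
    unfold lqNorm at hd
    rw [if_neg hq'] at hd
    intro h
    rw [h, ENNReal.top_rpow_of_pos (by positivity)] at hd
    exact lt_irrefl _ hd
  have h2 : Tendsto (fun i => ∑' j, f i j ^ q.toReal) l (𝓝 0) := by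
    have := tendsto_lintegral_filter_of_dominated_convergence (μ := Measure.count) (l := l)
      (F := fun i (j : ℤ) => f i j ^ q.toReal) (f := fun _ => 0) (fun j => d j ^ q.toReal)
      (Eventually.of_forall fun i => measurable_of_countable _)
      (by filter_upwards [hfd] with i hi
          exact Eventually.of_forall fun j => by gcongr; exact hi j)
      (by rwa [lintegral_count])
      (Eventually.of_forall fun j => by
        have := ((ENNReal.continuous_rpow_const (y := q.toReal)).tendsto 0).comp (hf j)
        simpa [h1, Function.comp_def] using this)
    simpa [lintegral_count] using this
  have h3 := ((ENNReal.continuous_rpow_const (y := 1 / q.toReal)).tendsto 0).comp h2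
  have h4 : (0 : ℝ≥0∞) ^ (1 / q.toReal) = 0 := ENNReal.zero_rpow_of_pos (by positivity)
  rw [h4] at h3
  refine h3.congr fun i => ?_
  simp [lqNorm, if_neg hq']

end SequenceNorm

/-! ### An abstract quadratic Duhamel equation in sequence spaces -/

section Core

variable {V : Type*} [NormedAddCommGroup V]

/-- The Chemin–Lerner norm of a path of sequences. -/
def pathNorm (q : ℝ≥0∞) (I : Set ℝ) (u : ℝ → ℤ → V) : ℝ≥0∞ :=
  lqNorm q fun j => ⨆ t ∈ I, ‖u t j‖ₑ

/-- Paths with finite Chemin–Lerner norm which are continuous for `t > 0`, uniformly over the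
frequencies. -/
structure AdmPath (q : ℝ≥0∞) (u : ℝ → ℤ → V) : Prop where
  bounded : pathNorm q (Ioi 0) u < ⊤
  cont : ∀ t₀, 0 < t₀ → ∀ ε, 0 < ε → ∀ᶠ t in 𝓝 t₀, ∀ j, ‖u t j - u t₀ j‖ ≤ ε

variable {q : ℝ≥0∞} {I : Set ℝ}

theorem enorm_le_pathNorm (hq : 1 ≤ q) (u : ℝ → ℤ → V) {t : ℝ} (ht : t ∈ I) (j : ℤ) :
    ‖u t j‖ₑ ≤ pathNorm q I u :=
  (le_iSup₂ (f := fun t (_ : t ∈ I) => ‖u t j‖ₑ) t ht).trans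
    (le_lqNorm hq (fun j => ⨆ t ∈ I, ‖u t j‖ₑ) j)

theorem pathNorm_mono {I J : Set ℝ} (h : I ⊆ J) (u : ℝ → ℤ → V) :
    pathNorm q I u ≤ pathNorm q J u :=
  lqNorm_mono fun _ => biSup_mono fun _ ht => h ht

theorem pathNorm_add_le (hq : 1 ≤ q) (u v : ℝ → ℤ → V) :
    pathNorm q I (u + v) ≤ pathNorm q I u + pathNorm q I v := by
  refine le_trans (lqNorm_mono fun j => ?_) (lqNorm_add_le hq _ _)
  refine iSup₂_le fun t ht => (enorm_add_le _ _).trans (add_le_add ?_ ?_)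
  · exact le_iSup₂ (f := fun t (_ : t ∈ I) => ‖u t j‖ₑ) t ht
  · exact le_iSup₂ (f := fun t (_ : t ∈ I) => ‖v t j‖ₑ) t ht

theorem pathNorm_congr {u v : ℝ → ℤ → V} (h : ∀ t ∈ I, ∀ j, ‖u t j‖ₑ = ‖v t j‖ₑ) :
    pathNorm q I u = pathNorm q I v := by
  unfold pathNorm
  congr 1
  funext j
  exact iSup_congr fun t => iSup_congr fun ht => h t ht j

theorem pathNorm_sub_comm (u v : ℝ → ℤ → V) :
    pathNorm q I (u - v) = pathNorm q I (v - u) :=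
  pathNorm_congr fun t _ j => by
    simpa only [Pi.sub_apply, edist_eq_enorm_sub] using edist_comm (u t j) (v t j)

theorem pathNorm_sub_le (hq : 1 ≤ q) (u v : ℝ → ℤ → V) :
    pathNorm q I (u - v) ≤ pathNorm q I u + pathNorm q I v := by
  rw [sub_eq_add_neg]
  refine (pathNorm_add_le hq _ _).trans_eq ?_
  congr 1
  exact pathNorm_congr fun t _ j => by simp

theorem eq_of_pathNorm_eq_zero (hq : 1 ≤ q) {u v : ℝ → ℤ → V} (h : pathNorm q I (u - v) = 0)
    {t : ℝ} (ht : t ∈ I) (j : ℤ) : u t j = v t j := by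
  have := enorm_le_pathNorm hq (u - v) ht j
  rw [h] at this
  simpa [sub_eq_zero] using this

theorem AdmPath.norm_le (hq : 1 ≤ q) {u : ℝ → ℤ → V} (hu : AdmPath q u) {t : ℝ} (ht : 0 < t)
    (j : ℤ) : ‖u t j‖ ≤ (pathNorm q (Ioi 0) u).toReal := by
  rw [← toReal_enorm]
  exact ENNReal.toReal_mono hu.bounded.ne (enorm_le_pathNorm hq u ht j)

theorem AdmPath.sub (hq : 1 ≤ q) {u v : ℝ → ℤ → V} (hu : AdmPath q u) (hv : AdmPath q v) :
    AdmPath q (u - v) where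
  bounded := (pathNorm_sub_le hq u v).trans_lt (ENNReal.add_lt_top.2 ⟨hu.bounded, hv.bounded⟩)
  cont t₀ h₀ ε hε := by
    filter_upwards [hu.cont t₀ h₀ (ε / 2) (by positivity), hv.cont t₀ h₀ (ε / 2) (by positivity)]
      with t h1 h2 j
    calc ‖(u - v) t j - (u - v) t₀ j‖ = ‖(u t j - u t₀ j) - (v t j - v t₀ j)‖ := by
          simp only [Pi.sub_apply]; congr 1; abel
      _ ≤ ‖u t j - u t₀ j‖ + ‖v t j - v t₀ j‖ := norm_sub_le _ _
      _ ≤ ε := by linarith [h1 j, h2 j]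

theorem AdmPath.continuousOn {u : ℝ → ℤ → V} (hu : AdmPath q u) (j : ℤ) :
    ContinuousOn (fun t => u t j) (Ioi 0) := by
  intro t₀ h₀
  refine ContinuousAt.continuousWithinAt ?_
  rw [ContinuousAt, Metric.tendsto_nhds]
  intro ε hε
  filter_upwards [hu.cont t₀ h₀ (ε / 2) (by positivity)] with t ht
  rw [dist_eq_norm]
  linarith [ht j]

theorem AdmPath.congr {u v : ℝ → ℤ → V} (hu : AdmPath q u) (h : ∀ t, 0 < t → ∀ j, u t j = v t j) :
    AdmPath q v where
  bounded := by
    rw [← pathNorm_congr (u := u) fun t ht j => by rw [h t ht j]]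
    exact hu.bounded
  cont t₀ h₀ ε hε := by
    filter_upwards [hu.cont t₀ h₀ ε hε, lt_mem_nhds h₀] with t h1 h2 j
    rw [← h t h2 j, ← h t₀ h₀ j]
    exact h1 j

/-- Heine–Cantor for the path with values in functions on ℤ under uniform convergence: continuity
uniform in j becomes uniform in j and in time on compact subintervals of (0, ∞). -/
theorem AdmPath.uniform_on_Icc {u : ℝ → ℤ → V} (hu : AdmPath q u) {a b : ℝ} (ha : 0 < a)
    {ε : ℝ} (hε : 0 < ε) :
    ∃ η > 0, ∀ s ∈ Icc a b, ∀ s' ∈ Icc a b, |s - s'| < η → ∀ j, ‖u s j - u s' j‖ ≤ ε := by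
  have hc : ContinuousOn (fun t => UniformFun.ofFun (u t)) (Icc a b) := by
    intro t ht
    refine ContinuousAt.continuousWithinAt ?_
    rw [ContinuousAt, UniformFun.tendsto_iff_tendstoUniformly, Metric.tendstoUniformly_iff]
    intro δ hδ
    filter_upwards [hu.cont t (ha.trans_le ht.1) (δ / 2) (by positivity)] with s hs j
    have := hs j
    rw [dist_comm, dist_eq_norm]
    change ‖u s j - u t j‖ < δ
    linarith
  have huc := isCompact_Icc.uniformContinuousOn_of_continuous hc
  rw [UniformContinuousOn, Filter.tendsto_def] at huc
  have hmem := huc _ ((UniformFun.hasBasis_uniformity ℤ V).mem_of_mem (Metric.dist_mem_uniformity hε))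
  rw [Filter.mem_inf_principal, Metric.mem_uniformity_dist] at hmem
  obtain ⟨η, hη, h⟩ := hmem
  refine ⟨η, hη, fun s hs s' hs' hd j => ?_⟩
  have h2 := h (a := s) (b := s') hd ⟨hs, hs'⟩ j
  rw [← dist_eq_norm]
  exact le_of_lt h2

/-- Limits of rapidly Cauchy sequences of admissible paths. -/
theorem exists_admPath_limit [CompleteSpace V] (hq : 1 ≤ q) (s : ℕ → ℝ → ℤ → V)
    (hs : ∀ m, AdmPath q (s m)) {c : ℝ≥0∞} (hc : c ≠ ⊤)
    (h : ∀ m, pathNorm q (Ioi 0) (s (m + 1) - s m) ≤ c / 2 ^ m) :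
    ∃ u : ℝ → ℤ → V, AdmPath q u ∧
      ∀ m, pathNorm q (Ioi 0) (u - s m) ≤ 2 * c / 2 ^ m := by
  have hed : ∀ t, 0 < t → ∀ j m, edist (s m t j) (s (m + 1) t j) ≤ c / 2 ^ m := by
    intro t ht j m
    rw [edist_comm, edist_eq_enorm_sub]
    exact (enorm_le_pathNorm hq (s (m + 1) - s m) ht j).trans (h m)
  -- Nothing is known for t ≤ 0, where the limit path takes the default value 0.
  have hlim : ∀ t j, ∃ x, 0 < t → Tendsto (fun m => s m t j) atTop (𝓝 x) := by
    intro t j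
    by_cases ht : 0 < t
    · obtain ⟨x, hx⟩ := cauchySeq_tendsto_of_complete
        (cauchySeq_of_edist_le_geometric_two c hc (hed t ht j))
      exact ⟨x, fun _ => hx⟩
    · exact ⟨0, fun h => absurd h ht⟩
  choose u hu using hlim
  have hN : ∀ m, pathNorm q (Ioi 0) (u - s m) ≤ 2 * c / 2 ^ m := by
    intro m
    -- The telescoping is done in each block before the ℓ^q norm is taken: the supremum in t of the
    -- tail is at most the sum of the suprema of the increments, and Minkowski's inequality then
    -- sums the geometric bounds.
    have h1 : ∀ j, (⨆ t ∈ Ioi (0 : ℝ), ‖(u - s m) t j‖ₑ) ≤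
        ∑' i, ⨆ t ∈ Ioi (0 : ℝ), ‖(s (m + i + 1) - s (m + i)) t j‖ₑ := by
      intro j
      refine iSup₂_le fun t ht => ?_
      have := edist_le_tsum_of_edist_le_of_tendsto (f := fun m => s m t j) (a := u t j)
        (fun m => ⨆ t ∈ Ioi (0 : ℝ), ‖(s (m + 1) - s m) t j‖ₑ) (fun i => by
          rw [edist_comm, edist_eq_enorm_sub]
          exact le_iSup₂ (f := fun t (_ : t ∈ Ioi (0 : ℝ)) => ‖(s (i + 1) - s i) t j‖ₑ) t ht)
        (hu t j ht) m
      rw [edist_comm, edist_eq_enorm_sub] at this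
      exact this
    refine (lqNorm_mono h1).trans ((lqNorm_tsum_le hq _).trans ?_)
    calc ∑' i, pathNorm q (Ioi 0) (s (m + i + 1) - s (m + i))
        ≤ ∑' i : ℕ, c / 2 ^ m * 2⁻¹ ^ i := by
          refine ENNReal.tsum_le_tsum fun i => (h (m + i)).trans_eq ?_
          rw [pow_add, div_eq_mul_inv, div_eq_mul_inv, ENNReal.mul_inv (by simp) (by simp),
            mul_assoc, ENNReal.inv_pow]
          simp [ENNReal.inv_pow]
      _ = 2 * c / 2 ^ m := by
          rw [ENNReal.tsum_mul_left, ENNReal.tsum_geometric]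
          simp [div_eq_mul_inv]
          ring
  have hfin : ∀ m, 2 * c / 2 ^ m ≠ ⊤ := fun m =>
    ENNReal.div_ne_top (ENNReal.mul_ne_top (by simp) hc) (by simp)
  refine ⟨u, ⟨?_, ?_⟩, hN⟩
  · have : u = (u - s 0) + s 0 := by simp
    rw [this]
    exact (pathNorm_add_le hq _ _).trans_lt
      (ENNReal.add_lt_top.2 ⟨(hN 0).trans_lt (hfin 0).lt_top, (hs 0).bounded⟩)
  · intro t₀ h₀ ε hε
    have ht : Tendsto (fun m : ℕ => 2 * c / 2 ^ m) atTop (𝓝 0) := by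
      have h2 : Tendsto (fun m : ℕ => (2⁻¹ : ℝ≥0∞) ^ m) atTop (𝓝 0) :=
        ENNReal.tendsto_pow_atTop_nhds_zero_of_lt_one (by simp)
      have := ENNReal.Tendsto.const_mul (a := 2 * c) h2
        (Or.inr (ENNReal.mul_ne_top (by simp) hc))
      simpa [div_eq_mul_inv, ENNReal.inv_pow] using this
    obtain ⟨m, hm⟩ := (ht.eventually_lt_const (u := ENNReal.ofReal (ε / 3))
      (by simpa using hε)).exists
    have hb : ∀ t, 0 < t → ∀ j, ‖u t j - s m t j‖ ≤ ε / 3 := by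
      intro t ht j
      rw [← toReal_enorm]
      refine ENNReal.toReal_le_of_le_ofReal (by positivity) ?_
      exact (enorm_le_pathNorm hq (u - s m) ht j).trans ((hN m).trans (le_of_lt hm))
    filter_upwards [(hs m).cont t₀ h₀ (ε / 3) (by positivity), lt_mem_nhds h₀] with t h1 h2 j
    calc ‖u t j - u t₀ j‖
        = ‖(u t j - s m t j) + (s m t j - s m t₀ j) - (u t₀ j - s m t₀ j)‖ := by
          congr 1; abel
      _ ≤ ‖u t j - s m t j‖ + ‖s m t j - s m t₀ j‖ + ‖u t₀ j - s m t₀ j‖ :=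
          (norm_sub_le _ _).trans (add_le_add (norm_add_le _ _) le_rfl)
      _ ≤ ε := by linarith [hb t h2 j, hb t₀ h₀ j, h1 j]

end Core

/-! ### Bilinear forms on sequences with off-diagonal decay. -/

section Core

variable {V : Type*} [NormedAddCommGroup V]

/-- A family of biadditive maps `M j k l` on `V` with off-diagonal decay. -/
structure BilinearBlocks (V : Type*) [NormedAddCommGroup V] where
  toFun : ℤ → ℤ → ℤ → V → V → V
  w : ℤ → NNReal
  summable : Summable w
  sub_left : ∀ j k l u u' v, toFun j k l (u - u') v = toFun j k l u v - toFun j k l u' v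
  sub_right : ∀ j k l u v v', toFun j k l u (v - v') = toFun j k l u v - toFun j k l u v'
  bound : ∀ j k l u v, ‖toFun j k l u v‖ ≤ w (k - j) * w (l - j) * ‖u‖ * ‖v‖

/-- The bilinear map `(u, v) ↦ ∑ M j k l u_k v_l` on bounded sequences. -/
def BilinearBlocks.sum (M : BilinearBlocks V) (u v : ℤ → V) (j : ℤ) : V :=
  ∑' kl : ℤ × ℤ, M.toFun j kl.1 kl.2 (u kl.1) (v kl.2)

namespace BilinearBlocks

variable (M : BilinearBlocks V)

/-- The total mass of the weight. -/
def mass : ℝ := ∑' m, (M.w m : ℝ)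

theorem mass_nonneg : 0 ≤ M.mass := tsum_nonneg fun _ => NNReal.coe_nonneg _

theorem hasSum_weight (j : ℤ) : HasSum (fun k => (M.w (k - j) : ℝ)) M.mass := by
  have h : Summable fun m => (M.w m : ℝ) := NNReal.summable_coe.2 M.summable
  exact ((Equiv.subRight j).hasSum_iff (f := fun m => (M.w m : ℝ))).2 h.hasSum

theorem hasSum_weight_mul (j : ℤ) :
    HasSum (fun kl : ℤ × ℤ => (M.w (kl.1 - j) : ℝ) * M.w (kl.2 - j)) (M.mass * M.mass) :=
  (M.hasSum_weight j).mul (M.hasSum_weight j)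
    ((M.hasSum_weight j).summable.mul_of_nonneg (M.hasSum_weight j).summable
      (fun _ => NNReal.coe_nonneg _) (fun _ => NNReal.coe_nonneg _))

theorem ennreal_tsum_weight : ∑' m, (M.w m : ℝ≥0∞) = ENNReal.ofReal M.mass := by
  rw [mass, ENNReal.ofReal_tsum_of_nonneg (fun _ => NNReal.coe_nonneg _)
    (NNReal.summable_coe.2 M.summable)]
  simp

variable {M} {u u' v v' : ℤ → V} {A A' B B' : ℝ}

theorem norm_term_le (hu : ∀ k, ‖u k‖ ≤ A) (hv : ∀ k, ‖v k‖ ≤ B) (j : ℤ) (kl : ℤ × ℤ) :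
    ‖M.toFun j kl.1 kl.2 (u kl.1) (v kl.2)‖ ≤
      (M.w (kl.1 - j) : ℝ) * M.w (kl.2 - j) * (A * B) := by
  refine (M.bound _ _ _ _ _).trans ?_
  rw [mul_assoc ((M.w (kl.1 - j) : ℝ) * M.w (kl.2 - j))]
  have hA : 0 ≤ A := (norm_nonneg _).trans (hu 0)
  gcongr
  · exact hu _
  · exact hv _

theorem norm_sum_le (hu : ∀ k, ‖u k‖ ≤ A) (hv : ∀ k, ‖v k‖ ≤ B) (j : ℤ) :
    ‖M.sum u v j‖ ≤ M.mass ^ 2 * (A * B) := by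
  rw [pow_two]
  exact tsum_of_norm_bounded ((M.hasSum_weight_mul j).mul_right (A * B)) (norm_term_le hu hv j)

/-- The weight is a product of a function of k - j and one of l - j, so the double sum factors into
two convolutions. -/
theorem enorm_sum_le (j : ℤ) :
    ‖M.sum u v j‖ₑ ≤ (∑' k, (M.w (k - j) : ℝ≥0∞) * ‖u k‖ₑ) *
      ∑' l, (M.w (l - j) : ℝ≥0∞) * ‖v l‖ₑ := by
  refine enorm_tsum_le_tsum_enorm.trans ?_
  rw [← ENNReal.tsum_mul_right, ENNReal.tsum_prod' (f := fun kl : ℤ × ℤ => _)]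
  refine ENNReal.tsum_le_tsum fun k => ?_
  rw [← ENNReal.tsum_mul_left]
  refine ENNReal.tsum_le_tsum fun l => ?_
  have h : ‖M.toFun j k l (u k) (v l)‖₊ ≤ M.w (k - j) * M.w (l - j) * ‖u k‖₊ * ‖v l‖₊ :=
    M.bound j k l (u k) (v l)
  calc ‖M.toFun j k l (u k) (v l)‖ₑ
      ≤ ((M.w (k - j) * M.w (l - j) * ‖u k‖₊ * ‖v l‖₊ : NNReal) : ℝ≥0∞) := by
        rw [enorm_eq_nnnorm]; exact_mod_cast h
    _ = _ := by push_cast; simp only [enorm_eq_nnnorm]; ring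

/-- Only one factor has to carry the ℓ^q summability. The other is bounded in ℓ^∞, which contains
ℓ^q, and contributes the mass of w; the remaining convolution is handled by Young's inequality. -/
theorem pathNorm_sum_le {q : ℝ≥0∞} (hq : 1 ≤ q) (I : Set ℝ) (u v : ℝ → ℤ → V) :
    pathNorm q I (fun t => M.sum (u t) (v t)) ≤
      ENNReal.ofReal (M.mass ^ 2) * (pathNorm q I u * pathNorm q I v) := by
  set α := fun j => ⨆ t ∈ I, ‖u t j‖ₑ
  have h1 : ∀ j, (⨆ t ∈ I, ‖M.sum (u t) (v t) j‖ₑ) ≤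
      (ENNReal.ofReal M.mass * pathNorm q I v) * ∑' k, (M.w (k - j) : ℝ≥0∞) * α k := by
    intro j
    refine iSup₂_le fun t ht => (enorm_sum_le j).trans ?_
    rw [mul_comm]
    gcongr with k
    · calc ∑' l, (M.w (l - j) : ℝ≥0∞) * ‖v t l‖ₑ
          ≤ ∑' l, (M.w (l - j) : ℝ≥0∞) * pathNorm q I v := by
            gcongr with l
            exact enorm_le_pathNorm hq v ht l
        _ = ENNReal.ofReal M.mass * pathNorm q I v := by
            rw [ENNReal.tsum_mul_right, ← ennreal_tsum_weight,
              ← (Equiv.subRight j).tsum_eq (fun m => (M.w m : ℝ≥0∞))]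
            rfl
    · exact le_iSup₂ (f := fun t (_ : t ∈ I) => ‖u t k‖ₑ) t ht
  refine (lqNorm_mono h1).trans ?_
  rw [lqNorm_const_mul hq]
  refine (mul_le_mul_right (lqNorm_conv_le hq (fun m => (M.w m : ℝ≥0∞)) α) _).trans_eq ?_
  rw [ennreal_tsum_weight, pow_two, ENNReal.ofReal_mul M.mass_nonneg]
  change _ * (_ * pathNorm q I u) = _
  ring

variable [CompleteSpace V]

theorem summable_term (hu : ∀ k, ‖u k‖ ≤ A) (hv : ∀ k, ‖v k‖ ≤ B) (j : ℤ) :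
    Summable fun kl : ℤ × ℤ => M.toFun j kl.1 kl.2 (u kl.1) (v kl.2) :=
  Summable.of_norm_bounded ((M.hasSum_weight_mul j).mul_right (A * B)).summable
    (norm_term_le hu hv j)

theorem sum_sub_left (hu : ∀ k, ‖u k‖ ≤ A) (hu' : ∀ k, ‖u' k‖ ≤ A') (hv : ∀ k, ‖v k‖ ≤ B) (j : ℤ) :
    M.sum (u - u') v j = M.sum u v j - M.sum u' v j := by
  unfold sum
  rw [← (summable_term hu hv j).tsum_sub (summable_term hu' hv j)]
  simp only [Pi.sub_apply, M.sub_left]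

theorem sum_sub_right (hu : ∀ k, ‖u k‖ ≤ A) (hv : ∀ k, ‖v k‖ ≤ B) (hv' : ∀ k, ‖v' k‖ ≤ B') (j : ℤ) :
    M.sum u (v - v') j = M.sum u v j - M.sum u v' j := by
  unfold sum
  rw [← (summable_term hu hv j).tsum_sub (summable_term hu hv' j)]
  simp only [Pi.sub_apply, M.sub_right]

theorem sum_sub_sum (hu : ∀ k, ‖u k‖ ≤ A) (hu' : ∀ k, ‖u' k‖ ≤ A') (hv : ∀ k, ‖v k‖ ≤ B)
    (hv' : ∀ k, ‖v' k‖ ≤ B') (j : ℤ) :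
    M.sum u v j - M.sum u' v' j = M.sum (u - u') v j + M.sum u' (v - v') j := by
  rw [sum_sub_left hu hu' hv, sum_sub_right hu' hv hv']
  abel

theorem admPath_sum {q : ℝ≥0∞} (hq : 1 ≤ q) {u v : ℝ → ℤ → V} (hu : AdmPath q u)
    (hv : AdmPath q v) : AdmPath q (fun t => M.sum (u t) (v t)) where
  bounded := (pathNorm_sum_le hq _ u v).trans_lt
    (ENNReal.mul_lt_top ENNReal.ofReal_lt_top (ENNReal.mul_lt_top hu.bounded hv.bounded))
  cont t₀ h₀ ε hε := by
    set A := (pathNorm q (Ioi 0) u).toReal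
    set B := (pathNorm q (Ioi 0) v).toReal
    have hA : 0 ≤ A := ENNReal.toReal_nonneg
    have hB : 0 ≤ B := ENNReal.toReal_nonneg
    set δ := ε / (M.mass ^ 2 * (A + B) + 1) with hδ
    have hden : 0 < M.mass ^ 2 * (A + B) + 1 := by positivity
    have hδ0 : 0 < δ := by positivity
    filter_upwards [hu.cont t₀ h₀ δ hδ0, hv.cont t₀ h₀ δ hδ0, lt_mem_nhds h₀] with t h1 h2 h3 j
    rw [sum_sub_sum (hu.norm_le hq h3) (hu.norm_le hq h₀) (hv.norm_le hq h3) (hv.norm_le hq h₀)]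
    calc _ ≤ M.mass ^ 2 * (δ * B) + M.mass ^ 2 * (A * δ) :=
          (norm_add_le _ _).trans (add_le_add
            (norm_sum_le (fun k => h1 k) (hv.norm_le hq h3) j)
            (norm_sum_le (hu.norm_le hq h₀) (fun k => h2 k) j))
      _ = (M.mass ^ 2 * (A + B)) * δ := by ring
      _ ≤ (M.mass ^ 2 * (A + B) + 1) * δ := by gcongr; linarith
      _ = ε := by rw [hδ]; field_simp

end BilinearBlocks

end Core

/-! ### Duhamel integrals with frequency-localized parabolic kernels. -/

section Core

variable {V : Type*} [NormedAddCommGroup V] [NormedSpace ℝ V]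

/-- A family of operators with the (rescaled) bounds of the frequency-localised heat semigroup. -/
structure DuhamelKernel (V : Type*) [NormedAddCommGroup V] [NormedSpace ℝ V] where
  toFun : ℤ → ℝ → V →L[ℝ] V
  C : ℝ
  C_pos : 0 < C
  bound : ∀ j σ, 0 ≤ σ → ‖toFun j σ‖ ≤ C * ((4 : ℝ) ^ j / (1 + (4 : ℝ) ^ j * σ) ^ 2)
  lipschitz : ∀ j σ σ', 0 < σ → σ ≤ σ' → ‖toFun j σ' - toFun j σ‖ ≤ C * ((σ' - σ) / σ ^ 2)
  cont : ∀ j, ContinuousOn (toFun j) (Ici 0)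

namespace DuhamelKernel

variable (H : DuhamelKernel V)

/-- The Duhamel integral `∫₀ᵗ H_j(t - τ) F_j(τ) dτ`. -/
def duhamel (F : ℝ → ℤ → V) (t : ℝ) (j : ℤ) : V :=
  ∫ τ in (0 : ℝ)..t, H.toFun j (t - τ) (F τ j)

/-- The integrand is the derivative of -(1 + aσ)⁻¹, so its mass is at most 1 for every a. With a =
4^j this is maximal regularity in L^∞ of time for each block, uniformly in the frequency. -/
theorem integral_weight_le (a : ℝ) (ha : 0 < a) {t : ℝ} (ht : 0 ≤ t) :
    IntervalIntegrable (fun σ => a / (1 + a * σ) ^ 2) volume 0 t ∧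
    ∫ σ in (0 : ℝ)..t, a / (1 + a * σ) ^ 2 ≤ 1 := by
  have hpos : ∀ σ ∈ uIcc 0 t, 0 < 1 + a * σ := by
    intro σ hσ
    rw [uIcc_of_le ht] at hσ
    have := hσ.1
    positivity
  have hInt : IntervalIntegrable (fun σ => a / (1 + a * σ) ^ 2) volume 0 t := by
    refine ContinuousOn.intervalIntegrable ?_
    refine ContinuousOn.div (by fun_prop) (by fun_prop) fun σ hσ => ?_
    have := hpos σ hσ
    positivity
  refine ⟨hInt, ?_⟩
  have hd : ∀ σ ∈ uIcc 0 t, HasDerivAt (fun σ => -(1 + a * σ)⁻¹) (a / (1 + a * σ) ^ 2) σ := by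
    intro σ hσ
    have h1 : HasDerivAt (fun σ => 1 + a * σ) a σ := by
      simpa using ((hasDerivAt_id σ).const_mul a).const_add 1
    have h2 : HasDerivAt (fun σ => -(1 + a * σ)⁻¹) (-(-a / (1 + a * σ) ^ 2)) σ :=
      (h1.inv (hpos σ hσ).ne').neg
    rwa [neg_div, neg_neg] at h2
  rw [intervalIntegral.integral_eq_sub_of_hasDerivAt hd hInt]
  have := hpos t right_mem_uIcc
  have h3 : 0 < (1 + a * t)⁻¹ := by positivity
  simp
  linarith

/-- Since (1 + aσ)² ≥ aσ. It gives control of the kernel away from σ = 0 that does not see the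
frequency. -/
theorem weight_le_inv {a σ : ℝ} (ha : 0 < a) (hσ : 0 < σ) : a / (1 + a * σ) ^ 2 ≤ 1 / σ := by
  rw [div_le_div_iff₀ (by positivity) hσ]
  nlinarith [mul_pos ha hσ]

theorem norm_apply_le (j : ℤ) {σ : ℝ} (hσ : 0 ≤ σ) {x : V} {S : ℝ} (hx : ‖x‖ ≤ S) :
    ‖H.toFun j σ x‖ ≤ (4 : ℝ) ^ j / (1 + (4 : ℝ) ^ j * σ) ^ 2 * (H.C * S) := by
  have hC := H.C_pos
  calc ‖H.toFun j σ x‖ ≤ ‖H.toFun j σ‖ * ‖x‖ := (H.toFun j σ).le_opNorm x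
    _ ≤ H.C * ((4 : ℝ) ^ j / (1 + (4 : ℝ) ^ j * σ) ^ 2) * S := by
        gcongr
        exact H.bound j σ hσ
    _ = _ := by ring

theorem norm_integral_le (G : ℝ → V) (j : ℤ) {t : ℝ} (ht : 0 < t) {S : ℝ}
    (hG : ∀ τ ∈ Ioo 0 t, ‖G τ‖ ≤ S) :
    ‖∫ σ in (0 : ℝ)..t, H.toFun j σ (G σ)‖ ≤ H.C * S := by
  have hS : 0 ≤ S := (norm_nonneg _).trans (hG (t / 2) ⟨by positivity, by linarith⟩)
  obtain ⟨h1, h2⟩ := integral_weight_le ((4 : ℝ) ^ j) (by positivity) ht.le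
  calc _ ≤ ∫ σ in (0 : ℝ)..t, (4 : ℝ) ^ j / (1 + (4 : ℝ) ^ j * σ) ^ 2 * (H.C * S) := by
        refine intervalIntegral.norm_integral_le_of_norm_le ht.le ?_ (h1.mul_const _)
        -- The endpoint σ = t corresponds to the initial time τ = 0 of the path, where no bound is
        -- available.
        have hne : ∀ᵐ σ : ℝ, σ ≠ t := by simp [ae_iff]
        filter_upwards [hne] with σ hσ hσ'
        exact H.norm_apply_le j hσ'.1.le (hG σ ⟨hσ'.1, lt_of_le_of_ne hσ'.2 hσ⟩)
    _ ≤ 1 * (H.C * S) := by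
        rw [intervalIntegral.integral_mul_const]
        have := H.C_pos
        gcongr
    _ = _ := one_mul _

theorem duhamel_eq (F : ℝ → ℤ → V) (t : ℝ) (j : ℤ) :
    H.duhamel F t j = ∫ σ in (0 : ℝ)..t, H.toFun j σ (F (t - σ) j) := by
  have := intervalIntegral.integral_comp_sub_left (a := 0) (b := t)
    (fun σ => H.toFun j σ (F (t - σ) j)) t
  simpa [duhamel] using this

theorem norm_duhamel_le (F : ℝ → ℤ → V) (j : ℤ) {t : ℝ} (ht : 0 < t) {S : ℝ}
    (hF : ∀ τ ∈ Ioo 0 t, ‖F τ j‖ ≤ S) : ‖H.duhamel F t j‖ ≤ H.C * S := by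
  rw [duhamel_eq]
  exact H.norm_integral_le (fun σ => F (t - σ) j) j ht fun σ hσ =>
    hF _ ⟨by linarith [hσ.2], by linarith [hσ.1]⟩

/-- The Duhamel integral is causal, so the estimate localizes to any set of positive times that
contains, with each time, all earlier positive ones. The intervals (0, S) are needed for uniqueness.
-/
theorem pathNorm_duhamel_le {q : ℝ≥0∞} (hq : 1 ≤ q) {I : Set ℝ} (hI : ∀ t ∈ I, 0 < t)
    (hI' : ∀ t ∈ I, Ioo 0 t ⊆ I) (F : ℝ → ℤ → V) :
    pathNorm q I (H.duhamel F) ≤ ENNReal.ofReal H.C * pathNorm q I F := by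
  unfold pathNorm
  rw [← lqNorm_const_mul hq]
  refine lqNorm_mono fun j => iSup₂_le fun t ht => ?_
  set S := ⨆ t ∈ I, ‖F t j‖ₑ with hS
  by_cases htop : S = ⊤
  · rw [htop, ENNReal.mul_top (by simpa using H.C_pos)]
    exact le_top
  rw [← ofReal_norm, ← ENNReal.ofReal_toReal htop, ← ENNReal.ofReal_mul H.C_pos.le]
  refine ENNReal.ofReal_le_ofReal (H.norm_duhamel_le F j (hI t ht) fun τ hτ => ?_)
  rw [← toReal_enorm]
  exact ENNReal.toReal_mono htop
    (le_iSup₂ (f := fun t (_ : t ∈ I) => ‖F t j‖ₑ) τ (hI' t ht hτ))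

theorem continuousOn_integrand {q : ℝ≥0∞} {F : ℝ → ℤ → V} (hF : AdmPath q F) (j : ℤ) (t : ℝ) :
    ContinuousOn (fun τ => H.toFun j (t - τ) (F τ j)) (Ioc 0 t) := by
  refine ContinuousOn.clm_apply ?_ ((hF.continuousOn j).mono fun τ hτ => hτ.1)
  exact (H.cont j).comp (by fun_prop) fun τ hτ => by simpa using hτ.2

theorem intervalIntegrable_integrand {q : ℝ≥0∞} (hq : 1 ≤ q) {F : ℝ → ℤ → V} (hF : AdmPath q F)
    (j : ℤ) {t : ℝ} (ht : 0 ≤ t) :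
    IntervalIntegrable (fun τ => H.toFun j (t - τ) (F τ j)) volume 0 t := by
  rw [intervalIntegrable_iff_integrableOn_Ioc_of_le ht]
  refine IntegrableOn.of_bound (C := H.C * (4 : ℝ) ^ j * (pathNorm q (Ioi 0) F).toReal)
    (by simp) ((H.continuousOn_integrand hF j t).aestronglyMeasurable measurableSet_Ioc) ?_
  rw [ae_restrict_iff' measurableSet_Ioc]
  refine Eventually.of_forall fun τ hτ => ?_
  have hσ : 0 ≤ t - τ := by linarith [hτ.2]
  have hC := H.C_pos
  refine (H.norm_apply_le j hσ (hF.norm_le hq hτ.1 j)).trans ?_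
  have h4 : (4 : ℝ) ^ j / (1 + (4 : ℝ) ^ j * (t - τ)) ^ 2 ≤ (4 : ℝ) ^ j := by
    refine div_le_self (by positivity) ?_
    have : 0 ≤ (4 : ℝ) ^ j * (t - τ) := by positivity
    nlinarith
  calc _ ≤ (4 : ℝ) ^ j * (H.C * (pathNorm q (Ioi 0) F).toReal) := by gcongr
    _ = _ := by ring

theorem duhamel_sub {q : ℝ≥0∞} (hq : 1 ≤ q) {F G : ℝ → ℤ → V} (hF : AdmPath q F)
    (hG : AdmPath q G) {t : ℝ} (ht : 0 ≤ t) (j : ℤ) :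
    H.duhamel (F - G) t j = H.duhamel F t j - H.duhamel G t j := by
  unfold duhamel
  rw [← intervalIntegral.integral_sub (H.intervalIntegrable_integrand hq hF j ht)
    (H.intervalIntegrable_integrand hq hG j ht)]
  simp

theorem duhamel_add {q : ℝ≥0∞} (hq : 1 ≤ q) {F G : ℝ → ℤ → V} (hF : AdmPath q F)
    (hG : AdmPath q G) {t : ℝ} (ht : 0 ≤ t) (j : ℤ) :
    H.duhamel (F + G) t j = H.duhamel F t j + H.duhamel G t j := by
  unfold duhamel
  rw [← intervalIntegral.integral_add (H.intervalIntegrable_integrand hq hF j ht)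
    (H.intervalIntegrable_integrand hq hG j ht)]
  simp

/-- Splitting for continuity in time. For remote times the lag is bounded below and the kernel is
differenced; the middle interval is short; in the recent window of length δ, where the kernel is
singular uniformly in j, the change of variables σ = t - τ allows the path to be differenced
instead. -/
theorem duhamel_sub_eq {q : ℝ≥0∞} (hq : 1 ≤ q) {F : ℝ → ℤ → V} (hF : AdmPath q F) (j : ℤ)
    {δ s t : ℝ} (hs : δ ≤ s) (ht : δ ≤ t) (hδ : 0 < δ) (hst : s - δ ≤ t) :
    H.duhamel F t j - H.duhamel F s j =
      (∫ τ in (0 : ℝ)..(s - δ), (H.toFun j (t - τ) - H.toFun j (s - τ)) (F τ j)) +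
      (∫ τ in (s - δ)..(t - δ), H.toFun j (t - τ) (F τ j)) +
      ∫ σ in (0 : ℝ)..δ, H.toFun j σ (F (t - σ) j - F (s - σ) j) := by
  have hi : ∀ r, 0 ≤ r → ∀ a b, 0 ≤ a → a ≤ r → 0 ≤ b → b ≤ r →
      IntervalIntegrable (fun τ => H.toFun j (r - τ) (F τ j)) volume a b := by
    intro r hr a b ha ha' hb hb'
    refine (H.intervalIntegrable_integrand hq hF j hr).mono_set ?_
    rw [uIcc_of_le hr]
    exact uIcc_subset_Icc ⟨ha, ha'⟩ ⟨hb, hb'⟩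
  have hshift : ∀ r, δ ≤ r → ∫ τ in (r - δ)..r, H.toFun j (r - τ) (F τ j) =
      ∫ σ in (0 : ℝ)..δ, H.toFun j σ (F (r - σ) j) := by
    intro r hr
    have := intervalIntegral.integral_comp_sub_left (a := r - δ) (b := r)
      (fun σ => H.toFun j σ (F (r - σ) j)) r
    simpa using this
  have hi' : ∀ r, δ ≤ r → IntervalIntegrable (fun σ => H.toFun j σ (F (r - σ) j)) volume 0 δ := by
    intro r hr
    have := (hi r (hδ.le.trans hr) (r - δ) r (by linarith) (by linarith) (by linarith) le_rfl).comp_sub_left r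
    simpa using this.symm
  have e1 : H.duhamel F t j = (∫ τ in (0 : ℝ)..(s - δ), H.toFun j (t - τ) (F τ j)) +
      (∫ τ in (s - δ)..(t - δ), H.toFun j (t - τ) (F τ j)) +
      ∫ σ in (0 : ℝ)..δ, H.toFun j σ (F (t - σ) j) := by
    rw [← hshift t ht, intervalIntegral.integral_add_adjacent_intervals,
      intervalIntegral.integral_add_adjacent_intervals, duhamel]
    all_goals apply hi <;> linarith
  have e2 : H.duhamel F s j = (∫ τ in (0 : ℝ)..(s - δ), H.toFun j (s - τ) (F τ j)) +
      ∫ σ in (0 : ℝ)..δ, H.toFun j σ (F (s - σ) j) := by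
    rw [← hshift s hs, intervalIntegral.integral_add_adjacent_intervals, duhamel]
    all_goals apply hi <;> linarith
  have e3 : (∫ τ in (0 : ℝ)..(s - δ), (H.toFun j (t - τ) - H.toFun j (s - τ)) (F τ j)) =
      (∫ τ in (0 : ℝ)..(s - δ), H.toFun j (t - τ) (F τ j)) -
      ∫ τ in (0 : ℝ)..(s - δ), H.toFun j (s - τ) (F τ j) := by
    rw [← intervalIntegral.integral_sub]
    · simp
    all_goals apply hi <;> linarith
  have e4 : (∫ σ in (0 : ℝ)..δ, H.toFun j σ (F (t - σ) j - F (s - σ) j)) =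
      (∫ σ in (0 : ℝ)..δ, H.toFun j σ (F (t - σ) j)) -
      ∫ σ in (0 : ℝ)..δ, H.toFun j σ (F (s - σ) j) := by
    rw [← intervalIntegral.integral_sub (hi' t ht) (hi' s hs)]
    simp
  rw [e1, e2, e3, e4]
  abel

theorem admPath_duhamel {q : ℝ≥0∞} (hq : 1 ≤ q) {F : ℝ → ℤ → V} (hF : AdmPath q F) :
    AdmPath q (H.duhamel F) where
  bounded := (H.pathNorm_duhamel_le hq (fun t ht => ht) (fun t _ τ hτ => hτ.1) F).trans_lt
    (ENNReal.mul_lt_top ENNReal.ofReal_lt_top hF.bounded)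
  cont s hs ε hε := by
    set B := (pathNorm q (Ioi 0) F).toReal
    have hB : 0 ≤ B := ENNReal.toReal_nonneg
    have hC := H.C_pos
    -- For |t - s| < δ/2 the remote and middle lags are then at least δ/2, and the times t - σ, s -
    -- σ of the recent window lie in [δ, 2s], inside the compact interval of uniform continuity.
    set δ := s / 4 with hδ
    have hδ0 : 0 < δ := by positivity
    -- The constant `H.C` of the kernel bound cancels, so that the recent window contributes ε/3;
    -- the other two pieces share 2ε/3.
    obtain ⟨η, hη, hu⟩ := hF.uniform_on_Icc (a := δ) (b := 2 * s) hδ0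
      (ε := ε / (3 * H.C)) (by positivity)
    have hlim : Tendsto (fun t => H.C * (|t - s| / (δ / 2) ^ 2) * B * s +
        1 / (δ / 2) * (H.C * B) * |t - s|) (𝓝 s) (𝓝 0) := by
      have : Continuous (fun t => H.C * (|t - s| / (δ / 2) ^ 2) * B * s +
        1 / (δ / 2) * (H.C * B) * |t - s|) := by fun_prop
      simpa using this.tendsto s
    filter_upwards [hlim.eventually_lt_const (u := 2 * ε / 3) (by positivity),
      Metric.ball_mem_nhds s hη, Metric.ball_mem_nhds s (half_pos hδ0)] with t h1 h2 h3 j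
    rw [Metric.mem_ball, Real.dist_eq] at h2 h3
    obtain ⟨h3a, h3b⟩ := abs_lt.1 h3
    rw [H.duhamel_sub_eq hq hF j (by linarith) (by linarith) hδ0 (by linarith)]
    have b1 : ‖∫ τ in (0 : ℝ)..(s - δ), (H.toFun j (t - τ) - H.toFun j (s - τ)) (F τ j)‖ ≤
        H.C * (|t - s| / (δ / 2) ^ 2) * B * s := by
      refine (intervalIntegral.norm_integral_le_of_norm_le_const
        (C := H.C * (|t - s| / (δ / 2) ^ 2) * B) fun τ hτ => ?_).trans ?_
      · rw [uIoc_of_le (by linarith)] at hτ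
        have hl : ‖H.toFun j (t - τ) - H.toFun j (s - τ)‖ ≤ H.C * (|t - s| / (δ / 2) ^ 2) := by
          rcases le_total s t with h | h
          · refine (H.lipschitz j (s - τ) (t - τ) (by linarith [hτ.2]) (by linarith)).trans ?_
            rw [abs_of_nonneg (by linarith), sub_sub_sub_cancel_right]
            have : δ / 2 ≤ s - τ := by linarith [hτ.2]
            gcongr
          · rw [norm_sub_rev]
            refine (H.lipschitz j (t - τ) (s - τ) (by linarith [hτ.2]) (by linarith)).trans ?_
            rw [abs_of_nonpos (by linarith), sub_sub_sub_cancel_right, neg_sub]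
            have : δ / 2 ≤ t - τ := by linarith [hτ.2]
            gcongr
        refine (ContinuousLinearMap.le_opNorm _ _).trans ?_
        gcongr
        exact hF.norm_le hq hτ.1 j
      · gcongr
        rw [sub_zero, abs_of_nonneg (by linarith)]
        linarith
    have b2 : ‖∫ τ in (s - δ)..(t - δ), H.toFun j (t - τ) (F τ j)‖ ≤
        1 / (δ / 2) * (H.C * B) * |t - s| := by
      have h4 : (t - δ) - (s - δ) = t - s := by ring
      rw [← h4]
      refine intervalIntegral.norm_integral_le_of_norm_le_const fun τ hτ => ?_
      have hτ1 : τ ≤ t - δ / 2 := by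
        rcases mem_uIoc.1 hτ with h | h <;> linarith [h.1, h.2]
      have hτ0 : 0 < τ := by
        rcases mem_uIoc.1 hτ with h | h <;> linarith [h.1, h.2]
      refine (H.norm_apply_le j (by linarith) (hF.norm_le hq hτ0 j)).trans ?_
      refine mul_le_mul_of_nonneg_right ?_ (by positivity)
      refine (weight_le_inv (by positivity) (by linarith)).trans ?_
      exact one_div_le_one_div_of_le (by positivity) (by linarith)
    have b3 : ‖∫ σ in (0 : ℝ)..δ, H.toFun j σ (F (t - σ) j - F (s - σ) j)‖ ≤ ε / 3 := by
      refine (H.norm_integral_le (fun σ => F (t - σ) j - F (s - σ) j) j hδ0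
        (S := ε / (3 * H.C)) fun σ hσ => ?_).trans_eq (by field_simp)
      refine hu _ ⟨?_, ?_⟩ _ ⟨?_, ?_⟩ ?_ j
      all_goals first | linarith [hσ.1, hσ.2] | skip
      rwa [sub_sub_sub_cancel_right]
    calc _ ≤ _ + _ + _ := (norm_add_le _ _).trans (add_le_add (norm_add_le _ _) le_rfl)
      _ ≤ ε := by linarith

/-- Written as ∫ H_j(σ) F_j(t - σ) dσ, the integrand tends to zero for each fixed lag σ and is
dominated by the integrable weight 4^j/(1+4^jσ)² times a bound for F. -/
theorem tendsto_duhamel_zero {q : ℝ≥0∞} (hq : 1 ≤ q) {F : ℝ → ℤ → V} (hF : AdmPath q F) (j : ℤ)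
    (h : Tendsto (fun t => F t j) atTop (𝓝 0)) :
    Tendsto (fun t => H.duhamel F t j) atTop (𝓝 0) := by
  set B := (pathNorm q (Ioi 0) F).toReal
  have hB : 0 ≤ B := ENNReal.toReal_nonneg
  have hC := H.C_pos
  have hw : IntegrableOn (fun σ => (4 : ℝ) ^ j / (1 + (4 : ℝ) ^ j * σ) ^ 2) (Ioi 0) := by
    refine integrableOn_Ioi_of_intervalIntegral_norm_bounded (l := atTop) (b := id) 1 0
      (fun t => ?_) tendsto_id ?_
    · rcases le_total 0 t with ht | ht
      · have := (integral_weight_le ((4 : ℝ) ^ j) (by positivity) ht).1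
        rwa [intervalIntegrable_iff_integrableOn_Ioc_of_le ht] at this
      · simp [Ioc_eq_empty (not_lt.2 ht)]
    · filter_upwards [eventually_ge_atTop 0] with t ht
      refine le_trans (le_of_eq ?_) (integral_weight_le ((4 : ℝ) ^ j) (by positivity) ht).2
      refine intervalIntegral.integral_congr fun σ hσ => ?_
      simp only [Real.norm_eq_abs]
      rw [abs_of_nonneg]
      positivity
  -- The indicator puts all integrals on the fixed domain (0, ∞); it leaves out σ = t, where the
  -- path would be evaluated at time 0.
  have key := tendsto_integral_filter_of_dominated_convergence (μ := volume.restrict (Ioi (0 : ℝ)))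
    (l := (atTop : Filter ℝ))
    (F := fun t σ => indicator (Ico 0 t) (fun σ => H.toFun j σ (F (t - σ) j)) σ)
    (f := fun _ => (0 : V))
    (fun σ => (4 : ℝ) ^ j / (1 + (4 : ℝ) ^ j * σ) ^ 2 * (H.C * B)) ?_ ?_ (hw.mul_const _) ?_
  · rw [integral_zero] at key
    refine key.congr' ?_
    filter_upwards [eventually_ge_atTop 0] with t ht
    have hset : Ioi (0 : ℝ) ∩ Ico 0 t = Ioo 0 t := by
      ext σ
      simp only [mem_inter_iff, mem_Ioi, mem_Ico, mem_Ioo]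
      exact ⟨fun h => ⟨h.1, h.2.2⟩, fun h => ⟨h.1, h.1.le, h.2⟩⟩
    rw [duhamel_eq, intervalIntegral.integral_of_le ht, setIntegral_indicator measurableSet_Ico,
      hset, ← integral_Ioc_eq_integral_Ioo]
  · refine Eventually.of_forall fun t => ?_
    rw [aestronglyMeasurable_indicator_iff measurableSet_Ico]
    refine AEStronglyMeasurable.mono_measure ?_ (Measure.restrict_mono le_rfl Measure.restrict_le_self)
    refine ContinuousOn.aestronglyMeasurable ?_ measurableSet_Ico
    refine ContinuousOn.clm_apply ((H.cont j).mono fun σ hσ => hσ.1) ?_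
    exact (hF.continuousOn j).comp (by fun_prop) fun σ hσ => by simpa using hσ.2
  · refine Eventually.of_forall fun t => ?_
    rw [ae_restrict_iff' measurableSet_Ioi]
    refine Eventually.of_forall fun σ hσ => ?_
    by_cases hσ' : σ ∈ Ico 0 t
    · rw [indicator_of_mem hσ']
      exact H.norm_apply_le j hσ'.1 (hF.norm_le hq (by linarith [hσ'.2]) j)
    · rw [indicator_of_notMem hσ', norm_zero]
      positivity
  · refine Eventually.of_forall fun σ => ?_
    by_cases hσ : 0 ≤ σ
    · have h1 : Tendsto (fun t => H.toFun j σ (F (t - σ) j)) atTop (𝓝 0) := by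
        have h2 := h.comp (tendsto_atTop_add_const_right atTop (-σ) tendsto_id)
        simpa [Function.comp_def, sub_eq_add_neg] using
          ((H.toFun j σ).continuous.tendsto 0).comp h2
      refine h1.congr' ?_
      filter_upwards [eventually_gt_atTop σ] with t ht
      rw [indicator_of_mem (show σ ∈ Ico 0 t from ⟨hσ, ht⟩)]
    · refine tendsto_const_nhds.congr fun t => ?_
      rw [indicator_of_notMem (show σ ∉ Ico 0 t from fun h => hσ h.1)]

end DuhamelKernel

end Core

/-! ### Existence, uniqueness and decay for the quadratic Duhamel equation. -/

section Core

variable {V : Type*} [NormedAddCommGroup V] [NormedSpace ℝ V]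
  (H : DuhamelKernel V) (M : BilinearBlocks V) {q : ℝ≥0∞}

/-- The quadratic Duhamel term. -/
def quadDuhamel (u v : ℝ → ℤ → V) : ℝ → ℤ → V :=
  H.duhamel fun t => M.sum (u t) (v t)

/-- The norm of the quadratic Duhamel term. -/
def quadConst : ℝ := H.C * M.mass ^ 2

variable {H M}

theorem pathNorm_quadDuhamel_le (hq : 1 ≤ q) {I : Set ℝ} (hI : ∀ t ∈ I, 0 < t)
    (hI' : ∀ t ∈ I, Ioo 0 t ⊆ I) (u v : ℝ → ℤ → V) :
    pathNorm q I (quadDuhamel H M u v) ≤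
      ENNReal.ofReal (quadConst H M) * (pathNorm q I u * pathNorm q I v) := by
  refine (H.pathNorm_duhamel_le hq hI hI' _).trans ?_
  rw [quadConst, ENNReal.ofReal_mul H.C_pos.le, mul_assoc]
  gcongr
  exact BilinearBlocks.pathNorm_sum_le hq I u v

variable [CompleteSpace V]

theorem admPath_quadDuhamel (hq : 1 ≤ q) {u v : ℝ → ℤ → V} (hu : AdmPath q u) (hv : AdmPath q v) :
    AdmPath q (quadDuhamel H M u v) :=
  H.admPath_duhamel hq (BilinearBlocks.admPath_sum hq hu hv)

theorem quadDuhamel_sub (hq : 1 ≤ q) {u v : ℝ → ℤ → V} (hu : AdmPath q u) (hv : AdmPath q v)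
    {t : ℝ} (ht : 0 < t) (j : ℤ) :
    quadDuhamel H M u u t j - quadDuhamel H M v v t j =
      quadDuhamel H M (u - v) u t j + quadDuhamel H M v (u - v) t j := by
  have huv := hu.sub hq hv
  unfold quadDuhamel
  rw [← H.duhamel_sub hq (BilinearBlocks.admPath_sum hq hu hu)
      (BilinearBlocks.admPath_sum hq hv hv) ht.le,
    ← H.duhamel_add hq (BilinearBlocks.admPath_sum hq huv hu)
      (BilinearBlocks.admPath_sum hq hv huv) ht.le]
  unfold DuhamelKernel.duhamel
  refine intervalIntegral.integral_congr_ae (Eventually.of_forall fun τ hτ => ?_)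
  rw [uIoc_of_le ht.le] at hτ
  congr 1
  exact BilinearBlocks.sum_sub_sum (hu.norm_le hq hτ.1) (hv.norm_le hq hτ.1)
    (hu.norm_le hq hτ.1) (hv.norm_le hq hτ.1) j

theorem pathNorm_quadDuhamel_sub_le (hq : 1 ≤ q) {I : Set ℝ} (hI : ∀ t ∈ I, 0 < t)
    (hI' : ∀ t ∈ I, Ioo 0 t ⊆ I) {u v : ℝ → ℤ → V} (hu : AdmPath q u) (hv : AdmPath q v) :
    pathNorm q I (quadDuhamel H M u u - quadDuhamel H M v v) ≤
      ENNReal.ofReal (quadConst H M) * ((pathNorm q I u + pathNorm q I v) *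
        pathNorm q I (u - v)) := by
  rw [pathNorm_congr (v := quadDuhamel H M (u - v) u + quadDuhamel H M v (u - v)) fun t ht j => by
    simp only [Pi.sub_apply, Pi.add_apply, quadDuhamel_sub hq hu hv (hI t ht) j]]
  refine (pathNorm_add_le hq _ _).trans ((add_le_add
    (pathNorm_quadDuhamel_le hq hI hI' _ _) (pathNorm_quadDuhamel_le hq hI hI' _ _)).trans_eq ?_)
  ring

/-- Existence of small solutions to `u = A - ∫ H M(u, u)`, together with any closed property that is
propagated by the iteration. -/
theorem exists_quadratic_fixedPoint (hq : 1 ≤ q) {A : ℝ → ℤ → V} (hA : AdmPath q A)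
    (hsmall : 8 * ENNReal.ofReal (quadConst H M) * pathNorm q (Ioi 0) A ≤ 1)
    (P : (ℝ → ℤ → V) → Prop) (hPA : P A)
    (hPstep : ∀ u, AdmPath q u → P u → P (A - quadDuhamel H M u u))
    (hPlim : ∀ (s : ℕ → ℝ → ℤ → V) u, (∀ m, P (s m)) →
      Tendsto (fun m => pathNorm q (Ioi 0) (u - s m)) atTop (𝓝 0) → P u) :
    ∃ u, AdmPath q u ∧ (∀ t, 0 < t → ∀ j, u t j = A t j - quadDuhamel H M u u t j) ∧
      pathNorm q (Ioi 0) u ≤ 2 * pathNorm q (Ioi 0) A ∧ P u := by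
  set N := pathNorm q (Ioi 0) A with hN
  set K := ENNReal.ofReal (quadConst H M) with hK
  have hI : ∀ t ∈ Ioi (0 : ℝ), 0 < t := fun t ht => ht
  have hI' : ∀ t ∈ Ioi (0 : ℝ), Ioo 0 t ⊆ Ioi 0 := fun t _ τ hτ => hτ.1
  have hNtop : N ≠ ⊤ := hA.bounded.ne
  -- This one number serves twice: K(2N)² ≤ N/2 keeps the ball of radius 2N invariant, and K(2N +
  -- 2N) ≤ 1/2 is the contraction factor on it.
  have hKN : 4 * (K * N) ≤ 2⁻¹ := by
    rw [ENNReal.le_inv_iff_mul_le]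
    calc 4 * (K * N) * 2 = 8 * K * N := by ring
      _ ≤ 1 := hsmall
  obtain ⟨s, hs0, hs1⟩ : ∃ s : ℕ → ℝ → ℤ → V, s 0 = A ∧
      ∀ m, s (m + 1) = A - quadDuhamel H M (s m) (s m) :=
    ⟨fun m => Nat.rec A (fun _ u => A - quadDuhamel H M u u) m, rfl, fun _ => rfl⟩
  have hadm : ∀ m, AdmPath q (s m) := by
    intro m
    induction m with
    | zero => rw [hs0]; exact hA
    | succ m ih => rw [hs1]; exact hA.sub hq (admPath_quadDuhamel hq ih ih)
  have hP : ∀ m, P (s m) := by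
    intro m
    induction m with
    | zero => rw [hs0]; exact hPA
    | succ m ih => rw [hs1]; exact hPstep _ (hadm m) ih
  have hbd : ∀ m, pathNorm q (Ioi 0) (s m) ≤ 2 * N := by
    intro m
    induction m with
    | zero => rw [hs0, two_mul]; exact le_self_add
    | succ m ih =>
      rw [hs1]
      refine (pathNorm_sub_le hq _ _).trans ?_
      rw [two_mul]
      refine add_le_add le_rfl ((pathNorm_quadDuhamel_le hq hI hI' _ _).trans ?_)
      calc K * (pathNorm q (Ioi 0) (s m) * pathNorm q (Ioi 0) (s m))
          ≤ K * ((2 * N) * (2 * N)) := by gcongr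
        _ = (4 * (K * N)) * N := by ring
        _ ≤ 2⁻¹ * N := by gcongr
        _ ≤ 1 * N := by gcongr; simp
        _ = N := one_mul N
  have hstep : ∀ u v, AdmPath q u → AdmPath q v → pathNorm q (Ioi 0) u ≤ 2 * N →
      pathNorm q (Ioi 0) v ≤ 2 * N →
      pathNorm q (Ioi 0) (quadDuhamel H M u u - quadDuhamel H M v v) ≤
        2⁻¹ * pathNorm q (Ioi 0) (u - v) := by
    intro u v hu hv hu' hv'
    refine (pathNorm_quadDuhamel_sub_le hq hI hI' hu hv).trans ?_
    calc _ ≤ K * ((2 * N + 2 * N) * pathNorm q (Ioi 0) (u - v)) := by gcongr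
      _ = (4 * (K * N)) * pathNorm q (Ioi 0) (u - v) := by ring
      _ ≤ _ := by gcongr
  have hdiff : ∀ m, pathNorm q (Ioi 0) (s (m + 1) - s m) ≤ (4 * N) / 2 ^ m := by
    intro m
    induction m with
    | zero =>
      refine (pathNorm_sub_le hq _ _).trans ((add_le_add (hbd _) (hbd _)).trans_eq ?_)
      simp
      ring
    | succ m ih =>
      have : s (m + 1 + 1) - s (m + 1) =
          quadDuhamel H M (s m) (s m) - quadDuhamel H M (s (m + 1)) (s (m + 1)) := by
        rw [hs1 (m + 1), hs1 m]
        abel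
      rw [this]
      refine (hstep _ _ (hadm _) (hadm _) (hbd _) (hbd _)).trans ?_
      rw [pathNorm_sub_comm]
      calc 2⁻¹ * pathNorm q (Ioi 0) (s (m + 1) - s m) ≤ 2⁻¹ * ((4 * N) / 2 ^ m) := by gcongr
        _ = 4 * N / 2 ^ (m + 1) := by
          rw [pow_succ, div_eq_mul_inv, div_eq_mul_inv, ENNReal.mul_inv (by simp) (by simp)]
          ring
  obtain ⟨u, hu, hlim⟩ := exists_admPath_limit hq s hadm
    (c := 4 * N) (ENNReal.mul_ne_top (by simp) hNtop) hdiff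
  have hlim0 : Tendsto (fun m => pathNorm q (Ioi 0) (u - s m)) atTop (𝓝 0) := by
    have h2 : Tendsto (fun m : ℕ => (2⁻¹ : ℝ≥0∞) ^ m) atTop (𝓝 0) :=
      ENNReal.tendsto_pow_atTop_nhds_zero_of_lt_one (by simp)
    have h3 := ENNReal.Tendsto.const_mul (a := 2 * (4 * N)) h2
      (Or.inr (ENNReal.mul_ne_top (by simp) (ENNReal.mul_ne_top (by simp) hNtop)))
    rw [mul_zero] at h3
    refine tendsto_of_tendsto_of_tendsto_of_le_of_le tendsto_const_nhds h3 (fun _ => zero_le)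
      fun m => (hlim m).trans_eq ?_
    rw [div_eq_mul_inv, ENNReal.inv_pow]
  have hu2 : pathNorm q (Ioi 0) u ≤ 2 * N := by
    have h4 : Tendsto (fun m => pathNorm q (Ioi 0) (u - s m) + 2 * N) atTop (𝓝 (0 + 2 * N)) :=
      hlim0.add tendsto_const_nhds
    rw [zero_add] at h4
    refine ge_of_tendsto' h4 fun m => ?_
    calc pathNorm q (Ioi 0) u = pathNorm q (Ioi 0) ((u - s m) + s m) := by simp
      _ ≤ _ := (pathNorm_add_le hq _ _).trans (add_le_add le_rfl (hbd m))
  refine ⟨u, hu, ?_, hu2, hPlim s u hP hlim0⟩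
  -- The defect of u is compared with the recursion for s (m + 1); both resulting terms are tails of
  -- a convergent sequence.
  have hzero : pathNorm q (Ioi 0) (u - (A - quadDuhamel H M u u)) = 0 := by
    have h5 : Tendsto (fun m => pathNorm q (Ioi 0) (u - s (m + 1)) +
        2⁻¹ * pathNorm q (Ioi 0) (u - s m)) atTop (𝓝 (0 + 2⁻¹ * 0)) :=
      ((tendsto_add_atTop_iff_nat 1).2 hlim0).add
        (ENNReal.Tendsto.const_mul hlim0 (Or.inr (by simp)))
    rw [mul_zero, add_zero] at h5
    refine le_antisymm (ge_of_tendsto' h5 fun m => ?_) zero_le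
    have : u - (A - quadDuhamel H M u u) =
        (u - s (m + 1)) + (quadDuhamel H M u u - quadDuhamel H M (s m) (s m)) := by
      rw [hs1]
      abel
    rw [this]
    exact (pathNorm_add_le hq _ _).trans
      (add_le_add le_rfl (hstep _ _ hu (hadm m) hu2 (hbd m)))
  intro t ht j
  exact eq_of_pathNorm_eq_zero hq hzero ht j

/-- Subtracting the two equations bounds the norm of the difference by half of itself on I. It is
finite, hence zero. -/
theorem pathNorm_sub_eq_zero_of_small (hq : 1 ≤ q) {A u v : ℝ → ℤ → V}
    (hu : AdmPath q u) (hv : AdmPath q v)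
    (hu' : ∀ t, 0 < t → ∀ j, u t j = A t j - quadDuhamel H M u u t j)
    (hv' : ∀ t, 0 < t → ∀ j, v t j = A t j - quadDuhamel H M v v t j)
    {I : Set ℝ} (hI : ∀ t ∈ I, 0 < t) (hI' : ∀ t ∈ I, Ioo 0 t ⊆ I)
    (hsmall : 2 * ENNReal.ofReal (quadConst H M) * (pathNorm q I u + pathNorm q I v) ≤ 1) :
    pathNorm q I (u - v) = 0 := by
  have h1 : pathNorm q I (u - v) = pathNorm q I (quadDuhamel H M v v - quadDuhamel H M u u) := by
    refine pathNorm_congr fun t ht j => ?_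
    simp only [Pi.sub_apply]
    rw [hu' t (hI t ht) j, hv' t (hI t ht) j]
    congr 1
    abel
  have h2 : pathNorm q I (u - v) ≤ 2⁻¹ * pathNorm q I (u - v) := by
    conv_lhs => rw [h1]
    refine (pathNorm_quadDuhamel_sub_le hq hI hI' hv hu).trans ?_
    rw [pathNorm_sub_comm v u, ← mul_assoc]
    gcongr
    rw [ENNReal.le_inv_iff_mul_le]
    calc _ = _ := by ring
      _ ≤ 1 := hsmall
  have h3 : pathNorm q I (u - v) ≠ ⊤ := by
    refine ne_top_of_le_ne_top (ENNReal.add_ne_top.2 ⟨hu.bounded.ne, hv.bounded.ne⟩)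
      ((pathNorm_mono (J := Ioi 0) (fun t ht => hI t ht) _).trans (pathNorm_sub_le hq u v))
  by_contra h0
  rw [mul_comm, ← div_eq_mul_inv] at h2
  exact absurd h2 (not_le.2 (ENNReal.half_lt_self h0 h3))

/-- Unconditional uniqueness for `q < ∞`, given that the two solutions have the same initial
value and that one of them is small. -/
theorem eq_of_initial_eq (hq : 1 ≤ q) (hq' : q ≠ ⊤) {A u v : ℝ → ℤ → V}
    (hu : AdmPath q u) (hv : AdmPath q v)
    (hu' : ∀ t, 0 < t → ∀ j, u t j = A t j - quadDuhamel H M u u t j)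
    (hv' : ∀ t, 0 < t → ∀ j, v t j = A t j - quadDuhamel H M v v t j)
    (h0 : ∀ j, Tendsto (fun t => u t j - v t j) (𝓝[>] 0) (𝓝 0))
    (hsmall : 8 * ENNReal.ofReal (quadConst H M) * pathNorm q (Ioi 0) u ≤ 1)
    {t : ℝ} (ht : 0 < t) (j : ℤ) : u t j = v t j := by
  set K := ENNReal.ofReal (quadConst H M) with hK
  by_contra hne
  -- T is the infimum of the times at which the two paths disagree. The contradiction is agreement
  -- on some (0, S) with S > T.
  set Z := {t : ℝ | 0 < t ∧ ∃ j, u t j ≠ v t j} with hZ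
  have hZne : Z.Nonempty := ⟨t, ht, j, hne⟩
  have hZb : BddBelow Z := ⟨0, fun s hs => hs.1.le⟩
  set T := sInf Z with hT
  have hT0 : 0 ≤ T := le_csInf hZne fun s hs => hs.1.le
  have hbefore : ∀ s, 0 < s → s < T → ∀ k, u s k = v s k := by
    intro s hs hsT k
    by_contra h
    exact absurd (csInf_le hZb ⟨hs, k, h⟩) (not_le.2 hsT)
  have hadm := hu.sub hq hv
  -- For T = 0 this is the common initial value; for T > 0 the difference vanishes before T and is
  -- continuous at T.
  have hright : ∀ k, Tendsto (fun s => u s k - v s k) (𝓝[>] T) (𝓝 0) := by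
    intro k
    rcases hT0.eq_or_lt with h | h
    · rw [← h]; exact h0 k
    · have hc : ContinuousAt (fun s => u s k - v s k) T :=
        (hadm.continuousOn k).continuousAt (Ioi_mem_nhds h)
      have hz : u T k - v T k = 0 := by
        have h1 : Tendsto (fun s => u s k - v s k) (𝓝[<] T) (𝓝 0) := by
          refine tendsto_const_nhds.congr' ?_
          filter_upwards [Ioo_mem_nhdsLT h] with s hs
          rw [hbefore s hs.1 hs.2, sub_self]
        exact tendsto_nhds_unique (hc.tendsto.mono_left nhdsWithin_le_nhds) h1
      have h2 := hc.tendsto.mono_left (nhdsWithin_le_nhds (s := Ioi T))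
      rwa [hz] at h2
  -- As S decreases to T each block of the difference tends to zero, uniformly over (0, S), and the
  -- blocks are dominated by a fixed ℓ^q sequence. This is where q < ∞ enters.
  have hlim : Tendsto (fun S => pathNorm q (Ioo 0 S) (u - v)) (𝓝[>] T) (𝓝 0) := by
    refine tendsto_lqNorm_zero hq hq' (d := fun k => ⨆ t ∈ Ioi (0 : ℝ), ‖(u - v) t k‖ₑ)
      hadm.bounded (Eventually.of_forall fun S k => biSup_mono fun s hs => hs.1) fun k => ?_
    rw [ENNReal.tendsto_nhds_zero]
    intro ε hε
    have h1 : ∀ᶠ s in 𝓝[>] T, ‖u s k - v s k‖ₑ ≤ ε := by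
      have h2 := (hright k).enorm
      rw [enorm_zero, ENNReal.tendsto_nhds_zero] at h2
      exact h2 ε hε
    rw [eventually_nhdsWithin_iff, Metric.eventually_nhds_iff] at h1
    obtain ⟨δ, hδ, h1⟩ := h1
    filter_upwards [Ioo_mem_nhdsGT (show T < T + δ by linarith), self_mem_nhdsWithin]
      with S hS hS'
    refine iSup₂_le fun s hs => ?_
    rcases lt_trichotomy s T with h | h | h
    · simp [hbefore s hs.1 h]
    · have hz : u s k - v s k = 0 := by
        rw [h] at hs ⊢
        have hc : ContinuousAt (fun s => u s k - v s k) T :=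
          (hadm.continuousOn k).continuousAt (Ioi_mem_nhds hs.1)
        exact tendsto_nhds_unique (hc.tendsto.mono_left (nhdsWithin_le_nhds (s := Ioi T)))
          (hright k)
      simp [hz]
    · refine h1 (y := s) ?_ h
      rw [Real.dist_eq, abs_of_pos (by linarith)]
      linarith [hs.2, hS.2]
  -- The norm of v is at most that of u plus that of u - v, so on a short enough interval the
  -- smallness of u alone gives the smallness needed of the sum.
  have hev : ∀ᶠ S in 𝓝[>] T, 4 * K * pathNorm q (Ioo 0 S) (u - v) ≤ 2⁻¹ := by
    have h3 := ENNReal.Tendsto.const_mul (a := 4 * K) hlim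
      (Or.inr (ENNReal.mul_ne_top (by simp) ENNReal.ofReal_ne_top))
    rw [mul_zero] at h3
    exact (h3.eventually_lt_const (u := 2⁻¹) (by simp)).mono fun _ h => h.le
  obtain ⟨S, hS, hTS⟩ := (hev.and self_mem_nhdsWithin).exists
  have hI : ∀ t ∈ Ioo 0 S, 0 < t := fun t ht => ht.1
  have hI' : ∀ t ∈ Ioo 0 S, Ioo 0 t ⊆ Ioo 0 S := fun t ht τ hτ => ⟨hτ.1, hτ.2.trans ht.2⟩
  have hzero : pathNorm q (Ioo 0 S) (u - v) = 0 := by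
    refine pathNorm_sub_eq_zero_of_small hq hu hv hu' hv' hI hI' ?_
    have h4 : pathNorm q (Ioo 0 S) v ≤
        pathNorm q (Ioo 0 S) (u - v) + pathNorm q (Ioi 0) u := by
      calc pathNorm q (Ioo 0 S) v = pathNorm q (Ioo 0 S) (u - (u - v)) := by simp
        _ ≤ pathNorm q (Ioo 0 S) u + pathNorm q (Ioo 0 S) (u - v) := pathNorm_sub_le hq _ _
        _ ≤ _ := by
          rw [add_comm]
          exact add_le_add le_rfl (pathNorm_mono (fun s hs => hs.1) u)
    have h5 : pathNorm q (Ioo 0 S) u ≤ pathNorm q (Ioi 0) u := pathNorm_mono (fun s hs => hs.1) u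
    calc 2 * K * (pathNorm q (Ioo 0 S) u + pathNorm q (Ioo 0 S) v)
        ≤ 2 * K * (pathNorm q (Ioi 0) u +
          (pathNorm q (Ioo 0 S) (u - v) + pathNorm q (Ioi 0) u)) := by gcongr
      _ = 2⁻¹ * (8 * K * pathNorm q (Ioi 0) u) + 2⁻¹ * (4 * K * pathNorm q (Ioo 0 S) (u - v)) := by
          have e1 : (8 : ℝ≥0∞) = 2 * 4 := by norm_num
          have e2 : (4 : ℝ≥0∞) = 2 * 2 := by norm_num
          have e3 : (2 : ℝ≥0∞)⁻¹ * 2 = 1 := ENNReal.inv_mul_cancel (by simp) (by simp)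
          calc _ = 1 * (4 * K * pathNorm q (Ioi 0) u) +
                1 * (2 * K * pathNorm q (Ioo 0 S) (u - v)) := by ring
            _ = _ := by rw [← e3, e1, e2]; ring
      _ ≤ 2⁻¹ * 1 + 2⁻¹ * 1 := by
          gcongr
          exact hS.trans (by simp)
      _ = 1 := by rw [mul_one, ENNReal.inv_two_add_inv_two]
  obtain ⟨s, hsZ, hsS⟩ := exists_lt_of_csInf_lt hZne (show sInf Z < S from hTS)
  obtain ⟨hs0, k, hk⟩ := hsZ
  exact hk (eq_of_pathNorm_eq_zero hq hzero (show s ∈ Ioo 0 S from ⟨hs0, hsS⟩) k)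

/-- Dominated convergence for the double series: each term tends to zero and is bounded by B² times
a summable product weight independent of t. -/
theorem tendsto_sum_zero {E : Type*} [NormedAddCommGroup E] [CompleteSpace E]
    {M : BilinearBlocks E} (hq : 1 ≤ q) {u : ℝ → ℤ → E} (hu : AdmPath q u)
    (h : ∀ j, Tendsto (fun t => u t j) atTop (𝓝 0)) (j : ℤ) :
    Tendsto (fun t => M.sum (u t) (u t) j) atTop (𝓝 0) := by
  set B := (pathNorm q (Ioi 0) u).toReal
  have := tendsto_tsum_of_dominated_convergence (𝓕 := (atTop : Filter ℝ))
    (f := fun t (kl : ℤ × ℤ) => M.toFun j kl.1 kl.2 (u t kl.1) (u t kl.2)) (g := fun _ => (0 : E))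
    (((M.hasSum_weight_mul j).mul_right (B * B)).summable) ?_ ?_
  · simpa [BilinearBlocks.sum] using this
  · intro kl
    refine squeeze_zero_norm (fun t => M.bound j kl.1 kl.2 _ _) ?_
    have h1 := ((h kl.1).norm.const_mul ((M.w (kl.1 - j) : ℝ) * M.w (kl.2 - j))).mul (h kl.2).norm
    simpa using h1
  · filter_upwards [eventually_gt_atTop 0] with t ht kl
    exact BilinearBlocks.norm_term_le (hu.norm_le hq ht) (hu.norm_le hq ht) j kl

theorem tendsto_quadDuhamel_zero (hq : 1 ≤ q) {u : ℝ → ℤ → V} (hu : AdmPath q u)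
    (h : ∀ j, Tendsto (fun t => u t j) atTop (𝓝 0)) (j : ℤ) :
    Tendsto (fun t => quadDuhamel H M u u t j) atTop (𝓝 0) :=
  H.tendsto_duhamel_zero hq (BilinearBlocks.admPath_sum hq hu hu) j (tendsto_sum_zero hq hu h j)

theorem tendsto_zero_of_pathNorm_limit {E : Type*} [NormedAddCommGroup E] (hq : 1 ≤ q)
    {s : ℕ → ℝ → ℤ → E} {u : ℝ → ℤ → E}
    (hs : ∀ m j, Tendsto (fun t => s m t j) atTop (𝓝 0))
    (h : Tendsto (fun m => pathNorm q (Ioi 0) (u - s m)) atTop (𝓝 0)) (j : ℤ) :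
    Tendsto (fun t => u t j) atTop (𝓝 0) := by
  rw [tendsto_zero_iff_enorm_tendsto_zero, ENNReal.tendsto_nhds_zero]
  intro ε hε
  obtain ⟨m, hm⟩ := ((ENNReal.tendsto_nhds_zero.1 h) (ε / 2) (ENNReal.half_pos hε.ne')).exists
  have h1 := hs m j
  rw [tendsto_zero_iff_enorm_tendsto_zero, ENNReal.tendsto_nhds_zero] at h1
  filter_upwards [h1 (ε / 2) (ENNReal.half_pos hε.ne'), eventually_gt_atTop 0] with t h2 h3
  calc ‖u t j‖ₑ = ‖(u - s m) t j + s m t j‖ₑ := by simp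
    _ ≤ ε / 2 + ε / 2 := (enorm_add_le _ _).trans
        (add_le_add ((enorm_le_pathNorm hq _ h3 j).trans hm) h2)
    _ = ε := ENNReal.add_halves ε

end Core

open FourierTransform

variable {n : ℕ}

/-! ### Gaussians are Schwartz functions -/

section Gaussian

/-- (1 + r)^m is absorbed into (1 + c r²)^m, which is at most m! e^{1 + c r²}; the exponential then
cancels against the Gaussian. -/
theorem one_add_pow_mul_exp_le {c : ℝ} (hc : 0 < c) (m : ℕ) {r : ℝ} (hr : 0 ≤ r) :
    (1 + r) ^ m * Real.exp (-c * r ^ 2) ≤ 2 ^ m * (1 + 1 / c) ^ m * m.factorial * Real.exp 1 := by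
  have h1 : (1 + r) ^ m ≤ (2 * ((1 + 1 / c) * (1 + c * r ^ 2))) ^ m := by
    gcongr
    have : (1 + 1 / c) * (1 + c * r ^ 2) = 1 + r ^ 2 + 1 / c + c * r ^ 2 := by
      field_simp
      ring
    rw [this]
    have : 0 < 1 / c := by positivity
    nlinarith [sq_nonneg (r - 1), mul_nonneg hc.le (sq_nonneg r)]
  have h2 : (1 + c * r ^ 2) ^ m ≤ m.factorial * Real.exp (1 + c * r ^ 2) := by
    have := Real.pow_div_factorial_le_exp (1 + c * r ^ 2) (by positivity) m
    rwa [div_le_iff₀' (by positivity)] at this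
  calc (1 + r) ^ m * Real.exp (-c * r ^ 2)
      ≤ (2 * ((1 + 1 / c) * (1 + c * r ^ 2))) ^ m * Real.exp (-c * r ^ 2) := by gcongr
    _ = 2 ^ m * (1 + 1 / c) ^ m * (1 + c * r ^ 2) ^ m * Real.exp (-c * r ^ 2) := by
        rw [mul_pow, mul_pow]; ring
    _ ≤ 2 ^ m * (1 + 1 / c) ^ m * (m.factorial * Real.exp (1 + c * r ^ 2)) *
        Real.exp (-c * r ^ 2) := by gcongr
    _ = 2 ^ m * (1 + 1 / c) ^ m * m.factorial * Real.exp 1 := by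
        rw [Real.exp_add, neg_mul, Real.exp_neg]
        field_simp

/-- A Faà di Bruno bound with outer function e^{-cs} and inner function |x|²: each derivative costs
a power of 1 + |x|, which the Gaussian absorbs. -/
theorem gaussian_decay {c : ℝ} (hc : 0 < c) (k m : ℕ) :
    ∃ C : ℝ, ∀ x : Space n,
      ‖x‖ ^ k * ‖iteratedFDeriv ℝ m (fun x : Space n => Real.exp (-c * ‖x‖ ^ 2)) x‖ ≤ C := by
  have htg : (fun x : Space n => ‖x‖ ^ 2).HasTemperateGrowth := by fun_prop
  obtain ⟨N, D, hD, hbd⟩ := htg.norm_iteratedFDeriv_le_uniform m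
  -- The added 1 makes E(1 + |x|)^N at least 1, so that the bound on the i-th derivative may be
  -- raised to the power i.
  set E := (D + 1)
  refine ⟨m.factorial * (1 + c) ^ m * E ^ m * (2 ^ (k + N * m) * (1 + 1 / c) ^ (k + N * m) *
    (k + N * m).factorial * Real.exp 1), fun x => ?_⟩
  have h1 : ‖iteratedFDeriv ℝ m ((fun s : ℝ => Real.exp (-c * s)) ∘ fun x : Space n => ‖x‖ ^ 2) x‖ ≤
      m.factorial * ((1 + c) ^ m * Real.exp (-c * ‖x‖ ^ 2)) * (E * (1 + ‖x‖) ^ N) ^ m := by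
    refine norm_iteratedFDeriv_comp_le (N := ∞) (by fun_prop) (contDiff_norm_sq ℝ)
      (by exact_mod_cast le_top) x (fun i hi => ?_) (fun i hi hi' => ?_)
    · rw [norm_iteratedFDeriv_eq_norm_iteratedDeriv, iteratedDeriv_exp_const_mul]
      simp only [norm_mul, norm_pow, norm_neg, Real.norm_eq_abs, Real.abs_exp, abs_of_pos hc]
      gcongr
      calc c ^ i ≤ (1 + c) ^ i := by gcongr; linarith
        _ ≤ (1 + c) ^ m := pow_le_pow_right₀ (by linarith) hi
    · have hb : (1 : ℝ) ≤ E * (1 + ‖x‖) ^ N := by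
        have : (1 : ℝ) ≤ (1 + ‖x‖) ^ N := one_le_pow₀ (by linarith [norm_nonneg x])
        nlinarith
      calc _ ≤ D * (1 + ‖x‖) ^ N := hbd i hi' x
        _ ≤ E * (1 + ‖x‖) ^ N := by gcongr; linarith
        _ ≤ _ := le_self_pow₀ hb (by omega)
  calc _ ≤ (1 + ‖x‖) ^ k * (m.factorial * ((1 + c) ^ m * Real.exp (-c * ‖x‖ ^ 2)) *
        (E * (1 + ‖x‖) ^ N) ^ m) := by
        gcongr
        · linarith
        · exact h1
    _ = m.factorial * (1 + c) ^ m * E ^ m *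
        ((1 + ‖x‖) ^ (k + N * m) * Real.exp (-c * ‖x‖ ^ 2)) := by
        rw [mul_pow, ← pow_mul, pow_add]; ring
    _ ≤ _ := by
        exact mul_le_mul_of_nonneg_left (one_add_pow_mul_exp_le hc _ (norm_nonneg x))
          (by positivity)

/-- The Gaussian `exp (-c |x|²)` as a Schwartz function. -/
def gaussian {c : ℝ} (hc : 0 < c) : 𝓢(Space n, ℂ) :=
  SchwartzMap.postcompCLM (𝕜 := ℝ) Complex.ofRealCLM
    { toFun := fun x : Space n => Real.exp (-c * ‖x‖ ^ 2)
      smooth' := (contDiff_const.mul (contDiff_norm_sq ℝ)).exp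
      decay' := fun k m => gaussian_decay hc k m }

theorem gaussian_apply {c : ℝ} (hc : 0 < c) (x : Space n) :
    gaussian hc x = (Real.exp (-c * ‖x‖ ^ 2) : ℂ) := rfl

end Gaussian

/-! ### Distributions represented by functions -/

section Rep

/-- The Gaussian is an admissible test function without zeros, so regularity of g · gaussian passes
to g by division. -/
theorem IsRep.aestronglyMeasurable {T : TDist n} {g : Space n → ℂ} (h : IsRep T g) :
    AEStronglyMeasurable g := by
  have h1 := (h (gaussian one_pos)).1.aestronglyMeasurable
  have h2 : AEStronglyMeasurable (fun x : Space n => (gaussian (n := n) one_pos x)⁻¹) :=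
    ((gaussian (n := n) one_pos).continuous.inv₀ fun x => by
      rw [gaussian_apply]; exact_mod_cast (Real.exp_pos _).ne').aestronglyMeasurable
  refine (h1.mul h2).congr (Eventually.of_forall fun x => ?_)
  have : gaussian (n := n) one_pos x ≠ 0 := by
    rw [gaussian_apply]; exact_mod_cast (Real.exp_pos _).ne'
  simp [this]

theorem IsRep.locallyIntegrable {T : TDist n} {g : Space n → ℂ} (h : IsRep T g) :
    LocallyIntegrable g := by
  have h1 := (h (gaussian one_pos)).1.locallyIntegrable
  have h2 : Continuous (fun x : Space n => (gaussian (n := n) one_pos x)⁻¹) :=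
    (gaussian (n := n) one_pos).continuous.inv₀ fun x => by
      rw [gaussian_apply]; exact_mod_cast (Real.exp_pos _).ne'
  have h3 := h1.continuous_mul h2
  refine h3.congr (Eventually.of_forall fun x => ?_)
  have : gaussian (n := n) one_pos x ≠ 0 := by
    rw [gaussian_apply]; exact_mod_cast (Real.exp_pos _).ne'
  field_simp

/-- The fundamental lemma of the calculus of variations. The infimum in `distLpNorm` thus runs over
essentially one function. -/
theorem IsRep.ae_eq {T : TDist n} {g g' : Space n → ℂ} (h : IsRep T g) (h' : IsRep T g') :
    g =ᵐ[volume] g' := by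
  refine ae_eq_of_integral_contDiff_smul_eq h.locallyIntegrable h'.locallyIntegrable ?_
  intro φ hφ hφ'
  have hg₁ : HasCompactSupport (Complex.ofRealCLM ∘ φ) := hφ'.comp_left rfl
  have hg₂ : ContDiff ℝ ∞ (Complex.ofRealCLM ∘ φ) := by fun_prop
  have e1 := (h (hg₁.toSchwartzMap hg₂)).2
  have e2 := (h' (hg₁.toSchwartzMap hg₂)).2
  rw [e1] at e2
  simpa [mul_comm] using e2

theorem IsRep.congr {T : TDist n} {g g' : Space n → ℂ} (h : IsRep T g) (hg : g =ᵐ[volume] g') :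
    IsRep T g' := by
  intro φ
  have : (fun x => g x * φ x) =ᵐ[volume] fun x => g' x * φ x := by
    filter_upwards [hg] with x hx
    rw [hx]
  exact ⟨(h φ).1.congr this, (h φ).2.trans (integral_congr_ae this)⟩

theorem IsRep.add {S T : TDist n} {g h : Space n → ℂ} (hS : IsRep S g) (hT : IsRep T h) :
    IsRep (S + T) (g + h) := by
  intro φ
  have e : (fun x => (g + h) x * φ x) = fun x => g x * φ x + h x * φ x := by
    funext x; simp [add_mul]
  rw [e]
  refine ⟨(hS φ).1.add (hT φ).1, ?_⟩
  rw [integral_add (hS φ).1 (hT φ).1, ← (hS φ).2, ← (hT φ).2]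
  rfl

theorem isRep_zero : IsRep (0 : TDist n) 0 := by
  intro φ
  simp

theorem IsRep.sum {ι : Type*} {s : Finset ι} {T : ι → TDist n} {g : ι → Space n → ℂ}
    (h : ∀ i ∈ s, IsRep (T i) (g i)) : IsRep (∑ i ∈ s, T i) (∑ i ∈ s, g i) := by
  classical
  induction s using Finset.induction_on with
  | empty => simpa using isRep_zero
  | insert a s ha ih =>
    rw [Finset.sum_insert ha, Finset.sum_insert ha]
    exact (h a (by simp)).add (ih fun i hi => h i (by simp [hi]))

theorem distLpNorm_eq {p : ℝ} {T : TDist n} {g : Space n → ℂ} (h : IsRep T g) :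
    distLpNorm p T = eLpNorm g (ENNReal.ofReal p) volume := by
  refine le_antisymm (iInf₂_le g h) (le_iInf₂ fun g' h' => ?_)
  rw [eLpNorm_congr_ae (h.ae_eq h')]

theorem exists_rep_of_distLpNorm_lt_top {p : ℝ} {T : TDist n} (h : distLpNorm p T < ⊤) :
    ∃ g, IsRep T g ∧ MemLp g (ENNReal.ofReal p) volume := by
  unfold distLpNorm at h
  simp only [iInf_lt_iff] at h
  obtain ⟨g, hg, hlt⟩ := h
  exact ⟨g, hg, hg.aestronglyMeasurable, hlt⟩

theorem isRep_toTemperedDistribution {a : ℝ≥0∞} [Fact (1 ≤ a)]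
    (g : Lp ℂ a (volume : Measure (Space n))) : IsRep (g : TDist n) g := by
  intro φ
  have hq := ENNReal.HolderConjugate.inv_one_sub_inv' (Fact.out : 1 ≤ a)
  refine ⟨?_, ?_⟩
  · exact (Lp.memLp g).integrable_mul (φ.memLp (1 - a⁻¹)⁻¹)
  · rw [Lp.toTemperedDistribution_apply]
    simp [mul_comm]

end Rep

/-! ### Convolution with a kernel -/

section Convolution

/-- The convolution `k * g`. -/
def cv (k g : Space n → ℂ) (x : Space n) : ℂ := ∫ y, k y * g (x - y)

/-- The convolution of the absolute values. -/
def absCv (k g : Space n → ℂ) (x : Space n) : ℝ≥0∞ := ∫⁻ y, ‖k y‖ₑ * ‖g (x - y)‖ₑ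

theorem enorm_cv_le_absCv (k g : Space n → ℂ) (x : Space n) : ‖cv k g x‖ₑ ≤ absCv k g x := by
  refine (enorm_integral_le_lintegral_enorm _).trans_eq ?_
  simp [absCv, enorm_mul]

variable {k g : Space n → ℂ}

theorem aestronglyMeasurable_comp_sub (hg : AEStronglyMeasurable g) (x : Space n) :
    AEStronglyMeasurable (fun y => g (x - y)) :=
  hg.comp_quasiMeasurePreserving (quasiMeasurePreserving_sub_left_of_right_invariant volume x)

theorem aestronglyMeasurable_cv (hk : AEStronglyMeasurable k) (hg : AEStronglyMeasurable g) :
    AEStronglyMeasurable (cv k g) :=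
  (hk.convolution_integrand (ContinuousLinearMap.mul ℂ ℂ) hg).integral_prod_right'

/-- Jensen's inequality for the measure `|k| dy`. -/
theorem absCv_rpow_le {a : ℝ} (ha : 1 ≤ a) (hk : AEStronglyMeasurable k)
    (hg : AEStronglyMeasurable g) (x : Space n) :
    absCv k g x ^ a ≤ (∫⁻ y, ‖k y‖ₑ) ^ (a - 1) * ∫⁻ y, ‖k y‖ₑ * ‖g (x - y)‖ₑ ^ a := by
  have ha0 : 0 < a := zero_lt_one.trans_le ha
  set ν := (volume : Measure (Space n)).withDensity fun y => ‖k y‖ₑ with hν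
  have hgx := aestronglyMeasurable_comp_sub hg x
  have h := eLpNorm'_le_eLpNorm'_mul_rpow_measure_univ (μ := ν) (f := fun y => g (x - y)) one_pos ha
    (hgx.mono_ac (withDensity_absolutelyContinuous _ _))
  simp only [eLpNorm', ENNReal.rpow_one, div_one] at h
  rw [hν, lintegral_withDensity_eq_lintegral_mul₀ hk.enorm hgx.enorm,
    lintegral_withDensity_eq_lintegral_mul₀ hk.enorm (hgx.enorm.pow_const a),
    withDensity_apply _ MeasurableSet.univ, Measure.restrict_univ] at h
  calc absCv k g x ^ a ≤ _ := ENNReal.rpow_le_rpow h ha0.le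
    _ = _ := by
      rw [ENNReal.mul_rpow_of_nonneg _ _ ha0.le, ← ENNReal.rpow_mul, ← ENNReal.rpow_mul,
        one_div_mul_cancel ha0.ne', ENNReal.rpow_one, mul_comm]
      congr 2
      field_simp

/-- After Jensen's inequality the remaining kernel is bounded by its supremum: this is Young's
inequality L^a → L^∞. -/
theorem absCv_le {a : ℝ} (ha : 1 ≤ a) (hk : AEStronglyMeasurable k)
    (hg : AEStronglyMeasurable g) {K : ℝ≥0∞} (hK : ∀ y, ‖k y‖ₑ ≤ K) (x : Space n) :
    absCv k g x ≤ (∫⁻ y, ‖k y‖ₑ) ^ (1 - 1 / a) * K ^ (1 / a) *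
      eLpNorm g (ENNReal.ofReal a) volume := by
  have ha0 : 0 < a := zero_lt_one.trans_le ha
  have h1 : ∫⁻ y, ‖k y‖ₑ * ‖g (x - y)‖ₑ ^ a ≤ K * ∫⁻ y, ‖g y‖ₑ ^ a := by
    rw [← lintegral_sub_left_eq_self (fun y => ‖g y‖ₑ ^ a) x, ← lintegral_const_mul'']
    · gcongr with y
      exact hK y
    · exact (aestronglyMeasurable_comp_sub hg x).enorm.pow_const a
  have h2 := (absCv_rpow_le ha hk hg x).trans (mul_le_mul_right h1 _)
  rw [eLpNorm_eq_lintegral_rpow_enorm_toReal (by simpa using ha0) (by simp),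
    ENNReal.toReal_ofReal ha0.le]
  have h3 := ENNReal.rpow_le_rpow h2 (show 0 ≤ 1 / a by positivity)
  rw [← ENNReal.rpow_mul, mul_one_div_cancel ha0.ne', ENNReal.rpow_one,
    ENNReal.mul_rpow_of_nonneg _ _ (by positivity), ENNReal.mul_rpow_of_nonneg _ _ (by positivity),
    ← ENNReal.rpow_mul] at h3
  refine h3.trans_eq ?_
  rw [mul_assoc]
  congr 2
  field_simp

/-- Integrating Jensen's inequality in x and applying Tonelli and translation invariance gives
Young's inequality on L^a. -/
theorem eLpNorm_cv_le {a : ℝ} (ha : 1 ≤ a) (hk : AEStronglyMeasurable k)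
    (hg : AEStronglyMeasurable g) :
    eLpNorm (cv k g) (ENNReal.ofReal a) volume ≤
      (∫⁻ y, ‖k y‖ₑ) * eLpNorm g (ENNReal.ofReal a) volume := by
  have ha0 : 0 < a := zero_lt_one.trans_le ha
  rw [eLpNorm_eq_lintegral_rpow_enorm_toReal (by simpa using ha0) (by simp),
    eLpNorm_eq_lintegral_rpow_enorm_toReal (by simpa using ha0) (by simp),
    ENNReal.toReal_ofReal ha0.le]
  have hmeas : AEMeasurable (fun z : Space n × Space n => ‖k z.2‖ₑ * ‖g (z.1 - z.2)‖ₑ ^ a)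
      (volume.prod volume) := by
    have h1 : AEMeasurable (fun z : Space n × Space n => ‖k z.2‖ₑ) (volume.prod volume) :=
      (hk.comp_quasiMeasurePreserving Measure.quasiMeasurePreserving_snd).enorm
    have h2 : AEStronglyMeasurable (fun z : Space n × Space n => g (z.1 - z.2))
        (volume.prod volume) :=
      hg.comp_quasiMeasurePreserving (quasiMeasurePreserving_sub_of_right_invariant volume volume)
    exact h1.mul (h2.enorm.pow_const a)
  have h1 : ∫⁻ x, ‖cv k g x‖ₑ ^ a ≤ (∫⁻ y, ‖k y‖ₑ) ^ a * ∫⁻ y, ‖g y‖ₑ ^ a := by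
    calc ∫⁻ x, ‖cv k g x‖ₑ ^ a
        ≤ ∫⁻ x, (∫⁻ y, ‖k y‖ₑ) ^ (a - 1) * ∫⁻ y, ‖k y‖ₑ * ‖g (x - y)‖ₑ ^ a := by
          refine lintegral_mono fun x => le_trans ?_ (absCv_rpow_le ha hk hg x)
          gcongr
          exact enorm_cv_le_absCv k g x
      _ = (∫⁻ y, ‖k y‖ₑ) ^ (a - 1) * ∫⁻ x, ∫⁻ y, ‖k y‖ₑ * ‖g (x - y)‖ₑ ^ a :=
          lintegral_const_mul'' _ hmeas.lintegral_prod_right'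
      _ = (∫⁻ y, ‖k y‖ₑ) ^ (a - 1) * ∫⁻ y, ‖k y‖ₑ * ∫⁻ x, ‖g x‖ₑ ^ a := by
          rw [lintegral_lintegral_swap hmeas]
          congr 2
          funext y
          rw [lintegral_const_mul'', lintegral_sub_right_eq_self (fun x => ‖g x‖ₑ ^ a) y]
          exact (hg.comp_quasiMeasurePreserving
            (measurePreserving_sub_right volume y).quasiMeasurePreserving).enorm.pow_const a
      _ = (∫⁻ y, ‖k y‖ₑ) ^ (a - 1) * (∫⁻ y, ‖k y‖ₑ) * ∫⁻ x, ‖g x‖ₑ ^ a := by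
          rw [lintegral_mul_const'' _ hk.enorm, mul_assoc]
      _ = _ := by
          congr 1
          conv_lhs => rw [← ENNReal.rpow_one (∫⁻ y, ‖k y‖ₑ), ← ENNReal.rpow_mul, one_mul]
          rw [← ENNReal.rpow_add_of_nonneg _ _ (by linarith) zero_le_one]
          simp
  have h2 := ENNReal.rpow_le_rpow h1 (show 0 ≤ 1 / a by positivity)
  rwa [ENNReal.mul_rpow_of_nonneg _ _ (by positivity), ← ENNReal.rpow_mul,
    mul_one_div_cancel ha0.ne', ENNReal.rpow_one] at h2

/-- Interpolation of `L^b` between `L^a` and `L^∞`. -/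
theorem eLpNorm_le_of_bound {a b : ℝ} (ha : 0 < a) (hab : a ≤ b) {h : Space n → ℂ} {S : ℝ≥0∞}
    (hS : ∀ᵐ x, ‖h x‖ₑ ≤ S) (hh : AEStronglyMeasurable h) :
    eLpNorm h (ENNReal.ofReal b) volume ≤
      S ^ (1 - a / b) * eLpNorm h (ENNReal.ofReal a) volume ^ (a / b) := by
  have hb : 0 < b := ha.trans_le hab
  rw [eLpNorm_eq_lintegral_rpow_enorm_toReal (by simpa using hb) (by simp),
    eLpNorm_eq_lintegral_rpow_enorm_toReal (by simpa using ha) (by simp),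
    ENNReal.toReal_ofReal ha.le, ENNReal.toReal_ofReal hb.le]
  have h1 : ∫⁻ x, ‖h x‖ₑ ^ b ≤ S ^ (b - a) * ∫⁻ x, ‖h x‖ₑ ^ a := by
    rw [← lintegral_const_mul'' _ (hh.enorm.pow_const a)]
    refine lintegral_mono_ae ?_
    filter_upwards [hS] with x hx
    calc ‖h x‖ₑ ^ b = ‖h x‖ₑ ^ (b - a) * ‖h x‖ₑ ^ a := by
          rw [← ENNReal.rpow_add_of_nonneg _ _ (by linarith) ha.le]; simp
      _ ≤ _ := by gcongr
  have h2 := ENNReal.rpow_le_rpow h1 (show 0 ≤ 1 / b by positivity)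
  rw [ENNReal.mul_rpow_of_nonneg _ _ (by positivity), ← ENNReal.rpow_mul] at h2
  refine h2.trans_eq ?_
  rw [← ENNReal.rpow_mul]
  congr 2 <;> field_simp

/-- Young's inequality `L^a → L^b` for a bounded integrable kernel. -/
theorem eLpNorm_cv_le_of_le {a b : ℝ} (ha : 1 ≤ a) (hab : a ≤ b) (hk : AEStronglyMeasurable k)
    (hg : AEStronglyMeasurable g) {K : ℝ≥0∞} (hK : ∀ y, ‖k y‖ₑ ≤ K) :
    eLpNorm (cv k g) (ENNReal.ofReal b) volume ≤
      (∫⁻ y, ‖k y‖ₑ) ^ (1 - 1 / a + 1 / b) * K ^ (1 / a - 1 / b) *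
        eLpNorm g (ENNReal.ofReal a) volume := by
  have ha0 : 0 < a := zero_lt_one.trans_le ha
  have hb0 : 0 < b := ha0.trans_le hab
  have hab1 : a / b ≤ 1 := (div_le_one hb0).2 hab
  have h1a : 1 / a ≤ 1 := (div_le_one ha0).2 ha
  have e0 : 0 ≤ 1 - a / b := by linarith
  refine (eLpNorm_le_of_bound ha0 hab (Eventually.of_forall fun x =>
    (enorm_cv_le_absCv k g x).trans (absCv_le ha hk hg hK x)) (aestronglyMeasurable_cv hk hg)).trans ?_
  set I := ∫⁻ y, ‖k y‖ₑ
  set G := eLpNorm g (ENNReal.ofReal a) volume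
  calc _ ≤ (I ^ (1 - 1 / a) * K ^ (1 / a) * G) ^ (1 - a / b) * (I * G) ^ (a / b) := by
        gcongr
        exact eLpNorm_cv_le ha hk hg
    _ = (I ^ ((1 - 1 / a) * (1 - a / b)) * I ^ (a / b)) * K ^ (1 / a * (1 - a / b)) *
        (G ^ (1 - a / b) * G ^ (a / b)) := by
        rw [ENNReal.mul_rpow_of_nonneg _ _ e0, ENNReal.mul_rpow_of_nonneg _ _ e0,
          ENNReal.mul_rpow_of_nonneg _ _ (by positivity), ← ENNReal.rpow_mul, ← ENNReal.rpow_mul]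
        ring
    _ = _ := by
        rw [← ENNReal.rpow_add_of_nonneg _ _ (mul_nonneg (by linarith) e0) (by positivity),
          ← ENNReal.rpow_add_of_nonneg _ _ e0 (by positivity)]
        have e1 : (1 - 1 / a) * (1 - a / b) + a / b = 1 - 1 / a + 1 / b := by field_simp; ring
        have e2 : 1 / a * (1 - a / b) = 1 / a - 1 / b := by field_simp
        rw [e1, e2]
        simp

end Convolution

/-! ### Fourier multipliers with Schwartz symbols are convolutions -/

section Multiplier

/-- The Fourier multiplier with complex symbol `m`. -/
abbrev FM (m : Space n → ℂ) (T : TDist n) : TDist n :=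
  TemperedDistribution.fourierMultiplierCLM ℂ m T

/-- A multiplier acts on a distribution by transposition. On the test function the transpose is
correlation with the kernel, obtained from the convolution theorem after reflecting φ. -/
theorem fourier_mul_fourierInv_apply (m φ : 𝓢(Space n, ℂ)) (x : Space n) :
    𝓕 (SchwartzMap.smulLeftCLM ℂ m (𝓕⁻ φ)) x = ∫ y, (𝓕⁻ m : 𝓢(Space n, ℂ)) y * φ (x + y) := by
  set R := SchwartzMap.compCLMOfContinuousLinearEquiv ℂ
    (LinearIsometryEquiv.neg ℝ (E := Space n)).toContinuousLinearEquiv (F := ℂ) with hR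
  have hRa : ∀ (f : 𝓢(Space n, ℂ)) y, R f y = f (-y) := fun f y => rfl
  have e1 : 𝓕⁻ φ = 𝓕 (R φ) := by
    ext y
    rw [SchwartzMap.fourierInv_coe, SchwartzMap.fourier_coe, Real.fourierInv_eq_fourier_comp_neg]
    rfl
  have e2 : SchwartzMap.smulLeftCLM ℂ m (𝓕⁻ φ) =
      𝓕 (SchwartzMap.convolution (ContinuousLinearMap.mul ℂ ℂ) (𝓕⁻ m) (R φ)) := by
    rw [SchwartzMap.fourier_convolution, FourierTransform.fourier_fourierInv_eq, e1]
    ext y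
    simp [SchwartzMap.smulLeftCLM_apply_apply m.hasTemperateGrowth]
  have e3 : ∀ f : 𝓢(Space n, ℂ), 𝓕 f x = 𝓕⁻ f (-x) := by
    intro f
    rw [SchwartzMap.fourierInv_coe, SchwartzMap.fourier_coe, Real.fourierInv_eq_fourier_neg,
      neg_neg]
  rw [e3, e2, FourierTransform.fourierInv_fourier_eq, SchwartzMap.convolution_apply]
  simp [convolution, hRa, add_comm]

/-- Fubini's theorem and the measure-preserving shear (x, y) ↦ (x + y, y). Integrability on the
product follows because |k| * |g| is bounded, k being bounded and integrable and g in L^a. -/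
theorem IsRep.fm_schwartz {a : ℝ} (ha : 1 ≤ a) {T : TDist n} {g : Space n → ℂ} (h : IsRep T g)
    (hg : MemLp g (ENNReal.ofReal a) volume) (m : 𝓢(Space n, ℂ)) :
    IsRep (FM m T) (cv (𝓕⁻ m : 𝓢(Space n, ℂ)) g) := by
  intro φ
  set k := 𝓕⁻ m with hk
  have hkm : AEStronglyMeasurable (k : Space n → ℂ) := k.continuous.aestronglyMeasurable
  obtain ⟨K, hK⟩ : ∃ K : ℝ, ∀ y, ‖k y‖ ≤ K := ⟨_, fun y => SchwartzMap.norm_le_seminorm ℝ k y⟩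
  have hbd : ∃ S : ℝ≥0∞, S ≠ ⊤ ∧ ∀ x, absCv k g x ≤ S := by
    refine ⟨_, ?_, absCv_le ha hkm hg.1 (K := ENNReal.ofReal K) fun y => ?_⟩
    · have h1 : ∫⁻ y, ‖k y‖ₑ ≠ ⊤ := k.integrable.2.ne
      have h2 : (1 : ℝ) / a ≤ 1 := (div_le_one (by linarith)).2 ha
      exact ENNReal.mul_ne_top (ENNReal.mul_ne_top
        (ENNReal.rpow_ne_top_of_nonneg (by linarith) h1)
        (ENNReal.rpow_ne_top_of_nonneg (by positivity) (by simp))) hg.2.ne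
    · rw [← ofReal_norm]
      exact ENNReal.ofReal_le_ofReal (hK y)
  obtain ⟨S, hS, hbd⟩ := hbd
  let G : Space n × Space n → ℂ := fun z => k z.2 * g (z.1 - z.2) * φ z.1
  have hGm : AEStronglyMeasurable G (volume.prod volume) :=
    (hkm.convolution_integrand (ContinuousLinearMap.mul ℂ ℂ) hg.1).mul
      (φ.continuous.comp continuous_fst).aestronglyMeasurable
  have hGi : Integrable G (volume.prod volume) := by
    refine ⟨hGm, ?_⟩
    rw [hasFiniteIntegral_iff_enorm, lintegral_prod _ hGm.enorm]
    calc ∫⁻ x, ∫⁻ y, ‖G (x, y)‖ₑ ≤ ∫⁻ x, S * ‖φ x‖ₑ := by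
          refine lintegral_mono fun x => ?_
          have : ∫⁻ y, ‖G (x, y)‖ₑ = absCv k g x * ‖φ x‖ₑ := by
            unfold absCv
            rw [← lintegral_mul_const' _ _ (by simp)]
            simp [G, enorm_mul]
          simp only [this]
          gcongr
          exact hbd x
      _ = S * ∫⁻ x, ‖φ x‖ₑ := lintegral_const_mul' _ _ hS
      _ < ⊤ := ENNReal.mul_lt_top hS.lt_top φ.integrable.2
  have e1 : ∫ z, G z ∂(volume.prod volume) = ∫ x, cv k g x * φ x := by
    rw [integral_prod _ hGi]
    refine integral_congr_ae (Eventually.of_forall fun x => ?_)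
    simp only [cv, G]
    rw [← integral_mul_const]
  have hmp := measurePreserving_add_prod (volume : Measure (Space n)) volume
  have hme : MeasurableEmbedding (fun z : Space n × Space n => (z.1 + z.2, z.2)) := by
    refine MeasurableEquiv.measurableEmbedding (⟨⟨fun z => (z.1 + z.2, z.2),
      fun z => (z.1 - z.2, z.2), fun z => by simp, fun z => by simp⟩, ?_, ?_⟩ :
        Space n × Space n ≃ᵐ Space n × Space n)
    · exact (by fun_prop : Measurable fun z : Space n × Space n => (z.1 + z.2, z.2))
    · exact (by fun_prop : Measurable fun z : Space n × Space n => (z.1 - z.2, z.2))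
  have hGi' : Integrable (fun z : Space n × Space n => G (z.1 + z.2, z.2)) (volume.prod volume) :=
    (hmp.integrable_comp hGm).2 hGi
  have e2 : ∫ z, G z ∂(volume.prod volume) = ∫ x, g x * ∫ y, k y * φ (x + y) := by
    rw [← hmp.integral_comp hme G, integral_prod _ hGi']
    refine integral_congr_ae (Eventually.of_forall fun x => ?_)
    simp only [G]
    rw [← integral_const_mul]
    refine integral_congr_ae (Eventually.of_forall fun y => ?_)
    simp only [add_sub_cancel_right]
    ring
  refine ⟨?_, ?_⟩
  · refine hGi.integral_prod_left.congr (Eventually.of_forall fun x => ?_)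
    change ∫ y, k y * g (x - y) * φ x = (∫ y, k y * g (x - y)) * φ x
    rw [← integral_mul_const]
  · rw [← e1, e2, TemperedDistribution.fourierMultiplierCLM_apply_apply, (h _).2]
    refine integral_congr_ae (Eventually.of_forall fun x => ?_)
    simp only [fourier_mul_fourierInv_apply, hk]

/-- The function `m` is a Schwartz function. -/
def IsSchwartz (m : Space n → ℂ) : Prop := ∃ s : 𝓢(Space n, ℂ), ⇑s = m

/-- The `L¹` norm of the kernel of a symbol. -/
def kerNorm (m : Space n → ℂ) : ℝ≥0∞ := ∫⁻ y, ‖(𝓕⁻ m) y‖ₑ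

namespace IsSchwartz

variable {m m' : Space n → ℂ}

theorem continuous_kernel (h : IsSchwartz m) : Continuous (𝓕⁻ m) := by
  obtain ⟨s, rfl⟩ := h
  rw [← SchwartzMap.fourierInv_coe]
  exact (𝓕⁻ s).continuous

theorem exists_kernel_le (h : IsSchwartz m) : ∃ K : ℝ, 0 ≤ K ∧ ∀ y, ‖(𝓕⁻ m) y‖ ≤ K := by
  obtain ⟨s, rfl⟩ := h
  rw [← SchwartzMap.fourierInv_coe]
  exact ⟨_, apply_nonneg _ _, fun y => SchwartzMap.norm_le_seminorm ℝ (𝓕⁻ s) y⟩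

theorem kerNorm_ne_top (h : IsSchwartz m) : kerNorm m ≠ ⊤ := by
  obtain ⟨s, rfl⟩ := h
  rw [kerNorm, ← SchwartzMap.fourierInv_coe]
  exact (𝓕⁻ s).integrable.2.ne

theorem hasTemperateGrowth (h : IsSchwartz m) : m.HasTemperateGrowth := by
  obtain ⟨s, rfl⟩ := h
  exact s.hasTemperateGrowth

theorem of_hasCompactSupport (h : HasCompactSupport m) (h' : ContDiff ℝ ∞ m) : IsSchwartz m :=
  ⟨h.toSchwartzMap h', rfl⟩

theorem sub (h : IsSchwartz m) (h' : IsSchwartz m') : IsSchwartz (m - m') := by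
  obtain ⟨s, rfl⟩ := h
  obtain ⟨s', rfl⟩ := h'
  exact ⟨s - s', rfl⟩

theorem smul (c : ℂ) (h : IsSchwartz m) : IsSchwartz (c • m) := by
  obtain ⟨s, rfl⟩ := h
  exact ⟨c • s, rfl⟩

theorem mul_left (h : IsSchwartz m) (h' : m'.HasTemperateGrowth) : IsSchwartz (m' * m) := by
  obtain ⟨s, rfl⟩ := h
  exact ⟨SchwartzMap.smulLeftCLM ℂ m' s, by
    ext y; simp [SchwartzMap.smulLeftCLM_apply_apply h']⟩

theorem mul (h : IsSchwartz m) (h' : IsSchwartz m') : IsSchwartz (m * m') :=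
  h'.mul_left h.hasTemperateGrowth

theorem comp_smul (h : IsSchwartz m) {c : ℝ} (hc : c ≠ 0) : IsSchwartz fun ξ => m (c • ξ) := by
  obtain ⟨s, rfl⟩ := h
  exact ⟨SchwartzMap.compCLMOfContinuousLinearEquiv ℂ
    (ContinuousLinearEquiv.smulLeft (Units.mk0 c hc)) s, rfl⟩

end IsSchwartz

theorem IsRep.fm {a : ℝ} (ha : 1 ≤ a) {T : TDist n} {g : Space n → ℂ} (h : IsRep T g)
    (hg : MemLp g (ENNReal.ofReal a) volume) {m : Space n → ℂ} (hm : IsSchwartz m) :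
    IsRep (FM m T) (cv (𝓕⁻ m) g) := by
  obtain ⟨s, rfl⟩ := hm
  rw [← SchwartzMap.fourierInv_coe]
  exact h.fm_schwartz ha hg s

theorem memLp_cv {a : ℝ} (ha : 1 ≤ a) {g : Space n → ℂ} (hg : MemLp g (ENNReal.ofReal a) volume)
    {m : Space n → ℂ} (hm : IsSchwartz m) : MemLp (cv (𝓕⁻ m) g) (ENNReal.ofReal a) volume :=
  ⟨aestronglyMeasurable_cv hm.continuous_kernel.aestronglyMeasurable hg.1,
    (eLpNorm_cv_le ha hm.continuous_kernel.aestronglyMeasurable hg.1).trans_lt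
      (ENNReal.mul_lt_top hm.kerNorm_ne_top.lt_top hg.2)⟩

/-! ### Kernel norms -/

theorem fourierInv_comp_smul (m : Space n → ℂ) {c : ℝ} (hc : 0 < c) (y : Space n) :
    𝓕⁻ (fun ξ => m (c • ξ)) y = ((c ^ n)⁻¹ : ℝ) • 𝓕⁻ m (c⁻¹ • y) := by
  rw [Real.fourierInv_eq, Real.fourierInv_eq]
  have h := Measure.integral_comp_smul (volume : Measure (Space n))
    (fun v => Real.fourierChar (inner ℝ v (c⁻¹ • y)) • m v) c
  rw [finrank_euclideanSpace_fin, abs_of_pos (by positivity)] at h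
  rw [← h]
  congr 1
  ext v
  rw [inner_smul_left, inner_smul_right]
  simp [hc.ne']

/-- Dilating a symbol dilates its kernel in an L¹-normalized way. This is why bounds proved at
frequency 1 hold with the same constant at every 2^j. -/
theorem kerNorm_comp_smul (m : Space n → ℂ) {c : ℝ} (hc : 0 < c) :
    kerNorm (fun ξ => m (c • ξ)) = kerNorm m := by
  unfold kerNorm
  simp only [fourierInv_comp_smul m hc, enorm_smul]
  rw [lintegral_const_mul' _ _ (by simp)]
  have h := lintegral_map_equiv (μ := (volume : Measure (Space n))) (fun y => ‖𝓕⁻ m y‖ₑ)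
    (Homeomorph.smulOfNeZero c⁻¹ (inv_ne_zero hc.ne')).toMeasurableEquiv
  have e : (⇑(Homeomorph.smulOfNeZero c⁻¹ (inv_ne_zero hc.ne') :
      Space n ≃ₜ Space n).toMeasurableEquiv : Space n → Space n) = fun x => c⁻¹ • x := rfl
  rw [e, Measure.map_addHaar_smul _ (inv_ne_zero hc.ne'), lintegral_smul_measure] at h
  rw [← h, finrank_euclideanSpace_fin, smul_eq_mul, ← mul_assoc, ← ofReal_norm, Real.norm_eq_abs,
    ← ENNReal.ofReal_mul (abs_nonneg _), ← abs_mul]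
  simp [hc.ne']

theorem fourierInv_mul {m m' : Space n → ℂ} (h : IsSchwartz m) (h' : IsSchwartz m') :
    𝓕⁻ (m * m') = cv (𝓕⁻ m) (𝓕⁻ m') := by
  obtain ⟨s, rfl⟩ := h
  obtain ⟨s', rfl⟩ := h'
  have e1 := SchwartzMap.fourier_convolution (ContinuousLinearMap.mul ℂ ℂ)
    (𝓕⁻ s : 𝓢(Space n, ℂ)) (𝓕⁻ s')
  rw [FourierTransform.fourier_fourierInv_eq, FourierTransform.fourier_fourierInv_eq] at e1
  have e2 : (⇑s * ⇑s' : Space n → ℂ) =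
      ⇑(SchwartzMap.pairing (ContinuousLinearMap.mul ℂ ℂ) s s') := by
    ext x; simp
  rw [e2, ← e1, ← SchwartzMap.fourierInv_coe, FourierTransform.fourierInv_fourier_eq,
    ← SchwartzMap.fourierInv_coe, ← SchwartzMap.fourierInv_coe]
  ext x
  rw [SchwartzMap.convolution_apply]
  rfl

theorem kerNorm_mul_le {m m' : Space n → ℂ} (h : IsSchwartz m) (h' : IsSchwartz m') :
    kerNorm (m * m') ≤ kerNorm m * kerNorm m' := by
  have h1 := eLpNorm_cv_le le_rfl h.continuous_kernel.aestronglyMeasurable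
    h'.continuous_kernel.aestronglyMeasurable
  rw [ENNReal.ofReal_one, eLpNorm_one_eq_lintegral_enorm, eLpNorm_one_eq_lintegral_enorm] at h1
  rw [kerNorm, fourierInv_mul h h']
  exact h1

theorem kerNorm_add_le {m m' : Space n → ℂ} (h : IsSchwartz m) (h' : IsSchwartz m') :
    kerNorm (m + m') ≤ kerNorm m + kerNorm m' := by
  unfold kerNorm
  rw [← lintegral_add_left h.continuous_kernel.enorm.measurable]
  refine lintegral_mono fun y => ?_
  have : 𝓕⁻ (m + m') y = 𝓕⁻ m y + 𝓕⁻ m' y := by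
    obtain ⟨s, rfl⟩ := h
    obtain ⟨s', rfl⟩ := h'
    have : (⇑s + ⇑s' : Space n → ℂ) = ⇑(s + s') := rfl
    rw [this, ← SchwartzMap.fourierInv_coe, ← SchwartzMap.fourierInv_coe,
      ← SchwartzMap.fourierInv_coe, FourierTransform.fourierInv_add]
    rfl
  rw [this]
  exact enorm_add_le _ _

theorem kerNorm_smul (c : ℂ) (m : Space n → ℂ) : kerNorm (c • m) = ‖c‖ₑ * kerNorm m := by
  unfold kerNorm
  rw [← lintegral_const_mul' _ _ (by simp)]
  refine lintegral_congr fun y => ?_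
  rw [← enorm_mul, Real.fourierInv_eq, Real.fourierInv_eq, ← smul_eq_mul, ← integral_smul]
  congr 2
  ext v
  simp only [Pi.smul_apply]
  rw [smul_comm]

end Multiplier

/-! ### Calculus of Fourier multipliers -/

section Calculus

variable {m m' : Space n → ℂ}

theorem FM_FM (hm : m.HasTemperateGrowth) (hm' : m'.HasTemperateGrowth) (T : TDist n) :
    FM m (FM m' T) = FM (m * m') T := by
  rw [mul_comm]
  exact TemperedDistribution.fourierMultiplierCLM_fourierMultiplierCLM_apply hm' hm T

theorem FM_comm (hm : m.HasTemperateGrowth) (hm' : m'.HasTemperateGrowth) (T : TDist n) :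
    FM m (FM m' T) = FM m' (FM m T) := by
  rw [FM_FM hm hm', FM_FM hm' hm, mul_comm]

theorem FM_sum {ι : Type*} {s : Finset ι} {g : ι → Space n → ℂ}
    (hg : ∀ i ∈ s, (g i).HasTemperateGrowth) (T : TDist n) :
    FM (∑ i ∈ s, g i) T = ∑ i ∈ s, FM (g i) T := by
  have h := TemperedDistribution.fourierMultiplierCLM_sum ℂ hg
  have e : (fun x => ∑ i ∈ s, g i x) = ∑ i ∈ s, g i := by
    ext x; simp
  rw [e] at h
  rw [FM, h]
  exact sum_apply _ _ _

theorem FM_smul (hm : m.HasTemperateGrowth) (c : ℂ) (T : TDist n) :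
    FM (c • m) T = c • FM m T := by
  rw [FM, TemperedDistribution.fourierMultiplierCLM_smul hm]
  rfl

theorem FM_one (T : TDist n) : FM (fun _ => 1) T = T := by
  rw [FM, TemperedDistribution.fourierMultiplierCLM_const]
  exact one_smul ℂ T

theorem FM_zero (T : TDist n) : FM (0 : Space n → ℂ) T = 0 := by
  have := TemperedDistribution.fourierMultiplierCLM_const (E := Space n) (F := ℂ) 0
  rw [FM]
  change TemperedDistribution.fourierMultiplierCLM ℂ (fun _ => (0 : ℂ)) T = 0
  rw [this]
  exact zero_smul ℂ T

theorem FM_add (hm : m.HasTemperateGrowth) (hm' : m'.HasTemperateGrowth) (T : TDist n) :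
    FM (m + m') T = FM m T + FM m' T := by
  ext φ
  have : FM (m + m') T φ = FM m T φ + FM m' T φ := by
    simp only [FM, TemperedDistribution.fourierMultiplierCLM_apply_apply]
    rw [← map_add, ← FourierTransform.fourier_add]
    congr 2
    ext x
    simp [SchwartzMap.smulLeftCLM_apply_apply hm, SchwartzMap.smulLeftCLM_apply_apply hm',
      SchwartzMap.smulLeftCLM_apply_apply (hm.add hm'), add_mul]
  exact this

theorem FM_sub (hm : m.HasTemperateGrowth) (hm' : m'.HasTemperateGrowth) (T : TDist n) :
    FM (m - m') T = FM m T - FM m' T := by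
  rw [eq_sub_iff_add_eq, ← FM_add (hm.sub hm') hm', sub_add_cancel]

theorem hasTemperateGrowth_coord (i : Fin n) :
    (fun ξ : Space n => (2 * Real.pi * Complex.I) * (ξ i : ℂ)).HasTemperateGrowth := by
  have h : (fun ξ : Space n => ((inner ℝ ξ (EuclideanSpace.single i (1 : ℝ)) : ℝ) : ℂ)).HasTemperateGrowth := by
    fun_prop
  have e : (fun ξ : Space n => (2 * Real.pi * Complex.I) * (ξ i : ℂ)) = fun ξ : Space n =>
      (2 * Real.pi * Complex.I) * ((inner ℝ ξ (EuclideanSpace.single i (1 : ℝ)) : ℝ) : ℂ) := by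
    ext ξ
    simp [EuclideanSpace.inner_single_right]
  rw [e]
  fun_prop

theorem lineDeriv_eq_FM (i : Fin n) (T : TDist n) :
    ∂_{(EuclideanSpace.single i (1 : ℝ) : Space n)} T =
      FM (fun ξ => (2 * Real.pi * Complex.I) * (ξ i : ℂ)) T := by
  have h : (fun ξ : Space n => ((inner ℝ ξ (EuclideanSpace.single i (1 : ℝ)) : ℝ) : ℂ)).HasTemperateGrowth := by
    fun_prop
  rw [TemperedDistribution.lineDeriv_eq_fourierMultiplierCLM]
  have := FM_smul h (2 * Real.pi * Complex.I) T
  rw [FM, FM] at this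
  rw [← this]
  congr 2
  ext ξ
  simp [EuclideanSpace.inner_single_right]

end Calculus

/-! ### `Lᵖ` functions as tempered distributions -/

section Embedding

/-- The space `Lᵖ(ℝⁿ; ℂ)`. -/
abbrev LpC (n : ℕ) (p : ℝ) : Type := Lp ℂ (ENNReal.ofReal p) (volume : Measure (Space n))

variable {p : ℝ} [hp : Fact (1 ≤ ENNReal.ofReal p)]

theorem one_le_of_fact (p : ℝ) [hp : Fact (1 ≤ ENNReal.ofReal p)] : 1 ≤ p := by
  simpa using hp.out

/-- The embedding of `Lᵖ` into the tempered distributions. -/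
def emb : LpC n p →L[ℂ] TDist n := Lp.toTemperedDistributionCLM ℂ volume (ENNReal.ofReal p)

theorem isRep_emb (x : LpC n p) : IsRep (emb x) x := isRep_toTemperedDistribution x

theorem IsRep.unique {S T : TDist n} {g : Space n → ℂ} (hS : IsRep S g) (hT : IsRep T g) :
    S = T := by
  ext φ
  have : S φ = T φ := by rw [(hS φ).2, (hT φ).2]
  exact this

/-- Identities in L^p can therefore be checked for distributions, where the calculus of Fourier
multipliers is available. -/
theorem emb_injective : Function.Injective (emb : LpC n p → TDist n) := by
  intro x y hxy
  have h := isRep_emb x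
  rw [hxy] at h
  exact Lp.ext (h.ae_eq (isRep_emb y))

theorem distLpNorm_emb (x : LpC n p) : distLpNorm p (emb x) = ‖x‖ₑ := by
  rw [distLpNorm_eq (isRep_emb x), Lp.enorm_def]

theorem exists_emb_eq {T : TDist n} (h : distLpNorm p T < ⊤) : ∃ x : LpC n p, emb x = T := by
  obtain ⟨g, hg, hg'⟩ := exists_rep_of_distLpNorm_lt_top h
  exact ⟨hg'.toLp g, ((isRep_emb _).congr hg'.coeFn_toLp).unique hg⟩

theorem IsRep.emb_eq {x : LpC n p} {T : TDist n} {g : Space n → ℂ} (h : IsRep T g)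
    (hx : x =ᵐ[volume] g) : emb x = T :=
  ((isRep_emb x).congr hx).unique h

/-- Integration against a Schwartz function, as a functional on `Lᵖ`. -/
def pairLp (φ : 𝓢(Space n, ℂ)) : LpC n p →L[ℂ] ℂ where
  toFun x := emb x φ
  map_add' x y := by rw [map_add]; rfl
  map_smul' c x := by rw [map_smul]; rfl
  cont := by
    have h : Continuous fun T : TDist n => T φ :=
      (PointwiseConvergenceCLM.evalCLM (RingHom.id ℂ) ℂ φ).continuous
    exact h.comp emb.continuous

theorem isRep_fm_emb {m : Space n → ℂ} (hm : IsSchwartz m) (x : LpC n p) :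
    IsRep (FM m (emb x)) (cv (𝓕⁻ m) x) :=
  (isRep_emb x).fm (one_le_of_fact p) (Lp.memLp x) hm

open Classical in
/-- Convolution with the kernel of a Schwartz symbol, on `Lᵖ`. -/
def convLp (m : Space n → ℂ) : LpC n p →L[ℂ] LpC n p :=
  if hm : IsSchwartz m then
    LinearMap.mkContinuous
      { toFun := fun x => (memLp_cv (one_le_of_fact p) (Lp.memLp x) hm).toLp _
        map_add' := fun x y => by
          apply emb_injective
          rw [map_add, (isRep_fm_emb hm _).emb_eq (MemLp.coeFn_toLp _),
            (isRep_fm_emb hm _).emb_eq (MemLp.coeFn_toLp _),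
            (isRep_fm_emb hm _).emb_eq (MemLp.coeFn_toLp _), map_add]
          exact map_add _ _ _
        map_smul' := fun c x => by
          apply emb_injective
          rw [RingHom.id_apply, map_smul, (isRep_fm_emb hm _).emb_eq (MemLp.coeFn_toLp _),
            (isRep_fm_emb hm _).emb_eq (MemLp.coeFn_toLp _), map_smul]
          exact map_smul _ _ _ }
      (kerNorm m).toReal fun x => by
        simp only [LinearMap.coe_mk, AddHom.coe_mk, Lp.norm_toLp]
        rw [Lp.norm_def, ← ENNReal.toReal_mul]
        refine ENNReal.toReal_mono (ENNReal.mul_ne_top hm.kerNorm_ne_top (Lp.memLp x).2.ne) ?_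
        exact eLpNorm_cv_le (one_le_of_fact p) hm.continuous_kernel.aestronglyMeasurable
          (Lp.memLp x).1
  else 0

variable {m m' : Space n → ℂ}

theorem coeFn_convLp (hm : IsSchwartz m) (x : LpC n p) :
    convLp m x =ᵐ[volume] cv (𝓕⁻ m) x := by
  rw [convLp, dif_pos hm]
  exact MemLp.coeFn_toLp (memLp_cv (one_le_of_fact p) (Lp.memLp x) hm)

theorem emb_convLp (hm : IsSchwartz m) (x : LpC n p) : emb (convLp m x) = FM m (emb x) :=
  (isRep_fm_emb hm x).emb_eq (coeFn_convLp hm x)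

theorem norm_convLp_le (m : Space n → ℂ) : ‖(convLp m : LpC n p →L[ℂ] LpC n p)‖ ≤ (kerNorm m).toReal := by
  rw [convLp]
  split_ifs with hm
  · exact LinearMap.mkContinuous_norm_le _ ENNReal.toReal_nonneg _
  · simp

theorem convLp_sub (hm : IsSchwartz m) (hm' : IsSchwartz m') :
    (convLp (m - m') : LpC n p →L[ℂ] LpC n p) = convLp m - convLp m' := by
  ext1 x
  apply emb_injective
  rw [emb_convLp (hm.sub hm'), FM_sub hm.hasTemperateGrowth hm'.hasTemperateGrowth,
    sub_apply, map_sub, emb_convLp hm, emb_convLp hm']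

end Embedding

/-! ### Symbols supported in an annulus -/

section Annular

/-- Smooth symbols supported in an annulus. -/
def IsAnnular (m : Space n → ℂ) : Prop :=
  ContDiff ℝ ∞ m ∧ ∃ a b : ℝ, 0 < a ∧ ∀ ξ, m ξ ≠ 0 → a ≤ ‖ξ‖ ∧ ‖ξ‖ ≤ b

namespace IsAnnular

variable {m m' : Space n → ℂ}

theorem isSchwartz (h : IsAnnular m) : IsSchwartz m := by
  obtain ⟨h1, a, b, -, hb⟩ := h
  refine IsSchwartz.of_hasCompactSupport ?_ h1
  refine HasCompactSupport.of_support_subset_isCompact (isCompact_closedBall (0 : Space n) b) ?_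
  intro ξ hξ
  simpa using (hb ξ hξ).2

/-- The annulus stays away from the origin, the only point where a homogeneous symbol such as that
of the Helmholtz projection fails to be smooth. -/
theorem mul_contDiffOn (h : IsAnnular m) {g : Space n → ℂ} (hg : ContDiffOn ℝ ∞ g {0}ᶜ) :
    IsAnnular (m * g) := by
  obtain ⟨h1, a, b, ha, hb⟩ := h
  refine ⟨?_, a, b, ha, fun ξ hξ => hb ξ (left_ne_zero_of_mul hξ)⟩
  rw [contDiff_iff_contDiffAt]
  intro ξ
  by_cases hξ : ξ = 0
  · refine (contDiffAt_const (c := (0 : ℂ))).congr_of_eventuallyEq ?_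
    filter_upwards [Metric.ball_mem_nhds ξ ha] with η hη
    subst hξ
    by_contra hne
    have := (hb η (left_ne_zero_of_mul hne)).1
    simp at hη
    linarith
  · exact h1.contDiffAt.mul (hg.contDiffAt (isOpen_compl_singleton.mem_nhds hξ))

theorem add (h : IsAnnular m) (h' : IsAnnular m') : IsAnnular (m + m') := by
  obtain ⟨h1, a, b, ha, hb⟩ := h
  obtain ⟨h1', a', b', ha', hb'⟩ := h'
  refine ⟨h1.add h1', min a a', max b b', lt_min ha ha', fun ξ hξ => ?_⟩
  by_cases hm : m ξ = 0
  · have := hb' ξ (by simpa [hm] using hξ)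
    exact ⟨(min_le_right _ _).trans this.1, this.2.trans (le_max_right _ _)⟩
  · have := hb ξ hm
    exact ⟨(min_le_left _ _).trans this.1, this.2.trans (le_max_left _ _)⟩

theorem zero : IsAnnular (0 : Space n → ℂ) :=
  ⟨contDiff_const, 1, 1, one_pos, fun _ hξ => absurd rfl hξ⟩

theorem sum {ι : Type*} {s : Finset ι} {g : ι → Space n → ℂ} (h : ∀ i ∈ s, IsAnnular (g i)) :
    IsAnnular (∑ i ∈ s, g i) :=
  Finset.sum_induction _ _ (fun _ _ => add) zero h

theorem comp_smul (h : IsAnnular m) {c : ℝ} (hc : 0 < c) : IsAnnular fun ξ => m (c • ξ) := by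
  obtain ⟨h1, a, b, ha, hb⟩ := h
  refine ⟨h1.comp (contDiff_const_smul c), a / c, b / c, by positivity, fun ξ hξ => ?_⟩
  have := hb _ hξ
  rw [norm_smul, Real.norm_of_nonneg hc.le] at this
  rw [div_le_iff₀' hc, le_div_iff₀' hc]
  exact this

theorem contDiffOn (h : IsAnnular m) : ContDiffOn ℝ ∞ m {0}ᶜ := h.1.contDiffOn

end IsAnnular

theorem contDiffOn_norm_sq_zpow (k : ℤ) :
    ContDiffOn ℝ ∞ (fun ξ : Space n => ((‖ξ‖ ^ 2 : ℝ) : ℂ) ^ k) {0}ᶜ := by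
  have h : ContDiff ℝ ∞ fun ξ : Space n => ((‖ξ‖ ^ 2 : ℝ) : ℂ) :=
    Complex.ofRealCLM.contDiff.comp (contDiff_norm_sq ℝ)
  cases k with
  | ofNat k => simpa using (h.pow k).contDiffOn
  | negSucc k =>
    simp only [zpow_negSucc]
    refine ContDiffOn.inv (h.pow (k + 1)).contDiffOn fun ξ hξ => ?_
    have : ‖ξ‖ ≠ 0 := by simpa using hξ
    exact pow_ne_zero _ (by exact_mod_cast pow_ne_zero 2 this)

end Annular

/-! ### The heat semigroup on annular symbols -/

section Heat

/-- The symbol of `e^{rΔ}`. -/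
def heatSym (r : ℝ) (ξ : Space n) : ℂ :=
  ((Real.exp (-((2 * Real.pi) ^ 2 * r * ‖ξ‖ ^ 2)) : ℝ) : ℂ)

theorem heatSym_zero : (heatSym 0 : Space n → ℂ) = fun _ => 1 := by
  ext ξ; simp [heatSym]

theorem heatSym_add (r h : ℝ) : (heatSym (r + h) : Space n → ℂ) = heatSym r * heatSym h := by
  ext ξ
  simp only [heatSym, Pi.mul_apply]
  rw [← Complex.ofReal_mul, ← Real.exp_add]
  congr 2
  ring

theorem heatSym_smul (r c : ℝ) (ξ : Space n) : heatSym r (c • ξ) = heatSym (c ^ 2 * r) ξ := by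
  simp only [heatSym, norm_smul, Real.norm_eq_abs, mul_pow, sq_abs]
  congr 3
  ring

theorem isSchwartz_heatSym {r : ℝ} (hr : 0 < r) : IsSchwartz (heatSym r : Space n → ℂ) := by
  refine ⟨gaussian (n := n) (c := (2 * Real.pi) ^ 2 * r) (by positivity), ?_⟩
  ext ξ
  rw [gaussian_apply, heatSym]
  congr 2
  ring

theorem hasTemperateGrowth_heatSym {r : ℝ} (hr : 0 ≤ r) :
    (heatSym r : Space n → ℂ).HasTemperateGrowth := by
  rcases hr.eq_or_lt with rfl | hr
  · rw [heatSym_zero]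
    exact .const 1
  · exact (isSchwartz_heatSym hr).hasTemperateGrowth

theorem contDiff_heatSym (r : ℝ) : ContDiff ℝ ∞ (heatSym r : Space n → ℂ) := by
  unfold heatSym
  refine Complex.ofRealCLM.contDiff.comp (Real.contDiff_exp.comp (ContDiff.neg ?_))
  exact contDiff_const.mul (contDiff_norm_sq ℝ)

theorem IsAnnular.mul_heatSym {m : Space n → ℂ} (h : IsAnnular m) (r : ℝ) :
    IsAnnular (m * heatSym r) := h.mul_contDiffOn (contDiff_heatSym r).contDiffOn

theorem kerNorm_heatSym {r : ℝ} (hr : 0 < r) :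
    kerNorm (heatSym r : Space n → ℂ) = kerNorm (heatSym 1 : Space n → ℂ) := by
  rw [← kerNorm_comp_smul (heatSym 1) (Real.sqrt_pos.2 hr)]
  congr 1
  ext ξ
  rw [heatSym_smul, Real.sq_sqrt hr.le, mul_one]

/-- For r ≥ 1, multiply and divide by |ξ|⁴. On the annulus m/|ξ|⁴ is again a good symbol, while |ξ|⁴
e^{rΔ} is r⁻² times a dilate of |ξ|⁴ e^{Δ}, whose kernel norm does not depend on the dilation. For r
≤ 1 the scale-invariant norm of the heat kernel suffices. Quadratic decay is all that the Duhamel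
integral needs. -/
theorem IsAnnular.kerNorm_mul_heatSym_le {m : Space n → ℂ} (hm : IsAnnular m) :
    ∃ C : ℝ, 0 < C ∧ ∀ r, 0 ≤ r → kerNorm (m * heatSym r) ≤ ENNReal.ofReal (C / (1 + r) ^ 2) := by
  have hne : ∀ {ξ : Space n}, m ξ ≠ 0 → ‖ξ‖ ≠ 0 := by
    obtain ⟨-, a, b, ha, hb⟩ := hm
    intro ξ hξ
    exact (ha.trans_le (hb ξ hξ).1).ne'
  set N : Space n → ℂ := fun ξ => ((‖ξ‖ ^ 2 : ℝ) : ℂ) ^ (2 : ℤ)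
  set N' : Space n → ℂ := fun ξ => ((‖ξ‖ ^ 2 : ℝ) : ℂ) ^ (-2 : ℤ)
  have hN : N.HasTemperateGrowth := by
    have : (fun ξ : Space n => (((‖ξ‖ ^ 2 : ℝ) : ℂ))).HasTemperateGrowth := by fun_prop
    have h2 := this.mul this
    have e : N = fun ξ : Space n => (((‖ξ‖ ^ 2 : ℝ) : ℂ)) * ((‖ξ‖ ^ 2 : ℝ) : ℂ) := by
      funext ξ
      simp only [N, zpow_ofNat, sq]
    rw [e]
    exact h2
  have hm' : IsAnnular (m * N') := hm.mul_contDiffOn (contDiffOn_norm_sq_zpow _)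
  have h1 : IsSchwartz (N * heatSym 1) := (isSchwartz_heatSym one_pos).mul_left hN
  set E := kerNorm (heatSym 1 : Space n → ℂ)
  set c₁ := (kerNorm m * E).toReal
  set c₂ := (kerNorm (m * N') * kerNorm (N * heatSym 1)).toReal
  set c₀ := (kerNorm m).toReal
  have hc₁ : ENNReal.ofReal c₁ = kerNorm m * E := ENNReal.ofReal_toReal
    (ENNReal.mul_ne_top hm.isSchwartz.kerNorm_ne_top (isSchwartz_heatSym one_pos).kerNorm_ne_top)
  have hc₂ : ENNReal.ofReal c₂ = _ := ENNReal.ofReal_toReal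
    (ENNReal.mul_ne_top hm'.isSchwartz.kerNorm_ne_top h1.kerNorm_ne_top)
  have hc₀ : ENNReal.ofReal c₀ = _ := ENNReal.ofReal_toReal hm.isSchwartz.kerNorm_ne_top
  have p0 : 0 ≤ c₀ := ENNReal.toReal_nonneg
  have p1 : 0 ≤ c₁ := ENNReal.toReal_nonneg
  have p2 : 0 ≤ c₂ := ENNReal.toReal_nonneg
  refine ⟨4 * (c₀ + c₁ + c₂ + 1), by positivity, fun r hr => ?_⟩
  rcases hr.eq_or_lt with rfl | hr
  · rw [heatSym_zero, show (fun _ : Space n => (1 : ℂ)) = 1 from rfl, mul_one, ← hc₀]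
    refine ENNReal.ofReal_le_ofReal ?_
    norm_num
    linarith
  rcases le_total r 1 with hr1 | hr1
  · calc kerNorm (m * heatSym r) ≤ kerNorm m * kerNorm (heatSym r) :=
          kerNorm_mul_le hm.isSchwartz (isSchwartz_heatSym hr)
      _ = ENNReal.ofReal c₁ := by rw [kerNorm_heatSym hr, hc₁]
      _ ≤ _ := by
          refine ENNReal.ofReal_le_ofReal ?_
          rw [le_div_iff₀ (by positivity)]
          have : (1 + r) ^ 2 ≤ 4 := by nlinarith
          nlinarith
  · have e : m * heatSym r = (m * N') * (((r : ℂ)⁻¹ ^ 2) •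
        fun ξ => (N * heatSym 1 : Space n → ℂ) (Real.sqrt r • ξ)) := by
      funext ξ
      simp only [Pi.mul_apply, Pi.smul_apply, smul_eq_mul, heatSym_smul, Real.sq_sqrt hr.le,
        mul_one, N, N', norm_smul, mul_pow, Real.norm_eq_abs, sq_abs]
      by_cases hξ : m ξ = 0
      · simp [hξ]
      · have h3 : (‖ξ‖ : ℂ) ≠ 0 := by exact_mod_cast hne hξ
        have h4 : (r : ℂ) ≠ 0 := by exact_mod_cast hr.ne'
        push_cast
        simp only [zpow_neg, zpow_ofNat]
        field_simp
    have h5 := h1.comp_smul (Real.sqrt_pos.2 hr).ne'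
    calc kerNorm (m * heatSym r) ≤ kerNorm (m * N') * (‖((r : ℂ)⁻¹ ^ 2)‖ₑ * kerNorm (N * heatSym 1)) := by
          rw [e]
          refine (kerNorm_mul_le hm'.isSchwartz (h5.smul _)).trans_eq ?_
          rw [kerNorm_smul, kerNorm_comp_smul _ (Real.sqrt_pos.2 hr)]
      _ = ENNReal.ofReal (c₂ * (r⁻¹ ^ 2)) := by
          rw [ENNReal.ofReal_mul p2, hc₂, ← ofReal_norm, mul_right_comm, mul_assoc]
          congr 3
          simp [abs_of_pos hr]
      _ ≤ _ := by
          refine ENNReal.ofReal_le_ofReal ?_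
          rw [le_div_iff₀ (by positivity)]
          have h6 : r⁻¹ ^ 2 * (1 + r) ^ 2 ≤ 4 := by
            rw [← mul_pow]
            have : r⁻¹ * (1 + r) ≤ 2 := by
              rw [inv_mul_le_iff₀ hr]; linarith
            have h7 : 0 ≤ r⁻¹ * (1 + r) := by positivity
            nlinarith
          calc c₂ * r⁻¹ ^ 2 * (1 + r) ^ 2 = c₂ * (r⁻¹ ^ 2 * (1 + r) ^ 2) := by ring
            _ ≤ c₂ * 4 := by gcongr
            _ ≤ _ := by linarith

/-- The entire function `(e^z - 1) / z`. -/
theorem contDiff_dslope_exp : ContDiff ℝ ∞ (dslope Complex.exp 0) := by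
  have h : Differentiable ℂ (dslope Complex.exp 0) := by
    rw [← differentiableOn_univ, Complex.differentiableOn_dslope univ_mem, differentiableOn_univ]
    exact Complex.differentiable_exp
  exact (h.contDiff (n := ∞)).restrict_scalars ℝ

theorem isSchwartz_bump_mul (χ : ContDiffBump (0 : Space n)) {k : Space n → ℂ}
    (hk : ContDiff ℝ ∞ k) : IsSchwartz fun ξ => ((χ ξ : ℝ) : ℂ) * k ξ := by
  have h1 : HasCompactSupport fun ξ => ((χ ξ : ℝ) : ℂ) :=
    χ.hasCompactSupport.comp_left (g := fun t : ℝ => (t : ℂ)) rfl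
  have h2 : ContDiff ℝ ∞ fun ξ => ((χ ξ : ℝ) : ℂ) := Complex.ofRealCLM.contDiff.comp χ.contDiff
  exact IsSchwartz.of_hasCompactSupport (HasCompactSupport.mul_right h1) (h2.mul hk)

/-- For h ≤ 1, write e^{-ch|ξ|²} - 1 = -ch|ξ|² · E(-ch|ξ|²) with the entire function E(z) = (e^z -
1)/z. After a cutoff the last factor is a dilate of one fixed Schwartz symbol, so the gain h is
explicit and |ξ|² is absorbed by the annulus. For h ≥ 1 the triangle inequality is enough. -/
theorem IsAnnular.kerNorm_mul_heatSym_sub_le {m : Space n → ℂ} (hm : IsAnnular m) :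
    ∃ C : ℝ, 0 < C ∧ ∀ r h, 0 ≤ r → 0 ≤ h →
      kerNorm (m * heatSym (r + h) - m * heatSym r) ≤ ENNReal.ofReal (C * h / (1 + r) ^ 2) := by
  obtain ⟨-, a, b, ha, hb⟩ := id hm
  set N : Space n → ℂ := fun ξ => ((‖ξ‖ ^ 2 : ℝ) : ℂ) ^ (1 : ℤ)
  have hmN : IsAnnular (m * N) := hm.mul_contDiffOn (contDiffOn_norm_sq_zpow _)
  obtain ⟨C₁, hC₁, h1⟩ := hm.kerNorm_mul_heatSym_le
  obtain ⟨C₂, hC₂, h2⟩ := hmN.kerNorm_mul_heatSym_le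
  set c : ℝ := (2 * Real.pi) ^ 2
  -- The cutoff equals 1 on a ball containing the support of m, hence also at √h ξ for ξ in that
  -- support and h ≤ 1.
  set χ : ContDiffBump (0 : Space n) := ⟨|b| + 1, |b| + 2, by positivity, by linarith⟩
  set g : Space n → ℂ := fun ξ =>
    ((χ ξ : ℝ) : ℂ) * dslope Complex.exp 0 (-((c * ‖ξ‖ ^ 2 : ℝ) : ℂ))
  have hg : IsSchwartz g := by
    refine isSchwartz_bump_mul χ (contDiff_dslope_exp.comp ?_)
    refine (Complex.ofRealCLM.contDiff.comp ?_).neg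
    exact contDiff_const.mul (contDiff_norm_sq ℝ)
  set G := (kerNorm g).toReal
  have hG : ENNReal.ofReal G = kerNorm g := ENNReal.ofReal_toReal hg.kerNorm_ne_top
  set E := (kerNorm (heatSym 1 : Space n → ℂ)).toReal
  have hE : ENNReal.ofReal E = _ :=
    ENNReal.ofReal_toReal (isSchwartz_heatSym (n := n) one_pos).kerNorm_ne_top
  have pG : 0 ≤ G := ENNReal.toReal_nonneg
  have pE : 0 ≤ E := ENNReal.toReal_nonneg
  have pc : 0 ≤ c := by positivity
  refine ⟨C₁ * (E + 1) + c * C₂ * G, by positivity, fun r h hr hh => ?_⟩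
  rcases le_total h 1 with hh1 | hh1
  · rcases hh.eq_or_lt with rfl | hh
    · simp only [add_zero, sub_self]
      have := kerNorm_smul (0 : ℂ) (0 : Space n → ℂ)
      simp only [smul_zero, enorm_zero, zero_mul] at this
      simp [this]
    have e : m * heatSym (r + h) - m * heatSym r = (-(c * h : ℝ) : ℂ) •
        ((m * N * heatSym r) * fun ξ => g (Real.sqrt h • ξ)) := by
      ext ξ
      simp only [Pi.mul_apply, Pi.smul_apply, Pi.sub_apply, smul_eq_mul, heatSym_add]
      by_cases hξ : m ξ = 0
      · simp [hξ]
      have hχ : χ (Real.sqrt h • ξ) = 1 := by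
        refine χ.one_of_mem_closedBall ?_
        rw [mem_closedBall_zero_iff, norm_smul, Real.norm_of_nonneg (Real.sqrt_nonneg _)]
        change _ ≤ |b| + 1
        have h3 : Real.sqrt h ≤ 1 := Real.sqrt_le_one.2 hh1
        have h4 := (hb ξ hξ).2.trans (le_abs_self b)
        nlinarith [norm_nonneg ξ, Real.sqrt_nonneg h]
      have hs := sub_smul_dslope Complex.exp 0 (-((c * ‖Real.sqrt h • ξ‖ ^ 2 : ℝ) : ℂ))
      have hn : ‖Real.sqrt h • ξ‖ ^ 2 = h * ‖ξ‖ ^ 2 := by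
        rw [norm_smul, mul_pow, Real.norm_eq_abs, sq_abs, Real.sq_sqrt hh.le]
      have hexp : Complex.exp (-((c * ‖Real.sqrt h • ξ‖ ^ 2 : ℝ) : ℂ)) = heatSym h ξ := by
        rw [hn, heatSym, Complex.ofReal_exp]
        congr 1
        simp only [c]
        push_cast
        ring
      rw [hexp, Complex.exp_zero] at hs
      have e1 : m ξ * (heatSym r ξ * heatSym h ξ) - m ξ * heatSym r ξ =
          m ξ * heatSym r ξ * (heatSym h ξ - 1) := by ring
      rw [e1, ← hs]
      simp only [g, hχ, N, hn, zpow_one, smul_eq_mul]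
      push_cast
      ring
    rw [e, kerNorm_smul]
    calc _ ≤ ‖(-(c * h : ℝ) : ℂ)‖ₑ * (kerNorm (m * N * heatSym r) * kerNorm g) := by
          gcongr
          refine (kerNorm_mul_le (hmN.mul_heatSym r).isSchwartz
            (hg.comp_smul (Real.sqrt_pos.2 hh).ne')).trans_eq ?_
          rw [kerNorm_comp_smul _ (Real.sqrt_pos.2 hh)]
      _ ≤ ENNReal.ofReal (c * h) * (ENNReal.ofReal (C₂ / (1 + r) ^ 2) * ENNReal.ofReal G) := by
          rw [hG]
          gcongr
          · rw [← ofReal_norm, norm_neg, Complex.norm_real, Real.norm_of_nonneg (by positivity)]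
          · exact h2 r hr
      _ = ENNReal.ofReal (c * h * (C₂ / (1 + r) ^ 2 * G)) := by
          rw [← ENNReal.ofReal_mul (by positivity), ← ENNReal.ofReal_mul (by positivity)]
      _ ≤ _ := by
          refine ENNReal.ofReal_le_ofReal ?_
          have : c * h * (C₂ / (1 + r) ^ 2 * G) = c * C₂ * G * h / (1 + r) ^ 2 := by ring
          rw [this]
          gcongr
          have : 0 ≤ C₁ * (E + 1) := by positivity
          linarith
  · have hh0 : 0 < h := by linarith
    have e : m * heatSym (r + h) - m * heatSym r =
        (m * heatSym r) * heatSym h + (-1 : ℂ) • (m * heatSym r) := by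
      rw [heatSym_add, mul_assoc]
      ext ξ
      simp [sub_eq_add_neg]
    have hs := (hm.mul_heatSym r).isSchwartz
    rw [e]
    calc _ ≤ kerNorm ((m * heatSym r) * heatSym h) + kerNorm ((-1 : ℂ) • (m * heatSym r)) :=
          kerNorm_add_le (hs.mul (isSchwartz_heatSym hh0)) (hs.smul _)
      _ ≤ ENNReal.ofReal (C₁ / (1 + r) ^ 2) * ENNReal.ofReal E + ENNReal.ofReal (C₁ / (1 + r) ^ 2) := by
          gcongr
          · refine (kerNorm_mul_le hs (isSchwartz_heatSym hh0)).trans ?_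
            rw [kerNorm_heatSym hh0, hE]
            gcongr
            exact h1 r hr
          · rw [kerNorm_smul]
            simpa using h1 r hr
      _ = ENNReal.ofReal (C₁ * (E + 1) / (1 + r) ^ 2) := by
          rw [← ENNReal.ofReal_mul (by positivity), ← ENNReal.ofReal_add (by positivity) (by positivity)]
          congr 1
          ring
      _ ≤ _ := by
          refine ENNReal.ofReal_le_ofReal (div_le_div_of_nonneg_right ?_ (by positivity))
          have h3 : 0 ≤ c * C₂ * G := by positivity
          have h4 : 0 ≤ C₁ * (E + 1) := by positivity
          nlinarith

end Heat

/-! ### Littlewood–Paley symbols -/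

section LittlewoodPaley

/-- The symbol `ψ(2⁻ʲ ξ)` of the block `Δ_j`. -/
def lpSym (ψ : Space n → ℝ) (j : ℤ) (ξ : Space n) : ℂ := ((ψ ((2 : ℝ) ^ (-j) • ξ) : ℝ) : ℂ)

/-- The symbol of `∑_{|d| ≤ 2} Δ_{j+d}`, equal to `1` on the support of the symbol of `Δ_j`. -/
def fatSym (ψ : Space n → ℝ) (j : ℤ) : Space n → ℂ :=
  ∑ d ∈ Finset.Icc (-2 : ℤ) 2, lpSym ψ (j + d)

theorem block_eq_FM (ψ : Space n → ℝ) (j : ℤ) (T : TDist n) : block ψ j T = FM (lpSym ψ j) T := rfl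

theorem lpSym_eq_comp (ψ : Space n → ℝ) (j : ℤ) :
    lpSym ψ j = fun ξ => lpSym ψ 0 ((2 : ℝ) ^ (-j) • ξ) := by
  ext ξ; simp [lpSym]

theorem fatSym_eq_comp (ψ : Space n → ℝ) (j : ℤ) :
    fatSym ψ j = fun ξ => fatSym ψ 0 ((2 : ℝ) ^ (-j) • ξ) := by
  ext ξ
  simp only [fatSym, Finset.sum_apply, lpSym, zero_add, smul_smul]
  refine Finset.sum_congr rfl fun d _ => ?_
  rw [← zpow_add₀ two_ne_zero]
  congr 4
  ring

variable {ψ θ : Space n → ℝ}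

namespace IsLittlewoodPaley

theorem isAnnular_zero (h : IsLittlewoodPaley ψ) : IsAnnular (lpSym ψ 0) := by
  refine ⟨?_, 2⁻¹, 2, by norm_num, fun ξ hξ => ?_⟩
  · refine Complex.ofRealCLM.contDiff.comp (h.smooth.comp ?_)
    exact contDiff_const_smul _
  · exact h.support_subset (by simpa [lpSym] using hξ)

theorem isAnnular (h : IsLittlewoodPaley ψ) (j : ℤ) : IsAnnular (lpSym ψ j) := by
  rw [lpSym_eq_comp]
  exact h.isAnnular_zero.comp_smul (by positivity)

theorem isAnnular_fat (h : IsLittlewoodPaley ψ) (j : ℤ) : IsAnnular (fatSym ψ j) :=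
  IsAnnular.sum fun _ _ => h.isAnnular _

theorem isSchwartz (h : IsLittlewoodPaley ψ) (j : ℤ) : IsSchwartz (lpSym ψ j) :=
  (h.isAnnular j).isSchwartz

theorem isSchwartz_fat (h : IsLittlewoodPaley ψ) (j : ℤ) : IsSchwartz (fatSym ψ j) :=
  (h.isAnnular_fat j).isSchwartz

theorem bounds_of_ne_zero (h : IsLittlewoodPaley ψ) {j : ℤ} {ξ : Space n} (hξ : lpSym ψ j ξ ≠ 0) :
    (2 : ℝ) ^ (j - 1) ≤ ‖ξ‖ ∧ ‖ξ‖ ≤ (2 : ℝ) ^ (j + 1) := by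
  have h1 := h.support_subset (show ψ ((2 : ℝ) ^ (-j) • ξ) ≠ 0 by simpa [lpSym] using hξ)
  have hpos : (0 : ℝ) < 2 ^ j := by positivity
  simp only [mem_ofPred_eq, norm_smul, zpow_neg, Real.norm_of_nonneg (inv_nonneg.2 hpos.le)] at h1
  rw [zpow_sub₀ two_ne_zero, zpow_add₀ two_ne_zero, zpow_one]
  constructor
  · have := mul_le_mul_of_nonneg_left h1.1 hpos.le
    rw [mul_inv_cancel_left₀ hpos.ne'] at this
    rwa [div_eq_mul_inv]
  · have := mul_le_mul_of_nonneg_left h1.2 hpos.le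
    rwa [mul_inv_cancel_left₀ hpos.ne'] at this

theorem bounds_of_fat_ne_zero (h : IsLittlewoodPaley ψ) {j : ℤ} {ξ : Space n}
    (hξ : fatSym ψ j ξ ≠ 0) : (2 : ℝ) ^ (j - 3) ≤ ‖ξ‖ ∧ ‖ξ‖ ≤ (2 : ℝ) ^ (j + 3) := by
  rw [fatSym, Finset.sum_apply] at hξ
  obtain ⟨d, hd, hne⟩ := Finset.exists_ne_zero_of_sum_ne_zero hξ
  have h1 := h.bounds_of_ne_zero hne
  rw [Finset.mem_Icc] at hd
  exact ⟨(zpow_le_zpow_right₀ one_le_two (by omega)).trans h1.1,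
    h1.2.trans (zpow_le_zpow_right₀ one_le_two (by omega))⟩

/-- Both points lie in dyadic shells of ratio 4, so overlap bounds the distance of the indices. A
second function θ is allowed because ψ is later compared with its even part. -/
theorem near_of_ne_zero (h : IsLittlewoodPaley ψ) (hθ : IsLittlewoodPaley θ) {j k : ℤ}
    {ξ : Space n} (hj : lpSym ψ j ξ ≠ 0) (hk : lpSym θ k ξ ≠ 0) :
    k - j ∈ Finset.Icc (-2 : ℤ) 2 := by
  have h1 := h.bounds_of_ne_zero hj
  have h2 := hθ.bounds_of_ne_zero hk
  have h3 := (zpow_le_zpow_iff_right₀ (one_lt_two (α := ℝ))).1 (h1.1.trans h2.2)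
  have h4 := (zpow_le_zpow_iff_right₀ (one_lt_two (α := ℝ))).1 (h2.1.trans h1.2)
  rw [Finset.mem_Icc]
  omega

theorem lpSym_mul_eq_zero (h : IsLittlewoodPaley ψ) (hθ : IsLittlewoodPaley θ) {j k : ℤ}
    (hjk : k - j ∉ Finset.Icc (-2 : ℤ) 2) : lpSym ψ j * lpSym θ k = 0 := by
  ext ξ
  by_contra hne
  exact hjk (h.near_of_ne_zero hθ (left_ne_zero_of_mul hne) (right_ne_zero_of_mul hne))

/-- The partition of unity sums to 1 off the origin, and on the support of the j-th symbol only five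
neighbouring terms survive. -/
theorem fatSym_eq_one (h : IsLittlewoodPaley ψ) (hθ : IsLittlewoodPaley θ) {j : ℤ} {ξ : Space n}
    (hξ : lpSym ψ j ξ ≠ 0) : fatSym θ j ξ = 1 := by
  have hξ0 : ξ ≠ 0 := by
    have := (h.bounds_of_ne_zero hξ).1
    rintro rfl
    rw [norm_zero] at this
    have : (0 : ℝ) < 2 ^ (j - 1) := by positivity
    linarith
  have h1 := hθ.hasSum ξ hξ0
  have h2 : HasSum (fun k : ℤ => θ ((2 : ℝ) ^ (-(j + k)) • ξ)) 1 :=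
    (Equiv.addLeft j).hasSum_iff (f := fun k : ℤ => θ ((2 : ℝ) ^ (-k) • ξ)) |>.2 h1
  have h3 : HasSum (fun k : ℤ => θ ((2 : ℝ) ^ (-(j + k)) • ξ))
      (∑ d ∈ Finset.Icc (-2 : ℤ) 2, θ ((2 : ℝ) ^ (-(j + d)) • ξ)) := by
    refine hasSum_sum_of_ne_finset_zero fun k hk => ?_
    by_contra hne
    have := h.near_of_ne_zero hθ (k := j + k) hξ (by simpa [lpSym] using hne)
    simp only [add_sub_cancel_left] at this
    exact hk this
  rw [fatSym, Finset.sum_apply]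
  simp only [lpSym]
  rw [← Complex.ofReal_sum, h3.unique h2, Complex.ofReal_one]

theorem fatSym_mul_lpSym (h : IsLittlewoodPaley ψ) (hθ : IsLittlewoodPaley θ) (j : ℤ) :
    fatSym θ j * lpSym ψ j = lpSym ψ j := by
  ext ξ
  by_cases hξ : lpSym ψ j ξ = 0
  · simp [hξ]
  · simp [h.fatSym_eq_one hθ hξ]

end IsLittlewoodPaley

end LittlewoodPaley

/-! ### The operators of the linear problem -/

section Operators

/-- The symbol `δ_{ik} - ξ_i ξ_k / |ξ|²` of the Helmholtz projection. -/
def leraySym (i k : Fin n) (ξ : Space n) : ℂ :=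
  (((if i = k then 1 else 0) - ξ i * ξ k / ‖ξ‖ ^ 2 : ℝ) : ℂ)

theorem contDiffOn_leraySym (i k : Fin n) : ContDiffOn ℝ ∞ (leraySym i k) {0}ᶜ := by
  unfold leraySym
  refine Complex.ofRealCLM.contDiff.comp_contDiffOn ?_
  refine contDiffOn_const.sub (ContDiffOn.div ?_ (contDiff_norm_sq ℝ).contDiffOn fun ξ hξ => ?_)
  · exact (((EuclideanSpace.proj i : Space n →L[ℝ] ℝ).contDiff).mul
      ((EuclideanSpace.proj k : Space n →L[ℝ] ℝ).contDiff)).contDiffOn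
  · have : ‖ξ‖ ≠ 0 := by simpa using hξ
    exact pow_ne_zero 2 this

theorem leraySym_smul (i k : Fin n) {c : ℝ} (hc : c ≠ 0) (ξ : Space n) :
    leraySym i k (c • ξ) = leraySym i k ξ := by
  unfold leraySym
  congr 2
  simp only [PiLp.smul_apply, smul_eq_mul, norm_smul, Real.norm_eq_abs, mul_pow, sq_abs]
  rw [show c * ξ i * (c * ξ k) = c ^ 2 * (ξ i * ξ k) by ring,
    mul_div_mul_left _ _ (pow_ne_zero 2 hc)]

variable {p : ℝ} [hp : Fact (1 ≤ ENNReal.ofReal p)]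

/-- Vector fields with components in `Lᵖ`. -/
abbrev Fld (n : ℕ) (p : ℝ) : Type := Fin n → LpC n p

/-- The operator on vector fields given by a matrix of operators. -/
def matOp (B : Fin n → Fin n → (LpC n p →L[ℂ] LpC n p)) : Fld n p →L[ℝ] Fld n p :=
  ContinuousLinearMap.pi fun i =>
    ∑ k, ((B i k).restrictScalars ℝ).comp (ContinuousLinearMap.proj k)

theorem matOp_apply (B : Fin n → Fin n → (LpC n p →L[ℂ] LpC n p)) (x : Fld n p) (i : Fin n) :
    matOp B x i = ∑ k, B i k (x k) := by
  simp [matOp, sum_apply]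

theorem norm_matOp_le (B : Fin n → Fin n → (LpC n p →L[ℂ] LpC n p)) {S : ℝ} (hS : 0 ≤ S)
    (h : ∀ i k, ‖B i k‖ ≤ S) : ‖matOp B‖ ≤ n * S := by
  refine ContinuousLinearMap.opNorm_le_bound _ (by positivity) fun x => ?_
  refine (pi_norm_le_iff_of_nonneg (by positivity)).2 fun i => ?_
  rw [matOp_apply]
  calc ‖∑ k, B i k (x k)‖ ≤ ∑ k : Fin n, S * ‖x‖ := by
        refine norm_sum_le_of_le _ fun k _ => ?_
        refine ((B i k).le_opNorm _).trans ?_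
        gcongr
        · exact h i k
        · exact norm_le_pi_norm x k
    _ = n * S * ‖x‖ := by simp [mul_assoc]

theorem matOp_sub (B B' : Fin n → Fin n → (LpC n p →L[ℂ] LpC n p)) :
    matOp B - matOp B' = matOp (B - B') := by
  ext1 x
  funext i
  simp [matOp_apply, sub_apply, Finset.sum_sub_distrib]

/-- The matrix of convolution operators with symbols `fat_j(ξ) L_{ik}(ξ) e^{-σ(2π)²|ξ|²}`. -/
def heatMat (ψ : Space n → ℝ) (L : Fin n → Fin n → Space n → ℂ) (j : ℤ) (σ : ℝ) :
    Fld n p →L[ℝ] Fld n p :=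
  matOp fun i k => convLp (fatSym ψ j * L i k * heatSym σ)

/-- L is homogeneous of degree zero and |ξ|² scales by 4^{-j}, so every localized heat symbol is a
dilate of the one at frequency 1, at the rescaled time 4^j σ. -/
theorem symbol_eq_comp {ψ : Space n → ℝ} {L : Space n → ℂ}
    (hLs : ∀ c : ℝ, c ≠ 0 → ∀ ξ, L (c • ξ) = L ξ) (j : ℤ) (σ : ℝ) :
    fatSym ψ j * L * heatSym σ = fun ξ =>
      (fatSym ψ 0 * L * heatSym ((4 : ℝ) ^ j * σ) : Space n → ℂ) ((2 : ℝ) ^ (-j) • ξ) := by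
  rw [fatSym_eq_comp]
  ext ξ
  simp only [Pi.mul_apply]
  rw [hLs _ (by positivity), heatSym_smul]
  congr 2
  rw [← mul_assoc, show (4 : ℝ) = 2 ^ (2 : ℤ) by norm_num, ← zpow_mul, ← zpow_natCast, ← zpow_mul,
    ← zpow_add₀ two_ne_zero]
  simp [mul_comm]

/-- By dilation invariance of `kerNorm` only j = 0 has to be estimated. The matrix L is left general
because the heat flow of the datum uses the identity and the Duhamel term uses the Helmholtz
projection. -/
theorem exists_heatMat_bound {ψ : Space n → ℝ} (hψ : IsLittlewoodPaley ψ)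
    {L : Fin n → Fin n → Space n → ℂ} (hL : ∀ i k, ContDiffOn ℝ ∞ (L i k) {0}ᶜ)
    (hLs : ∀ i k (c : ℝ), c ≠ 0 → ∀ ξ, L i k (c • ξ) = L i k ξ) :
    ∃ C : ℝ, 0 < C ∧ (∀ j σ, 0 ≤ σ →
        ‖(heatMat ψ L j σ : Fld n p →L[ℝ] Fld n p)‖ ≤ C / (1 + (4 : ℝ) ^ j * σ) ^ 2) ∧
      ∀ j σ σ', 0 ≤ σ → σ ≤ σ' → ‖(heatMat ψ L j σ' - heatMat ψ L j σ : Fld n p →L[ℝ] Fld n p)‖ ≤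
        C * ((4 : ℝ) ^ j * (σ' - σ)) / (1 + (4 : ℝ) ^ j * σ) ^ 2 := by
  have hann : ∀ i k, IsAnnular (fatSym ψ 0 * L i k) := fun i k =>
    (hψ.isAnnular_fat 0).mul_contDiffOn (hL i k)
  have hann' : ∀ i k j, IsAnnular (fatSym ψ j * L i k) := fun i k j =>
    (hψ.isAnnular_fat j).mul_contDiffOn (hL i k)
  choose C₁ hC₁ h1 using fun i k => (hann i k).kerNorm_mul_heatSym_le
  choose C₂ hC₂ h2 using fun i k => (hann i k).kerNorm_mul_heatSym_sub_le
  set D := ∑ i, ∑ k, (C₁ i k + C₂ i k)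
  have hD : ∀ i k, C₁ i k + C₂ i k ≤ D := fun i k =>
    (Finset.single_le_sum (f := fun k => C₁ i k + C₂ i k)
      (fun k _ => (add_pos (hC₁ i k) (hC₂ i k)).le) (Finset.mem_univ k)).trans
    (Finset.single_le_sum (f := fun i => ∑ k, (C₁ i k + C₂ i k))
      (fun i _ => Finset.sum_nonneg fun k _ => (add_pos (hC₁ i k) (hC₂ i k)).le)
      (Finset.mem_univ i))
  have hD0 : 0 ≤ D := Finset.sum_nonneg fun i _ => Finset.sum_nonneg fun k _ =>
    (add_pos (hC₁ i k) (hC₂ i k)).le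
  have h4 : ∀ j : ℤ, (0 : ℝ) < 4 ^ j := fun j => by positivity
  refine ⟨n * D + 1, by positivity, fun j σ hσ => ?_, fun j σ σ' hσ hσ' => ?_⟩
  · have h4j := h4 j
    calc _ ≤ n * (D / (1 + (4 : ℝ) ^ j * σ) ^ 2) := by
          refine norm_matOp_le _ (by positivity) fun i k => (norm_convLp_le _).trans ?_
          rw [symbol_eq_comp (hLs i k), kerNorm_comp_smul _ (by positivity)]
          refine ENNReal.toReal_le_of_le_ofReal (by positivity) ((h1 i k _ (by positivity)).trans ?_)
          gcongr
          linarith [hD i k, hC₂ i k]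
      _ = n * D / (1 + (4 : ℝ) ^ j * σ) ^ 2 := by ring
      _ ≤ _ := by gcongr; linarith
  · have h4j := h4 j
    have h0 : 0 ≤ (4 : ℝ) ^ j * (σ' - σ) := mul_nonneg h4j.le (by linarith)
    unfold heatMat
    rw [matOp_sub]
    calc _ ≤ n * (D * ((4 : ℝ) ^ j * (σ' - σ)) / (1 + (4 : ℝ) ^ j * σ) ^ 2) := by
          refine norm_matOp_le _ (by positivity) fun i k => ?_
          simp only [Pi.sub_apply]
          rw [← convLp_sub ((hann' i k j).mul_heatSym _).isSchwartz
            ((hann' i k j).mul_heatSym _).isSchwartz]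
          refine (norm_convLp_le _).trans ?_
          have e : fatSym ψ j * L i k * heatSym σ' - fatSym ψ j * L i k * heatSym σ = fun ξ =>
              (fatSym ψ 0 * L i k * heatSym ((4 : ℝ) ^ j * σ + (4 : ℝ) ^ j * (σ' - σ)) -
                fatSym ψ 0 * L i k * heatSym ((4 : ℝ) ^ j * σ) : Space n → ℂ) ((2 : ℝ) ^ (-j) • ξ) := by
            rw [symbol_eq_comp (hLs i k) j σ, symbol_eq_comp (hLs i k) j σ']
            ext ξ
            simp only [Pi.sub_apply]
            rw [← mul_add]
            simp
          rw [e, kerNorm_comp_smul _ (by positivity)]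
          refine ENNReal.toReal_le_of_le_ofReal (by positivity)
            ((h2 i k _ _ (by positivity) h0).trans ?_)
          gcongr
          linarith [hD i k, hC₁ i k]
      _ = n * D * ((4 : ℝ) ^ j * (σ' - σ)) / (1 + (4 : ℝ) ^ j * σ) ^ 2 := by ring
      _ ≤ _ := by gcongr; linarith

theorem continuousOn_heatMat {ψ : Space n → ℝ} (hψ : IsLittlewoodPaley ψ)
    {L : Fin n → Fin n → Space n → ℂ} (hL : ∀ i k, ContDiffOn ℝ ∞ (L i k) {0}ᶜ)
    (hLs : ∀ i k (c : ℝ), c ≠ 0 → ∀ ξ, L i k (c • ξ) = L i k ξ) (j : ℤ) :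
    ContinuousOn (fun σ => (heatMat ψ L j σ : Fld n p →L[ℝ] Fld n p)) (Ici 0) := by
  obtain ⟨C, hC, -, h2⟩ := exists_heatMat_bound (p := p) hψ hL hLs
  have h4j : (0 : ℝ) < 4 ^ j := by positivity
  have key : ∀ σ ∈ Ici (0 : ℝ), ∀ σ' ∈ Ici (0 : ℝ), σ ≤ σ' →
      ‖(heatMat ψ L j σ' - heatMat ψ L j σ : Fld n p →L[ℝ] Fld n p)‖ ≤
        C * (4 : ℝ) ^ j * |σ' - σ| := by
    intro σ hσ σ' hσ' hle
    have hσ0 : 0 ≤ σ := hσ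
    refine (h2 j σ σ' hσ hle).trans ?_
    rw [abs_of_nonneg (by linarith), ← mul_assoc]
    refine div_le_self (mul_nonneg (by positivity) (by linarith)) ?_
    exact one_le_pow₀ (by nlinarith)
  refine (LipschitzOnWith.of_dist_le_mul (K := ⟨C * (4 : ℝ) ^ j, by positivity⟩)
    fun σ hσ σ' hσ' => ?_).continuousOn
  rw [dist_eq_norm, Real.dist_eq]
  rcases le_total σ σ' with hle | hle
  · rw [norm_sub_rev, abs_sub_comm]
    exact key σ hσ σ' hσ' hle
  · exact key σ' hσ' σ hσ hle

/-- The factor 4^j converts the weight 2^{(n/p-3)j} of the force into the weight 2^{(n/p-1)j} of the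
velocity. The Lipschitz bound is uniform in j because 4^j/(1 + 4^jσ) ≤ 1/σ. -/
theorem exists_duhamelKernel {ψ : Space n → ℝ} (hψ : IsLittlewoodPaley ψ) :
    ∃ H : DuhamelKernel (Fld n p),
      ∀ j σ, H.toFun j σ = ((4 : ℝ) ^ j) • heatMat ψ leraySym j σ := by
  have hL : ∀ i k : Fin n, ContDiffOn ℝ ∞ (leraySym i k) {0}ᶜ := contDiffOn_leraySym
  have hLs : ∀ (i k : Fin n) (c : ℝ), c ≠ 0 → ∀ ξ, leraySym i k (c • ξ) = leraySym i k ξ :=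
    fun i k c hc ξ => leraySym_smul i k hc ξ
  obtain ⟨C, hC, h1, h2⟩ := exists_heatMat_bound (p := p) hψ hL hLs
  refine ⟨⟨fun j σ => ((4 : ℝ) ^ j) • heatMat ψ leraySym j σ, C, hC, fun j σ hσ => ?_,
    fun j σ σ' hσ hσ' => ?_, fun j => ?_⟩, fun j σ => rfl⟩
  · have h4j : (0 : ℝ) < 4 ^ j := by positivity
    rw [norm_smul, Real.norm_of_nonneg h4j.le]
    refine (mul_le_mul_of_nonneg_left (h1 j σ hσ) h4j.le).trans_eq ?_
    ring
  · have h4j : (0 : ℝ) < 4 ^ j := by positivity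
    rw [← smul_sub, norm_smul, Real.norm_of_nonneg h4j.le]
    refine (mul_le_mul_of_nonneg_left (h2 j σ σ' hσ.le hσ') h4j.le).trans ?_
    have e : (4 : ℝ) ^ j * (C * ((4 : ℝ) ^ j * (σ' - σ)) / (1 + (4 : ℝ) ^ j * σ) ^ 2) =
        C * ((σ' - σ) * (((4 : ℝ) ^ j) ^ 2 / (1 + (4 : ℝ) ^ j * σ) ^ 2)) := by ring
    rw [e, div_eq_mul_inv (σ' - σ)]
    refine mul_le_mul_of_nonneg_left (mul_le_mul_of_nonneg_left ?_ (by linarith)) hC.le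
    rw [← div_pow, ← inv_pow]
    gcongr
    rw [div_le_iff₀ (by positivity), inv_mul_eq_div, le_div_iff₀ hσ]
    linarith
  · exact (continuousOn_const (c := (4 : ℝ) ^ j)).smul (continuousOn_heatMat (p := p) hψ hL hLs j)

end Operators

/-! ### Dyadic weights -/

section Weights

theorem dyadicWeight_ne_top (s : ℝ) (j : ℤ) : dyadicWeight s j ≠ ⊤ := ENNReal.ofReal_ne_top

theorem dyadicWeight_zero (j : ℤ) : dyadicWeight 0 j = 1 := by simp [dyadicWeight]

theorem dyadicWeight_rpow (s t : ℝ) (j : ℤ) : dyadicWeight s j ^ t = dyadicWeight (s * t) j := by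
  rw [dyadicWeight, dyadicWeight, ENNReal.ofReal_rpow_of_pos (by positivity),
    ← Real.rpow_mul two_pos.le]
  congr 2
  ring

end Weights

/-! ### Bernstein inequalities -/

section Bernstein

theorem rpow_mul_rpow_le {I K S : ℝ≥0∞} {α β : ℝ} (hα : 0 ≤ α) (hβ : 0 ≤ β) (h : α + β = 1)
    (hI : I ≤ S) (hK : K ≤ S) : I ^ α * K ^ β ≤ S := by
  calc I ^ α * K ^ β ≤ S ^ α * S ^ β := by gcongr
    _ = S := by rw [← ENNReal.rpow_add_of_nonneg _ _ hα hβ, h, ENNReal.rpow_one]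

/-- The kernel of the dilated symbol has L¹ norm independent of j and supremum of order 2^{nj};
Young's inequality L^a → L^b interpolates between the two. -/
theorem IsAnnular.bernstein {m : Space n → ℂ} (hm : IsAnnular m) :
    ∃ C : ℝ, 0 < C ∧ ∀ (j : ℤ) (a : ℝ), 1 ≤ a → ∀ g : Space n → ℂ, AEStronglyMeasurable g →
      (∀ b, a ≤ b → eLpNorm (cv (𝓕⁻ fun ξ => m ((2 : ℝ) ^ (-j) • ξ)) g) (ENNReal.ofReal b) volume ≤
        ENNReal.ofReal C * dyadicWeight (n / a - n / b) j * eLpNorm g (ENNReal.ofReal a) volume) ∧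
      ∀ x, ‖cv (𝓕⁻ fun ξ => m ((2 : ℝ) ^ (-j) • ξ)) g x‖ₑ ≤
        ENNReal.ofReal C * dyadicWeight (n / a) j * eLpNorm g (ENNReal.ofReal a) volume := by
  obtain ⟨K, hK0, hK⟩ := hm.isSchwartz.exists_kernel_le
  set I := (kerNorm m).toReal
  have hI0 : 0 ≤ I := ENNReal.toReal_nonneg
  have hI : ENNReal.ofReal I = kerNorm m := ENNReal.ofReal_toReal hm.isSchwartz.kerNorm_ne_top
  refine ⟨I + K + 1, by positivity, fun j a ha g hg => ?_⟩
  have ha0 : 0 < a := by linarith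
  have h2 : (0 : ℝ) < 2 ^ (-j) := by positivity
  set mj : Space n → ℂ := fun ξ => m ((2 : ℝ) ^ (-j) • ξ)
  have hmj : IsSchwartz mj := hm.isSchwartz.comp_smul h2.ne'
  have hker : ∫⁻ y, ‖𝓕⁻ mj y‖ₑ = ENNReal.ofReal I := by
    rw [hI]; exact kerNorm_comp_smul m h2
  have hbd : ∀ y, ‖𝓕⁻ mj y‖ₑ ≤ ENNReal.ofReal K * dyadicWeight n j := by
    intro y
    rw [fourierInv_comp_smul m h2, dyadicWeight, ← ENNReal.ofReal_mul hK0, ← ofReal_norm, norm_smul,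
      Real.norm_of_nonneg (by positivity), mul_comm]
    refine ENNReal.ofReal_le_ofReal (mul_le_mul (hK _) (le_of_eq ?_) (by positivity) hK0)
    rw [← Real.rpow_natCast, ← Real.rpow_intCast, ← Real.rpow_mul two_pos.le,
      ← Real.rpow_neg two_pos.le]
    congr 1
    push_cast
    ring
  have hIS : ENNReal.ofReal I ≤ ENNReal.ofReal (I + K + 1) := ENNReal.ofReal_le_ofReal (by linarith)
  have hKS : ENNReal.ofReal K ≤ ENNReal.ofReal (I + K + 1) := ENNReal.ofReal_le_ofReal (by linarith)
  have h1a : 1 / a ≤ 1 := (div_le_one ha0).2 ha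
  constructor
  · intro b hab
    have hba : 1 / b ≤ 1 / a := one_div_le_one_div_of_le ha0 hab
    have hb0 : 0 < 1 / b := by have := ha0.trans_le hab; positivity
    refine (eLpNorm_cv_le_of_le ha hab hmj.continuous_kernel.aestronglyMeasurable hg hbd).trans ?_
    rw [hker, ENNReal.mul_rpow_of_nonneg _ _ (by linarith), dyadicWeight_rpow,
      ← mul_assoc, show (n : ℝ) * (1 / a - 1 / b) = n / a - n / b by ring]
    gcongr
    exact rpow_mul_rpow_le (by linarith) (by linarith) (by ring) hIS hKS
  · intro x
    refine (enorm_cv_le_absCv _ _ x).trans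
      ((absCv_le ha hmj.continuous_kernel.aestronglyMeasurable hg hbd x).trans ?_)
    rw [hker, ENNReal.mul_rpow_of_nonneg _ _ (by positivity), dyadicWeight_rpow,
      ← mul_assoc, show (n : ℝ) * (1 / a) = n / a by ring]
    gcongr
    exact rpow_mul_rpow_le (by linarith) (by positivity) (by ring) hIS hKS

end Bernstein

/-! ### Products of frequency-localized functions -/

section Products

variable {p : ℝ} [hp : Fact (1 ≤ ENNReal.ofReal p)]

open Classical in
/-- The product of two functions in `Lᵖ`, if it is in `Lᵖ`. -/
def mulLp (x y : LpC n p) : LpC n p :=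
  if h : MemLp (fun z => x z * y z) (ENNReal.ofReal p) volume then h.toLp _ else 0

/-- The product of the frequency-localized parts of `x` and `y`. -/
def prodBlk (ψ : Space n → ℝ) (k l : ℤ) (x y : LpC n p) : LpC n p :=
  mulLp (convLp (fatSym ψ k) x) (convLp (fatSym ψ l) y)

/-- The normalized symbol `2⁻ʲ 2πi ξ_m ψ(2⁻ʲ ξ)` of `2⁻ʲ ∂_m Δ_j`. -/
def derSym (ψ : Space n → ℝ) (m : Fin n) (j : ℤ) (ξ : Space n) : ℂ :=
  lpSym ψ 0 ((2 : ℝ) ^ (-j) • ξ) *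
    ((2 * Real.pi * Complex.I) * ((((2 : ℝ) ^ (-j) • ξ) m : ℝ) : ℂ))

variable {ψ : Space n → ℝ}

theorem IsLittlewoodPaley.isAnnular_der_zero (hψ : IsLittlewoodPaley ψ) (m : Fin n) :
    IsAnnular fun ξ : Space n => lpSym ψ 0 ξ * ((2 * Real.pi * Complex.I) * (ξ m : ℂ)) := by
  refine hψ.isAnnular_zero.mul_contDiffOn (ContDiff.contDiffOn ?_)
  exact contDiff_const.mul (Complex.ofRealCLM.contDiff.comp
    (EuclideanSpace.proj m : Space n →L[ℝ] ℝ).contDiff)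

theorem IsLittlewoodPaley.isSchwartz_der (hψ : IsLittlewoodPaley ψ) (m : Fin n) (j : ℤ) :
    IsSchwartz (derSym ψ m j) :=
  (hψ.isAnnular_der_zero m).isSchwartz.comp_smul (by positivity)

theorem derSym_eq (ψ : Space n → ℝ) (m : Fin n) (j : ℤ) :
    (((2 : ℝ) ^ j : ℝ) : ℂ) • derSym ψ m j =
      lpSym ψ j * fun ξ => (2 * Real.pi * Complex.I) * (ξ m : ℂ) := by
  ext ξ
  have h2 : ((2 : ℂ) ^ j) ≠ 0 := zpow_ne_zero _ two_ne_zero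
  rw [lpSym_eq_comp ψ j]
  simp only [derSym, Pi.smul_apply, Pi.mul_apply, smul_eq_mul, PiLp.smul_apply]
  push_cast
  rw [show (2 : ℂ) ^ (-j) = (2 ^ j)⁻¹ from zpow_neg _ _]
  field_simp

/-- Sup bound and integrability bounds for a frequency-localized function. -/
theorem IsLittlewoodPaley.exists_fat_bound (hψ : IsLittlewoodPaley ψ) :
    ∃ C : ℝ, 0 < C ∧ ∀ (j : ℤ) (x : LpC n p),
      (∀ b, p ≤ b → eLpNorm (convLp (fatSym ψ j) x) (ENNReal.ofReal b) volume ≤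
        ENNReal.ofReal C * dyadicWeight (n / p - n / b) j * ‖x‖ₑ) ∧
      eLpNorm (convLp (fatSym ψ j) x) ⊤ volume ≤
        ENNReal.ofReal C * dyadicWeight (n / p) j * ‖x‖ₑ := by
  obtain ⟨C, hC, h⟩ := (hψ.isAnnular_fat 0).bernstein
  refine ⟨C, hC, fun j x => ?_⟩
  have h1 := h j p (one_le_of_fact p) x (Lp.memLp x).1
  rw [← fatSym_eq_comp, ← Lp.enorm_def] at h1
  have h2 := coeFn_convLp (hψ.isSchwartz_fat j) x
  refine ⟨fun b hb => ?_, ?_⟩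
  · rw [eLpNorm_congr_ae h2]
    exact h1.1 b hb
  · rw [eLpNorm_congr_ae h2]
    exact eLpNormEssSup_le_of_ae_enorm_bound (Eventually.of_forall h1.2)

/-- A frequency-localized function in L^p is bounded, so it multiplies L^p into itself. -/
theorem IsLittlewoodPaley.memLp_prod (hψ : IsLittlewoodPaley ψ) (k l : ℤ) (x y : LpC n p) :
    MemLp (fun z => convLp (fatSym ψ k) x z * convLp (fatSym ψ l) y z) (ENNReal.ofReal p)
      volume := by
  obtain ⟨C, hC, h⟩ := hψ.exists_fat_bound (p := p)
  have h1 : MemLp (convLp (fatSym ψ k) x) ⊤ volume :=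
    ⟨(Lp.memLp _).1, (h k x).2.trans_lt (ENNReal.mul_lt_top
      (ENNReal.mul_lt_top ENNReal.ofReal_lt_top (dyadicWeight_ne_top _ _).lt_top) enorm_lt_top)⟩
  exact MemLp.mul (Lp.memLp _) h1

theorem IsLittlewoodPaley.coeFn_prodBlk (hψ : IsLittlewoodPaley ψ) (k l : ℤ) (x y : LpC n p) :
    prodBlk ψ k l x y =ᵐ[volume] fun z => convLp (fatSym ψ k) x z * convLp (fatSym ψ l) y z := by
  rw [prodBlk, mulLp, dif_pos (hψ.memLp_prod k l x y)]
  exact MemLp.coeFn_toLp _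

theorem IsLittlewoodPaley.prodBlk_sub_left (hψ : IsLittlewoodPaley ψ) (k l : ℤ) (x x' y : LpC n p) :
    prodBlk ψ k l (x - x') y = prodBlk ψ k l x y - prodBlk ψ k l x' y := by
  apply Lp.ext
  filter_upwards [hψ.coeFn_prodBlk k l (x - x') y, hψ.coeFn_prodBlk k l x y,
    hψ.coeFn_prodBlk k l x' y, Lp.coeFn_sub (prodBlk ψ k l x y) (prodBlk ψ k l x' y),
    Lp.coeFn_sub (convLp (fatSym ψ k) x) (convLp (fatSym ψ k) x')] with z h1 h2 h3 h4 h5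
  rw [h1, h4, Pi.sub_apply, h2, h3, map_sub, h5, Pi.sub_apply, sub_mul]

theorem IsLittlewoodPaley.prodBlk_sub_right (hψ : IsLittlewoodPaley ψ) (k l : ℤ) (x y y' : LpC n p) :
    prodBlk ψ k l x (y - y') = prodBlk ψ k l x y - prodBlk ψ k l x y' := by
  apply Lp.ext
  filter_upwards [hψ.coeFn_prodBlk k l x (y - y'), hψ.coeFn_prodBlk k l x y,
    hψ.coeFn_prodBlk k l x y', Lp.coeFn_sub (prodBlk ψ k l x y) (prodBlk ψ k l x y'),
    Lp.coeFn_sub (convLp (fatSym ψ l) y) (convLp (fatSym ψ l) y')] with z h1 h2 h3 h4 h5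
  rw [h1, h4, Pi.sub_apply, h2, h3, map_sub, h5, Pi.sub_apply, mul_sub]

theorem IsLittlewoodPaley.prodBlk_comm (hψ : IsLittlewoodPaley ψ) (k l : ℤ) (x y : LpC n p) :
    prodBlk ψ k l x y = prodBlk ψ l k y x := by
  apply Lp.ext
  filter_upwards [hψ.coeFn_prodBlk k l x y, hψ.coeFn_prodBlk l k y x] with z h1 h2
  rw [h1, h2, mul_comm]

/-- Low-high estimate: the second factor is bounded. -/
theorem IsLittlewoodPaley.exists_der_prod_bound (hψ : IsLittlewoodPaley ψ) :
    ∃ C : ℝ, 0 < C ∧ ∀ (m : Fin n) (j k l : ℤ) (x y : LpC n p),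
      ‖convLp (derSym ψ m j) (prodBlk ψ k l x y)‖ₑ ≤
        ENNReal.ofReal C * dyadicWeight (n / p) l * (‖x‖ₑ * ‖y‖ₑ) := by
  obtain ⟨C, hC, h⟩ := hψ.exists_fat_bound (p := p)
  choose D hD hD' using fun m => (hψ.isAnnular_der_zero m).bernstein
  set E := ∑ m, D m
  have hE : ∀ m, D m ≤ E := fun m =>
    Finset.single_le_sum (f := D) (fun m _ => (hD m).le) (Finset.mem_univ m)
  have hE0 : 0 ≤ E := Finset.sum_nonneg fun m _ => (hD m).le
  refine ⟨(E + 1) * C * C, by positivity, fun m j k l x y => ?_⟩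
  have h0 : ‖prodBlk ψ k l x y‖ₑ ≤ (ENNReal.ofReal C * ‖x‖ₑ) *
      (ENNReal.ofReal C * dyadicWeight (n / p) l * ‖y‖ₑ) := by
    rw [Lp.enorm_def, eLpNorm_congr_ae (hψ.coeFn_prodBlk k l x y)]
    refine (eLpNorm_smul_le_mul_eLpNorm (p := ENNReal.ofReal p) (q := ⊤) (r := ENNReal.ofReal p)
      (Lp.memLp (convLp (fatSym ψ l) y)).1 (Lp.memLp (convLp (fatSym ψ k) x)).1).trans ?_
    have h1 := (h k x).1 p le_rfl
    rw [sub_self, dyadicWeight_zero, mul_one] at h1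
    gcongr
    exact (h l y).2
  have h1 := (hD' m j p (one_le_of_fact p) (prodBlk ψ k l x y) (Lp.memLp _).1).1 p le_rfl
  rw [sub_self, dyadicWeight_zero, mul_one, ← Lp.enorm_def] at h1
  rw [Lp.enorm_def, eLpNorm_congr_ae (coeFn_convLp (hψ.isSchwartz_der m j) _)]
  calc _ ≤ ENNReal.ofReal (D m) * ‖prodBlk ψ k l x y‖ₑ := h1
    _ ≤ ENNReal.ofReal (E + 1) * ((ENNReal.ofReal C * ‖x‖ₑ) *
      (ENNReal.ofReal C * dyadicWeight (n / p) l * ‖y‖ₑ)) := by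
        gcongr
        linarith [hE m]
    _ = _ := by
        rw [ENNReal.ofReal_mul (by positivity), ENNReal.ofReal_mul (by positivity)]
        ring

/-- High-high estimate, with `b = max 1 (p/2)`. -/
theorem IsLittlewoodPaley.exists_der_prod_bound' (hψ : IsLittlewoodPaley ψ) {b : ℝ} (hb : 1 ≤ b)
    (hbp : b ≤ p) (hpb : p ≤ 2 * b) :
    ∃ C : ℝ, 0 < C ∧ ∀ (m : Fin n) (j k l : ℤ) (x y : LpC n p),
      ‖convLp (derSym ψ m j) (prodBlk ψ k l x y)‖ₑ ≤
        ENNReal.ofReal C * dyadicWeight (n / b - n / p) j * dyadicWeight (n / p - n / (2 * b)) k *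
          dyadicWeight (n / p - n / (2 * b)) l * (‖x‖ₑ * ‖y‖ₑ) := by
  obtain ⟨C, hC, h⟩ := hψ.exists_fat_bound (p := p)
  choose D hD hD' using fun m => (hψ.isAnnular_der_zero m).bernstein
  set E := ∑ m, D m
  have hE : ∀ m, D m ≤ E := fun m =>
    Finset.single_le_sum (f := D) (fun m _ => (hD m).le) (Finset.mem_univ m)
  have hE0 : 0 ≤ E := Finset.sum_nonneg fun m _ => (hD m).le
  refine ⟨(E + 1) * C * C, by positivity, fun m j k l x y => ?_⟩
  have hb0 : 0 < b := by linarith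
  have hH : ENNReal.HolderTriple (ENNReal.ofReal (2 * b)) (ENNReal.ofReal (2 * b))
      (ENNReal.ofReal b) := by
    refine ⟨?_⟩
    rw [← ENNReal.ofReal_inv_of_pos (by positivity), ← ENNReal.ofReal_inv_of_pos hb0,
      ← ENNReal.ofReal_add (by positivity) (by positivity)]
    congr 1
    field_simp
    norm_num
  have h0 : eLpNorm (prodBlk ψ k l x y) (ENNReal.ofReal b) volume ≤
      (ENNReal.ofReal C * dyadicWeight (n / p - n / (2 * b)) k * ‖x‖ₑ) *
      (ENNReal.ofReal C * dyadicWeight (n / p - n / (2 * b)) l * ‖y‖ₑ) := by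
    rw [eLpNorm_congr_ae (hψ.coeFn_prodBlk k l x y)]
    refine (eLpNorm_smul_le_mul_eLpNorm (p := ENNReal.ofReal (2 * b)) (q := ENNReal.ofReal (2 * b))
      (r := ENNReal.ofReal b)
      (Lp.memLp (convLp (fatSym ψ l) y)).1 (Lp.memLp (convLp (fatSym ψ k) x)).1).trans ?_
    gcongr
    · exact (h k x).1 _ hpb
    · exact (h l y).1 _ hpb
  have h1 := (hD' m j b hb (prodBlk ψ k l x y) (Lp.memLp _).1).1 p hbp
  rw [Lp.enorm_def, eLpNorm_congr_ae (coeFn_convLp (hψ.isSchwartz_der m j) _)]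
  calc _ ≤ ENNReal.ofReal (D m) * dyadicWeight (n / b - n / p) j *
        eLpNorm (prodBlk ψ k l x y) (ENNReal.ofReal b) volume := h1
    _ ≤ ENNReal.ofReal (E + 1) * dyadicWeight (n / b - n / p) j *
        ((ENNReal.ofReal C * dyadicWeight (n / p - n / (2 * b)) k * ‖x‖ₑ) *
        (ENNReal.ofReal C * dyadicWeight (n / p - n / (2 * b)) l * ‖y‖ₑ)) := by
        gcongr
        linarith [hE m]
    _ = _ := by
        rw [ENNReal.ofReal_mul (by positivity), ENNReal.ofReal_mul (by positivity)]
        ring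

end Products

/-! ### Spectral localization of products -/

section Spectral

/-- The Fourier transform of a product is a convolution, whose integrand vanishes identically at ζ
under the hypothesis. -/
theorem fourier_mul_eq_zero (f g : 𝓢(Space n, ℂ)) {ζ : Space n}
    (h : ∀ η, 𝓕 f η ≠ 0 → 𝓕 g (ζ - η) = 0) :
    𝓕 (fun x => f x * g x) ζ = 0 := by
  have e : ∀ (k : Space n → ℂ) (η : Space n), 𝓕⁻ k η = 𝓕 k (-η) := fun k η => by
    rw [Real.fourierInv_eq_fourier_neg]
  have h1 := fourierInv_mul (m := f) (m' := g) ⟨f, rfl⟩ ⟨g, rfl⟩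
  have h2 := congrFun h1 (-ζ)
  rw [e, neg_neg] at h2
  change 𝓕 (⇑f * ⇑g) ζ = 0
  rw [h2, cv]
  refine integral_eq_zero_of_ae (Eventually.of_forall fun y => ?_)
  simp only [e, Pi.zero_apply, mul_eq_zero]
  by_cases hy : 𝓕 (⇑f) (-y) = 0
  · exact Or.inl hy
  · right
    have h3 := h (-y) (by rw [SchwartzMap.fourier_coe]; exact hy)
    rw [SchwartzMap.fourier_coe] at h3
    convert h3 using 2
    abel

variable {p : ℝ} [hp : Fact (1 ≤ ENNReal.ofReal p)] {ψ : Space n → ℝ}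

theorem emb_toLp (f : 𝓢(Space n, ℂ)) :
    emb (f.toLp (ENNReal.ofReal p) : LpC n p) = SchwartzMap.toTemperedDistributionCLM _ _ volume f :=
  Lp.toTemperedDistribution_toLp_eq f

theorem convLp_toLp {m : Space n → ℂ} (hm : IsSchwartz m) (f : 𝓢(Space n, ℂ)) :
    convLp m (f.toLp (ENNReal.ofReal p) : LpC n p) =
      (SchwartzMap.fourierMultiplierCLM ℂ m f).toLp (ENNReal.ofReal p) := by
  apply emb_injective
  rw [emb_convLp hm, emb_toLp, emb_toLp]
  exact TemperedDistribution.fourierMultiplierCLM_toTemperedDistributionCLM_eq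
    hm.hasTemperateGrowth f

theorem fourier_fourierMultiplier {m : Space n → ℂ} (hm : IsSchwartz m) (f : 𝓢(Space n, ℂ))
    (η : Space n) : 𝓕 (SchwartzMap.fourierMultiplierCLM ℂ m f) η = m η * 𝓕 f η := by
  rw [SchwartzMap.fourierMultiplierCLM_apply, FourierTransform.fourier_fourierInv_eq,
    SchwartzMap.smulLeftCLM_apply_apply hm.hasTemperateGrowth, smul_eq_mul]

theorem convLp_prodBlk_toLp_eq_zero (hψ : IsLittlewoodPaley ψ) {m : Space n → ℂ} (hm : IsSchwartz m)
    {k l : ℤ} (h : ∀ η η', fatSym ψ k η ≠ 0 → fatSym ψ l η' ≠ 0 → m (η + η') = 0)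
    (f g : 𝓢(Space n, ℂ)) :
    convLp m (prodBlk ψ k l (f.toLp (ENNReal.ofReal p) : LpC n p)
      (g.toLp (ENNReal.ofReal p))) = 0 := by
  set F := SchwartzMap.fourierMultiplierCLM ℂ (fatSym ψ k) f
  set G := SchwartzMap.fourierMultiplierCLM ℂ (fatSym ψ l) g
  set Q := SchwartzMap.pairing (ContinuousLinearMap.mul ℂ ℂ) F G
  have hQ : (⇑Q : Space n → ℂ) = fun x => F x * G x := by
    ext x; simp [Q]
  have e1 : prodBlk ψ k l (f.toLp (ENNReal.ofReal p) : LpC n p) (g.toLp (ENNReal.ofReal p)) =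
      Q.toLp (ENNReal.ofReal p) := by
    apply Lp.ext
    filter_upwards [hψ.coeFn_prodBlk k l (f.toLp (ENNReal.ofReal p) : LpC n p)
      (g.toLp (ENNReal.ofReal p)), Q.coeFn_toLp (ENNReal.ofReal p),
      F.coeFn_toLp (ENNReal.ofReal p), G.coeFn_toLp (ENNReal.ofReal p)] with x h1 h2 h3 h4
    rw [h1, h2, convLp_toLp (hψ.isSchwartz_fat k), convLp_toLp (hψ.isSchwartz_fat l), h3, h4, hQ]
  rw [e1, convLp_toLp hm]
  have e2 : SchwartzMap.fourierMultiplierCLM ℂ m Q = 0 := by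
    have : 𝓕 (SchwartzMap.fourierMultiplierCLM ℂ m Q) = 0 := by
      ext ζ
      rw [fourier_fourierMultiplier hm, SchwartzMap.fourier_coe, hQ]
      by_cases hmζ : m ζ = 0
      · simp [hmζ]
      rw [fourier_mul_eq_zero F G fun η hη => ?_]
      · simp
      · rw [fourier_fourierMultiplier (hψ.isSchwartz_fat k)] at hη
        rw [fourier_fourierMultiplier (hψ.isSchwartz_fat l)]
        by_contra hne
        refine hmζ ?_
        have := h η (ζ - η) (left_ne_zero_of_mul hη) (left_ne_zero_of_mul hne)
        simpa using this
    have h2 := congrArg (fun s : 𝓢(Space n, ℂ) => 𝓕⁻ s) this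
    simp only [FourierTransform.fourierInv_fourier_eq] at h2
    rw [h2]
    ext x
    simp
  rw [e2]
  exact map_zero (SchwartzMap.toLpCLM ℝ ℂ (ENNReal.ofReal p) volume)

/-- The convolution theorem settles Schwartz functions. They are dense in L^p for p < ∞, and the
localized product is Lipschitz in each variable, the second factor being bounded by Bernstein's
inequality. -/
theorem convLp_prodBlk_eq_zero (hψ : IsLittlewoodPaley ψ) {m : Space n → ℂ} (hm : IsSchwartz m)
    {k l : ℤ} (h : ∀ η η', fatSym ψ k η ≠ 0 → fatSym ψ l η' ≠ 0 → m (η + η') = 0)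
    (x y : LpC n p) : convLp m (prodBlk ψ k l x y) = 0 := by
  obtain ⟨C, hC, hbd⟩ := hψ.exists_fat_bound (p := p)
  have hnorm : ∀ x y : LpC n p, ‖prodBlk ψ k l x y‖ₑ ≤
      ENNReal.ofReal C * ENNReal.ofReal C * dyadicWeight (n / p) l * (‖x‖ₑ * ‖y‖ₑ) := by
    intro x y
    rw [Lp.enorm_def, eLpNorm_congr_ae (hψ.coeFn_prodBlk k l x y)]
    refine (eLpNorm_smul_le_mul_eLpNorm (p := ENNReal.ofReal p) (q := ⊤) (r := ENNReal.ofReal p)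
      (Lp.memLp (convLp (fatSym ψ l) y)).1 (Lp.memLp (convLp (fatSym ψ k) x)).1).trans ?_
    have h1 := (hbd k x).1 p le_rfl
    rw [sub_self, dyadicWeight_zero, mul_one] at h1
    refine (mul_le_mul' h1 (hbd l y).2).trans_eq (by ring)
  set K := ENNReal.ofReal C * ENNReal.ofReal C * dyadicWeight (n / p) l
  have hK : K ≠ ⊤ := ENNReal.mul_ne_top (by finiteness) (dyadicWeight_ne_top _ _)
  have hleft : ∀ y : LpC n p, Continuous fun x => prodBlk ψ k l x y := by
    intro y
    refine (LipschitzWith.continuous (K := (K * ‖y‖ₑ).toNNReal) fun x x' => ?_)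
    rw [edist_eq_enorm_sub, edist_eq_enorm_sub, ← hψ.prodBlk_sub_left, ENNReal.coe_toNNReal
      (ENNReal.mul_ne_top hK enorm_ne_top)]
    exact (hnorm _ _).trans_eq (by ring)
  have hright : ∀ x : LpC n p, Continuous fun y => prodBlk ψ k l x y := by
    intro x
    refine (LipschitzWith.continuous (K := (K * ‖x‖ₑ).toNNReal) fun y y' => ?_)
    rw [edist_eq_enorm_sub, edist_eq_enorm_sub, ← hψ.prodBlk_sub_right, ENNReal.coe_toNNReal
      (ENNReal.mul_ne_top hK enorm_ne_top)]
    exact (hnorm _ _).trans_eq (by ring)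
  have hd : DenseRange (SchwartzMap.toLpCLM ℝ ℂ (ENNReal.ofReal p) (volume : Measure (Space n))) :=
    SchwartzMap.denseRange_toLpCLM ENNReal.ofReal_ne_top
  refine hd.induction_on x (isClosed_eq ((convLp m).continuous.comp (hleft y)) continuous_const)
    fun f => ?_
  refine hd.induction_on y (isClosed_eq ((convLp m).continuous.comp (hright _)) continuous_const)
    fun g => ?_
  exact convLp_prodBlk_toLp_eq_zero hψ hm h f g

/-- Frequencies `2^k` and `2^l` interact to give the frequency `2^j`. -/
def Interact (j k l : ℤ) : Prop :=
  j ≤ max k l + 5 ∧ (l + 8 ≤ k → k - 5 ≤ j) ∧ (k + 8 ≤ l → l - 5 ≤ j)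

/-- Triangle inequality for the shells: widened blocks occupy 2^{k-3} ≤ |ξ| ≤ 2^{k+3}, output blocks
2^{j-1} ≤ |ξ| ≤ 2^{j+1}. A gap of 8 makes the smaller input at most half of the lower bound of the
larger one, so no cancellation can occur. -/
theorem lpSym_add_eq_zero (hψ : IsLittlewoodPaley ψ) {j k l : ℤ} (h : ¬ Interact j k l)
    {η η' : Space n} (hη : fatSym ψ k η ≠ 0) (hη' : fatSym ψ l η' ≠ 0) : lpSym ψ j (η + η') = 0 := by
  by_contra hne
  apply h
  obtain ⟨a1, a2⟩ := hψ.bounds_of_ne_zero hne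
  obtain ⟨b1, b2⟩ := hψ.bounds_of_fat_ne_zero hη
  obtain ⟨c1, c2⟩ := hψ.bounds_of_fat_ne_zero hη'
  have mono : ∀ {a b : ℤ}, a ≤ b → (2 : ℝ) ^ a ≤ 2 ^ b := fun h => zpow_le_zpow_right₀ one_le_two h
  have dbl : ∀ a : ℤ, (2 : ℝ) ^ (a + 1) = 2 * 2 ^ a := fun a => by
    rw [zpow_add₀ two_ne_zero, zpow_one, mul_comm]
  have key : ∀ {a b : ℤ} {η η' : Space n}, b + 8 ≤ a → (2 : ℝ) ^ (a - 3) ≤ ‖η‖ →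
      ‖η'‖ ≤ 2 ^ (b + 3) → ‖η + η'‖ ≤ 2 ^ (j + 1) → a - 5 ≤ j := by
    intro a b η η' hab h1 h2 h3
    have h4 : ‖η‖ ≤ ‖η + η'‖ + ‖η'‖ := by
      have := norm_sub_le (η + η') η'
      simpa using this
    have h5 : (2 : ℝ) ^ (b + 3) ≤ 2 ^ (a - 4) := mono (by omega)
    have h6 := dbl (a - 4)
    rw [show a - 4 + 1 = a - 3 by ring] at h6
    have h7 : (2 : ℝ) ^ (a - 4) ≤ 2 ^ (j + 1) := by linarith
    have := (zpow_le_zpow_iff_right₀ (one_lt_two (α := ℝ))).1 h7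
    omega
  refine ⟨?_, fun hkl => key hkl b1 c2 a2, fun hkl => key hkl c1 b2 (by rwa [add_comm])⟩
  have h1 : ‖η + η'‖ ≤ 2 * 2 ^ (max k l + 3) := by
    refine (norm_add_le _ _).trans ?_
    have h2 : (2 : ℝ) ^ (k + 3) ≤ 2 ^ (max k l + 3) := mono (by omega)
    have h3 : (2 : ℝ) ^ (l + 3) ≤ 2 ^ (max k l + 3) := mono (by omega)
    linarith
  rw [← dbl] at h1
  have := (zpow_le_zpow_iff_right₀ (one_lt_two (α := ℝ))).1 (a1.trans h1)
  omega

theorem convLp_der_prodBlk_eq_zero (hψ : IsLittlewoodPaley ψ) {j k l : ℤ} (h : ¬ Interact j k l)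
    (m : Fin n) (x y : LpC n p) : convLp (derSym ψ m j) (prodBlk ψ k l x y) = 0 := by
  refine convLp_prodBlk_eq_zero hψ (hψ.isSchwartz_der m j) (fun η η' hη hη' => ?_) x y
  have := lpSym_add_eq_zero hψ h hη hη'
  rw [lpSym_eq_comp] at this
  simp only at this
  rw [derSym, this, zero_mul]

end Spectral

/-! ### The bilinear blocks of `div (u ⊗ v)` -/

section Bilinear

theorem summable_two_rpow_neg_abs {η : ℝ} (hη : 0 < η) :
    Summable fun d : ℤ => (2 : ℝ) ^ (-η * |(d : ℝ)|) := by
  have hr : (2 : ℝ) ^ (-η) < 1 := Real.rpow_lt_one_of_one_lt_of_neg one_lt_two (by linarith)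
  have hg := summable_geometric_of_lt_one (by positivity) hr
  refine Summable.of_nat_of_neg (hg.congr fun m => ?_) (hg.congr fun m => ?_) <;>
  · rw [← Real.rpow_natCast, ← Real.rpow_mul two_pos.le]
    simp

variable {p : ℝ} [hp : Fact (1 ≤ ENNReal.ofReal p)] {ψ : Space n → ℝ}

theorem norm_le_of_enorm_le {E F G : Type*} [NormedAddCommGroup E] [NormedAddCommGroup F]
    [NormedAddCommGroup G] {z : E} {x : F} {y : G} {A : ℝ} (hA : 0 ≤ A)
    (h : ‖z‖ₑ ≤ ENNReal.ofReal A * (‖x‖ₑ * ‖y‖ₑ)) : ‖z‖ ≤ A * (‖x‖ * ‖y‖) := by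
  rw [← ofReal_norm, ← ofReal_norm, ← ofReal_norm, ← ENNReal.ofReal_mul (norm_nonneg _),
    ← ENNReal.ofReal_mul hA] at h
  exact (ENNReal.ofReal_le_ofReal_iff (by positivity)).1 h

/-- The estimate behind the nonlinear term, with A = n/p and B = n/b. If k dominates l, then j is
close to k, and placing the low factor in L^∞ leaves the exponent (A - 1)(j - k) - (j - l); the case
where l dominates is symmetric. If k and l are comparable, the product is placed in L^b and the
exponent is (B/2 - 1)((j - k) + (j - l)), which decays as j → -∞ exactly because B > 2. Here n ≥ 3
and p < n are used. -/
theorem exists_trilinear_bound (hn : 3 ≤ n) (hpn : p < n) (hψ : IsLittlewoodPaley ψ) :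
    ∃ C η : ℝ, 0 < C ∧ 0 < η ∧ ∀ (m : Fin n) (j k l : ℤ) (x y : LpC n p),
      (2 : ℝ) ^ ((n / p - 2) * j - (n / p - 1) * k - (n / p - 1) * l) *
        ‖convLp (derSym ψ m j) (prodBlk ψ k l x y)‖ ≤
      C * (2 : ℝ) ^ (-η * |((k - j : ℤ) : ℝ)|) * (2 : ℝ) ^ (-η * |((l - j : ℤ) : ℝ)|) *
        (‖x‖ * ‖y‖) := by
  have hp1 := one_le_of_fact p
  have hn3 : (3 : ℝ) ≤ n := by exact_mod_cast hn
  -- The smallest exponent b ≥ 1 with 2b ≥ p: both factors can then be placed in L^{2b} by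
  -- Bernstein's inequality, and B = n/b > 2.
  set b := max 1 (p / 2) with hb
  have hb1 : 1 ≤ b := le_max_left _ _
  have hbp : b ≤ p := max_le hp1 (by linarith)
  have hpb : p ≤ 2 * b := by linarith [le_max_right 1 (p / 2)]
  have hb2 : 2 * b < n := by
    rcases max_choice 1 (p / 2) with h | h <;> rw [hb, h] <;> linarith
  set A : ℝ := n / p with hA
  set B : ℝ := n / b with hB
  have hB2 : 2 < B := by rw [hB, lt_div_iff₀ (by linarith)]; linarith
  have hB' : (n : ℝ) / (2 * b) = B / 2 := by rw [hB]; field_simp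
  obtain ⟨C₁, hC₁, h1⟩ := hψ.exists_der_prod_bound (p := p)
  obtain ⟨C₂, hC₂, h2⟩ := hψ.exists_der_prod_bound' hb1 hbp hpb
  set δ := B - 2 with hδ
  have hδ0 : 0 < δ := by linarith
  set η := min 1 (δ / 2) with hη
  have hη1 : η ≤ 1 := min_le_left _ _
  have hη2 : η ≤ δ / 2 := min_le_right _ _
  have hη0 : 0 < η := lt_min one_pos (by linarith)
  -- E collects the bounded losses: 12δ for each of the two differences in the high-high case, and
  -- 5|A - 1| + 5 from |j - k| ≤ 5 or |j - l| ≤ 5 in the other cases.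
  set E := 24 * δ + 5 * |A - 1| + 5 with hE
  have hlow : ∀ (m : Fin n) (j k l : ℤ) (x y : LpC n p),
      ‖convLp (derSym ψ m j) (prodBlk ψ k l x y)‖ ≤ C₁ * (2 : ℝ) ^ (A * l) * (‖x‖ * ‖y‖) := by
    intro m j k l x y
    refine norm_le_of_enorm_le (by positivity) ?_
    have := h1 m j k l x y
    rwa [dyadicWeight, ← ENNReal.ofReal_mul hC₁.le] at this
  have hlow' : ∀ (m : Fin n) (j k l : ℤ) (x y : LpC n p),
      ‖convLp (derSym ψ m j) (prodBlk ψ k l x y)‖ ≤ C₁ * (2 : ℝ) ^ (A * k) * (‖x‖ * ‖y‖) := by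
    intro m j k l x y
    rw [hψ.prodBlk_comm, mul_comm ‖x‖]
    exact hlow m j l k y x
  have hhigh : ∀ (m : Fin n) (j k l : ℤ) (x y : LpC n p),
      ‖convLp (derSym ψ m j) (prodBlk ψ k l x y)‖ ≤
        C₂ * (2 : ℝ) ^ ((B - A) * j + (A - B / 2) * k + (A - B / 2) * l) * (‖x‖ * ‖y‖) := by
    intro m j k l x y
    refine norm_le_of_enorm_le (by positivity) ?_
    have := h2 m j k l x y
    rw [dyadicWeight, dyadicWeight, dyadicWeight, ← ENNReal.ofReal_mul hC₂.le,
      ← ENNReal.ofReal_mul (by positivity), ← ENNReal.ofReal_mul (by positivity), hB', mul_assoc,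
      mul_assoc, ← Real.rpow_add two_pos, ← Real.rpow_add two_pos, ← add_assoc] at this
    exact this
  have fin : ∀ {z D e f E' : ℝ} {N : ℝ}, 0 ≤ N → 0 ≤ D → D ≤ C₁ + C₂ → z ≤ D * (2 : ℝ) ^ f * N →
      e + f ≤ E + E' → (2 : ℝ) ^ e * z ≤ (C₁ + C₂) * 2 ^ E * 2 ^ E' * N := by
    intro z D e f E' N hN hD hD' hz hef
    calc (2 : ℝ) ^ e * z ≤ 2 ^ e * (D * 2 ^ f * N) := by gcongr
      _ = D * 2 ^ (e + f) * N := by rw [Real.rpow_add two_pos]; ring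
      _ ≤ (C₁ + C₂) * 2 ^ (E + E') * N := by
          gcongr
          exact one_le_two
      _ = _ := by rw [Real.rpow_add two_pos]; ring
  refine ⟨(C₁ + C₂) * 2 ^ E, η, by positivity, hη0, fun m j k l x y => ?_⟩
  by_cases hI : Interact j k l
  swap
  · rw [convLp_der_prodBlk_eq_zero hψ hI, norm_zero, mul_zero]
    positivity
  rw [mul_assoc ((C₁ + C₂) * 2 ^ E), ← Real.rpow_add two_pos]
  have hN : 0 ≤ ‖x‖ * ‖y‖ := by positivity
  obtain ⟨i1, i2, i3⟩ := hI
  have hAabs := abs_nonneg (A - 1)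
  push_cast
  have bd : ∀ r : ℝ, |r| ≤ 5 → (A - 1) * r ≤ 5 * |A - 1| := by
    intro r hr
    calc (A - 1) * r ≤ |(A - 1) * r| := le_abs_self _
      _ = |A - 1| * |r| := abs_mul _ _
      _ ≤ _ := by nlinarith
  rcases le_or_gt (l + 8) k with hkl | hkl
  · have j1 := i2 hkl
    have j2 : j ≤ k + 5 := by omega
    refine fin hN hC₁.le (by linarith) (hlow m j k l x y) ?_
    have r1 : ((k : ℝ) - 5) ≤ j := by exact_mod_cast j1
    have r2 : (j : ℝ) ≤ k + 5 := by exact_mod_cast j2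
    have r3 : (l : ℝ) + 8 ≤ k := by exact_mod_cast hkl
    have r4 := bd (j - k) (abs_le.2 ⟨by linarith, by linarith⟩)
    have r5 : |(k : ℝ) - j| ≤ 5 := abs_le.2 ⟨by linarith, by linarith⟩
    have r6 : |(l : ℝ) - j| = j - l := by rw [abs_of_neg (by linarith)]; ring
    rw [r6]
    nlinarith [abs_nonneg ((k : ℝ) - j)]
  rcases le_or_gt (k + 8) l with hlk | hlk
  · have j1 := i3 hlk
    have j2 : j ≤ l + 5 := by omega
    refine fin hN hC₁.le (by linarith) (hlow' m j k l x y) ?_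
    have r1 : ((l : ℝ) - 5) ≤ j := by exact_mod_cast j1
    have r2 : (j : ℝ) ≤ l + 5 := by exact_mod_cast j2
    have r3 : (k : ℝ) + 8 ≤ l := by exact_mod_cast hlk
    have r4 := bd (j - l) (abs_le.2 ⟨by linarith, by linarith⟩)
    have r5 : |(l : ℝ) - j| ≤ 5 := abs_le.2 ⟨by linarith, by linarith⟩
    have r6 : |(k : ℝ) - j| = j - k := by rw [abs_of_neg (by linarith)]; ring
    rw [r6]
    nlinarith [abs_nonneg ((l : ℝ) - j)]
  -- Now |k - l| ≤ 7 and j ≤ max k l + 5, so j exceeds neither k nor l by more than 12.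
  · refine fin hN hC₂.le (by linarith) (hhigh m j k l x y) ?_
    have r1 : (j : ℝ) ≤ k + 12 := by exact_mod_cast (show j ≤ k + 12 by omega)
    have r2 : (j : ℝ) ≤ l + 12 := by exact_mod_cast (show j ≤ l + 12 by omega)
    have e : (A - 2) * j - (A - 1) * k - (A - 1) * l +
        ((B - A) * j + (A - B / 2) * k + (A - B / 2) * l) =
        δ / 2 * (j - k) + δ / 2 * (j - l) := by rw [hδ]; ring
    have half : ∀ r : ℝ, r ≤ 12 → δ / 2 * r ≤ 12 * δ - η * |r| := by
      intro r hr
      rcases le_total 0 r with h | h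
      · rw [abs_of_nonneg h]; nlinarith
      · rw [abs_of_nonpos h]; nlinarith
    have r3 := half (j - k) (by linarith)
    have r4 := half (j - l) (by linarith)
    rw [e, abs_sub_comm (k : ℝ), abs_sub_comm (l : ℝ)]
    linarith

/-- The exponent n/p - 2 of j is n/p - 3, the weight of the force space, plus 1 for the derivative,
whose symbol is normalized in `derSym`; the terms in k and l remove the weights of the inputs. -/
theorem exists_bilinearBlocks (hn : 3 ≤ n) (hpn : p < n) (hψ : IsLittlewoodPaley ψ) :
    ∃ M : BilinearBlocks (Fld n p), ∀ j k l u v i, M.toFun j k l u v i =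
      (2 : ℝ) ^ ((n / p - 2) * j - (n / p - 1) * k - (n / p - 1) * l) •
        ∑ m, convLp (derSym ψ m j) (prodBlk ψ k l (u i) (v m)) := by
  obtain ⟨C, η, hC, hη, h⟩ := exists_trilinear_bound (p := p) hn hpn hψ
  refine ⟨⟨fun j k l u v i => (2 : ℝ) ^ ((n / p - 2) * j - (n / p - 1) * k - (n / p - 1) * l) •
        ∑ m, convLp (derSym ψ m j) (prodBlk ψ k l (u i) (v m)),
      -- The weight occurs twice in the bound, so each copy takes the square root of the constant.
      fun d => Real.toNNReal (Real.sqrt (n * C) * (2 : ℝ) ^ (-η * |(d : ℝ)|)), ?_, ?_, ?_, ?_⟩,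
    fun j k l u v i => rfl⟩
  · exact ((summable_two_rpow_neg_abs hη).mul_left _).toNNReal
  · intro j k l u u' v
    funext i
    simp only [Pi.sub_apply, hψ.prodBlk_sub_left, map_sub, Finset.sum_sub_distrib, smul_sub]
  · intro j k l u v v'
    funext i
    simp only [Pi.sub_apply, hψ.prodBlk_sub_right, map_sub, Finset.sum_sub_distrib, smul_sub]
  · intro j k l u v
    refine (pi_norm_le_iff_of_nonneg (by positivity)).2 fun i => ?_
    rw [norm_smul, Real.norm_of_nonneg (by positivity)]
    rw [Real.coe_toNNReal _ (by positivity), Real.coe_toNNReal _ (by positivity)]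
    set X := (2 : ℝ) ^ (-η * |((k - j : ℤ) : ℝ)|)
    set Y := (2 : ℝ) ^ (-η * |((l - j : ℤ) : ℝ)|)
    calc _ ≤ (2 : ℝ) ^ ((n / p - 2) * j - (n / p - 1) * k - (n / p - 1) * l) *
          ∑ m, ‖convLp (derSym ψ m j) (prodBlk ψ k l (u i) (v m))‖ := by
            gcongr
            exact norm_sum_le _ _
      _ = ∑ m, (2 : ℝ) ^ ((n / p - 2) * j - (n / p - 1) * k - (n / p - 1) * l) *
            ‖convLp (derSym ψ m j) (prodBlk ψ k l (u i) (v m))‖ := Finset.mul_sum _ _ _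
      _ ≤ ∑ m : Fin n, C * X * Y * (‖u‖ * ‖v‖) := by
            refine Finset.sum_le_sum fun m _ => (h m j k l (u i) (v m)).trans ?_
            gcongr
            · exact norm_le_pi_norm u i
            · exact norm_le_pi_norm v m
      _ = (Real.sqrt (n * C) * Real.sqrt (n * C)) * X * Y * ‖u‖ * ‖v‖ := by
            rw [Real.mul_self_sqrt (by positivity)]
            simp
            ring
      _ = _ := by ring

end Bilinear

/-! ### Weighted estimates against a test function -/

section Test

/-- The measure `|φ| dx`. -/
def testMeasure (φ : 𝓢(Space n, ℂ)) : Measure (Space n) := volume.withDensity fun x => ‖φ x‖ₑ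

/-- The norm `‖φ‖_{L¹} + ‖φ‖_{L^∞}` of a test function. -/
def testNorm (φ : 𝓢(Space n, ℂ)) : ℝ :=
  ‖SchwartzMap.toLpCLM ℂ ℂ 1 volume φ‖ + ‖SchwartzMap.toBoundedContinuousFunctionCLM ℂ (Space n) ℂ φ‖

theorem testNorm_nonneg (φ : 𝓢(Space n, ℂ)) : 0 ≤ testNorm φ := by
  unfold testNorm; positivity

theorem continuous_testNorm : Continuous (testNorm : 𝓢(Space n, ℂ) → ℝ) := by
  unfold testNorm; fun_prop

theorem testNorm_zero : testNorm (0 : 𝓢(Space n, ℂ)) = 0 := by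
  simp only [testNorm, map_zero, norm_zero, add_zero]

theorem testMeasure_univ_le (φ : 𝓢(Space n, ℂ)) :
    testMeasure φ univ ≤ ENNReal.ofReal (testNorm φ) := by
  rw [testMeasure, withDensity_apply _ MeasurableSet.univ, Measure.restrict_univ,
    ← eLpNorm_one_eq_lintegral_enorm, ← ENNReal.ofReal_toReal (φ.memLp 1 volume).2.ne]
  refine ENNReal.ofReal_le_ofReal ?_
  rw [← SchwartzMap.norm_toLp]
  exact le_add_of_nonneg_right (norm_nonneg _)

theorem testMeasure_le (φ : 𝓢(Space n, ℂ)) :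
    testMeasure φ ≤ ENNReal.ofReal (testNorm φ) • volume := by
  rw [testMeasure, ← withDensity_const]
  refine withDensity_mono (Eventually.of_forall fun x => ?_)
  simp only
  rw [← ofReal_norm]
  refine ENNReal.ofReal_le_ofReal ?_
  have := (SchwartzMap.toBoundedContinuousFunctionCLM ℂ (Space n) ℂ φ).norm_coe_le_norm x
  exact this.trans (le_add_of_nonneg_left (norm_nonneg _))

theorem testMeasure_absolutelyContinuous (φ : 𝓢(Space n, ℂ)) : testMeasure φ ≪ volume :=
  withDensity_absolutelyContinuous _ _

theorem eLpNorm_testMeasure_le {g : Space n → ℂ} (hg : AEStronglyMeasurable g)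
    (φ : 𝓢(Space n, ℂ)) :
    eLpNorm g 2 (testMeasure φ) ≤ eLpNorm g ⊤ volume * ENNReal.ofReal (testNorm φ) ^ (1 / 2 : ℝ) := by
  refine (eLpNorm_le_eLpNorm_mul_rpow_measure_univ le_top
    (hg.mono_ac (testMeasure_absolutelyContinuous φ))).trans ?_
  simp only [ENNReal.toReal_top, div_zero, sub_zero, ENNReal.toReal_ofNat]
  refine mul_le_mul' (eLpNormEssSup_mono_measure g (testMeasure_absolutelyContinuous φ)) ?_
  gcongr
  exact testMeasure_univ_le φ

/-- The bounded density contributes the power 1/r of the test norm and the finite mass the power 1/2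
- 1/r. The total 1/2 does not depend on r, so a product of two functions is bounded by the test norm
to the first power. -/
theorem eLpNorm_testMeasure_le' {g : Space n → ℂ} (hg : AEStronglyMeasurable g) {r : ℝ} (hr : 2 ≤ r)
    (φ : 𝓢(Space n, ℂ)) :
    eLpNorm g 2 (testMeasure φ) ≤
      eLpNorm g (ENNReal.ofReal r) volume * ENNReal.ofReal (testNorm φ) ^ (1 / 2 : ℝ) := by
  have hr0 : 0 < r := by linarith
  have h2 : (2 : ℝ≥0∞) ≤ ENNReal.ofReal r := by
    rw [← ENNReal.ofReal_ofNat]; exact ENNReal.ofReal_le_ofReal hr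
  have hrr : 1 / r ≤ 1 / 2 := one_div_le_one_div_of_le two_pos hr
  have hrr0 : 0 < 1 / r := by positivity
  refine (eLpNorm_le_eLpNorm_mul_rpow_measure_univ h2
    (hg.mono_ac (testMeasure_absolutelyContinuous φ))).trans ?_
  simp only [ENNReal.toReal_ofNat, ENNReal.toReal_ofReal hr0.le]
  set N := ENNReal.ofReal (testNorm φ)
  calc _ ≤ (N ^ (1 / r) * eLpNorm g (ENNReal.ofReal r) volume) * N ^ (1 / 2 - 1 / r) := by
        gcongr
        · refine (eLpNorm_mono_measure g (testMeasure_le φ)).trans_eq ?_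
          rw [eLpNorm_smul_measure_of_ne_top ENNReal.ofReal_ne_top, smul_eq_mul]
          congr 2
          rw [one_div, ENNReal.toReal_inv, ENNReal.toReal_ofReal hr0.le, one_div]
        · exact testMeasure_univ_le φ
    _ = eLpNorm g (ENNReal.ofReal r) volume * (N ^ (1 / r) * N ^ (1 / 2 - 1 / r)) := by ring
    _ = _ := by
        rw [← ENNReal.rpow_add_of_nonneg _ _ hrr0.le (by linarith)]
        congr 2
        ring

theorem lintegral_mul_test_eq {F : Space n → ℝ≥0∞} (hF : AEMeasurable F) (φ : 𝓢(Space n, ℂ)) :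
    ∫⁻ x, F x * ‖φ x‖ₑ = ∫⁻ x, F x ∂(testMeasure φ) := by
  rw [testMeasure, lintegral_withDensity_eq_lintegral_mul₀ φ.continuous.enorm.aemeasurable hF]
  simp [mul_comm]

theorem lintegral_mul_mul_test_le {g h : Space n → ℂ} (hg : AEStronglyMeasurable g)
    (hh : AEStronglyMeasurable h) (φ : 𝓢(Space n, ℂ)) :
    ∫⁻ x, ‖g x‖ₑ * ‖h x‖ₑ * ‖φ x‖ₑ ≤
      eLpNorm g 2 (testMeasure φ) * eLpNorm h 2 (testMeasure φ) := by
  rw [lintegral_mul_test_eq (F := fun x => ‖g x‖ₑ * ‖h x‖ₑ) (hg.enorm.mul hh.enorm)]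
  have ac := testMeasure_absolutelyContinuous φ
  have := eLpNorm_smul_le_mul_eLpNorm (p := 2) (q := 2) (r := 1) (μ := testMeasure φ)
    (hh.mono_ac ac) (hg.mono_ac ac)
  rw [eLpNorm_one_eq_lintegral_enorm] at this
  simpa [enorm_smul] using this

theorem lintegral_mul_test_le {g : Space n → ℂ} (hg : AEStronglyMeasurable g)
    (φ : 𝓢(Space n, ℂ)) :
    ∫⁻ x, ‖g x‖ₑ * ‖φ x‖ₑ ≤
      eLpNorm g 2 (testMeasure φ) * ENNReal.ofReal (testNorm φ) ^ (1 / 2 : ℝ) := by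
  rw [lintegral_mul_test_eq hg.enorm, ← eLpNorm_one_eq_lintegral_enorm]
  refine (eLpNorm_le_eLpNorm_mul_rpow_measure_univ (q := 2) (by norm_num)
    (hg.mono_ac (testMeasure_absolutelyContinuous φ))).trans ?_
  simp only [ENNReal.toReal_one, ENNReal.toReal_ofNat]
  norm_num
  gcongr
  exact testMeasure_univ_le φ

/-- A family of distributions with summable bounds can be summed. -/
theorem exists_hasSum_dist {ι : Type*} (T : ι → TDist n) {c : ι → ℝ} (hc : Summable c)
    (h : ∀ i φ, ‖T i φ‖ ≤ c i * testNorm φ) :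
    ∃ S : TDist n, ∀ φ, HasSum (fun i => T i φ) (S φ) := by
  have hs : ∀ φ, Summable fun i => T i φ := fun φ =>
    Summable.of_norm_bounded (hc.mul_right (testNorm φ)) fun i => h i φ
  let L : 𝓢(Space n, ℂ) →ₗ[ℂ] ℂ :=
    { toFun := fun φ => ∑' i, T i φ
      map_add' := fun φ φ' => by
        simp only [map_add]
        exact (hs φ).tsum_add (hs φ')
      map_smul' := fun a φ => by
        simp only [map_smul, RingHom.id_apply]
        exact (hs φ).tsum_const_smul a }
  have hb : ∀ φ, ‖L φ‖ ≤ (∑' i, c i) * testNorm φ := by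
    intro φ
    refine tsum_of_norm_bounded ?_ fun i => h i φ
    exact hc.hasSum.mul_right _
  have hL : Continuous L := by
    refine continuous_of_continuousAt_zero L ?_
    rw [ContinuousAt, map_zero]
    refine squeeze_zero_norm hb ?_
    have := (continuous_testNorm (n := n)).tendsto 0
    rw [testNorm_zero] at this
    simpa using this.const_mul (∑' i, c i)
  exact ⟨ContinuousLinearMap.toPointwiseConvergenceCLM ℂ (RingHom.id ℂ) _ _ ⟨L, hL⟩,
    fun φ => (hs φ).hasSum⟩

end Test

/-! ### Frequency-localized functions against a test function -/

section Tame

variable {p : ℝ} [hp : Fact (1 ≤ ENNReal.ofReal p)]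

/-- The room on both sides of the critical weight. For k ≤ 0, Bernstein's inequality into L^∞ gives
2^{nk/p}, better than the weight by 2^k. For k ≥ 0, Bernstein's inequality into L^r with r = max 2 p
gives 2^{(n/p - n/r)k}, better by the power n/r - 1, which is positive because p < n and n > 2. -/
theorem IsAnnular.exists_tame (hn : 3 ≤ n) (hpn : p < n) {m : Space n → ℂ} (hm : IsAnnular m) :
    ∃ C η : ℝ, 0 < C ∧ 0 < η ∧ ∀ (k : ℤ) (x : LpC n p) (φ : 𝓢(Space n, ℂ)),
      eLpNorm (convLp (fun ξ => m ((2 : ℝ) ^ (-k) • ξ)) x) 2 (testMeasure φ) ≤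
        ENNReal.ofReal (C * (2 : ℝ) ^ ((n / p - 1) * k + -η * |(k : ℝ)|)) *
          ENNReal.ofReal (testNorm φ) ^ (1 / 2 : ℝ) * ‖x‖ₑ := by
  have hp1 := one_le_of_fact p
  have hn3 : (3 : ℝ) ≤ n := by exact_mod_cast hn
  obtain ⟨C, hC, h⟩ := hm.bernstein
  set r := max 2 p with hr
  have hr2 : 2 ≤ r := le_max_left _ _
  have hrp : p ≤ r := le_max_right _ _
  have hrn : r < n := max_lt (by linarith) hpn
  set η := min 1 (n / r - 1)
  have hη0 : 0 < η := lt_min one_pos (by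
    rw [sub_pos, one_lt_div (by linarith)]; exact hrn)
  refine ⟨C, η, hC, hη0, fun k x φ => ?_⟩
  have hms : IsSchwartz fun ξ => m ((2 : ℝ) ^ (-k) • ξ) :=
    hm.isSchwartz.comp_smul (zpow_ne_zero _ two_ne_zero)
  have h1 := h k p hp1 x (Lp.memLp x).1
  rw [← Lp.enorm_def] at h1
  have hcongr := coeFn_convLp hms x
  have hmeas := (Lp.memLp (convLp (fun ξ => m ((2 : ℝ) ^ (-k) • ξ)) x)).1
  rcases le_total k 0 with hk | hk
  · refine (eLpNorm_testMeasure_le hmeas φ).trans ?_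
    rw [eLpNorm_congr_ae hcongr]
    have h2 : eLpNorm (cv (𝓕⁻ fun ξ => m ((2 : ℝ) ^ (-k) • ξ)) x) ⊤ volume ≤
        ENNReal.ofReal C * dyadicWeight (n / p) k * ‖x‖ₑ :=
      eLpNormEssSup_le_of_ae_enorm_bound (Eventually.of_forall h1.2)
    rw [mul_right_comm]
    gcongr
    refine h2.trans ?_
    rw [dyadicWeight, ← ENNReal.ofReal_mul hC.le]
    gcongr
    · exact one_le_two
    · have hk' : (k : ℝ) ≤ 0 := by exact_mod_cast hk
      rw [abs_of_nonpos hk']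
      have : η ≤ 1 := min_le_left _ _
      nlinarith
  · refine (eLpNorm_testMeasure_le' hmeas hr2 φ).trans ?_
    rw [eLpNorm_congr_ae hcongr, mul_right_comm]
    gcongr
    refine (h1.1 r hrp).trans ?_
    rw [dyadicWeight, ← ENNReal.ofReal_mul hC.le]
    gcongr
    · exact one_le_two
    · have hk' : (0 : ℝ) ≤ k := by exact_mod_cast hk
      rw [abs_of_nonneg hk']
      have : η ≤ n / r - 1 := min_le_right _ _
      nlinarith

end Tame

/-! ### Realization of sequences of blocks and their products -/

section Realization

variable {p : ℝ} [hp : Fact (1 ≤ ENNReal.ofReal p)]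

theorem emb_real_smul (r : ℝ) (x : LpC n p) : emb (r • x) = (r : ℂ) • emb x := by
  rw [← map_smul]
  congr 1

theorem exists_dist_of_bound (L : 𝓢(Space n, ℂ) →ₗ[ℂ] ℂ) {K : ℝ}
    (h : ∀ φ, ‖L φ‖ ≤ K * testNorm φ) : ∃ T : TDist n, ∀ φ, T φ = L φ := by
  have hL : Continuous L := by
    refine continuous_of_continuousAt_zero L ?_
    rw [ContinuousAt, map_zero]
    refine squeeze_zero_norm h ?_
    have := (continuous_testNorm (n := n)).tendsto 0
    rw [testNorm_zero] at this
    simpa using this.const_mul K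
  exact ⟨ContinuousLinearMap.toPointwiseConvergenceCLM ℂ (RingHom.id ℂ) _ _ ⟨L, hL⟩, fun φ => rfl⟩

/-- A sequence of functions whose sum converges absolutely in `L²(|φ| dx)` for all test
functions `φ`. -/
def Tame (z : ℤ → LpC n p) : Prop :=
  ∃ c : ℤ → ℝ, (∀ k, 0 ≤ c k) ∧ Summable c ∧ ∀ k φ, eLpNorm (z k) 2 (testMeasure φ) ≤
    ENNReal.ofReal (c k) * ENNReal.ofReal (testNorm φ) ^ (1 / 2 : ℝ)

theorem testNorm_half_mul (φ : 𝓢(Space n, ℂ)) :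
    ENNReal.ofReal (testNorm φ) ^ (1 / 2 : ℝ) * ENNReal.ofReal (testNorm φ) ^ (1 / 2 : ℝ) =
      ENNReal.ofReal (testNorm φ) := by
  rw [← ENNReal.rpow_add_of_nonneg _ _ (by norm_num) (by norm_num)]
  norm_num

theorem integral_norm_le_of_lintegral {f : Space n → ℂ} {K : ℝ} (hK : 0 ≤ K)
    (hf : AEStronglyMeasurable f) (h : ∫⁻ x, ‖f x‖ₑ ≤ ENNReal.ofReal K) :
    Integrable f ∧ ∫ x, ‖f x‖ ≤ K := by
  refine ⟨⟨hf, h.trans_lt ENNReal.ofReal_lt_top⟩, ?_⟩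
  rw [integral_norm_eq_lintegral_enorm hf]
  exact ENNReal.toReal_le_of_le_ofReal hK h

theorem integrable_tsum_of_summable_integral_norm {ι : Type*} [Countable ι]
    {F : ι → Space n → ℂ} (hF : ∀ i, Integrable (F i)) (hs : Summable fun i => ∫ x, ‖F i x‖) :
    Integrable fun x => ∑' i, F i x := by
  have h1 : ∫⁻ x, ∑' i, ‖F i x‖ₑ ≠ ⊤ := by
    rw [lintegral_tsum fun i => (hF i).1.enorm]
    simp only [← ofReal_integral_norm_eq_lintegral_enorm (hF _)]
    exact hs.tsum_ofReal_ne_top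
  have h2 : ∀ᵐ x, Summable fun i => F i x := by
    filter_upwards [ae_lt_top' (AEMeasurable.tsum fun i => (hF i).1.enorm) h1] with x hx
    have := ENNReal.summable_toReal hx.ne
    simp only [toReal_enorm] at this
    exact this.of_norm
  refine ⟨?_, ?_⟩
  · refine aestronglyMeasurable_of_tendsto_ae (u := (atTop : Filter (Finset ι)))
      (f := fun s x => ∑ i ∈ s, F i x) ?_ ?_
    · exact fun s => Finset.aestronglyMeasurable_fun_sum _ fun i _ => (hF i).1
    · filter_upwards [h2] with x hx using hx.hasSum
  · refine lt_of_le_of_lt (lintegral_mono fun x => ?_) h1.lt_top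
    exact enorm_tsum_le_tsum_enorm

theorem exists_tame (hn : 3 ≤ n) (hpn : p < n) {m : Space n → ℂ} (hm : IsAnnular m) :
    ∃ c : ℤ → ℝ, (∀ k, 0 ≤ c k) ∧ Summable c ∧ ∀ (k : ℤ) (x : LpC n p) (φ : 𝓢(Space n, ℂ)),
      eLpNorm (((2 : ℝ) ^ (-((n / p - 1) * (k : ℝ)))) • convLp (fun ξ => m ((2 : ℝ) ^ (-k) • ξ)) x :
        LpC n p) 2 (testMeasure φ) ≤
      ENNReal.ofReal (c k) * ENNReal.ofReal (testNorm φ) ^ (1 / 2 : ℝ) * ‖x‖ₑ := by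
  obtain ⟨C, η, hC, hη, h⟩ := hm.exists_tame (p := p) hn hpn
  refine ⟨fun k => C * (2 : ℝ) ^ (-η * |(k : ℝ)|), fun k => by positivity,
    (summable_two_rpow_neg_abs hη).mul_left C, fun k x φ => ?_⟩
  set r : ℝ := (2 : ℝ) ^ (-((n / p - 1) * (k : ℝ)))
  set y := convLp (fun ξ => m ((2 : ℝ) ^ (-k) • ξ)) x
  have e : (r • y : LpC n p) =ᵐ[testMeasure φ] r • (y : Space n → ℂ) :=
    (testMeasure_absolutelyContinuous φ).ae_le (Lp.coeFn_smul r y)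
  rw [eLpNorm_congr_ae e]
  refine (eLpNorm_const_smul_le (c := r)).trans ?_
  rw [← ofReal_norm, Real.norm_of_nonneg (by positivity)]
  refine (mul_le_mul_right (h k x φ) _).trans_eq ?_
  rw [← mul_assoc, ← mul_assoc, ← ENNReal.ofReal_mul (by positivity)]
  congr 3
  rw [Real.rpow_add two_pos]
  have : r * 2 ^ ((n / p - 1) * (k : ℝ)) = 1 := by
    rw [← Real.rpow_add two_pos]; simp
  linear_combination C * 2 ^ (-η * |(k : ℝ)|) * this

theorem tame_of_annular (hn : 3 ≤ n) (hpn : p < n) {m : Space n → ℂ} (hm : IsAnnular m)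
    {x : ℤ → LpC n p} {B : ℝ} (hx : ∀ k, ‖x k‖ ≤ B) :
    Tame fun k => ((2 : ℝ) ^ (-((n / p - 1) * (k : ℝ)))) •
      convLp (fun ξ => m ((2 : ℝ) ^ (-k) • ξ)) (x k) := by
  obtain ⟨c, hc, hcs, h⟩ := exists_tame (p := p) hn hpn hm
  have hB : 0 ≤ B := (norm_nonneg _).trans (hx 0)
  refine ⟨fun k => c k * B, fun k => mul_nonneg (hc k) hB, hcs.mul_right B, fun k φ => ?_⟩
  refine (h k (x k) φ).trans ?_
  rw [ENNReal.ofReal_mul (hc k), mul_right_comm]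
  gcongr
  rw [← ofReal_norm]
  exact ENNReal.ofReal_le_ofReal (hx k)

namespace Tame

variable {z z' : ℤ → LpC n p}

theorem exists_bound {r : ℝ} {z : ℤ → LpC n r} (hz : Tame z) :
    ∃ c : ℤ → ℝ, Summable c ∧ ∀ k φ, Integrable (fun x => z k x * φ x) ∧ ∫ x, ‖z k x * φ x‖ ≤ c k * testNorm φ := by
  obtain ⟨c, hc, hcs, h⟩ := hz
  refine ⟨c, hcs, fun k φ => ?_⟩
  refine integral_norm_le_of_lintegral (mul_nonneg (hc k) (testNorm_nonneg φ))
    ((Lp.memLp (z k)).1.mul φ.continuous.aestronglyMeasurable) ?_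
  simp only [enorm_mul]
  refine (lintegral_mul_test_le (Lp.memLp (z k)).1 φ).trans ((mul_le_mul_left (h k φ) _).trans_eq ?_)
  rw [mul_assoc, testNorm_half_mul, ENNReal.ofReal_mul (hc k)]

theorem exists_bound_mul {r : ℝ} {z z' : ℤ → LpC n r} (hz : Tame z) (hz' : Tame z') :
    ∃ c c' : ℤ → ℝ, Summable c ∧ Summable c' ∧
    (∀ k, 0 ≤ c k) ∧ (∀ k, 0 ≤ c' k) ∧ ∀ k l φ, Integrable (fun x => z k x * z' l x * φ x) ∧
      ∫ x, ‖z k x * z' l x * φ x‖ ≤ c k * c' l * testNorm φ := by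
  obtain ⟨c, hc, hcs, h⟩ := hz
  obtain ⟨c', hc', hcs', h'⟩ := hz'
  refine ⟨c, c', hcs, hcs', hc, hc', fun k l φ => ?_⟩
  refine integral_norm_le_of_lintegral
    (mul_nonneg (mul_nonneg (hc k) (hc' l)) (testNorm_nonneg φ))
    (((Lp.memLp (z k)).1.mul (Lp.memLp (z' l)).1).mul φ.continuous.aestronglyMeasurable) ?_
  simp only [enorm_mul]
  refine (lintegral_mul_mul_test_le (Lp.memLp (z k)).1 (Lp.memLp (z' l)).1 φ).trans
    ((mul_le_mul' (h k φ) (h' l φ)).trans_eq ?_)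
  rw [ENNReal.ofReal_mul (mul_nonneg (hc k) (hc' l)), ENNReal.ofReal_mul (hc k), mul_mul_mul_comm,
    testNorm_half_mul]

/-- Testing with a Gaussian gives almost everywhere summability after multiplication by it, and it
has no zeros. -/
theorem ae_summable {r : ℝ} {z : ℤ → LpC n r} (hz : Tame z) : ∀ᵐ x, Summable fun k => ‖z k x‖ := by
  obtain ⟨c, hcs, h⟩ := hz.exists_bound
  set γ := gaussian (n := n) one_pos
  have hγ : ∀ x, γ x ≠ 0 := fun x => by
    rw [gaussian_apply]; exact_mod_cast (Real.exp_pos _).ne'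
  have hm : ∀ k, AEMeasurable (fun x => ‖z k x * γ x‖ₑ) := fun k => (h k γ).1.1.enorm
  have h1 : ∫⁻ x, ∑' k, ‖z k x * γ x‖ₑ ≠ ⊤ := by
    rw [lintegral_tsum hm]
    have : Summable fun k => ∫ x, ‖z k x * γ x‖ :=
      Summable.of_nonneg_of_le (fun k => integral_nonneg fun x => norm_nonneg _)
        (fun k => (h k γ).2) (hcs.mul_right _)
    have e : ∀ k, ∫⁻ x, ‖z k x * γ x‖ₑ = ENNReal.ofReal (∫ x, ‖z k x * γ x‖) := fun k => by
      rw [ofReal_integral_norm_eq_lintegral_enorm (h k γ).1]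
    simp only [e]
    exact this.tsum_ofReal_ne_top
  filter_upwards [ae_lt_top' (AEMeasurable.tsum hm) h1] with x hx
  have h2 : Summable fun k => ‖z k x * γ x‖ := by
    have := ENNReal.summable_toReal hx.ne
    simpa using this
  have h3 := h2.mul_right ‖γ x‖⁻¹
  refine h3.congr fun k => ?_
  rw [norm_mul, mul_inv_cancel_right₀ (norm_ne_zero_iff.2 (hγ x))]

/-- Absolute convergence in L²(|φ| dx) makes the pointwise sum and the sum in 𝓢' agree. The series
converges without subtracting polynomials, so the class has a canonical representative that is a
function. -/
theorem exists_realization (hz : Tame z) : ∃ (T : TDist n) (g : Space n → ℂ), IsRep T g ∧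
    (∀ᵐ x, HasSum (fun k => z k x) (g x)) ∧ ∀ φ, HasSum (fun k => emb (z k) φ) (T φ) := by
  obtain ⟨c, hcs, h⟩ := hz.exists_bound
  have hnn : ∀ k, ∀ φ : 𝓢(Space n, ℂ), ‖emb (z k) φ‖ ≤ c k * testNorm φ := fun k φ => by
    rw [(isRep_emb (z k) φ).2]
    exact (norm_integral_le_integral_norm _).trans (h k φ).2
  obtain ⟨T, hT⟩ := exists_hasSum_dist (fun k => emb (z k)) hcs hnn
  have hae := hz.ae_summable
  have hm : AEStronglyMeasurable (fun x => ∑' k, z k x) := by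
    have h1 : ∀ᵐ x, Tendsto (fun N : ℕ => ∑ k ∈ Finset.Icc (-(N : ℤ)) N, z k x) atTop
        (𝓝 (∑' k, z k x)) := by
      filter_upwards [hae] with x hx
      refine hx.of_norm.hasSum.comp (Filter.tendsto_atTop_finset_of_monotone ?_ ?_)
      · intro a b hab
        exact Finset.Icc_subset_Icc (by omega) (by omega)
      · intro k
        exact ⟨k.natAbs, by rw [Finset.mem_Icc]; omega⟩
    refine aestronglyMeasurable_of_tendsto_ae _ (fun N => ?_) h1
    exact Finset.aestronglyMeasurable_fun_sum _ fun k _ => (Lp.memLp (z k)).1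
  refine ⟨T, fun x => ∑' k, z k x, fun φ => ?_, ?_, hT⟩
  · have hs : Summable fun k => ∫ x, ‖z k x * φ x‖ :=
      Summable.of_nonneg_of_le (fun k => integral_nonneg fun x => norm_nonneg _)
        (fun k => (h k φ).2) (hcs.mul_right _)
    have h1 := hasSum_integral_of_summable_integral_norm (fun k => (h k φ).1) hs
    simp only [tsum_mul_right] at h1
    refine ⟨?_, ?_⟩
    · have := integrable_tsum_of_summable_integral_norm (fun k => (h k φ).1) hs
      simpa only [tsum_mul_right] using this
    · refine (hT φ).unique ?_
      simp only [(isRep_emb (z _) φ).2]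
      exact h1
  · filter_upwards [hae] with x hx
    exact hx.of_norm.hasSum

/-- By Cauchy–Schwarz in L²(|φ| dx) the double series of products converges absolutely, so the
pointwise product of the two sums is a distribution and may be expanded in any order. -/
theorem exists_product (hz : Tame z) (hz' : Tame z') {g g' : Space n → ℂ}
    (hg : ∀ᵐ x, HasSum (fun k => z k x) (g x)) (hg' : ∀ᵐ x, HasSum (fun k => z' k x) (g' x)) :
    ∃ W : TDist n, ∀ φ, W φ = ∫ x, g x * g' x * φ x ∧
      (∀ k l, Integrable (fun x => z k x * z' l x * φ x)) ∧
      HasSum (fun kl : ℤ × ℤ => ∫ x, z kl.1 x * z' kl.2 x * φ x) (W φ) := by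
  obtain ⟨c, c', hcs, hcs', hc, hc', h⟩ := hz.exists_bound_mul hz'
  have hcc : Summable fun kl : ℤ × ℤ => c kl.1 * c' kl.2 :=
    hcs.mul_of_nonneg hcs' hc hc'
  have hs : ∀ φ : 𝓢(Space n, ℂ), Summable fun kl : ℤ × ℤ => ∫ x, ‖z kl.1 x * z' kl.2 x * φ x‖ := fun φ =>
    Summable.of_nonneg_of_le (fun k => integral_nonneg fun x => norm_nonneg _)
      (fun kl => (h kl.1 kl.2 φ).2) (hcc.mul_right _)
  have hae : ∀ φ : 𝓢(Space n, ℂ), ∀ᵐ x, ∑' kl : ℤ × ℤ, z kl.1 x * z' kl.2 x * φ x =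
      g x * g' x * φ x := by
    intro φ
    filter_upwards [hz.ae_summable, hz'.ae_summable, hg, hg'] with x h1 h2 h3 h4
    rw [tsum_mul_right, ← tsum_mul_tsum_of_summable_norm h1 h2, h3.tsum_eq, h4.tsum_eq]
  have hInt : ∀ φ : 𝓢(Space n, ℂ), Integrable fun x => g x * g' x * φ x := fun φ =>
    (integrable_tsum_of_summable_integral_norm (fun kl : ℤ × ℤ => (h kl.1 kl.2 φ).1) (hs φ)).congr (hae φ)
  have hsum : ∀ φ : 𝓢(Space n, ℂ), HasSum (fun kl : ℤ × ℤ => ∫ x, z kl.1 x * z' kl.2 x * φ x)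
      (∫ x, g x * g' x * φ x) := by
    intro φ
    have h1 := hasSum_integral_of_summable_integral_norm
      (fun kl : ℤ × ℤ => (h kl.1 kl.2 φ).1) (hs φ)
    rwa [integral_congr_ae (hae φ)] at h1
  let L : 𝓢(Space n, ℂ) →ₗ[ℂ] ℂ :=
    { toFun := fun φ => ∫ x, g x * g' x * φ x
      map_add' := fun φ φ' => by
        rw [← integral_add (hInt φ) (hInt φ')]
        simp [mul_add]
      map_smul' := fun a φ => by
        simp only [RingHom.id_apply, smul_eq_mul]
        rw [← integral_const_mul]
        congr 1
        ext x
        simp only [smul_apply, smul_eq_mul]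
        ring }
  obtain ⟨W, hW⟩ := exists_dist_of_bound L (K := ∑' kl : ℤ × ℤ, c kl.1 * c' kl.2) fun φ => by
    change ‖∫ x, g x * g' x * φ x‖ ≤ _
    rw [← (hsum φ).tsum_eq]
    refine tsum_of_norm_bounded (hcc.hasSum.mul_right _) fun kl => ?_
    exact (norm_integral_le_integral_norm _).trans (h kl.1 kl.2 φ).2
  exact ⟨W, fun φ => ⟨hW φ, fun k l => (h k l φ).1, by rw [hW φ]; exact hsum φ⟩⟩

end Tame

/-- Square partial sums are cofinal among finite subsets of ℤ × ℤ, so for an absolutely convergent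
double series their limit is the unconditional sum. Both directions are needed: one produces the
product for the constructed solution, the other identifies the product in an arbitrary solution. -/
theorem isProduct_iff {ψ : Space n → ℝ} {S T W : TDist n} {z z' : ℤ → LpC n p}
    (hS : ∀ j, block ψ j S = emb (z j)) (hT : ∀ j, block ψ j T = emb (z' j))
    (hi : ∀ k l (φ : 𝓢(Space n, ℂ)), Integrable (fun x => z k x * z' l x * φ x))
    (hs : ∀ φ : 𝓢(Space n, ℂ), Summable fun kl : ℤ × ℤ => ∫ x, z kl.1 x * z' kl.2 x * φ x) :
    IsProduct ψ S T W ↔ ∀ φ : 𝓢(Space n, ℂ),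
      HasSum (fun kl : ℤ × ℤ => ∫ x, z kl.1 x * z' kl.2 x * φ x) (W φ) := by
  set J : ℕ → Finset ℤ := fun N => Finset.Icc (-(N : ℤ)) N
  have hJ : Tendsto (fun N => J N ×ˢ J N) atTop atTop := by
    refine Filter.tendsto_atTop_finset_of_monotone ?_ ?_
    · intro a b hab
      have : J a ⊆ J b := Finset.Icc_subset_Icc (by omega) (by omega)
      exact Finset.product_subset_product this this
    · rintro ⟨k, l⟩
      refine ⟨max k.natAbs l.natAbs, ?_⟩
      simp only [J, Finset.mem_product, Finset.mem_Icc]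
      omega
  have rS : ∀ N, IsRep (partialSum ψ N S) (∑ j ∈ J N, (z j : Space n → ℂ)) := fun N => by
    rw [partialSum]
    refine IsRep.sum fun j _ => ?_
    rw [hS]; exact isRep_emb _
  have rT : ∀ N, IsRep (partialSum ψ N T) (∑ j ∈ J N, (z' j : Space n → ℂ)) := fun N => by
    rw [partialSum]
    refine IsRep.sum fun j _ => ?_
    rw [hT]; exact isRep_emb _
  have e : ∀ N (φ : 𝓢(Space n, ℂ)), (fun x => (∑ j ∈ J N, (z j : Space n → ℂ)) x *
      (∑ j ∈ J N, (z' j : Space n → ℂ)) x * φ x) =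
      fun x => ∑ kl ∈ J N ×ˢ J N, z kl.1 x * z' kl.2 x * φ x := by
    intro N φ
    ext x
    rw [Finset.sum_apply, Finset.sum_apply, Finset.sum_mul_sum, ← Finset.sum_product',
      Finset.sum_mul]
  have ei : ∀ N (φ : 𝓢(Space n, ℂ)), ∫ x, (∑ j ∈ J N, (z j : Space n → ℂ)) x *
      (∑ j ∈ J N, (z' j : Space n → ℂ)) x * φ x =
      ∑ kl ∈ J N ×ˢ J N, ∫ x, z kl.1 x * z' kl.2 x * φ x := by
    intro N φ
    rw [e, integral_finsetSum _ fun kl _ => hi kl.1 kl.2 φ]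
  constructor
  · rintro ⟨g, h, hg, hh, hlim⟩ φ
    have h1 := (hlim φ).2
    have h2 : Tendsto (fun N => ∫ x, g N x * h N x * φ x) atTop
        (𝓝 (∑' kl : ℤ × ℤ, ∫ x, z kl.1 x * z' kl.2 x * φ x)) := by
      have := (hs φ).hasSum.comp hJ
      refine this.congr fun N => ?_
      simp only [Function.comp_apply]
      rw [← ei]
      refine integral_congr_ae ?_
      filter_upwards [(rS N).ae_eq (hg N), (rT N).ae_eq (hh N)] with x h3 h4
      rw [h3, h4]
    rw [tendsto_nhds_unique h1 h2]
    exact (hs φ).hasSum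
  · intro h
    refine ⟨_, _, rS, rT, fun φ => ⟨fun N => ?_, ?_⟩⟩
    · rw [e]
      exact integrable_finsetSum _ fun kl _ => hi kl.1 kl.2 φ
    · simp only [ei]
      exact (h φ).comp hJ

end Realization

/-! ### Polynomials as tempered distributions -/

section Polynomial

theorem FM_apply (m : Space n → ℂ) (T : TDist n) (φ : 𝓢(Space n, ℂ)) :
    FM m T φ = T (𝓕 (SchwartzMap.smulLeftCLM ℂ m (𝓕⁻ φ))) :=
  TemperedDistribution.fourierMultiplierCLM_apply_apply _ _ _

theorem hasTemperateGrowth_inner_single (i : Fin n) :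
    (fun ξ : Space n => inner ℝ ξ (EuclideanSpace.single i (1 : ℝ))).HasTemperateGrowth := by
  fun_prop

theorem exists_poly_mul (P : MvPolynomial (Fin n) ℂ) (φ : 𝓢(Space n, ℂ)) :
    ∃ Φ : 𝓢(Space n, ℂ), ∀ x, Φ x = MvPolynomial.eval (fun i => ((x i : ℝ) : ℂ)) P * φ x := by
  induction P using MvPolynomial.induction_on generalizing φ with
  | C a => exact ⟨a • φ, fun x => by simp⟩
  | add P Q hP hQ =>
    obtain ⟨Φ, h⟩ := hP φ
    obtain ⟨Ψ, h'⟩ := hQ φ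
    exact ⟨Φ + Ψ, fun x => by simp [h, h', add_mul]⟩
  | mul_X P i hP =>
    obtain ⟨Φ, h⟩ := hP (SchwartzMap.smulLeftCLM ℂ
      (fun ξ : Space n => inner ℝ ξ (EuclideanSpace.single i (1 : ℝ))) φ)
    refine ⟨Φ, fun x => ?_⟩
    rw [h, SchwartzMap.smulLeftCLM_apply_apply (hasTemperateGrowth_inner_single i)]
    simp [EuclideanSpace.inner_single_right, mul_assoc]

theorem integrable_poly_mul (P : MvPolynomial (Fin n) ℂ) (φ : 𝓢(Space n, ℂ)) :
    Integrable fun x => MvPolynomial.eval (fun i => ((x i : ℝ) : ℂ)) P * φ x := by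
  obtain ⟨Φ, h⟩ := exists_poly_mul P φ
  exact Φ.integrable.congr (ae_of_all _ h)

theorem polyPairing_add (P Q : MvPolynomial (Fin n) ℂ) (φ : 𝓢(Space n, ℂ)) :
    polyPairing (P + Q) φ = polyPairing P φ + polyPairing Q φ := by
  rw [polyPairing, polyPairing, polyPairing,
    ← integral_add (integrable_poly_mul P φ) (integrable_poly_mul Q φ)]
  simp [add_mul]

theorem polyPairing_smul (c : ℂ) (P : MvPolynomial (Fin n) ℂ) (φ : 𝓢(Space n, ℂ)) :
    polyPairing (c • P) φ = c * polyPairing P φ := by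
  rw [polyPairing, polyPairing, ← integral_const_mul]
  simp [mul_assoc]

theorem polyPairing_sum {ι : Type*} (s : Finset ι) (P : ι → MvPolynomial (Fin n) ℂ)
    (φ : 𝓢(Space n, ℂ)) : polyPairing (∑ i ∈ s, P i) φ = ∑ i ∈ s, polyPairing (P i) φ := by
  classical
  induction s using Finset.induction_on with
  | empty => simp [polyPairing]
  | insert i s hi ih => rw [Finset.sum_insert hi, Finset.sum_insert hi, polyPairing_add, ih]

theorem fourierInv_apply_zero (φ : 𝓢(Space n, ℂ)) : (𝓕⁻ φ) 0 = ∫ x, φ x := by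
  rw [SchwartzMap.fourierInv_coe, Real.fourierInv_eq]
  simp

/-- The Fourier transform of a polynomial is supported at the origin. By induction on the
polynomial, multiplication by a coordinate moves onto g as a derivative, which still vanishes near
0. -/
theorem polyPairing_fourier_eq_zero (P : MvPolynomial (Fin n) ℂ) {g : 𝓢(Space n, ℂ)}
    (hg : ∀ᶠ ξ in 𝓝 0, g ξ = 0) : polyPairing P (𝓕 g) = 0 := by
  induction P using MvPolynomial.induction_on generalizing g with
  | C a =>
    rw [polyPairing]
    simp only [MvPolynomial.eval_C]
    rw [integral_const_mul, ← fourierInv_apply_zero, FourierTransform.fourierInv_fourier_eq,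
      hg.self_of_nhds, mul_zero]
  | add P Q hP hQ => rw [polyPairing_add, hP hg, hQ hg, add_zero]
  | mul_X P i hP =>
    have h1 : ∀ᶠ ξ in 𝓝 0, (∂_{(EuclideanSpace.single i (1 : ℝ) : Space n)} g) ξ = 0 := by
      filter_upwards [hg.eventually_nhds] with ξ hξ
      rw [SchwartzMap.lineDerivOp_apply_eq_fderiv]
      have : (g : Space n → ℂ) =ᶠ[𝓝 ξ] fun _ => 0 := hξ
      rw [this.fderiv_eq]
      simp
    have h2 := hP h1
    rw [SchwartzMap.fourier_lineDerivOp_eq] at h2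
    have hc : (2 * Real.pi * Complex.I : ℂ) ≠ 0 := by simp [Real.pi_ne_zero]
    have h3 : (2 * Real.pi * Complex.I : ℂ) * polyPairing (P * MvPolynomial.X i) (𝓕 g) = 0 := by
      rw [← h2, polyPairing, polyPairing, ← integral_const_mul]
      congr 1
      ext x
      rw [smul_apply, SchwartzMap.smulLeftCLM_apply_apply (hasTemperateGrowth_inner_single i)]
      simp [EuclideanSpace.inner_single_right]
      ring
    exact (mul_eq_zero.1 h3).resolve_left hc

theorem IsAnnular.eventually_eq_zero {m : Space n → ℂ} (hm : IsAnnular m) :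
    ∀ᶠ ξ in 𝓝 0, m ξ = 0 := by
  obtain ⟨-, a, b, ha, h⟩ := hm
  filter_upwards [Metric.ball_mem_nhds (0 : Space n) ha] with ξ hξ
  by_contra hne
  have := (h ξ hne).1
  rw [mem_ball_zero_iff] at hξ
  linarith

/-- An annular symbol vanishes near the origin and therefore annihilates polynomials; this makes
dyadic blocks well defined on 𝓢'/𝓟. -/
theorem EqModPoly.FM_eq {m : Space n → ℂ} (hm : IsAnnular m) {S T : TDist n} (h : EqModPoly S T) :
    FM m S = FM m T := by
  obtain ⟨P, hP⟩ := h
  have key : ∀ φ, FM m S φ = FM m T φ := fun φ => by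
    rw [FM_apply, FM_apply, ← sub_eq_zero, hP]
    refine polyPairing_fourier_eq_zero P ?_
    filter_upwards [hm.eventually_eq_zero] with ξ hξ
    rw [SchwartzMap.smulLeftCLM_apply_apply hm.isSchwartz.hasTemperateGrowth, hξ, zero_smul]
  ext φ
  exact key φ

theorem EqModPoly.refl (T : TDist n) : EqModPoly T T := ⟨0, fun φ => by simp [polyPairing]⟩

theorem EqModPoly.apply_eq {S T : TDist n} (h : EqModPoly S T) {φ : 𝓢(Space n, ℂ)}
    (hφ : MomentFree φ) : S φ = T φ := by
  obtain ⟨P, hP⟩ := h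
  rw [← sub_eq_zero, hP, hφ]

end Polynomial

/-! ### Distributions all of whose dyadic blocks vanish -/

section Vanishing

/-- Repeated mean value inequality from the origin: each vanishing derivative gains one power of
|ξ|. -/
theorem norm_iteratedFDeriv_le_of_flat (g : 𝓢(Space n, ℂ)) {M : ℕ}
    (hg : ∀ m ≤ M, iteratedFDeriv ℝ m g 0 = 0) (r : ℕ) : ∀ m, m + r = M + 1 →
    ∃ K : ℝ, 0 ≤ K ∧ ∀ ξ, ‖iteratedFDeriv ℝ m g ξ‖ ≤ K * ‖ξ‖ ^ r := by
  induction r with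
  | zero =>
    refine fun m _ => ⟨SchwartzMap.seminorm ℝ 0 m g, apply_nonneg _ _, fun ξ => ?_⟩
    simpa using SchwartzMap.le_seminorm ℝ 0 m g ξ
  | succ r ih =>
    intro m hm
    obtain ⟨K, hK, h⟩ := ih (m + 1) (by omega)
    refine ⟨K, hK, fun ξ => ?_⟩
    have hd : ∀ x ∈ Metric.closedBall (0 : Space n) ‖ξ‖,
        DifferentiableAt ℝ (iteratedFDeriv ℝ m g) x := fun x _ =>
      ((g.smooth ⊤).differentiable_iteratedFDeriv (by exact_mod_cast ENat.natCast_lt_top m)) x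
    have hb : ∀ x ∈ Metric.closedBall (0 : Space n) ‖ξ‖,
        ‖fderiv ℝ (iteratedFDeriv ℝ m g) x‖ ≤ K * ‖ξ‖ ^ r := fun x hx => by
      rw [norm_fderiv_iteratedFDeriv]
      refine (h x).trans ?_
      gcongr
      exact mem_closedBall_zero_iff.1 hx
    have := (convex_closedBall (0 : Space n) ‖ξ‖).norm_image_sub_le_of_norm_fderiv_le hd hb
      (Metric.mem_closedBall_self (norm_nonneg ξ)) (mem_closedBall_zero_iff.2 le_rfl)
    rw [hg m (by omega), sub_zero, sub_zero] at this
    refine this.trans_eq ?_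
    ring

theorem norm_iteratedFDeriv_scaled_mul_le (κ g : 𝓢(Space n, ℂ)) (c : ℝ) (l : ℕ) (ξ : Space n) :
    ‖iteratedFDeriv ℝ l (fun ξ => κ (c • ξ) * g ξ) ξ‖ ≤ ∑ i ∈ Finset.range (l + 1),
      (l.choose i : ℝ) * (|c| ^ i * SchwartzMap.seminorm ℝ 0 i κ) *
        ‖iteratedFDeriv ℝ (l - i) g ξ‖ := by
  have h1 : ContDiff ℝ ∞ fun ξ => κ (c • ξ) := (κ.smooth ⊤).comp (contDiff_const_smul c)
  refine (norm_iteratedFDeriv_mul_le h1 (g.smooth ⊤) ξ (by exact_mod_cast le_top)).trans ?_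
  refine Finset.sum_le_sum fun i _ => ?_
  gcongr
  rw [iteratedFDeriv_comp_const_smul c (κ.smooth i)]
  simp only [norm_smul, norm_pow, Real.norm_eq_abs]
  gcongr
  simpa using SchwartzMap.le_seminorm ℝ 0 i κ (c • ξ)

/-- The function lives in |ξ| ≤ 2ε. Each derivative falling on the cutoff costs ε⁻¹, but leaves one
derivative less on g and so gains one order of vanishing. What remains is ε^{M+1-l} ≤ ε. -/
theorem seminorm_near_le (κ g : 𝓢(Space n, ℂ)) (hκ : ∀ ξ, 2 ≤ ‖ξ‖ → κ ξ = 0) {M : ℕ}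
    (hg : ∀ m ≤ M, iteratedFDeriv ℝ m g 0 = 0) (k : ℕ) {l : ℕ} (hl : l ≤ M) :
    ∃ C : ℝ, 0 ≤ C ∧ ∀ ε, 0 < ε → ε ≤ 1 → ∀ ξ,
      ‖ξ‖ ^ k * ‖iteratedFDeriv ℝ l (fun ξ => κ (ε⁻¹ • ξ) * g ξ) ξ‖ ≤ C * ε := by
  have hK : ∀ i, ∃ K : ℝ, 0 ≤ K ∧ (i ≤ l → ∀ ξ, ‖iteratedFDeriv ℝ (l - i) g ξ‖ ≤
      K * ‖ξ‖ ^ (M + 1 - l + i)) := fun i => by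
    by_cases hi : i ≤ l
    · obtain ⟨K, h1, h2⟩ := norm_iteratedFDeriv_le_of_flat g hg (M + 1 - l + i) (l - i) (by omega)
      exact ⟨K, h1, fun _ => h2⟩
    · exact ⟨0, le_rfl, fun h => absurd h hi⟩
  choose K hK0 hK using hK
  refine ⟨2 ^ k * ∑ i ∈ Finset.range (l + 1), (l.choose i : ℝ) *
    SchwartzMap.seminorm ℝ 0 i κ * (K i * 2 ^ (M + 1 - l + i)), ?_, fun ε hε hε1 ξ => ?_⟩
  · exact mul_nonneg (by positivity) (Finset.sum_nonneg fun i _ => mul_nonneg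
      (mul_nonneg (by positivity) (apply_nonneg _ _)) (mul_nonneg (hK0 i) (by positivity)))
  by_cases hξ : 2 * ε < ‖ξ‖
  · have : (fun ξ => κ (ε⁻¹ • ξ) * g ξ) =ᶠ[𝓝 ξ] fun _ => 0 := by
      filter_upwards [(continuous_norm.tendsto ξ).eventually (lt_mem_nhds hξ)] with y hy
      rw [hκ, zero_mul]
      rw [norm_smul, norm_inv, Real.norm_of_nonneg hε.le, ← div_eq_inv_mul, le_div_iff₀ hε]
      exact hy.le
    rw [(this.iteratedFDeriv ℝ l).eq_of_nhds]
    have h0 : iteratedFDeriv ℝ l (fun _ : Space n => (0 : ℂ)) ξ = 0 := by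
      simp
    rw [h0, norm_zero, mul_zero]
    exact mul_nonneg (mul_nonneg (by positivity) (Finset.sum_nonneg fun i _ => mul_nonneg
      (mul_nonneg (by positivity) (apply_nonneg _ _)) (mul_nonneg (hK0 i) (by positivity)))) hε.le
  · rw [not_lt] at hξ
    rw [mul_assoc (2 ^ k), Finset.sum_mul]
    refine mul_le_mul ?_ ((norm_iteratedFDeriv_scaled_mul_le κ g _ l ξ).trans ?_)
      (norm_nonneg _) (by positivity)
    · exact pow_le_pow_left₀ (norm_nonneg _) (by linarith) _
    · refine Finset.sum_le_sum fun i hi => ?_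
      rw [abs_of_pos (inv_pos.2 hε)]
      have hi' : i ≤ l := by simpa [Nat.lt_succ_iff] using hi
      have h1 : ‖iteratedFDeriv ℝ (l - i) g ξ‖ ≤ K i * (2 * ε) ^ (M + 1 - l + i) := by
        refine (hK i hi' ξ).trans ?_
        have := hK0 i
        gcongr
      have hs : 0 ≤ SchwartzMap.seminorm ℝ 0 i κ := apply_nonneg _ _
      calc (l.choose i : ℝ) * (ε⁻¹ ^ i * SchwartzMap.seminorm ℝ 0 i κ) *
            ‖iteratedFDeriv ℝ (l - i) g ξ‖
          ≤ (l.choose i : ℝ) * (ε⁻¹ ^ i * SchwartzMap.seminorm ℝ 0 i κ) *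
            (K i * (2 * ε) ^ (M + 1 - l + i)) := by gcongr
        _ = (l.choose i : ℝ) * SchwartzMap.seminorm ℝ 0 i κ * (K i * 2 ^ (M + 1 - l + i)) *
            ε ^ (M + 1 - l) := by
          rw [mul_pow, pow_add ε, inv_pow]
          field_simp
        _ ≤ _ := by
          have := hK0 i
          gcongr
          exact pow_le_of_le_one hε.le hε1 (by omega)

/-- The function lives in |ξ| ≥ 1/ε, where one additional power of |ξ| in the Schwartz seminorm is
worth a factor ε. -/
theorem seminorm_far_le (κ g : 𝓢(Space n, ℂ)) (hκ : ∀ ξ, ‖ξ‖ ≤ 1 → κ ξ = 1) (k l : ℕ) :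
    ∃ C : ℝ, 0 ≤ C ∧ ∀ ε, 0 < ε → ε ≤ 1 → ∀ ξ,
      ‖ξ‖ ^ k * ‖iteratedFDeriv ℝ l (fun ξ => g ξ - κ (ε • ξ) * g ξ) ξ‖ ≤ C * ε := by
  set D : ℝ := SchwartzMap.seminorm ℝ (k + 1) l g + ∑ i ∈ Finset.range (l + 1), (l.choose i : ℝ) *
    SchwartzMap.seminorm ℝ 0 i κ * SchwartzMap.seminorm ℝ (k + 1) (l - i) g
  have hD : 0 ≤ D := add_nonneg (apply_nonneg _ _) (Finset.sum_nonneg fun i _ => mul_nonneg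
      (mul_nonneg (by positivity) (apply_nonneg _ _)) (apply_nonneg _ _))
  refine ⟨D, hD, fun ε hε hε1 ξ => ?_⟩
  by_cases hξ : ‖ξ‖ < ε⁻¹
  · have : (fun ξ => g ξ - κ (ε • ξ) * g ξ) =ᶠ[𝓝 ξ] fun _ => 0 := by
      filter_upwards [(continuous_norm.tendsto ξ).eventually (gt_mem_nhds hξ)] with y hy
      rw [hκ, one_mul, sub_self]
      rw [norm_smul, Real.norm_of_nonneg hε.le]
      calc ε * ‖y‖ ≤ ε * ε⁻¹ := by gcongr
        _ = 1 := mul_inv_cancel₀ hε.ne'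
    rw [(this.iteratedFDeriv ℝ l).eq_of_nhds]
    have h0 : iteratedFDeriv ℝ l (fun _ : Space n => (0 : ℂ)) ξ = 0 := by
      simp
    rw [h0, norm_zero, mul_zero]
    positivity
  · rw [not_lt] at hξ
    have h1 : ContDiff ℝ l fun ξ => κ (ε • ξ) * g ξ :=
      ((κ.smooth l).comp (contDiff_const_smul ε)).mul (g.smooth l)
    have e : iteratedFDeriv ℝ l (fun ξ => g ξ - κ (ε • ξ) * g ξ) ξ =
        iteratedFDeriv ℝ l g ξ - iteratedFDeriv ℝ l (fun ξ => κ (ε • ξ) * g ξ) ξ :=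
      iteratedFDeriv_sub_apply (g.smooth l).contDiffAt h1.contDiffAt
    have h2 : ‖ξ‖ ^ k ≤ ε * ‖ξ‖ ^ (k + 1) := by
      have : 1 ≤ ε * ‖ξ‖ := by
        calc (1 : ℝ) = ε * ε⁻¹ := (mul_inv_cancel₀ hε.ne').symm
          _ ≤ _ := by gcongr
      calc ‖ξ‖ ^ k = 1 * ‖ξ‖ ^ k := (one_mul _).symm
        _ ≤ (ε * ‖ξ‖) * ‖ξ‖ ^ k := by gcongr
        _ = _ := by ring
    have h3 : ‖ξ‖ ^ (k + 1) * ‖iteratedFDeriv ℝ l (fun ξ => g ξ - κ (ε • ξ) * g ξ) ξ‖ ≤ D := by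
      rw [e]
      refine (mul_le_mul_of_nonneg_left (norm_sub_le _ _) (by positivity)).trans ?_
      rw [mul_add]
      refine add_le_add (SchwartzMap.le_seminorm ℝ _ _ g ξ) ?_
      refine (mul_le_mul_of_nonneg_left (norm_iteratedFDeriv_scaled_mul_le κ g ε l ξ)
        (by positivity)).trans ?_
      rw [Finset.mul_sum]
      refine Finset.sum_le_sum fun i _ => ?_
      have hs : 0 ≤ SchwartzMap.seminorm ℝ 0 i κ := apply_nonneg _ _
      have h5 : |ε| ^ i ≤ 1 := pow_le_one₀ (abs_nonneg _) (by rwa [abs_of_pos hε])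
      calc ‖ξ‖ ^ (k + 1) * ((l.choose i : ℝ) * (|ε| ^ i * SchwartzMap.seminorm ℝ 0 i κ) *
            ‖iteratedFDeriv ℝ (l - i) g ξ‖)
          ≤ ‖ξ‖ ^ (k + 1) * ((l.choose i : ℝ) * (1 * SchwartzMap.seminorm ℝ 0 i κ) *
            ‖iteratedFDeriv ℝ (l - i) g ξ‖) := by gcongr
        _ = (l.choose i : ℝ) * SchwartzMap.seminorm ℝ 0 i κ *
            (‖ξ‖ ^ (k + 1) * ‖iteratedFDeriv ℝ (l - i) g ξ‖) := by ring
        _ ≤ _ := by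
          gcongr
          exact SchwartzMap.le_seminorm ℝ _ _ g ξ
    calc _ ≤ (ε * ‖ξ‖ ^ (k + 1)) * ‖iteratedFDeriv ℝ l (fun ξ => g ξ - κ (ε • ξ) * g ξ) ξ‖ := by
          gcongr
      _ = ε * (‖ξ‖ ^ (k + 1) * ‖iteratedFDeriv ℝ l (fun ξ => g ξ - κ (ε • ξ) * g ξ) ξ‖) := by ring
      _ ≤ ε * D := by gcongr
      _ = D * ε := mul_comm _ _

theorem IsLittlewoodPaley.sum_lpSym_eq_one {ψ : Space n → ℝ} (h : IsLittlewoodPaley ψ)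
    {s : Finset ℤ} {ξ : Space n} (hξ : ξ ≠ 0) (hs : ∀ j, lpSym ψ j ξ ≠ 0 → j ∈ s) :
    ∑ j ∈ s, lpSym ψ j ξ = 1 := by
  have h1 : HasSum (fun j => lpSym ψ j ξ) 1 := by
    have := Complex.hasSum_ofReal.2 (h.hasSum ξ hξ)
    simpa [lpSym] using this
  refine (hasSum_sum_of_ne_finset_zero fun j hj => ?_).unique h1
  by_contra hne
  exact hj (hs j hne)

theorem IsAnnular.exists_partition {ψ : Space n → ℝ} (h : IsLittlewoodPaley ψ)
    {m : Space n → ℂ} (hm : IsAnnular m) : ∃ s : Finset ℤ, m * ∑ j ∈ s, lpSym ψ j = m := by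
  obtain ⟨-, a, b, ha, hab⟩ := hm
  obtain ⟨N, hN⟩ := pow_unbounded_of_one_lt (max b a⁻¹) (one_lt_two (α := ℝ))
  have hb : b < 2 ^ N := (le_max_left _ _).trans_lt hN
  have ha' : (2 ^ N : ℝ)⁻¹ < a := inv_lt_of_inv_lt₀ ha ((le_max_right _ _).trans_lt hN)
  refine ⟨Finset.Icc (-(N : ℤ) - 1) (N + 1), ?_⟩
  ext ξ
  rw [Pi.mul_apply]
  by_cases hξ : m ξ = 0
  · rw [hξ, zero_mul]
  have h1 := hab ξ hξ
  have hξ0 : ξ ≠ 0 := by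
    rintro rfl
    rw [norm_zero] at h1
    linarith [h1.1]
  rw [Finset.sum_apply, h.sum_lpSym_eq_one hξ0, mul_one]
  intro j hj
  have h2 := h.bounds_of_ne_zero hj
  have h3 : (2 : ℝ) ^ (j - 1) < 2 ^ (N : ℤ) := by
    rw [zpow_natCast]; linarith
  have h4 : (2 : ℝ) ^ (-(N : ℤ)) < 2 ^ (j + 1) := by
    rw [zpow_neg, zpow_natCast]; linarith
  rw [zpow_lt_zpow_iff_right₀ one_lt_two] at h3 h4
  rw [Finset.mem_Icc]
  omega

/-- An annulus meets only finitely many dyadic shells, so an annular multiplier factors through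
finitely many blocks. -/
theorem FM_eq_zero_of_blocks {ψ : Space n → ℝ} (h : IsLittlewoodPaley ψ) {m : Space n → ℂ}
    (hm : IsAnnular m) {T : TDist n} (hT : ∀ j, block ψ j T = 0) : FM m T = 0 := by
  obtain ⟨s, hs⟩ := hm.exists_partition h
  have hg : ∀ j ∈ s, (lpSym ψ j).HasTemperateGrowth := fun j _ => (h.isSchwartz j).hasTemperateGrowth
  rw [← hs, ← FM_FM hm.isSchwartz.hasTemperateGrowth
    (IsAnnular.sum fun j _ => h.isAnnular j).isSchwartz.hasTemperateGrowth, FM_sum hg]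
  rw [Finset.sum_eq_zero fun j _ => (block_eq_FM ψ j T).symm.trans (hT j)]
  exact map_zero _

theorem exists_cutoff (n : ℕ) : ∃ κ : 𝓢(Space n, ℂ), (∀ ξ, ‖ξ‖ ≤ 1 → κ ξ = 1) ∧
    ∀ ξ, 2 ≤ ‖ξ‖ → κ ξ = 0 := by
  let χ : ContDiffBump (0 : Space n) := ⟨1, 2, one_pos, one_lt_two⟩
  obtain ⟨κ, hκ⟩ := isSchwartz_bump_mul χ (contDiff_const (c := (1 : ℂ)))
  refine ⟨κ, fun ξ hξ => ?_, fun ξ hξ => ?_⟩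
  · rw [hκ]
    simp [χ.one_of_mem_closedBall (mem_closedBall_zero_iff.2 hξ)]
  · rw [hκ]
    simp [χ.zero_of_le_dist (show χ.rOut ≤ dist ξ 0 by simpa using hξ)]

theorem isAnnular_cutoff_sub {κ : 𝓢(Space n, ℂ)} (h1 : ∀ ξ, ‖ξ‖ ≤ 1 → κ ξ = 1)
    (h2 : ∀ ξ, 2 ≤ ‖ξ‖ → κ ξ = 0) {ε : ℝ} (hε : 0 < ε) (hε1 : ε ≤ 1) :
    IsAnnular fun ξ => κ (ε • ξ) - κ (ε⁻¹ • ξ) := by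
  refine ⟨?_, ε, 2 * ε⁻¹, hε, fun ξ hξ => ⟨?_, ?_⟩⟩
  · exact ((κ.smooth ⊤).comp (contDiff_const_smul _)).sub ((κ.smooth ⊤).comp (contDiff_const_smul _))
  · by_contra hlt
    rw [not_le] at hlt
    refine hξ ?_
    change κ (ε • ξ) - κ (ε⁻¹ • ξ) = 0
    rw [h1, h1, sub_self]
    · rw [norm_smul, norm_inv, Real.norm_of_nonneg hε.le, ← div_eq_inv_mul, div_le_one hε]
      exact hlt.le
    · rw [norm_smul, Real.norm_of_nonneg hε.le]
      exact mul_le_one₀ hε1 (norm_nonneg _) (hlt.le.trans hε1)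
  · by_contra hlt
    rw [not_le] at hlt
    refine hξ ?_
    change κ (ε • ξ) - κ (ε⁻¹ • ξ) = 0
    have h3 : 2 ≤ ε * ‖ξ‖ := by
      rw [← div_eq_mul_inv, div_lt_iff₀ hε] at hlt
      linarith
    rw [h2, h2, sub_self]
    · rw [norm_smul, norm_inv, Real.norm_of_nonneg hε.le]
      refine h3.trans ?_
      gcongr
      exact hε1.trans ((one_le_inv₀ hε).2 hε1)
    · rwa [norm_smul, Real.norm_of_nonneg hε.le]

/-- The Fourier transform of T is supported at the origin and has finite order there. Removing from
g its part in the annulus between ε and 1/ε does not change T (𝓕 g), and the remaining near and far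
pieces are O(ε) in the finitely many seminorms that control T. -/
theorem exists_order_of_blocks {ψ : Space n → ℝ} (hψ : IsLittlewoodPaley ψ) {T : TDist n}
    (hT : ∀ j, block ψ j T = 0) : ∃ M : ℕ, ∀ g : 𝓢(Space n, ℂ),
      (∀ m ≤ M, iteratedFDeriv ℝ m g 0 = 0) → T (𝓕 g) = 0 := by
  have hc : Continuous fun g : 𝓢(Space n, ℂ) => T (𝓕 g) :=
    (map_continuous T).comp (FourierTransform.fourierCLM ℂ 𝓢(Space n, ℂ)).continuous
  let L : 𝓢(Space n, ℂ) →ₗ[ℂ] ℂ :=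
    { toFun := fun g => T (𝓕 g)
      map_add' := fun g g' => by rw [FourierTransform.fourier_add, map_add]
      map_smul' := fun c g => by rw [FourierTransform.fourier_smul, map_smul]; rfl }
  obtain ⟨s, C, -, hC⟩ := Seminorm.bound_of_continuous (schwartz_withSeminorms ℂ (Space n) ℂ)
    ((normSeminorm ℂ ℂ).comp L) (by exact continuous_norm.comp hc)
  have hC' : ∀ g, ‖T (𝓕 g)‖ ≤ C * (s.sup (schwartzSeminormFamily ℂ (Space n) ℂ)) g := hC
  -- The order is the largest number of derivatives in the seminorms that control T ∘ 𝓕.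
  refine ⟨s.sup fun i => i.2, fun g hg => ?_⟩
  obtain ⟨κ, hκ1, hκ2⟩ := exists_cutoff n
  have hnear : ∀ i : ℕ × ℕ, ∃ D : ℝ, 0 ≤ D ∧ (i ∈ s → ∀ ε, 0 < ε → ε ≤ 1 → ∀ ξ,
      ‖ξ‖ ^ i.1 * ‖iteratedFDeriv ℝ i.2 (fun ξ => κ (ε⁻¹ • ξ) * g ξ) ξ‖ ≤ D * ε) := fun i => by
    by_cases hi : i ∈ s
    · obtain ⟨D, h1, h2⟩ := seminorm_near_le κ g hκ2 hg i.1 (Finset.le_sup (f := fun i => i.2) hi)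
      exact ⟨D, h1, fun _ => h2⟩
    · exact ⟨0, le_rfl, fun h => absurd h hi⟩
  choose D hD0 hD using hnear
  choose D' hD0' hD' using fun i : ℕ × ℕ => seminorm_far_le κ g hκ1 i.1 i.2
  set B : ℝ := ∑ i ∈ s, (D i + D' i)
  have hB : ∀ i ∈ s, D i + D' i ≤ B := fun i hi =>
    Finset.single_le_sum (f := fun i => D i + D' i) (fun i _ => add_nonneg (hD0 i) (hD0' i)) hi
  have hB0 : 0 ≤ B := Finset.sum_nonneg fun i _ => add_nonneg (hD0 i) (hD0' i)
  have key : ∀ ε, 0 < ε → ε ≤ 1 → ‖T (𝓕 g)‖ ≤ C * (B * ε) := by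
    intro ε hε hε1
    have hμ := isAnnular_cutoff_sub hκ1 hκ2 hε hε1
    set μ : Space n → ℂ := fun ξ => κ (ε • ξ) - κ (ε⁻¹ • ξ)
    set R : 𝓢(Space n, ℂ) := g - SchwartzMap.smulLeftCLM ℂ μ g
    have hR : T (𝓕 R) = T (𝓕 g) := by
      have h1 : T (𝓕 (SchwartzMap.smulLeftCLM ℂ μ g)) = 0 := by
        have h2 : FM μ T (𝓕 g) = 0 := by rw [FM_eq_zero_of_blocks hψ hμ hT]; rfl
        rwa [FM_apply, FourierTransform.fourierInv_fourier_eq] at h2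
      have h3 : T (𝓕 R) = T (𝓕 g) - T (𝓕 (SchwartzMap.smulLeftCLM ℂ μ g)) := L.map_sub _ _
      rw [h3, h1, sub_zero]
    rw [← hR]
    refine (hC' R).trans ?_
    refine mul_le_mul_of_nonneg_left ?_ C.2
    refine Seminorm.finset_sup_apply_le (by positivity) fun i hi => ?_
    refine SchwartzMap.seminorm_le_bound ℂ i.1 i.2 R (by positivity) fun ξ => ?_
    have e : (R : Space n → ℂ) = (fun ξ => κ (ε⁻¹ • ξ) * g ξ) + fun ξ => g ξ - κ (ε • ξ) * g ξ := by
      ext ξ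
      rw [Pi.add_apply, show R ξ = g ξ - SchwartzMap.smulLeftCLM ℂ μ g ξ from rfl,
        SchwartzMap.smulLeftCLM_apply_apply hμ.isSchwartz.hasTemperateGrowth]
      simp only [μ, smul_eq_mul]
      ring
    have d1 : ContDiff ℝ i.2 fun ξ => κ (ε⁻¹ • ξ) * g ξ :=
      ((κ.smooth _).comp (contDiff_const_smul _)).mul (g.smooth _)
    have d2 : ContDiff ℝ i.2 fun ξ => g ξ - κ (ε • ξ) * g ξ :=
      (g.smooth _).sub (((κ.smooth _).comp (contDiff_const_smul _)).mul (g.smooth _))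
    rw [e, iteratedFDeriv_add_apply d1.contDiffAt d2.contDiffAt]
    calc _ ≤ ‖ξ‖ ^ i.1 * (‖iteratedFDeriv ℝ i.2 (fun ξ => κ (ε⁻¹ • ξ) * g ξ) ξ‖ +
          ‖iteratedFDeriv ℝ i.2 (fun ξ => g ξ - κ (ε • ξ) * g ξ) ξ‖) := by
          gcongr
          exact norm_add_le _ _
      _ ≤ D i * ε + D' i * ε := by
          rw [mul_add]
          exact add_le_add (hD i hi ε hε hε1 ξ) (hD' i ε hε hε1 ξ)
      _ ≤ B * ε := by
          rw [← add_mul]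
          have := hB i hi
          gcongr
  have hlim : Tendsto (fun ε : ℝ => C * (B * ε)) (𝓝[>] 0) (𝓝 0) := by
    have : Tendsto (fun ε : ℝ => C * (B * ε)) (𝓝 0) (𝓝 (C * (B * 0))) := by
      apply Continuous.tendsto
      fun_prop
    simp only [mul_zero] at this
    exact this.mono_left nhdsWithin_le_nhds
  have := ge_of_tendsto hlim (by
    filter_upwards [Ioc_mem_nhdsGT one_pos] with ε hε
    exact key ε hε.1 hε.2)
  exact norm_le_zero_iff.1 this

theorem exists_poly_iteratedLineDeriv {m : ℕ} (i : Fin m → Fin n) :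
    ∃ P : MvPolynomial (Fin n) ℂ, ∀ φ : 𝓢(Space n, ℂ), ∃ Φ : 𝓢(Space n, ℂ),
      (∀ x, Φ x = MvPolynomial.eval (fun i => ((x i : ℝ) : ℂ)) P * φ x) ∧
      ∂^{fun k => (EuclideanSpace.single (i k) (1 : ℝ) : Space n)} (𝓕⁻ φ) = 𝓕⁻ Φ := by
  induction m with
  | zero => exact ⟨1, fun φ => ⟨φ, fun x => by simp, by simp⟩⟩
  | succ m ih =>
    obtain ⟨P, hP⟩ := ih fun k => i k.succ
    refine ⟨MvPolynomial.C (2 * Real.pi * Complex.I) * MvPolynomial.X (i 0) * P, fun φ => ?_⟩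
    obtain ⟨Φ, h1, h2⟩ := hP φ
    refine ⟨(2 * Real.pi * Complex.I : ℂ) • SchwartzMap.smulLeftCLM ℂ
      (fun ξ : Space n => inner ℝ ξ (EuclideanSpace.single (i 0) (1 : ℝ))) Φ, fun x => ?_, ?_⟩
    · rw [smul_apply, SchwartzMap.smulLeftCLM_apply_apply (hasTemperateGrowth_inner_single _), h1]
      simp [EuclideanSpace.inner_single_right]
      ring
    · rw [LineDeriv.iteratedLineDerivOp_succ_left, ← SchwartzMap.lineDerivOp_fourierInv_eq, ← h2]
      rfl

/-- T vanishes on the common kernel of finitely many functionals, the derivatives at 0 of the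
inverse Fourier transform up to order M. By linear algebra it is a combination of them, and each is
the pairing with a polynomial. -/
theorem eqModPoly_zero_of_blocks {ψ : Space n → ℝ} (hψ : IsLittlewoodPaley ψ) {T : TDist n}
    (hT : ∀ j, block ψ j T = 0) : EqModPoly T 0 := by
  obtain ⟨M, hM⟩ := exists_order_of_blocks hψ hT
  choose P hP using fun ι : (Σ m : Fin (M + 1), (Fin m → Fin n)) =>
    exists_poly_iteratedLineDeriv ι.2
  let L : (Σ m : Fin (M + 1), (Fin m → Fin n)) → 𝓢(Space n, ℂ) →ₗ[ℂ] ℂ := fun ι =>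
    { toFun := fun φ => polyPairing (P ι) φ
      map_add' := fun φ φ' => by
        rw [polyPairing, polyPairing, polyPairing,
          ← integral_add (integrable_poly_mul _ φ) (integrable_poly_mul _ φ')]
        simp [mul_add]
      map_smul' := fun c φ => by
        rw [RingHom.id_apply, smul_eq_mul, polyPairing, polyPairing, ← integral_const_mul]
        congr 1
        ext x
        simp only [smul_apply, smul_eq_mul]
        ring }
  let K : 𝓢(Space n, ℂ) →ₗ[ℂ] ℂ :=
    { toFun := fun φ => T φ
      map_add' := fun g g' => map_add _ _ _
      map_smul' := fun c g => map_smul _ _ _ }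
  have hL : ∀ ι φ, L ι φ =
      iteratedFDeriv ℝ ι.1 (𝓕⁻ φ : 𝓢(Space n, ℂ)) 0 fun k => EuclideanSpace.single (ι.2 k) (1 : ℝ) := by
    intro ι φ
    obtain ⟨Φ, h1, h2⟩ := hP ι φ
    rw [← SchwartzMap.iteratedLineDerivOp_eq_iteratedFDeriv, h2, fourierInv_apply_zero]
    simp only [h1]
    rfl
  have hker : ⨅ ι, (L ι).ker ≤ K.ker := by
    intro φ hφ
    rw [Submodule.mem_iInf] at hφ
    rw [LinearMap.mem_ker]
    have h1 := hM (𝓕⁻ φ) fun m hm => ?_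
    · rwa [FourierTransform.fourier_fourierInv_eq] at h1
    · have h2 : (iteratedFDeriv ℝ m (𝓕⁻ φ : 𝓢(Space n, ℂ)) 0).toMultilinearMap = 0 := by
        refine Module.Basis.ext_multilinear
          (fun _ => (EuclideanSpace.basisFun (Fin n) ℝ).toBasis) fun v => ?_
        have h3 := hL ⟨⟨m, Nat.lt_succ_of_le hm⟩, v⟩ φ
        rw [(LinearMap.mem_ker).1 (hφ _)] at h3
        simpa using h3.symm
      ext v
      exact congrArg (fun f => f v) h2
  have hmem := mem_span_of_iInf_ker_le_ker hker
  obtain ⟨c, hc⟩ := (Submodule.mem_span_range_iff_exists_fun ℂ).1 hmem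
  refine ⟨∑ ι, c ι • P ι, fun φ => ?_⟩
  have h1 := congrArg (fun f => f φ) hc
  simp only [LinearMap.sum_apply, LinearMap.smul_apply] at h1
  rw [polyPairing_sum]
  simp only [polyPairing_smul]
  have h0 : (0 : TDist n) φ = 0 := rfl
  rw [h0, sub_zero]
  exact h1.symm

theorem eqModPoly_of_blocks {ψ : Space n → ℝ} (hψ : IsLittlewoodPaley ψ) {S T : TDist n}
    (h : ∀ j, block ψ j S = block ψ j T) : EqModPoly S T := by
  obtain ⟨P, hP⟩ := eqModPoly_zero_of_blocks hψ (T := S - T) fun j => by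
    rw [block_eq_FM, FM, map_sub, sub_eq_zero]
    exact h j
  refine ⟨P, fun φ => ?_⟩
  rw [← hP φ]
  have h0 : (0 : TDist n) φ = 0 := rfl
  rw [h0, sub_zero]
  rfl

end Vanishing

/-! ### Real distributions -/

section Real

open ComplexConjugate

/-- A tempered distribution that takes real values on real test functions. -/
def IsRealDist (T : TDist n) : Prop :=
  ∀ φ : 𝓢(Space n, ℂ), (∀ x, (φ x).im = 0) → (T φ).im = 0

/-- A symbol `m` with `m(-ξ) = conj (m ξ)`, so that the multiplier preserves real functions. -/
def IsHermitianSym (m : Space n → ℂ) : Prop := ∀ ξ, m (-ξ) = conj (m ξ)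

theorem IsHermitianSym.mul {m m' : Space n → ℂ} (h : IsHermitianSym m) (h' : IsHermitianSym m') :
    IsHermitianSym (m * m') := fun ξ => by simp [h ξ, h' ξ]

theorem isHermitianSym_heatSym (r : ℝ) : IsHermitianSym (heatSym r : Space n → ℂ) := fun ξ => by
  simp only [heatSym, norm_neg, Complex.conj_ofReal]

theorem isHermitianSym_leraySym (i k : Fin n) : IsHermitianSym (leraySym i k) := fun ξ => by
  simp only [leraySym, norm_neg, Complex.conj_ofReal, PiLp.neg_apply, neg_mul_neg]

theorem isHermitianSym_coord (i : Fin n) :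
    IsHermitianSym fun ξ : Space n => (2 * Real.pi * Complex.I) * (ξ i : ℂ) := fun ξ => by
  simp [Complex.conj_ofReal, Complex.conj_ofNat]

theorem conj_fourierInv_neg {φ : 𝓢(Space n, ℂ)} (hφ : ∀ x, (φ x).im = 0) (ξ : Space n) :
    conj ((𝓕⁻ φ) (-ξ)) = (𝓕⁻ φ) ξ := by
  rw [SchwartzMap.fourierInv_coe, Real.fourierInv_eq', Real.fourierInv_eq', ← integral_conj]
  congr 1
  ext x
  rw [smul_eq_mul, smul_eq_mul, map_mul, Complex.conj_eq_iff_im.2 (hφ x), ← Complex.exp_conj]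
  simp [Complex.conj_ofReal, Complex.conj_ofNat]

theorem conj_fourier {h : 𝓢(Space n, ℂ)} (hh : ∀ ξ, conj (h (-ξ)) = h ξ) (x : Space n) :
    conj ((𝓕 h) x) = (𝓕 h) x := by
  rw [SchwartzMap.fourier_coe, Real.fourier_eq', ← integral_conj, ← integral_neg_eq_self]
  congr 1
  ext ξ
  rw [smul_eq_mul, smul_eq_mul, map_mul, hh ξ, ← Complex.exp_conj]
  simp [Complex.conj_ofReal, Complex.conj_ofNat]

theorem IsRealDist.FM {m : Space n → ℂ} (hm : m.HasTemperateGrowth) (hh : IsHermitianSym m)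
    {T : TDist n} (hT : IsRealDist T) : IsRealDist (FM m T) := fun φ hφ => by
  rw [FM_apply]
  refine hT _ fun x => Complex.conj_eq_iff_im.1 (conj_fourier (fun ξ => ?_) x)
  rw [SchwartzMap.smulLeftCLM_apply_apply hm, SchwartzMap.smulLeftCLM_apply_apply hm, smul_eq_mul,
    smul_eq_mul, map_mul, conj_fourierInv_neg hφ, hh, Complex.conj_conj]

theorem IsRealDist.sum {ι : Type*} {s : Finset ι} {T : ι → TDist n} (h : ∀ i ∈ s, IsRealDist (T i)) :
    IsRealDist (∑ i ∈ s, T i) := fun φ hφ => by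
  rw [sum_apply, Complex.im_sum]
  exact Finset.sum_eq_zero fun i hi => h i hi φ hφ

theorem IsRealDist.sub {S T : TDist n} (hS : IsRealDist S) (hT : IsRealDist T) :
    IsRealDist (S - T) := fun φ hφ => by
  rw [sub_apply, Complex.sub_im, hS φ hφ, hT φ hφ, sub_zero]

theorem IsRealDist.isRealModPoly {T : TDist n} (hT : IsRealDist T) : IsRealModPoly T :=
  ⟨T, EqModPoly.refl T, hT⟩

theorem IsRealModPoly.FM {m : Space n → ℂ} (hm : IsAnnular m) (hh : IsHermitianSym m)
    {T : TDist n} (hT : IsRealModPoly T) : IsRealDist (FM m T) := by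
  obtain ⟨S, h1, h2⟩ := hT
  rw [h1.FM_eq hm]
  exact IsRealDist.FM hm.isSchwartz.hasTemperateGrowth hh h2

theorem IsRealDist.rep {T : TDist n} (hT : IsRealDist T) {g : Space n → ℂ} (hg : IsRep T g) :
    ∀ᵐ x, (g x).im = 0 := by
  have hl : LocallyIntegrable fun x => (g x).im := fun x => by
    obtain ⟨s, hs, hi⟩ := hg.locallyIntegrable x
    exact ⟨s, hs, hi.im⟩
  refine ae_eq_zero_of_integral_contDiff_smul_eq_zero hl fun φ hφ hφ' => ?_
  have hg₁ : HasCompactSupport (Complex.ofRealCLM ∘ φ) := hφ'.comp_left rfl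
  have hg₂ : ContDiff ℝ ∞ (Complex.ofRealCLM ∘ φ) := by fun_prop
  have h1 := hT (hg₁.toSchwartzMap hg₂) fun x => by simp
  rw [(hg _).2] at h1
  have h2 := integral_im (hg (hg₁.toSchwartzMap hg₂)).1
  have h3 : RCLike.im (∫ x, g x * (hg₁.toSchwartzMap hg₂) x) = 0 := h1
  rw [h3] at h2
  rw [← h2]
  congr 1
  ext x
  simp [mul_comm]

/-- The even part of a Littlewood–Paley symbol. -/
def evenPart (ψ : Space n → ℝ) (ξ : Space n) : ℝ := (ψ ξ + ψ (-ξ)) / 2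

/-- ψ need not be even, so its blocks need not preserve real distributions. The even part is again a
Littlewood–Paley function, and its blocks do; reality is tested with it. -/
theorem IsLittlewoodPaley.evenPart {ψ : Space n → ℝ} (h : IsLittlewoodPaley ψ) :
    IsLittlewoodPaley (evenPart ψ) where
  smooth := (h.smooth.add (h.smooth.comp contDiff_neg)).div_const 2
  support_subset := by
    intro ξ hξ
    by_cases h1 : ψ ξ = 0
    · have h2 : ψ (-ξ) ≠ 0 := fun h2 => hξ (by simp [ForcedNS.evenPart, h1, h2])
      simpa using h.support_subset h2
    · exact h.support_subset h1
  nonneg ξ := div_nonneg (add_nonneg (h.nonneg _) (h.nonneg _)) two_pos.le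
  le_one ξ := by
    have h1 := h.le_one ξ
    have h2 := h.le_one (-ξ)
    unfold ForcedNS.evenPart
    linarith
  hasSum ξ hξ := by
    have h1 := ((h.hasSum ξ hξ).add (h.hasSum (-ξ) (neg_ne_zero.2 hξ))).div_const 2
    simp only [smul_neg] at h1
    rwa [show ((1 : ℝ) + 1) / 2 = 1 by norm_num] at h1

theorem isHermitianSym_evenPart (ψ : Space n → ℝ) (j : ℤ) :
    IsHermitianSym (lpSym (evenPart ψ) j) := fun ξ => by
  simp only [lpSym, evenPart, Complex.conj_ofReal, smul_neg, neg_neg, add_comm]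

end Real

/-! ### Sequences of dyadic blocks -/

section BlockSequences

variable {p : ℝ} [hp : Fact (1 ≤ ENNReal.ofReal p)]

/-- The sequence `z` has the properties that characterize the sequence of dyadic blocks of a real
distribution. -/
structure RealBlocks (ψ : Space n → ℝ) (z : ℤ → LpC n p) : Prop where
  fat : ∀ j, convLp (fatSym ψ j) (z j) = z j
  compat : ∀ j k, convLp (lpSym ψ j) (z k) = convLp (lpSym ψ k) (z j)
  vanish : ∀ j k, k - j ∉ Finset.Icc (-2 : ℤ) 2 → convLp (lpSym ψ j) (z k) = 0
  real : ∀ j, IsRealDist (emb (convLp (lpSym (evenPart ψ) j) (∑ d ∈ Finset.Icc (-2 : ℤ) 2, z (j + d))))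

theorem TDist.ext {S T : TDist n} (h : ∀ φ, S φ = T φ) : S = T := by
  ext φ; exact h φ

variable {ψ : Space n → ℝ} {z : ℤ → LpC n p}

theorem realBlocks_of_blocks (hψ : IsLittlewoodPaley ψ) {T : TDist n} (hT : IsRealModPoly T)
    (hz : ∀ j, emb (z j) = block ψ j T) : RealBlocks ψ z where
  fat j := by
    apply emb_injective
    rw [emb_convLp (hψ.isSchwartz_fat j), hz, block_eq_FM,
      FM_FM (hψ.isSchwartz_fat j).hasTemperateGrowth (hψ.isSchwartz j).hasTemperateGrowth,
      hψ.fatSym_mul_lpSym hψ]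
  compat j k := by
    apply emb_injective
    rw [emb_convLp (hψ.isSchwartz j), emb_convLp (hψ.isSchwartz k), hz, hz, block_eq_FM, block_eq_FM,
      FM_comm (hψ.isSchwartz j).hasTemperateGrowth (hψ.isSchwartz k).hasTemperateGrowth]
  vanish j k hjk := by
    apply emb_injective
    rw [emb_convLp (hψ.isSchwartz j), hz, block_eq_FM,
      FM_FM (hψ.isSchwartz j).hasTemperateGrowth (hψ.isSchwartz k).hasTemperateGrowth,
      hψ.lpSym_mul_eq_zero hψ hjk, FM_zero, map_zero]
  real j := by
    rw [emb_convLp (hψ.evenPart.isSchwartz j), map_sum]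
    have e : ∑ d ∈ Finset.Icc (-2 : ℤ) 2, emb (z (j + d)) = FM (fatSym ψ j) T := by
      rw [fatSym, FM_sum fun d _ => (hψ.isSchwartz _).hasTemperateGrowth]
      exact Finset.sum_congr rfl fun d _ => hz _
    rw [e, FM_FM (hψ.evenPart.isSchwartz j).hasTemperateGrowth
      (hψ.isSchwartz_fat j).hasTemperateGrowth, mul_comm, hψ.evenPart.fatSym_mul_lpSym hψ]
    exact hT.FM (hψ.evenPart.isAnnular j) (isHermitianSym_evenPart ψ j)

/-- Every condition is an identity between continuous linear expressions in finitely many blocks, so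
it survives limits taken block by block. This lets the property pass to the limit of the iteration.
-/
theorem RealBlocks.of_tendsto {w : ℕ → ℤ → LpC n p} (hw : ∀ N, RealBlocks ψ (w N))
    (h : ∀ k, Tendsto (fun N => w N k) atTop (𝓝 (z k))) : RealBlocks ψ z where
  fat j := tendsto_nhds_unique
    (((convLp (fatSym ψ j)).continuous.tendsto _).comp (h j)) ((h j).congr fun N => ((hw N).fat j).symm)
  compat j k := tendsto_nhds_unique (((convLp (lpSym ψ j)).continuous.tendsto _).comp (h k))
    ((((convLp (lpSym ψ k)).continuous.tendsto _).comp (h j)).congr fun N => ((hw N).compat j k).symm)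
  vanish j k hjk := tendsto_nhds_unique (((convLp (lpSym ψ j)).continuous.tendsto _).comp (h k))
    (tendsto_const_nhds.congr fun N => ((hw N).vanish j k hjk).symm)
  real j φ hφ := by
    have h1 : Tendsto (fun N => ∑ d ∈ Finset.Icc (-2 : ℤ) 2, w N (j + d)) atTop
        (𝓝 (∑ d ∈ Finset.Icc (-2 : ℤ) 2, z (j + d))) := tendsto_finsetSum _ fun d _ => h _
    have h2 := ((Complex.continuous_im.comp ((pairLp φ).continuous.comp
      (convLp (lpSym (evenPart ψ) j)).continuous)).tendsto _).comp h1
    exact tendsto_nhds_unique h2 (tendsto_const_nhds.congr fun N => ((hw N).real j φ hφ).symm)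

/-- By compatibility Δ_j z_k = Δ_k z_j, so Δ_j of the sum is the sum of the Δ_k z_j. Only |k - j| ≤
2 contributes, and there the symbols add up to the widened symbol, which fixes z_j. -/
theorem RealBlocks.block_eq (hψ : IsLittlewoodPaley ψ) (hz : RealBlocks ψ z) {T : TDist n}
    (hT : ∀ φ, HasSum (fun k => emb (z k) φ) (T φ)) (j : ℤ) : block ψ j T = emb (z j) := by
  refine TDist.ext fun φ => ?_
  have h1 : HasSum (fun k => emb (convLp (lpSym ψ k) (z j)) φ) (block ψ j T φ) := by
    rw [block_eq_FM, FM_apply]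
    convert hT _ using 2 with k
    rw [← hz.compat, emb_convLp (hψ.isSchwartz j), FM_apply]
  have h2 : HasSum (fun k => emb (convLp (lpSym ψ k) (z j)) φ)
      (∑ k ∈ (Finset.Icc (-2 : ℤ) 2).map (addLeftEmbedding j), emb (convLp (lpSym ψ k) (z j)) φ) := by
    refine hasSum_sum_of_ne_finset_zero fun k hk => ?_
    rw [hz.vanish, map_zero]
    · rfl
    · intro hmem
      refine hk (Finset.mem_map.2 ⟨k - j, ?_, by simp⟩)
      rw [Finset.mem_Icc] at hmem ⊢
      omega
  rw [h1.unique h2, Finset.sum_map]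
  simp only [addLeftEmbedding_apply]
  conv_rhs => rw [← hz.fat j, emb_convLp (hψ.isSchwartz_fat j), fatSym,
    FM_sum fun d _ => (hψ.isSchwartz _).hasTemperateGrowth, sum_apply]
  refine Finset.sum_congr rfl fun d _ => ?_
  rw [emb_convLp (hψ.isSchwartz _)]

/-- The sequence of blocks with the weight `2^{(n/p-1)j}` removed. -/
def unscale (x : ℤ → LpC n p) (k : ℤ) : LpC n p := ((2 : ℝ) ^ (-((n / p - 1) * (k : ℝ)))) • x k

theorem convLp_real_smul (m : Space n → ℂ) (r : ℝ) (x : LpC n p) :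
    convLp m (r • x) = r • convLp m x :=
  ((convLp m).restrictScalars ℝ).map_smul r x

theorem tame_unscale (hn : 3 ≤ n) (hpn : p < n) (hψ : IsLittlewoodPaley ψ) {x : ℤ → LpC n p}
    {B : ℝ} (hx : ∀ k, ‖x k‖ ≤ B) (hfat : ∀ j, convLp (fatSym ψ j) (unscale x j) = unscale x j) :
    Tame (unscale x) := by
  have h := tame_of_annular hn hpn (hψ.isAnnular_fat 0) hx
  convert h using 2 with k
  rw [← fatSym_eq_comp, ← convLp_real_smul]
  exact (hfat k).symm

/-- Decompose each z_k with the even function θ and regroup by the θ-index j: the group is Δ_j^θ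
applied to the five neighbouring blocks z_{j+d}, which is real by assumption although the single z_k
need not be. Regrouping is legitimate because the series converges for each of the five shifts d
separately. -/
theorem RealBlocks.isRealDist (hn : 3 ≤ n) (hpn : p < n) (hψ : IsLittlewoodPaley ψ)
    {x : ℤ → LpC n p} {B : ℝ} (hx : ∀ k, ‖x k‖ ≤ B) (hz : RealBlocks ψ (unscale x)) {T : TDist n}
    (hT : ∀ φ, HasSum (fun k => emb (unscale x k) φ) (T φ)) : IsRealDist T := by
  intro φ hφ
  set θ := ForcedNS.evenPart ψ
  have hθ : IsLittlewoodPaley θ := hψ.evenPart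
  have hs : ∀ d : ℤ, Summable fun k => emb (convLp (lpSym θ (k - d)) (unscale x k)) φ := fun d => by
    have h := tame_of_annular hn hpn (hθ.isAnnular (-d)) hx
    obtain ⟨S, -, -, -, hS⟩ := h.exists_realization
    refine (hS φ).summable.congr fun k => ?_
    have e : (fun ξ => lpSym θ (-d) ((2 : ℝ) ^ (-k) • ξ)) = lpSym θ (k - d) := by
      ext ξ
      simp only [lpSym]
      rw [smul_smul, ← zpow_add₀ two_ne_zero]
      congr 4
      omega
    rw [unscale, convLp_real_smul, e]
  have hfat : ∀ k, fatSym θ k = ∑ d ∈ Finset.Icc (-2 : ℤ) 2, lpSym θ (k - d) := fun k => by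
    refine Finset.sum_nbij' (fun d => -d) (fun d => -d) ?_ ?_ ?_ ?_ ?_ <;>
      simp only [Finset.mem_Icc, neg_neg, implies_true, sub_neg_eq_add] <;> omega
  have h1 : ∀ k, emb (unscale x k) φ =
      ∑ d ∈ Finset.Icc (-2 : ℤ) 2, emb (convLp (lpSym θ (k - d)) (unscale x k)) φ := fun k => by
    have e : emb (unscale x k) = FM (fatSym θ k) (emb (unscale x k)) := by
      rw [← hz.block_eq hψ hT k, block_eq_FM, FM_FM (hθ.isSchwartz_fat k).hasTemperateGrowth
        (hψ.isSchwartz k).hasTemperateGrowth, hψ.fatSym_mul_lpSym hθ]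
    rw [e, hfat, FM_sum fun d _ => (hθ.isSchwartz _).hasTemperateGrowth, sum_apply]
    exact Finset.sum_congr rfl fun d _ => by rw [emb_convLp (hθ.isSchwartz _)]
  have h2 := hT φ
  simp only [h1] at h2
  have h3 := hasSum_sum fun d (_ : d ∈ Finset.Icc (-2 : ℤ) 2) => (hs d).hasSum
  have h4 := hasSum_sum fun d (_ : d ∈ Finset.Icc (-2 : ℤ) 2) =>
    (Equiv.addRight d).hasSum_iff.2 (hs d).hasSum
  rw [← h2.unique h3] at h4
  have h5 := Complex.imCLM.hasSum h4
  refine h5.unique ?_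
  convert hasSum_zero using 2 with j
  have h6 := hz.real j φ hφ
  rw [map_sum, map_sum, sum_apply] at h6
  simpa using h6

end BlockSequences

/-! ### The mild formulation -/

section Mild

variable {p : ℝ} [hp : Fact (1 ≤ ENNReal.ofReal p)] {ψ : Space n → ℝ}

theorem heat_eq_FM (t : ℝ) (T : TDist n) : heat t T = FM (heatSym t) T := rfl

theorem isAnnular_mul_leraySym {m : Space n → ℂ} (hm : IsAnnular m) (i k : Fin n) :
    IsAnnular (m * leraySym i k) := hm.mul_contDiffOn (contDiffOn_leraySym i k)

theorem lerayBlock_eq_FM (ψ : Space n → ℝ) (j : ℤ) (g : VDist n) (i : Fin n) :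
    lerayBlock ψ j g i = ∑ k, FM (lpSym ψ j * leraySym i k) (g k) := by
  rw [lerayBlock]
  refine Finset.sum_congr rfl fun k _ => ?_
  rw [mult]
  congr 2
  ext ξ
  simp only [lpSym, leraySym, Pi.mul_apply, Complex.ofReal_mul]

/-- The component `i` of `m(D) ℙ e^{σΔ} g`. -/
def lerayHeat (m : Space n → ℂ) (σ : ℝ) (g : VDist n) (i : Fin n) : TDist n :=
  ∑ k, FM (m * leraySym i k * heatSym σ) (g k)

theorem heat_lerayBlock (hψ : IsLittlewoodPaley ψ) (j : ℤ) {σ : ℝ} (hσ : 0 ≤ σ) (g : VDist n)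
    (i : Fin n) : heat σ (lerayBlock ψ j g i) = lerayHeat (lpSym ψ j) σ g i := by
  rw [heat_eq_FM, lerayBlock_eq_FM, lerayHeat, FM, map_sum]
  refine Finset.sum_congr rfl fun k _ => ?_
  rw [mul_comm (lpSym ψ j * leraySym i k)]
  exact FM_FM (hasTemperateGrowth_heatSym hσ)
    (isAnnular_mul_leraySym (hψ.isAnnular j) i k).isSchwartz.hasTemperateGrowth _

theorem FM_lerayHeat {m m' : Space n → ℂ} (hm : IsAnnular m) (hm' : IsAnnular m') (σ : ℝ)
    (g : VDist n) (i : Fin n) : FM m' (lerayHeat m σ g i) = lerayHeat (m' * m) σ g i := by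
  rw [lerayHeat, lerayHeat, FM, map_sum]
  refine Finset.sum_congr rfl fun k _ => ?_
  rw [mul_assoc m', mul_assoc m']
  exact FM_FM hm'.isSchwartz.hasTemperateGrowth
    ((isAnnular_mul_leraySym hm i k).mul_heatSym σ).isSchwartz.hasTemperateGrowth _

theorem lerayHeat_zero (σ : ℝ) (g : VDist n) (i : Fin n) : lerayHeat 0 σ g i = 0 := by
  simp [lerayHeat, FM_zero]

theorem lerayHeat_sum {ι : Type*} {s : Finset ι} {m : ι → Space n → ℂ}
    (hm : ∀ d ∈ s, IsAnnular (m d)) (σ : ℝ) (g : VDist n) (i : Fin n) :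
    lerayHeat (∑ d ∈ s, m d) σ g i = ∑ d ∈ s, lerayHeat (m d) σ g i := by
  simp only [lerayHeat]
  rw [Finset.sum_comm]
  refine Finset.sum_congr rfl fun k _ => ?_
  rw [Finset.sum_mul, Finset.sum_mul, FM_sum fun d hd =>
    ((isAnnular_mul_leraySym (hm d hd) i k).mul_heatSym σ).isSchwartz.hasTemperateGrowth]

theorem lerayHeat_isRealDist {m : Space n → ℂ} (hm : IsAnnular m) (hh : IsHermitianSym m) (σ : ℝ)
    {g : VDist n} (hg : ∀ k, IsRealModPoly (g k)) (i : Fin n) : IsRealDist (lerayHeat m σ g i) :=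
  IsRealDist.sum fun k _ => (hg k).FM ((isAnnular_mul_leraySym hm i k).mul_heatSym σ)
    ((hh.mul (isHermitianSym_leraySym i k)).mul (isHermitianSym_heatSym σ))

/-- The mild formulation at the time `t`, for the sequence `z` of dyadic blocks, with initial value
`a` and right-hand side `G`. -/
def MildAt (ψ : Space n → ℝ) (a : VDist n) (G : ℝ → VDist n) (t : ℝ) (z : Fin n → ℤ → LpC n p) :
    Prop :=
  ∀ (j : ℤ) (i : Fin n) (φ : 𝓢(Space n, ℂ)),
    IntervalIntegrable (fun τ => heat (t - τ) (lerayBlock ψ j (G τ) i) φ) volume 0 t ∧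
    emb (z i j) φ = heat t (block ψ j (a i)) φ +
      ∫ τ in (0 : ℝ)..t, heat (t - τ) (lerayBlock ψ j (G τ) i) φ

/-- An annular multiplier is moved onto the test function, so it passes under the time integral
without any vector-valued integration of distributions. -/
theorem FM_mildAt (hψ : IsLittlewoodPaley ψ) {a : VDist n} {G : ℝ → VDist n} {t : ℝ} (ht : 0 < t)
    {z : Fin n → ℤ → LpC n p} (h : MildAt ψ a G t z) {m : Space n → ℂ} (hm : IsAnnular m)
    (j : ℤ) (i : Fin n) (φ : 𝓢(Space n, ℂ)) :
    IntervalIntegrable (fun τ => lerayHeat (m * lpSym ψ j) (t - τ) (G τ) i φ) volume 0 t ∧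
    emb (convLp m (z i j)) φ = FM (m * lpSym ψ j * heatSym t) (a i) φ +
      ∫ τ in (0 : ℝ)..t, lerayHeat (m * lpSym ψ j) (t - τ) (G τ) i φ := by
  obtain ⟨h1, h2⟩ := h j i (𝓕 (SchwartzMap.smulLeftCLM ℂ m (𝓕⁻ φ)))
  have e : ∀ τ ∈ uIoc 0 t, heat (t - τ) (lerayBlock ψ j (G τ) i)
      (𝓕 (SchwartzMap.smulLeftCLM ℂ m (𝓕⁻ φ))) =
      lerayHeat (m * lpSym ψ j) (t - τ) (G τ) i φ := fun τ hτ => by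
    rw [uIoc_of_le ht.le] at hτ
    rw [← FM_apply, heat_lerayBlock hψ j (by linarith [hτ.2]), FM_lerayHeat (hψ.isAnnular j) hm]
  refine ⟨h1.congr fun τ hτ => e τ hτ, ?_⟩
  rw [emb_convLp hm.isSchwartz, FM_apply, h2,
    intervalIntegral.integral_congr_ae (Eventually.of_forall e)]
  congr 1
  rw [← FM_apply, heat_eq_FM, block_eq_FM, FM_FM (hasTemperateGrowth_heatSym ht.le)
      (hψ.isSchwartz j).hasTemperateGrowth, FM_FM hm.isSchwartz.hasTemperateGrowth
      ((mul_comm (lpSym ψ j) (heatSym t)) ▸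
        ((hψ.isAnnular j).mul_heatSym t).isSchwartz.hasTemperateGrowth)]
  rw [mul_comm (heatSym t), mul_assoc]

/-- Every block of the right-hand side comes from multipliers applied to the same data a and G, so
the compatibility relations reduce to identities between symbols; reality follows since the Leray
and heat symbols are Hermitian. -/
theorem realBlocks_of_mildAt (hψ : IsLittlewoodPaley ψ) {a : VDist n} {G : ℝ → VDist n} {t : ℝ}
    (ht : 0 < t) {z : Fin n → ℤ → LpC n p} (h : MildAt ψ a G t z)
    (ha : ∀ i, IsRealModPoly (a i)) (hG : ∀ τ, 0 < τ → ∀ k, IsRealModPoly (G τ k)) (i : Fin n) :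
    RealBlocks ψ (z i) where
  fat j := by
    apply emb_injective
    refine TDist.ext fun φ => ?_
    rw [(FM_mildAt hψ ht h (hψ.isAnnular_fat j) j i φ).2]
    rw [hψ.fatSym_mul_lpSym hψ]
    rw [(h j i φ).2]
    congr 1
    · rw [heat_eq_FM, block_eq_FM, FM_FM (hasTemperateGrowth_heatSym ht.le)
        (hψ.isSchwartz j).hasTemperateGrowth, mul_comm]
    · refine intervalIntegral.integral_congr_ae (Eventually.of_forall fun τ hτ => ?_)
      rw [uIoc_of_le ht.le] at hτ
      rw [heat_lerayBlock hψ j (by linarith [hτ.2])]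
  compat j k := by
    apply emb_injective
    refine TDist.ext fun φ => ?_
    rw [(FM_mildAt hψ ht h (hψ.isAnnular j) k i φ).2, (FM_mildAt hψ ht h (hψ.isAnnular k) j i φ).2,
      mul_comm (lpSym ψ j)]
  vanish j k hjk := by
    apply emb_injective
    refine TDist.ext fun φ => ?_
    rw [(FM_mildAt hψ ht h (hψ.isAnnular j) k i φ).2, hψ.lpSym_mul_eq_zero hψ hjk, zero_mul, FM_zero,
      map_zero]
    simp only [lerayHeat_zero]
    simp
  real j φ hφ := by
    have hθ := hψ.evenPart
    have hA := hθ.isAnnular j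
    rw [map_sum, map_sum, sum_apply]
    have hi := fun d : ℤ => FM_mildAt hψ ht h hA (j + d) i φ
    have hA' : ∀ d ∈ Finset.Icc (-2 : ℤ) 2, IsAnnular (lpSym (evenPart ψ) j * lpSym ψ (j + d)) :=
      fun d _ => hA.mul_contDiffOn (hψ.isAnnular _).contDiffOn
    have e : ∑ d ∈ Finset.Icc (-2 : ℤ) 2, lpSym (evenPart ψ) j * lpSym ψ (j + d) =
        lpSym (evenPart ψ) j := by
      rw [← Finset.mul_sum, mul_comm]
      exact hθ.fatSym_mul_lpSym hψ j
    rw [Finset.sum_congr rfl fun d _ => (hi d).2, Finset.sum_add_distrib,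
      ← intervalIntegral.integral_finsetSum fun d _ => (hi d).1]
    have e1 : ∑ d ∈ Finset.Icc (-2 : ℤ) 2,
        FM (lpSym (evenPart ψ) j * lpSym ψ (j + d) * heatSym t) (a i) φ =
        FM (lpSym (evenPart ψ) j * heatSym t) (a i) φ := by
      conv_rhs => rw [← e, Finset.sum_mul, FM_sum fun d hd =>
        ((hA' d hd).mul_heatSym t).isSchwartz.hasTemperateGrowth, sum_apply]
    have e2 : ∀ τ, ∑ d ∈ Finset.Icc (-2 : ℤ) 2,
        lerayHeat (lpSym (evenPart ψ) j * lpSym ψ (j + d)) (t - τ) (G τ) i φ =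
        lerayHeat (lpSym (evenPart ψ) j) (t - τ) (G τ) i φ := fun τ => by
      conv_rhs => rw [← e, lerayHeat_sum hA', sum_apply]
    have hInt : IntervalIntegrable
        (fun τ => lerayHeat (lpSym (evenPart ψ) j) (t - τ) (G τ) i φ) volume 0 t := by
      have := IntervalIntegrable.sum (Finset.Icc (-2 : ℤ) 2) fun d _ => (hi d).1
      refine this.congr fun τ _ => ?_
      rw [Finset.sum_apply, e2]
    rw [e1, Complex.add_im, (ha i).FM (hA.mul_heatSym t)
      ((isHermitianSym_evenPart ψ j).mul (isHermitianSym_heatSym t)) φ hφ, zero_add]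
    simp only [e2]
    have h3 := Complex.imCLM.intervalIntegral_comp_comm hInt
    rw [Complex.imCLM_apply] at h3
    rw [← h3]
    refine intervalIntegral.integral_zero_ae (Eventually.of_forall fun τ hτ => ?_)
    rw [uIoc_of_le ht.le] at hτ
    exact lerayHeat_isRealDist hA (isHermitianSym_evenPart ψ j) _ (hG τ hτ.1) i φ hφ

end Mild

/-! ### Weighted blocks of distributions -/

section Transfer

variable {p : ℝ} [hp : Fact (1 ≤ ENNReal.ofReal p)] {ψ : Space n → ℝ}

/-- `x` is the sequence of the dyadic blocks of `T` with the weights `2^{sj}`. -/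
def BlocksOf (ψ : Space n → ℝ) (s : ℝ) (x : ℤ → LpC n p) (T : TDist n) : Prop :=
  ∀ j, emb (x j) = (((2 : ℝ) ^ (s * (j : ℝ)) : ℝ) : ℂ) • block ψ j T

theorem two_rpow_ofReal_ne_zero (r : ℝ) : (((2 : ℝ) ^ r : ℝ) : ℂ) ≠ 0 :=
  Complex.ofReal_ne_zero.2 (Real.rpow_pos_of_pos two_pos _).ne'

theorem blocksOf_iff_unscale {x : ℤ → LpC n p} {T : TDist n} :
    BlocksOf ψ (n / p - 1) x T ↔ ∀ j, emb (unscale x j) = block ψ j T := by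
  refine forall_congr' fun j => ?_
  rw [unscale, emb_real_smul, Real.rpow_neg two_pos.le, Complex.ofReal_inv,
    inv_smul_eq_iff₀ (two_rpow_ofReal_ne_zero _)]

theorem distLpNorm_smul {c : ℂ} (hc : c ≠ 0) (T : TDist n) :
    distLpNorm p (c • T) = ‖c‖ₑ * distLpNorm p T := by
  have key : ∀ {c : ℂ} (_ : c ≠ 0) (T : TDist n), distLpNorm p (c • T) ≤ ‖c‖ₑ * distLpNorm p T := by
    intro c hc T
    by_cases h : distLpNorm p T < ⊤
    · obtain ⟨x, rfl⟩ := exists_emb_eq h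
      rw [← map_smul, distLpNorm_emb, distLpNorm_emb, enorm_smul]
    · rw [not_lt_top_iff.1 h, ENNReal.mul_top (enorm_ne_zero.2 hc)]
      exact le_top
  refine le_antisymm (key hc T) ?_
  have h1 := key (inv_ne_zero hc) (c • T)
  rw [inv_smul_smul₀ hc] at h1
  calc _ ≤ ‖c‖ₑ * (‖c⁻¹‖ₑ * distLpNorm p (c • T)) := by gcongr
    _ = _ := by
      rw [← mul_assoc, ← enorm_mul, mul_inv_cancel₀ hc]
      simp

theorem dyadicWeight_eq_enorm (s : ℝ) (j : ℤ) :
    dyadicWeight s j = ‖(((2 : ℝ) ^ (s * (j : ℝ)) : ℝ) : ℂ)‖ₑ := by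
  rw [dyadicWeight, ← ofReal_norm, Complex.norm_real, Real.norm_of_nonneg (by positivity)]

theorem weight_mul_distLpNorm (s : ℝ) (j : ℤ) (T : TDist n) :
    dyadicWeight s j * distLpNorm p T =
      distLpNorm p ((((2 : ℝ) ^ (s * (j : ℝ)) : ℝ) : ℂ) • T) := by
  rw [distLpNorm_smul (two_rpow_ofReal_ne_zero _), dyadicWeight_eq_enorm]

theorem BlocksOf.weight_mul {s : ℝ} {x : ℤ → LpC n p} {T : TDist n} (h : BlocksOf ψ s x T) (j : ℤ) :
    dyadicWeight s j * distLpNorm p (block ψ j T) = ‖x j‖ₑ := by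
  rw [weight_mul_distLpNorm, ← h j, distLpNorm_emb]

theorem BlocksOf.besovNorm_eq {s : ℝ} {q : ℝ≥0∞} {x : ℤ → LpC n p} {T : TDist n}
    (h : BlocksOf ψ s x T) : besovNorm ψ s p q T = lqNorm q fun j => ‖x j‖ₑ := by
  unfold besovNorm
  congr 1
  funext j
  exact h.weight_mul j

theorem exists_blocksOf {s : ℝ} {q : ℝ≥0∞} (hq : 1 ≤ q) {T : TDist n}
    (h : besovNorm ψ s p q T < ⊤) : ∃ x : ℤ → LpC n p, BlocksOf ψ s x T := by
  choose x hx using fun j : ℤ => exists_emb_eq (p := p)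
    (T := (((2 : ℝ) ^ (s * (j : ℝ)) : ℝ) : ℂ) • block ψ j T) (by
      rw [← weight_mul_distLpNorm]
      exact (le_lqNorm hq _ j).trans_lt h)
  exact ⟨x, hx⟩

theorem BlocksOf.sub {s : ℝ} {x y : ℤ → LpC n p} {S T : TDist n} (hx : BlocksOf ψ s x S)
    (hy : BlocksOf ψ s y T) : BlocksOf ψ s (x - y) (S - T) := fun j => by
  rw [Pi.sub_apply, map_sub, hx j, hy j, block_eq_FM, block_eq_FM, block_eq_FM]
  change _ = _ • TemperedDistribution.fourierMultiplierCLM ℂ (lpSym ψ j) (S - T)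
  rw [map_sub, smul_sub]

theorem BlocksOf.eqModPoly {s : ℝ} {x : ℤ → LpC n p} {S T : TDist n} (hψ : IsLittlewoodPaley ψ)
    (hS : BlocksOf ψ s x S) (hT : BlocksOf ψ s x T) : EqModPoly S T :=
  eqModPoly_of_blocks hψ fun j =>
    smul_right_injective _ (two_rpow_ofReal_ne_zero (s * (j : ℝ))) ((hS j).symm.trans (hT j))

theorem convLp_fat_of_unscale {x : ℤ → LpC n p} {j : ℤ}
    (h : convLp (fatSym ψ j) (unscale x j) = unscale x j) : convLp (fatSym ψ j) (x j) = x j := by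
  rw [unscale, convLp_real_smul] at h
  exact smul_right_injective _ (Real.rpow_pos_of_pos two_pos _).ne' h

/-- Test with φ and move the symbol of 2^{-j} ∂_m Δ_j onto it: the defining series of M becomes the
double series for the products W, and the powers of 2 match through (n/p - 3) + 1 = n/p - 2. -/
theorem blocksOf_sum (hψ : IsLittlewoodPaley ψ) {M : BilinearBlocks (Fld n p)}
    (hM : ∀ j k l u v i, M.toFun j k l u v i =
      (2 : ℝ) ^ ((n / p - 2) * (j : ℝ) - (n / p - 1) * (k : ℝ) - (n / p - 1) * (l : ℝ)) •
        ∑ m, convLp (derSym ψ m j) (prodBlk ψ k l (u i) (v m)))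
    {x : ℤ → Fld n p} {B : ℝ} (hx : ∀ k, ‖x k‖ ≤ B)
    (hfat : ∀ i j, convLp (fatSym ψ j) (x j i) = x j i) {W : Fin n → Fin n → TDist n}
    (hW : ∀ i m (φ : 𝓢(Space n, ℂ)), HasSum (fun kl : ℤ × ℤ =>
      ∫ y, unscale (fun k => x k i) kl.1 y * unscale (fun k => x k m) kl.2 y * φ y) (W i m φ))
    (i : Fin n) : BlocksOf ψ (n / p - 3) (fun j => M.sum x x j i) (matDiv W i) := by
  intro j
  refine TDist.ext fun φ => ?_
  have h1 : HasSum (fun kl : ℤ × ℤ => emb (M.toFun j kl.1 kl.2 (x kl.1) (x kl.2) i) φ)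
      (emb (M.sum x x j i) φ) := by
    have h2 := (BilinearBlocks.summable_term (M := M) hx hx j).hasSum
    have h3 := (((pairLp φ).restrictScalars ℝ).comp
      (ContinuousLinearMap.proj (R := ℝ) (φ := fun _ : Fin n => LpC n p) i)).hasSum h2
    exact h3
  set Φ : Fin n → 𝓢(Space n, ℂ) := fun m => 𝓕 (SchwartzMap.smulLeftCLM ℂ (derSym ψ m j) (𝓕⁻ φ))
  set c : ℂ := (((2 : ℝ) ^ ((n / p - 2) * (j : ℝ)) : ℝ) : ℂ)
  have hterm : ∀ kl : ℤ × ℤ, emb (M.toFun j kl.1 kl.2 (x kl.1) (x kl.2) i) φ =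
      ∑ m, c * ∫ y, unscale (fun k => x k i) kl.1 y * unscale (fun k => x k m) kl.2 y * Φ m y := by
    rintro ⟨k, l⟩
    rw [hM, emb_real_smul, map_sum, smul_apply, sum_apply, Finset.smul_sum]
    refine Finset.sum_congr rfl fun m _ => ?_
    rw [emb_convLp (hψ.isSchwartz_der m j), FM_apply, (isRep_emb _ _).2, smul_eq_mul,
      sub_sub, Real.rpow_sub two_pos, div_eq_mul_inv, Complex.ofReal_mul, mul_assoc]
    congr 1
    rw [← integral_const_mul]
    refine integral_congr_ae ?_
    filter_upwards [hψ.coeFn_prodBlk k l (x k i) (x l m),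
      Lp.coeFn_smul ((2 : ℝ) ^ (-((n / p - 1) * (k : ℝ)))) (x k i),
      Lp.coeFn_smul ((2 : ℝ) ^ (-((n / p - 1) * (l : ℝ)))) (x l m)] with y e1 e2 e3
    rw [e1, hfat, hfat]
    simp only [unscale]
    rw [e2, e3, Pi.smul_apply, Pi.smul_apply, Complex.real_smul, Complex.real_smul, ← Real.rpow_neg
      two_pos.le, neg_add, Real.rpow_add two_pos, Complex.ofReal_mul]
    ring
  have h4 : HasSum (fun kl : ℤ × ℤ => emb (M.toFun j kl.1 kl.2 (x kl.1) (x kl.2) i) φ)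
      (∑ m, c * W i m (Φ m)) := by
    simp only [hterm]
    exact hasSum_sum fun m _ => (hW i m (Φ m)).mul_left c
  rw [h1.unique h4, matDiv, smul_apply, block_eq_FM, FM, map_sum, sum_apply, smul_eq_mul,
    Finset.mul_sum]
  refine Finset.sum_congr rfl fun m _ => ?_
  have e5 : FM (lpSym ψ j) (∂_{(EuclideanSpace.single m (1 : ℝ) : Space n)} (W i m)) =
      (((2 : ℝ) ^ j : ℝ) : ℂ) • FM (derSym ψ m j) (W i m) := by
    rw [lineDeriv_eq_FM, FM_FM (hψ.isSchwartz j).hasTemperateGrowth (hasTemperateGrowth_coord m),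
      ← derSym_eq, FM_smul (hψ.isSchwartz_der m j).hasTemperateGrowth]
  have e6 := congrArg (fun T : TDist n => T φ) e5
  rw [show (TemperedDistribution.fourierMultiplierCLM ℂ (lpSym ψ j))
    (∂_{(EuclideanSpace.single m (1 : ℝ) : Space n)} (W i m)) φ = _ from e6, smul_apply, FM_apply,
    smul_eq_mul, ← mul_assoc]
  congr 1
  rw [← Complex.ofReal_mul, ← Real.rpow_intCast, ← Real.rpow_add two_pos,
    show (n / p - 3) * (j : ℝ) + j = (n / p - 2) * (j : ℝ) by ring]

/-- Pairing with φ is a continuous functional on L^p and commutes with the Bochner integral. The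
widened cutoff in the kernel is invisible on a genuine block, and 4^j · 2^{(n/p-3)j} = 2^{(n/p-1)j}.
-/
theorem duhamel_pair (hψ : IsLittlewoodPaley ψ) {H : DuhamelKernel (Fld n p)}
    (hH : ∀ j σ, H.toFun j σ = ((4 : ℝ) ^ j) • heatMat ψ leraySym j σ) {q : ℝ≥0∞} (hq : 1 ≤ q)
    {F : ℝ → ℤ → Fld n p} (hF : AdmPath q F) {G : ℝ → VDist n}
    (hG : ∀ τ, 0 < τ → ∀ k, BlocksOf ψ (n / p - 3) (fun j => F τ j k) (G τ k)) {t : ℝ} (ht : 0 ≤ t)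
    (j : ℤ) (i : Fin n) (φ : 𝓢(Space n, ℂ)) :
    IntervalIntegrable (fun τ => heat (t - τ) (lerayBlock ψ j (G τ) i) φ) volume 0 t ∧
    emb (H.duhamel F t j i) φ = (((2 : ℝ) ^ ((n / p - 1) * (j : ℝ)) : ℝ) : ℂ) *
      ∫ τ in (0 : ℝ)..t, heat (t - τ) (lerayBlock ψ j (G τ) i) φ := by
  set c : ℂ := (((2 : ℝ) ^ ((n / p - 1) * (j : ℝ)) : ℝ) : ℂ)
  have hc : c ≠ 0 := two_rpow_ofReal_ne_zero _
  set L : Fld n p →L[ℝ] ℂ := ((pairLp φ).restrictScalars ℝ).comp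
      (ContinuousLinearMap.proj (R := ℝ) (φ := fun _ : Fin n => LpC n p) i)
  have hi := H.intervalIntegrable_integrand hq hF j ht
  have e : ∀ τ ∈ uIoc 0 t, L (H.toFun j (t - τ) (F τ j)) =
      c * heat (t - τ) (lerayBlock ψ j (G τ) i) φ := by
    intro τ hτ
    rw [uIoc_of_le ht] at hτ
    rw [heat_lerayBlock hψ j (by linarith [hτ.2]), lerayHeat, sum_apply, hH]
    change emb (((4 : ℝ) ^ j) • heatMat ψ leraySym j (t - τ) (F τ j) i) φ = _
    rw [emb_real_smul, heatMat, matOp_apply, map_sum, smul_apply, sum_apply, smul_eq_mul,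
      Finset.mul_sum, Finset.mul_sum]
    refine Finset.sum_congr rfl fun k _ => ?_
    have hA := (isAnnular_mul_leraySym (hψ.isAnnular_fat j) i k).mul_heatSym (t - τ)
    have e1 : FM (fatSym ψ j * leraySym i k * heatSym (t - τ)) (block ψ j (G τ k)) =
        FM (lpSym ψ j * leraySym i k * heatSym (t - τ)) (G τ k) := by
      rw [block_eq_FM, FM_FM hA.isSchwartz.hasTemperateGrowth (hψ.isSchwartz j).hasTemperateGrowth]
      rw [show fatSym ψ j * leraySym i k * heatSym (t - τ) * lpSym ψ j =
        fatSym ψ j * lpSym ψ j * leraySym i k * heatSym (t - τ) by ring, hψ.fatSym_mul_lpSym hψ j]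
    rw [emb_convLp hA.isSchwartz, hG τ hτ.1 k j, FM, map_smul, smul_apply, smul_eq_mul]
    rw [show (TemperedDistribution.fourierMultiplierCLM ℂ (fatSym ψ j * leraySym i k *
      heatSym (t - τ))) (block ψ j (G τ k)) = _ from e1, ← mul_assoc, ← Complex.ofReal_mul]
    congr 2
    rw [show (4 : ℝ) ^ j = (2 : ℝ) ^ (2 * (j : ℝ)) by
      rw [Real.rpow_mul two_pos.le, Real.rpow_intCast]; norm_num, ← Real.rpow_add two_pos]
    congr 1
    ring
  have h1 : IntervalIntegrable (fun τ => L (H.toFun j (t - τ) (F τ j))) volume 0 t :=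
    ⟨L.integrable_comp hi.1, L.integrable_comp hi.2⟩
  refine ⟨?_, ?_⟩
  · have h2 := (h1.congr e).const_mul c⁻¹
    simpa only [inv_mul_cancel_left₀ hc] using h2
  · change L (H.duhamel F t j) = _
    rw [DuhamelKernel.duhamel, ← L.intervalIntegral_comp_comm hi,
      intervalIntegral.integral_congr_ae (Eventually.of_forall e),
      intervalIntegral.integral_const_mul]

end Transfer

/-! ### Besov norms and sequence norms -/

section Glue

variable {p : ℝ} [hp : Fact (1 ≤ ENNReal.ofReal p)] {ψ : Space n → ℝ} {s : ℝ} {q : ℝ≥0∞}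

theorem enorm_apply_le (x : Fld n p) (i : Fin n) : ‖x i‖ₑ ≤ ‖x‖ₑ := by
  rw [← ofReal_norm, ← ofReal_norm]
  exact ENNReal.ofReal_le_ofReal (norm_le_pi_norm x i)

theorem enorm_le_sum (x : Fld n p) : ‖x‖ₑ ≤ ∑ i, ‖x i‖ₑ := by
  simp only [← ofReal_norm]
  rw [← ENNReal.ofReal_sum_of_nonneg fun i _ => norm_nonneg _]
  refine ENNReal.ofReal_le_ofReal ((pi_norm_le_iff_of_nonneg
    (Finset.sum_nonneg fun i _ => norm_nonneg _)).2 fun i => ?_)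
  exact Finset.single_le_sum (f := fun i => ‖x i‖) (fun i _ => norm_nonneg _) (Finset.mem_univ i)

theorem vBesovNorm_eq {x : ℤ → Fld n p} {v : VDist n}
    (h : ∀ i, BlocksOf ψ s (fun j => x j i) (v i)) :
    vBesovNorm ψ s p q v = ∑ i, lqNorm q fun j => ‖x j i‖ₑ :=
  Finset.sum_congr rfl fun i _ => (h i).besovNorm_eq

theorem vBesovNorm_le {x : ℤ → Fld n p} {v : VDist n}
    (h : ∀ i, BlocksOf ψ s (fun j => x j i) (v i)) :
    vBesovNorm ψ s p q v ≤ n * lqNorm q fun j => ‖x j‖ₑ := by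
  rw [vBesovNorm_eq h]
  refine (Finset.sum_le_card_nsmul _ _ (lqNorm q fun j => ‖x j‖ₑ) fun i _ =>
    lqNorm_mono fun j => enorm_apply_le _ _).trans_eq ?_
  simp

theorem le_vBesovNorm (hq : 1 ≤ q) {x : ℤ → Fld n p} {v : VDist n}
    (h : ∀ i, BlocksOf ψ s (fun j => x j i) (v i)) :
    lqNorm q (fun j => ‖x j‖ₑ) ≤ vBesovNorm ψ s p q v := by
  rw [vBesovNorm_eq h]
  exact (lqNorm_mono fun j => enorm_le_sum (x j)).trans (lqNorm_finset_sum_le hq _ _)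

theorem exists_blocksOf_field (hq : 1 ≤ q) {v : VDist n} (h : vBesovNorm ψ s p q v < ⊤) :
    ∃ x : ℤ → Fld n p, ∀ i, BlocksOf ψ s (fun j => x j i) (v i) := by
  choose x hx using fun i => exists_blocksOf (p := p) hq
    ((ENNReal.sum_lt_top (f := fun i => besovNorm ψ s p q (v i)) (s := Finset.univ)).1 h i
      (Finset.mem_univ i))
  exact ⟨fun j i => x i j, hx⟩

/-- A strict superlevel set would be a neighbourhood and would have positive measure. It reconciles
the essential supremum in `tildeNorm` with the supremum in `pathNorm`. -/
theorem le_essSup_of_continuousOn {f : ℝ → ℝ≥0∞} (hf : ContinuousOn f (Ioi 0)) {t : ℝ} (ht : 0 < t) :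
    f t ≤ essSup f (volume.restrict (Ioi 0)) := by
  by_contra hlt
  rw [not_le] at hlt
  have h1 : ∀ᶠ x in 𝓝 t, essSup f (volume.restrict (Ioi 0)) < f x :=
    (hf.continuousAt (Ioi_mem_nhds ht)).eventually (lt_mem_nhds hlt)
  have h2 : {x | essSup f (volume.restrict (Ioi 0)) < f x} ∩ Ioi 0 ∈ 𝓝 t :=
    inter_mem h1 (Ioi_mem_nhds ht)
  have h3 := ae_le_essSup (f := f) (μ := volume.restrict (Ioi (0 : ℝ)))
  rw [ae_restrict_iff' measurableSet_Ioi] at h3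
  have h4 : volume ({x | essSup f (volume.restrict (Ioi 0)) < f x} ∩ Ioi 0) = 0 := by
    refine measure_mono_null (fun x hx => ?_) (ae_iff.1 h3)
    simp only [mem_ofPred_eq, not_forall, not_le]
    exact ⟨hx.2, hx.1⟩
  exact (Measure.measure_pos_of_mem_nhds volume h2).ne' h4

/-- Continuity in the Besov norm controls every weighted block at once, since ℓ^q embeds in ℓ^∞;
this is the uniformity over frequencies in `AdmPath`. -/
theorem exists_admPath_of_memTildeC (hq : 1 ≤ q) {F : ℝ → VDist n}
    (hF : MemTildeC ψ (Ioi 0) s p q F) : ∃ x : ℝ → ℤ → Fld n p, AdmPath q x ∧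
      pathNorm q (Ioi 0) x ≤ tildeNorm ψ (Ioi 0) s p q F ∧
      ∀ t, 0 < t → ∀ i, BlocksOf ψ s (fun j => x t j i) (F t i) := by
  have hex : ∀ t, ∃ y : ℤ → Fld n p, 0 < t → ∀ i, BlocksOf ψ s (fun j => y j i) (F t i) := fun t => by
    by_cases ht : 0 < t
    · obtain ⟨y, hy⟩ := exists_blocksOf_field hq (hF.mem t ht)
      exact ⟨y, fun _ => hy⟩
    · exact ⟨0, fun h => absurd h ht⟩
  choose x hx using hex
  have hcont : ∀ t₀, 0 < t₀ → ∀ ε > 0, ∀ᶠ t in 𝓝 t₀, ∀ j, ‖x t j - x t₀ j‖ ≤ ε := by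
    intro t₀ h₀ ε hε
    have h1 := hF.continuous t₀ h₀
    rw [isOpen_Ioi.nhdsWithin_eq h₀] at h1
    filter_upwards [(ENNReal.tendsto_nhds_zero.1 h1) (ENNReal.ofReal ε) (by simpa using hε),
      Ioi_mem_nhds h₀] with t h2 h3 j
    have h4 := le_vBesovNorm (q := q) hq (x := x t - x t₀) (v := F t - F t₀)
      fun i => (hx t h3 i).sub (hx t₀ h₀ i)
    have h5 := (le_lqNorm hq (fun j => ‖(x t - x t₀) j‖ₑ) j).trans (h4.trans h2)
    rw [← ofReal_norm] at h5
    exact (ENNReal.ofReal_le_ofReal_iff hε.le).1 h5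
  have hc : ∀ j, ContinuousOn (fun t => x t j) (Ioi 0) := by
    intro j t₀ h₀
    refine ContinuousAt.continuousWithinAt ?_
    rw [ContinuousAt, Metric.tendsto_nhds]
    intro ε hε
    filter_upwards [hcont t₀ h₀ (ε / 2) (by positivity)] with t ht
    rw [dist_eq_norm]
    linarith [ht j]
  have hle : pathNorm q (Ioi 0) x ≤ tildeNorm ψ (Ioi 0) s p q F := by
    refine (lqNorm_mono fun j => iSup₂_le fun t ht => ?_).trans (lqNorm_finset_sum_le hq _ _)
    refine (enorm_le_sum _).trans (Finset.sum_le_sum fun i _ => ?_)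
    have hci : ContinuousOn (fun t => ‖x t j i‖ₑ) (Ioi 0) :=
      continuous_enorm.comp_continuousOn ((continuous_apply i).comp_continuousOn (hc j))
    refine (le_essSup_of_continuousOn hci ht).trans_eq ?_
    rw [← ENNReal.essSup_const_mul]
    refine essSup_congr_ae ?_
    filter_upwards [ae_restrict_mem measurableSet_Ioi] with r hr
    exact ((hx r hr i).weight_mul j).symm
  exact ⟨x, ⟨hle.trans_lt hF.bounded, hcont⟩, hle, hx⟩

theorem tendsto_vBesovNorm_zero (hq : 1 ≤ q) (hq' : q ≠ ⊤) {l : Filter ℝ} [l.IsCountablyGenerated]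
    {y : ℝ → ℤ → Fld n p} {D : ℝ → VDist n}
    (hD : ∀ᶠ t in l, ∀ i, BlocksOf ψ s (fun j => y t j i) (D t i)) {d : ℤ → ℝ≥0∞}
    (hd : lqNorm q d < ⊤) (hyd : ∀ᶠ t in l, ∀ j, ‖y t j‖ₑ ≤ d j)
    (hy : ∀ j, Tendsto (fun t => y t j) l (𝓝 0)) :
    Tendsto (fun t => vBesovNorm ψ s p q (D t)) l (𝓝 0) := by
  have h1 := tendsto_lqNorm_zero hq hq' hd hyd fun j => tendsto_zero_iff_enorm_tendsto_zero.1 (hy j)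
  have h2 := ENNReal.Tendsto.const_mul (a := (n : ℝ≥0∞)) h1 (Or.inr (by simp))
  rw [mul_zero] at h2
  refine tendsto_of_tendsto_of_tendsto_of_le_of_le' tendsto_const_nhds h2
    (Eventually.of_forall fun _ => zero_le) ?_
  filter_upwards [hD] with t ht
  exact vBesovNorm_le ht

theorem tildeNorm_le {x : ℝ → ℤ → Fld n p} {T : ℝ → VDist n}
    (hT : ∀ t, 0 < t → ∀ i, BlocksOf ψ s (fun j => x t j i) (T t i)) :
    tildeNorm ψ (Ioi 0) s p q T ≤ n * pathNorm q (Ioi 0) x := by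
  refine (Finset.sum_le_card_nsmul _ _ (pathNorm q (Ioi 0) x) fun i _ =>
    lqNorm_mono fun j => ?_).trans_eq (by simp)
  rw [← ENNReal.essSup_const_mul]
  refine essSup_le_of_ae_le _ ?_
  filter_upwards [ae_restrict_mem measurableSet_Ioi] with t ht
  rw [(hT t ht i).weight_mul j]
  exact (enorm_apply_le _ _).trans (le_iSup₂ (f := fun t (_ : t ∈ Ioi 0) => ‖x t j‖ₑ) t ht)

theorem iSup_enorm_lt_top {x : ℤ → Fld n p} {d : ℤ → ℝ≥0∞} (hd : lqNorm q d < ⊤)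
    (h : ∀ j, ‖x j‖ₑ ≤ d j) {v : VDist n} (hv : ∀ i, BlocksOf ψ s (fun j => x j i) (v i)) :
    vBesovNorm ψ s p q v < ⊤ :=
  (vBesovNorm_le hv).trans_lt (ENNReal.mul_lt_top (by simp) ((lqNorm_mono h).trans_lt hd))

/-- For q = ∞ continuity uniform in j is continuity in norm. For q < ∞ each block is continuous and
dominated by its supremum in time, and dominated convergence in ℓ^q applies. -/
theorem continuous_of_admPath (hq : 1 ≤ q) {x : ℝ → ℤ → Fld n p} (hx : AdmPath q x)
    {T : ℝ → VDist n} (hT : ∀ t, 0 < t → ∀ i, BlocksOf ψ s (fun j => x t j i) (T t i))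
    {t₀ : ℝ} (h₀ : 0 < t₀) :
    Tendsto (fun t => vBesovNorm ψ s p q (T t - T t₀)) (𝓝 t₀) (𝓝 0) := by
  have hD : ∀ᶠ t in 𝓝 t₀, ∀ i, BlocksOf ψ s (fun j => (x t - x t₀) j i) ((T t - T t₀) i) := by
    filter_upwards [Ioi_mem_nhds h₀] with t ht i
    exact (hT t ht i).sub (hT t₀ h₀ i)
  by_cases hq' : q = ⊤
  · rw [ENNReal.tendsto_nhds_zero]
    intro ε hε
    obtain ⟨δ, hδ, hδε⟩ : ∃ δ : ℝ, 0 < δ ∧ (n : ℝ≥0∞) * ENNReal.ofReal δ ≤ ε := by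
      by_cases hε' : ε = ⊤
      · exact ⟨1, one_pos, by simp [hε']⟩
      · refine ⟨ε.toReal / (n + 1), by have := ENNReal.toReal_pos hε.ne' hε'; positivity, ?_⟩
        rw [← ENNReal.ofReal_natCast, ← ENNReal.ofReal_mul (by positivity)]
        refine ENNReal.ofReal_le_of_le_toReal ?_
        rw [mul_div_assoc', div_le_iff₀ (by positivity), mul_comm]
        have : 0 ≤ ε.toReal := ENNReal.toReal_nonneg
        nlinarith
    filter_upwards [hD, hx.cont t₀ h₀ δ hδ] with t h1 h2
    refine (vBesovNorm_le h1).trans (le_trans ?_ hδε)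
    gcongr
    rw [lqNorm, if_pos hq']
    refine iSup_le fun j => ?_
    rw [← ofReal_norm]
    exact ENNReal.ofReal_le_ofReal (h2 j)
  · refine tendsto_vBesovNorm_zero hq hq' hD
      (d := fun j => (⨆ t ∈ Ioi 0, ‖x t j‖ₑ) + (⨆ t ∈ Ioi 0, ‖x t j‖ₑ)) ?_ ?_ ?_
    · exact (lqNorm_add_le hq _ _).trans_lt (ENNReal.add_lt_top.2 ⟨hx.bounded, hx.bounded⟩)
    · filter_upwards [Ioi_mem_nhds h₀] with t ht j
      refine enorm_sub_le.trans (add_le_add ?_ ?_)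
      · exact le_iSup₂ (f := fun t (_ : t ∈ Ioi 0) => ‖x t j‖ₑ) t ht
      · exact le_iSup₂ (f := fun t (_ : t ∈ Ioi 0) => ‖x t j‖ₑ) t₀ h₀
    · intro j
      have h1 := (hx.continuousOn j).continuousAt (Ioi_mem_nhds h₀)
      have h2 := h1.tendsto.sub_const (x t₀ j)
      simpa using h2

theorem memTildeC_of_admPath (hq : 1 ≤ q) {x : ℝ → ℤ → Fld n p} (hx : AdmPath q x)
    {T : ℝ → VDist n} (hT : ∀ t, 0 < t → ∀ i, BlocksOf ψ s (fun j => x t j i) (T t i)) :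
    MemTildeC ψ (Ioi 0) s p q T where
  mem t ht := iSup_enorm_lt_top (d := fun j => ⨆ t ∈ Ioi 0, ‖x t j‖ₑ) hx.bounded
    (fun j => le_iSup₂ (f := fun t (_ : t ∈ Ioi 0) => ‖x t j‖ₑ) t ht) (hT t ht)
  continuous t₀ h₀ := (continuous_of_admPath hq hx hT h₀).mono_left nhdsWithin_le_nhds
  bounded := (tildeNorm_le hT).trans_lt (ENNReal.mul_lt_top (by simp) hx.bounded)

theorem memTildeC_Ici_of_admPath (hq : 1 ≤ q) (hq' : q ≠ ⊤) {x : ℝ → ℤ → Fld n p}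
    (hx : AdmPath q x) {T : ℝ → VDist n}
    (hT : ∀ t, 0 < t → ∀ i, BlocksOf ψ s (fun j => x t j i) (T t i)) {x₀ : ℤ → Fld n p}
    (hx₀ : lqNorm q (fun j => ‖x₀ j‖ₑ) < ⊤) (hT₀ : ∀ i, BlocksOf ψ s (fun j => x₀ j i) (T 0 i))
    (hlim : ∀ j, Tendsto (fun t => x t j) (𝓝[>] 0) (𝓝 (x₀ j))) :
    MemTildeC ψ (Ici 0) s p q T where
  mem t ht := by
    rcases eq_or_lt_of_le (mem_Ici.1 ht) with rfl | ht
    · exact iSup_enorm_lt_top hx₀ (fun j => le_rfl) hT₀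
    · exact (memTildeC_of_admPath hq hx hT).mem t ht
  continuous t₀ h₀ := by
    rcases eq_or_lt_of_le (mem_Ici.1 h₀) with rfl | h₀
    · have key : Tendsto (fun t => vBesovNorm ψ s p q (T t - T 0)) (𝓝[>] 0) (𝓝 0) := by
        refine tendsto_vBesovNorm_zero hq hq' (y := fun t => x t - x₀)
          (d := fun j => (⨆ t ∈ Ioi 0, ‖x t j‖ₑ) + ‖x₀ j‖ₑ) ?_ ?_ ?_ ?_
        · filter_upwards [self_mem_nhdsWithin] with t ht i
          exact (hT t ht i).sub (hT₀ i)
        · exact (lqNorm_add_le hq _ _).trans_lt (ENNReal.add_lt_top.2 ⟨hx.bounded, hx₀⟩)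
        · filter_upwards [self_mem_nhdsWithin] with t ht j
          refine enorm_sub_le.trans (add_le_add ?_ le_rfl)
          exact le_iSup₂ (f := fun t (_ : t ∈ Ioi 0) => ‖x t j‖ₑ) t ht
        · intro j
          have := (hlim j).sub_const (x₀ j)
          simpa using this
      rw [← Ioi_insert, nhdsWithin_insert, tendsto_sup]
      refine ⟨?_, key⟩
      rw [tendsto_pure_left]
      intro S hS
      have e : vBesovNorm ψ s p q (T 0 - T 0) = 0 := by
        have h1 := vBesovNorm_le (q := q) (x := x₀ - x₀) (v := T 0 - T 0)
          fun i => (hT₀ i).sub (hT₀ i)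
        simp only [sub_self, Pi.zero_apply, enorm_zero, lqNorm_zero hq, mul_zero] at h1
        simpa using h1
      rw [e]
      exact mem_of_mem_nhds hS
    · exact (continuous_of_admPath hq hx hT h₀).mono_left nhdsWithin_le_nhds
  bounded := by
    have := (memTildeC_of_admPath hq hx hT).bounded
    unfold tildeNorm at this ⊢
    rwa [Measure.restrict_congr_set (Ioi_ae_eq_Ici (a := (0 : ℝ)) (μ := volume)).symm]

end Glue

/-! ### The heat flow of the initial datum -/

section HeatPart

variable {p : ℝ} [hp : Fact (1 ≤ ENNReal.ofReal p)] {ψ : Space n → ℝ} {s : ℝ} {q : ℝ≥0∞}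

/-- The symbol of the identity matrix. -/
def idSym (i k : Fin n) (_ : Space n) : ℂ := if i = k then 1 else 0

/-- The heat flow of a sequence of blocks. -/
def heatPart (ψ : Space n → ℝ) (x : ℤ → Fld n p) (t : ℝ) (j : ℤ) : Fld n p :=
  heatMat ψ idSym j t (x j)

theorem contDiffOn_idSym (i k : Fin n) : ContDiffOn ℝ ∞ (idSym i k) {0}ᶜ := contDiffOn_const

theorem heatPart_apply (x : ℤ → Fld n p) (t : ℝ) (j : ℤ) (i : Fin n) :
    heatPart ψ x t j i = convLp (fatSym ψ j * heatSym t) (x j i) := by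
  rw [heatPart, heatMat, matOp_apply, Finset.sum_eq_single i]
  · congr 2
    have : (idSym i i : Space n → ℂ) = 1 := by ext; simp [idSym]
    rw [this, mul_one]
  · intro k _ hk
    have : (idSym i k : Space n → ℂ) = 0 := by ext; simp [idSym, hk.symm]
    apply emb_injective
    rw [this, mul_zero, zero_mul, emb_convLp IsAnnular.zero.isSchwartz, FM_zero, map_zero]
  · simp

theorem emb_heatPart (hψ : IsLittlewoodPaley ψ) {x : ℤ → Fld n p} {a : VDist n}
    (hx : ∀ i, BlocksOf ψ s (fun j => x j i) (a i)) {t : ℝ} (ht : 0 ≤ t) (j : ℤ) (i : Fin n) :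
    emb (heatPart ψ x t j i) =
      (((2 : ℝ) ^ (s * (j : ℝ)) : ℝ) : ℂ) • heat t (block ψ j (a i)) := by
  have hA := (hψ.isAnnular_fat j).mul_heatSym t
  rw [heatPart_apply, emb_convLp hA.isSchwartz, hx i j, heat_eq_FM, block_eq_FM, FM, map_smul]
  congr 1
  have e1 : FM (fatSym ψ j * heatSym t) (FM (lpSym ψ j) (a i)) =
      FM (heatSym t) (FM (lpSym ψ j) (a i)) := by
    rw [FM_FM hA.isSchwartz.hasTemperateGrowth (hψ.isSchwartz j).hasTemperateGrowth,
      FM_FM (hasTemperateGrowth_heatSym ht) (hψ.isSchwartz j).hasTemperateGrowth, mul_right_comm,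
      hψ.fatSym_mul_lpSym hψ, mul_comm]
  exact e1

theorem exists_heatPart_bound (hψ : IsLittlewoodPaley ψ) : ∃ C : ℝ, 0 < C ∧ ∀ x : ℤ → Fld n p,
    (∀ t, 0 ≤ t → ∀ j, ‖heatPart ψ x t j‖ ≤ C / (1 + (4 : ℝ) ^ j * t) ^ 2 * ‖x j‖) ∧
    (∀ r t, 0 < r → r ≤ t → ∀ j, ‖heatPart ψ x t j - heatPart ψ x r j‖ ≤ C * ((t - r) / r) * ‖x j‖) := by
  obtain ⟨C, hC, h1, h2⟩ := exists_heatMat_bound (p := p) hψ contDiffOn_idSym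
    (fun i k c _ ξ => rfl)
  refine ⟨C, hC, fun x => ⟨fun t ht j => ?_, fun r t hr hrt j => ?_⟩⟩
  · refine ((heatMat ψ idSym j t).le_opNorm (x j)).trans ?_
    gcongr
    exact h1 j t ht
  · have e : heatPart ψ x t j - heatPart ψ x r j =
      (heatMat ψ idSym j t - heatMat ψ idSym j r : Fld n p →L[ℝ] Fld n p) (x j) := rfl
    rw [e]
    refine (ContinuousLinearMap.le_opNorm _ (x j)).trans ?_
    gcongr
    refine (h2 j r t hr.le hrt).trans ?_
    have h3 := DuhamelKernel.weight_le_inv (a := (4 : ℝ) ^ j) (by positivity) hr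
    have h4 : 0 ≤ t - r := sub_nonneg.2 hrt
    calc C * ((4 : ℝ) ^ j * (t - r)) / (1 + (4 : ℝ) ^ j * r) ^ 2
        = C * (t - r) * ((4 : ℝ) ^ j / (1 + (4 : ℝ) ^ j * r) ^ 2) := by ring
      _ ≤ C * (t - r) * (1 / r) := by gcongr
      _ = _ := by ring

/-- The relative modulus (t - r)/r is uniform in j, so the heat flow is continuous at positive times
for every q; each block decays like (1 + 4^j t)⁻². -/
theorem exists_admPath_heatPart (hψ : IsLittlewoodPaley ψ) (hq : 1 ≤ q) : ∃ C : ℝ, 0 < C ∧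
    ∀ x : ℤ → Fld n p, lqNorm q (fun j => ‖x j‖ₑ) < ⊤ → AdmPath q (heatPart ψ x) ∧
      pathNorm q (Ioi 0) (heatPart ψ x) ≤ ENNReal.ofReal C * lqNorm q (fun j => ‖x j‖ₑ) ∧
      ∀ j, Tendsto (fun t => heatPart ψ x t j) atTop (𝓝 0) := by
  obtain ⟨C, hC, h⟩ := exists_heatPart_bound (p := p) hψ
  refine ⟨C, hC, fun x hx => ?_⟩
  obtain ⟨h1, h2⟩ := h x
  have hle : pathNorm q (Ioi 0) (heatPart ψ x) ≤ ENNReal.ofReal C * lqNorm q (fun j => ‖x j‖ₑ) := by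
    rw [← lqNorm_const_mul hq]
    refine lqNorm_mono fun j => iSup₂_le fun t ht => ?_
    rw [← ofReal_norm, ← ofReal_norm, ← ENNReal.ofReal_mul hC.le]
    refine ENNReal.ofReal_le_ofReal ((h1 t (le_of_lt ht) j).trans ?_)
    have : 0 < t := ht
    gcongr
    refine div_le_self hC.le (one_le_pow₀ ?_)
    have : 0 ≤ (4 : ℝ) ^ j * t := by positivity
    linarith
  refine ⟨⟨hle.trans_lt (ENNReal.mul_lt_top ENNReal.ofReal_lt_top hx), ?_⟩, hle, fun j => ?_⟩
  · intro t₀ h₀ ε hε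
    set B := (lqNorm q fun j => ‖x j‖ₑ).toReal
    have hB : ∀ j, ‖x j‖ ≤ B := fun j => by
      rw [← toReal_enorm]
      exact ENNReal.toReal_mono hx.ne (le_lqNorm hq (fun j => ‖x j‖ₑ) j)
    have hB0 : 0 ≤ B := ENNReal.toReal_nonneg
    have hlim : Tendsto (fun t => C * (|t - t₀| / min t t₀) * B) (𝓝 t₀) (𝓝 0) := by
      have : ContinuousAt (fun t => C * (|t - t₀| / min t t₀) * B) t₀ := by
        refine (continuousAt_const.mul (ContinuousAt.div ?_ ?_ ?_)).mul continuousAt_const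
        · fun_prop
        · fun_prop
        · simpa using h₀.ne'
      simpa [ContinuousAt] using this
    filter_upwards [hlim.eventually (gt_mem_nhds hε), Ioi_mem_nhds h₀] with t h3 h4 j
    have h4 : 0 < t := h4
    refine le_trans ?_ h3.le
    rcases le_total t t₀ with hle | hle
    · rw [norm_sub_rev, min_eq_left hle, abs_sub_comm, abs_of_nonneg (sub_nonneg.2 hle)]
      refine (h2 t t₀ h4 hle j).trans ?_
      have := sub_nonneg.2 hle
      gcongr
      exact hB j
    · rw [min_eq_right hle, abs_of_nonneg (sub_nonneg.2 hle)]
      refine (h2 t₀ t h₀ hle j).trans ?_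
      have := sub_nonneg.2 hle
      gcongr
      exact hB j
  · have h4j : (0 : ℝ) < 4 ^ j := by positivity
    have hlim : Tendsto (fun t : ℝ => C / (1 + (4 : ℝ) ^ j * t) ^ 2 * ‖x j‖) atTop (𝓝 0) := by
      have h5 : Tendsto (fun t : ℝ => (1 + (4 : ℝ) ^ j * t) ^ 2) atTop atTop :=
        (tendsto_pow_atTop two_ne_zero).comp
          (tendsto_atTop_add_const_left _ _ (tendsto_id.const_mul_atTop h4j))
      simpa using (h5.const_div_atTop C).mul_const ‖x j‖
    refine squeeze_zero_norm' ?_ hlim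
    filter_upwards [eventually_ge_atTop 0] with t ht
    exact h1 t ht j

theorem tendsto_heatPart_initial (hψ : IsLittlewoodPaley ψ) {x : ℤ → Fld n p} {a : VDist n}
    (hx : ∀ i, BlocksOf ψ s (fun j => x j i) (a i)) (j : ℤ) :
    Tendsto (fun t => heatPart ψ x t j) (𝓝[>] 0) (𝓝 (x j)) := by
  have h0 : heatPart ψ x 0 j = x j := by
    funext i
    apply emb_injective
    rw [emb_heatPart hψ hx le_rfl, hx i j, heat_eq_FM, heatSym_zero, FM_one]
  have h1 := (continuousOn_heatMat (p := p) hψ contDiffOn_idSym (fun i k c _ ξ => rfl) j) 0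
    self_mem_Ici
  have h2 : Tendsto (fun t => heatPart ψ x t j) (𝓝[≥] 0) (𝓝 (heatPart ψ x 0 j)) :=
    (((ContinuousLinearMap.apply ℝ (Fld n p) (x j)).continuous.tendsto _).comp h1)
  rw [h0] at h2
  exact h2.mono_left (nhdsWithin_mono _ Ioi_subset_Ici_self)

/-- At a fixed frequency the kernel is bounded by a multiple of 4^j, so the integral is O(t). No
uniformity in j is claimed. -/
theorem tendsto_duhamel_initial (H : DuhamelKernel (Fld n p)) (hq : 1 ≤ q) {F : ℝ → ℤ → Fld n p}
    (hF : AdmPath q F) (j : ℤ) : Tendsto (fun t => H.duhamel F t j) (𝓝[>] 0) (𝓝 0) := by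
  set B := (pathNorm q (Ioi 0) F).toReal
  have hB : 0 ≤ B := ENNReal.toReal_nonneg
  have hC := H.C_pos
  have h4 : (0 : ℝ) < 4 ^ j := by positivity
  have hlim : Tendsto (fun t : ℝ => (4 : ℝ) ^ j * (H.C * B) * |t - 0|) (𝓝[>] 0) (𝓝 0) := by
    have : Tendsto (fun t : ℝ => (4 : ℝ) ^ j * (H.C * B) * |t - 0|) (𝓝 0) (𝓝 _) :=
      Continuous.tendsto (by fun_prop) 0
    simpa using this.mono_left nhdsWithin_le_nhds
  refine squeeze_zero_norm' ?_ hlim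
  filter_upwards [self_mem_nhdsWithin] with t ht
  have ht : 0 < t := ht
  refine intervalIntegral.norm_integral_le_of_norm_le_const fun τ hτ => ?_
  rw [uIoc_of_le ht.le] at hτ
  have hσ : 0 ≤ t - τ := by linarith [hτ.2]
  refine (H.norm_apply_le j hσ (hF.norm_le hq hτ.1 j)).trans ?_
  gcongr
  refine div_le_self h4.le (one_le_pow₀ ?_)
  have : 0 ≤ (4 : ℝ) ^ j * (t - τ) := by positivity
  linarith

end HeatPart

/-! ### The nonlinear term -/

section Nonlinear

variable {p : ℝ} [hp : Fact (1 ≤ ENNReal.ofReal p)] {ψ : Space n → ℝ} {q : ℝ≥0∞}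

/-- The scalar sequence of the component `i`, without weights. -/
def comp (y : ℤ → Fld n p) (i : Fin n) : ℤ → LpC n p := unscale fun j => y j i

theorem norm_comp_le {y : ℤ → Fld n p} {B : ℝ} (hy : ∀ k, ‖y k‖ ≤ B) (i : Fin n) (k : ℤ) :
    ‖y k i‖ ≤ B := (norm_le_pi_norm _ _).trans (hy k)

theorem tame_comp (hn : 3 ≤ n) (hpn : p < n) (hψ : IsLittlewoodPaley ψ) {y : ℤ → Fld n p} {B : ℝ}
    (hy : ∀ k, ‖y k‖ ≤ B) {i : Fin n} (hr : RealBlocks ψ (comp y i)) : Tame (comp y i) :=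
  tame_unscale hn hpn hψ (norm_comp_le hy i) hr.fat

theorem exists_realization_field (hn : 3 ≤ n) (hpn : p < n) (hψ : IsLittlewoodPaley ψ)
    {y : ℤ → Fld n p} {B : ℝ} (hy : ∀ k, ‖y k‖ ≤ B) (hr : ∀ i, RealBlocks ψ (comp y i)) :
    ∃ (T : VDist n) (W : Fin n → Fin n → TDist n),
      (∀ i, IsRealDist (T i)) ∧ (∀ i, BlocksOf ψ (n / p - 1) (fun j => y j i) (T i)) ∧
      (∀ i φ, HasSum (fun k => emb (comp y i k) φ) (T i φ)) ∧
      (∀ k l, IsProduct ψ (T k) (T l) (W k l)) ∧ (∀ k l, IsRealDist (W k l)) ∧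
      ∀ k l (φ : 𝓢(Space n, ℂ)), HasSum (fun ab : ℤ × ℤ =>
        ∫ x, comp y k ab.1 x * comp y l ab.2 x * φ x) (W k l φ) := by
  have ht := fun i => tame_comp hn hpn hψ hy (hr i)
  choose T g hg hg' hT using fun i => (ht i).exists_realization
  choose W hW using fun k l => (ht k).exists_product (ht l) (hg' k) (hg' l)
  have hb : ∀ i j, block ψ j (T i) = emb (comp y i j) := fun i j => (hr i).block_eq hψ (hT i) j
  have hreal : ∀ i, IsRealDist (T i) := fun i =>
    (hr i).isRealDist hn hpn hψ (norm_comp_le hy i) (hT i)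
  refine ⟨T, W, hreal, fun i => blocksOf_iff_unscale.2 fun j => (hb i j).symm, hT,
    fun k l => ?_, fun k l φ hφ => ?_, fun k l φ => (hW k l φ).2.2⟩
  · exact (isProduct_iff (hb k) (hb l) (fun a b φ => (hW k l φ).2.1 a b)
      fun φ => (hW k l φ).2.2.summable).2 fun φ => (hW k l φ).2.2
  · rw [(hW k l φ).1]
    have h1 : ∀ᵐ x, g k x * g l x * φ x = (((g k x).re * (g l x).re * (φ x).re : ℝ) : ℂ) := by
      filter_upwards [(hreal k).rep (hg k), (hreal l).rep (hg l)] with x h2 h3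
      apply Complex.ext <;> simp [h2, h3, hφ x]
    rw [integral_congr_ae h1, integral_complex_ofReal, Complex.ofReal_im]

/-- The given field may differ from the canonical realization by a polynomial, but `IsProduct` sees
only its blocks, so the product is the absolutely convergent double series. -/
theorem hasSum_of_isProduct (hn : 3 ≤ n) (hpn : p < n) (hψ : IsLittlewoodPaley ψ)
    {y : ℤ → Fld n p} {B : ℝ} (hy : ∀ k, ‖y k‖ ≤ B) (hr : ∀ i, RealBlocks ψ (comp y i))
    {v : VDist n} (hv : ∀ i, BlocksOf ψ (n / p - 1) (fun j => y j i) (v i))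
    {W : Fin n → Fin n → TDist n} (hW : ∀ k l, IsProduct ψ (v k) (v l) (W k l)) (k l : Fin n)
    (φ : 𝓢(Space n, ℂ)) : HasSum (fun ab : ℤ × ℤ =>
        ∫ x, comp y k ab.1 x * comp y l ab.2 x * φ x) (W k l φ) := by
  have ht := fun i => tame_comp hn hpn hψ hy (hr i)
  obtain ⟨_, g, -, hg, -⟩ := (ht k).exists_realization
  obtain ⟨_, g', -, hg', -⟩ := (ht l).exists_realization
  obtain ⟨W', hW'⟩ := (ht k).exists_product (ht l) hg hg'
  have hb : ∀ i j, block ψ j (v i) = emb (comp y i j) := fun i j =>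
    (blocksOf_iff_unscale.1 (hv i) j).symm
  exact (isProduct_iff (hb k) (hb l) (fun a b φ => (hW' φ).2.1 a b)
    fun φ => (hW' φ).2.2.summable).1 (hW k l) φ

/-- The linear part of the integral equation. -/
def linPart (ψ : Space n → ℝ) (H : DuhamelKernel (Fld n p)) (x₀ : ℤ → Fld n p)
    (F : ℝ → ℤ → Fld n p) (t : ℝ) (j : ℤ) : Fld n p := heatPart ψ x₀ t j + H.duhamel F t j

variable {H : DuhamelKernel (Fld n p)} {M : BilinearBlocks (Fld n p)}

/-- The equation tested against φ for an arbitrary path u, not only for a fixed point: it serves the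
induction step of the iteration, the mild identity of the limit, and the converse passage from a
solution to its blocks. -/
theorem emb_fixedPoint_step (hψ : IsLittlewoodPaley ψ)
    (hH : ∀ j σ, H.toFun j σ = ((4 : ℝ) ^ j) • heatMat ψ leraySym j σ) (hq : 1 ≤ q)
    {a : VDist n} {x₀ : ℤ → Fld n p} (hx₀ : ∀ i, BlocksOf ψ (n / p - 1) (fun j => x₀ j i) (a i))
    {f : ℝ → VDist n} {F : ℝ → ℤ → Fld n p} (hF : AdmPath q F)
    (hFf : ∀ t, 0 < t → ∀ i, BlocksOf ψ (n / p - 3) (fun j => F t j i) (f t i))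
    {u : ℝ → ℤ → Fld n p} (hu : AdmPath q u) {W : ℝ → Fin n → Fin n → TDist n}
    (hW : ∀ t, 0 < t → ∀ i, BlocksOf ψ (n / p - 3) (fun j => M.sum (u t) (u t) j i) (matDiv (W t) i))
    {t : ℝ} (ht : 0 ≤ t) (j : ℤ) (i : Fin n) (φ : 𝓢(Space n, ℂ)) :
    IntervalIntegrable
      (fun τ => heat (t - τ) (lerayBlock ψ j (f τ - matDiv (W τ)) i) φ) volume 0 t ∧
    emb ((linPart ψ H x₀ F - quadDuhamel H M u u) t j i) φ =
      (((2 : ℝ) ^ ((n / p - 1) * (j : ℝ)) : ℝ) : ℂ) * (heat t (block ψ j (a i)) φ +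
      ∫ τ in (0 : ℝ)..t, heat (t - τ) (lerayBlock ψ j (f τ - matDiv (W τ)) i) φ) := by
  have hS := BilinearBlocks.admPath_sum (M := M) hq hu hu
  obtain ⟨h1, h2⟩ := duhamel_pair hψ hH hq (hF.sub hq hS) (G := fun τ => f τ - matDiv (W τ))
    (fun τ hτ k => (hFf τ hτ k).sub (hW τ hτ k)) ht j i φ
  refine ⟨h1, ?_⟩
  have e : (linPart ψ H x₀ F - quadDuhamel H M u u) t j i = heatPart ψ x₀ t j i +
      H.duhamel (F - fun t => M.sum (u t) (u t)) t j i := by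
    rw [H.duhamel_sub hq hF hS ht]
    simp only [linPart, quadDuhamel, Pi.sub_apply, Pi.add_apply]
    abel
  rw [e, map_add, add_apply, h2, emb_heatPart hψ hx₀ ht, smul_apply, smul_eq_mul, mul_add]

theorem mildAt_fixedPoint_step (hψ : IsLittlewoodPaley ψ)
    (hH : ∀ j σ, H.toFun j σ = ((4 : ℝ) ^ j) • heatMat ψ leraySym j σ) (hq : 1 ≤ q)
    {a : VDist n} {x₀ : ℤ → Fld n p} (hx₀ : ∀ i, BlocksOf ψ (n / p - 1) (fun j => x₀ j i) (a i))
    {f : ℝ → VDist n} {F : ℝ → ℤ → Fld n p} (hF : AdmPath q F)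
    (hFf : ∀ t, 0 < t → ∀ i, BlocksOf ψ (n / p - 3) (fun j => F t j i) (f t i))
    {u : ℝ → ℤ → Fld n p} (hu : AdmPath q u) {W : ℝ → Fin n → Fin n → TDist n}
    (hW : ∀ t, 0 < t → ∀ i, BlocksOf ψ (n / p - 3) (fun j => M.sum (u t) (u t) j i) (matDiv (W t) i))
    {t : ℝ} (ht : 0 ≤ t) :
    MildAt ψ a (fun τ => f τ - matDiv (W τ)) t
      (comp ((linPart ψ H x₀ F - quadDuhamel H M u u) t)) := by
  intro j i φ
  obtain ⟨h1, h2⟩ := emb_fixedPoint_step (M := M) hψ hH hq hx₀ hF hFf hu hW ht j i φ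
  refine ⟨h1, ?_⟩
  rw [comp, unscale, emb_real_smul, smul_apply, h2, smul_eq_mul, Real.rpow_neg two_pos.le,
    Complex.ofReal_inv, inv_mul_cancel_left₀ (two_rpow_ofReal_ne_zero _)]

theorem isRealDist_matDiv {W : Fin n → Fin n → TDist n} (hW : ∀ k l, IsRealDist (W k l)) (i : Fin n) :
    IsRealDist (matDiv W i) :=
  IsRealDist.sum fun l _ => by
    rw [lineDeriv_eq_FM]
    exact (hW i l).FM (hasTemperateGrowth_coord l) (isHermitianSym_coord l)

theorem IsRealModPoly.sub_real {S T : TDist n} (hS : IsRealModPoly S) (hT : IsRealDist T) :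
    IsRealModPoly (S - T) := by
  obtain ⟨S', ⟨P, hP⟩, h⟩ := hS
  refine ⟨S' - T, ⟨P, fun φ => ?_⟩, IsRealDist.sub h hT⟩
  rw [← hP, sub_apply, sub_apply]
  ring

theorem realBlocks_zero : RealBlocks ψ (0 : ℤ → LpC n p) where
  fat j := by simp
  compat j k := by simp
  vanish j k _ := by simp
  real j φ _ := by
    simp only [Pi.zero_apply, Finset.sum_const_zero, map_zero]
    rfl

theorem sum_coord_mul_leraySym (k : Fin n) :
    ∑ i, (fun ξ : Space n => (2 * Real.pi * Complex.I) * (ξ i : ℂ)) * leraySym i k = 0 := by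
  ext ξ
  rw [Finset.sum_apply, Pi.zero_apply]
  simp only [Pi.mul_apply, leraySym, mul_assoc, ← Complex.ofReal_mul]
  rw [← Finset.mul_sum, ← Finset.mul_sum, ← Finset.mul_sum, ← Complex.ofReal_sum]
  have h1 : ∑ i, ξ i * ((if i = k then (1 : ℝ) else 0) - ξ i * ξ k / ‖ξ‖ ^ 2) = 0 := by
    simp only [mul_sub, Finset.sum_sub_distrib]
    have h2 : ∑ i, ξ i * (ξ i * ξ k / ‖ξ‖ ^ 2) = (∑ i, ξ i ^ 2) * (ξ k / ‖ξ‖ ^ 2) := by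
      rw [Finset.sum_mul]
      exact Finset.sum_congr rfl fun i _ => by ring
    rw [h2, ← EuclideanSpace.real_norm_sq_eq]
    simp only [mul_ite, mul_one, mul_zero, Finset.sum_ite_eq', Finset.mem_univ, if_true]
    by_cases hξ : ξ = 0
    · simp [hξ]
    · have : ‖ξ‖ ≠ 0 := norm_ne_zero_iff.2 hξ
      field_simp
      ring
  simp [h1]

/-- The divergence is a multiplier applied to each block. It annihilates the Duhamel term because ξ
· ℙ(ξ) = 0, and the heat term because a is divergence free modulo polynomials. -/
theorem divFree_of_mildAt (hψ : IsLittlewoodPaley ψ) {a : VDist n} (ha : DivFree a)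
    {G : ℝ → VDist n} {t : ℝ} (ht : 0 < t) {z : Fin n → ℤ → LpC n p} (h : MildAt ψ a G t z)
    {T : VDist n} (hT : ∀ i j, block ψ j (T i) = emb (z i j)) : DivFree T := by
  set D : Fin n → Space n → ℂ := fun i ξ => (2 * Real.pi * Complex.I) * (ξ i : ℂ)
  have hD : ∀ i, ContDiff ℝ ∞ (D i) := fun i => by
    refine contDiff_const.mul (Complex.ofRealCLM.contDiff.comp ?_)
    exact (EuclideanSpace.proj i : Space n →L[ℝ] ℝ).contDiff
  have hDg : ∀ i, (D i).HasTemperateGrowth := hasTemperateGrowth_coord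
  refine eqModPoly_zero_of_blocks hψ fun j => TDist.ext fun φ => ?_
  have hm : ∀ i, IsAnnular (fatSym ψ j * D i) := fun i =>
    (hψ.isAnnular_fat j).mul_contDiffOn (hD i).contDiffOn
  have hm' : ∀ i, IsAnnular (fatSym ψ j * D i * lpSym ψ j) := fun i =>
    (hm i).mul_contDiffOn (hψ.isAnnular j).contDiffOn
  have hl : ∀ i, fatSym ψ j * D i * lpSym ψ j = lpSym ψ j * D i := fun i => by
    rw [mul_right_comm, hψ.fatSym_mul_lpSym hψ]
  have hf := fun i => FM_mildAt hψ ht h (hm i) j i φ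
  have e1 : ∀ S : VDist n, block ψ j (∑ i, ∂_{(EuclideanSpace.single i (1 : ℝ) : Space n)} (S i)) =
      ∑ i, FM (lpSym ψ j * D i) (S i) := fun S => by
    rw [block_eq_FM, FM, map_sum]
    refine Finset.sum_congr rfl fun i _ => ?_
    rw [lineDeriv_eq_FM]
    exact FM_FM (hψ.isSchwartz j).hasTemperateGrowth (hDg i) _
  have e2 : ∀ i, FM (lpSym ψ j * D i) (T i) = emb (convLp (fatSym ψ j * D i) (z i j)) := fun i => by
    rw [emb_convLp (hm i).isSchwartz, ← hT, block_eq_FM,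
      FM_FM (hm i).isSchwartz.hasTemperateGrowth (hψ.isSchwartz j).hasTemperateGrowth, hl]
  rw [e1, sum_apply, Finset.sum_congr rfl fun i _ => by rw [e2 i, (hf i).2],
    Finset.sum_add_distrib, ← intervalIntegral.integral_finsetSum fun i _ => (hf i).1]
  have e3 : ∑ i, FM (fatSym ψ j * D i * lpSym ψ j * heatSym t) (a i) φ = 0 := by
    have h1 : FM (lpSym ψ j * heatSym t)
        (∑ i, ∂_{(EuclideanSpace.single i (1 : ℝ) : Space n)} (a i)) = 0 := by
      rw [ha.FM_eq ((hψ.isAnnular j).mul_heatSym t)]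
      exact map_zero _
    have h2 : ∑ i, FM (fatSym ψ j * D i * lpSym ψ j * heatSym t) (a i) = 0 := by
      rw [← h1, FM, map_sum]
      refine Finset.sum_congr rfl fun i _ => ?_
      rw [lineDeriv_eq_FM, hl, mul_right_comm]
      exact (FM_FM ((hψ.isAnnular j).mul_heatSym t).isSchwartz.hasTemperateGrowth (hDg i) _).symm
    rw [← sum_apply, h2]
    rfl
  have e4 : ∀ τ, ∑ i, lerayHeat (fatSym ψ j * D i * lpSym ψ j) (t - τ) (G τ) i φ = 0 := fun τ => by
    rw [← sum_apply]
    have h1 : ∑ i, lerayHeat (fatSym ψ j * D i * lpSym ψ j) (t - τ) (G τ) i = 0 := by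
      simp only [lerayHeat]
      rw [Finset.sum_comm]
      refine Finset.sum_eq_zero fun k _ => ?_
      rw [← FM_sum fun i _ => ((isAnnular_mul_leraySym (hm' i) i k).mul_heatSym
        (t - τ)).isSchwartz.hasTemperateGrowth]
      have h2 : ∑ i, fatSym ψ j * D i * lpSym ψ j * leraySym i k * heatSym (t - τ) =
          lpSym ψ j * heatSym (t - τ) * ∑ i, D i * leraySym i k := by
        rw [Finset.mul_sum]
        refine Finset.sum_congr rfl fun i _ => ?_
        rw [hl]
        ring
      rw [h2, sum_coord_mul_leraySym, mul_zero, FM_zero]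
    rw [h1]
    rfl
  rw [e3]
  simp only [e4]
  simp

end Nonlinear

/-! ### The fixed point -/

section Solution

variable {p : ℝ} [hp : Fact (1 ≤ ENNReal.ofReal p)] {ψ : Space n → ℝ} {q : ℝ≥0∞}
  {H : DuhamelKernel (Fld n p)} {M : BilinearBlocks (Fld n p)}

theorem sum_zero_zero (M : BilinearBlocks (Fld n p)) (j : ℤ) : M.sum 0 0 j = 0 := by
  have : ∀ kl : ℤ × ℤ, M.toFun j kl.1 kl.2 0 0 = 0 := fun kl => by
    have := M.bound j kl.1 kl.2 0 0
    simpa using this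
  simp [BilinearBlocks.sum, this]

theorem quadDuhamel_zero_zero : quadDuhamel H M 0 0 = 0 := by
  ext1 t
  ext1 j
  simp [quadDuhamel, DuhamelKernel.duhamel, sum_zero_zero]

theorem tendsto_comp {α : Type*} {l : Filter α} {w : α → ℤ → Fld n p} {y : ℤ → Fld n p} {k : ℤ}
    (h : Tendsto (fun a => w a k) l (𝓝 (y k))) (i : Fin n) :
    Tendsto (fun a => comp (w a) i k) l (𝓝 (comp y i k)) :=
  (((continuous_apply i).tendsto _).comp h).const_smul _

/-- The products that occur in the next iterate are available only when the current sequences are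
blocks of real distributions, so `RealBlocks` is propagated together with the decay of each block;
both pass to limits in `pathNorm`. -/
theorem exists_fixedPoint (hn : 3 ≤ n) (hpn : p < n) (hψ : IsLittlewoodPaley ψ)
    (hH : ∀ j σ, H.toFun j σ = ((4 : ℝ) ^ j) • heatMat ψ leraySym j σ)
    (hM : ∀ j k l u v i, M.toFun j k l u v i =
      (2 : ℝ) ^ ((n / p - 2) * (j : ℝ) - (n / p - 1) * (k : ℝ) - (n / p - 1) * (l : ℝ)) •
        ∑ m, convLp (derSym ψ m j) (prodBlk ψ k l (u i) (v m))) (hq : 1 ≤ q)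
    {a : VDist n} (ha : ∀ i, IsRealModPoly (a i)) {x₀ : ℤ → Fld n p}
    (hx₀ : ∀ i, BlocksOf ψ (n / p - 1) (fun j => x₀ j i) (a i))
    {f : ℝ → VDist n} (hf : ∀ t, 0 < t → ∀ i, IsRealModPoly (f t i)) {F : ℝ → ℤ → Fld n p}
    (hF : AdmPath q F)
    (hFf : ∀ t, 0 < t → ∀ i, BlocksOf ψ (n / p - 3) (fun j => F t j i) (f t i))
    (hA : AdmPath q (linPart ψ H x₀ F))
    (hsmall : 8 * ENNReal.ofReal (quadConst H M) * pathNorm q (Ioi 0) (linPart ψ H x₀ F) ≤ 1) :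
    ∃ u : ℝ → ℤ → Fld n p, AdmPath q u ∧
      (∀ t, 0 < t → ∀ j, u t j = linPart ψ H x₀ F t j - quadDuhamel H M u u t j) ∧
      pathNorm q (Ioi 0) u ≤ 2 * pathNorm q (Ioi 0) (linPart ψ H x₀ F) ∧
      (∀ t, 0 < t → ∀ i, RealBlocks ψ (comp (u t) i)) ∧
      ((∀ j, Tendsto (fun t => linPart ψ H x₀ F t j) atTop (𝓝 0)) →
        ∀ j, Tendsto (fun t => u t j) atTop (𝓝 0)) := by
  set A := linPart ψ H x₀ F
  have hstep : ∀ u, AdmPath q u → (∀ t, 0 < t → ∀ i, RealBlocks ψ (comp (u t) i)) →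
      ∀ t, 0 < t → ∀ i, RealBlocks ψ (comp ((A - quadDuhamel H M u u) t) i) := by
    intro u hu hr t ht i
    have hex : ∀ τ, ∃ W : Fin n → Fin n → TDist n, 0 < τ → (∀ k l, IsRealDist (W k l)) ∧
        ∀ i, BlocksOf ψ (n / p - 3) (fun j => M.sum (u τ) (u τ) j i) (matDiv W i) := fun τ => by
      by_cases hτ : 0 < τ
      · obtain ⟨T, W, -, -, -, -, hW1, hW2⟩ := exists_realization_field hn hpn hψ
          (hu.norm_le hq hτ) (hr τ hτ)
        exact ⟨W, fun _ => ⟨hW1, blocksOf_sum hψ hM (hu.norm_le hq hτ)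
          (fun i j => convLp_fat_of_unscale (x := fun j => u τ j i) ((hr τ hτ i).fat j)) hW2⟩⟩
      · exact ⟨0, fun h => absurd h hτ⟩
    choose W hW using hex
    have hm := mildAt_fixedPoint_step (M := M) hψ hH hq hx₀ hF hFf hu
      (fun τ hτ => (hW τ hτ).2) ht.le
    exact realBlocks_of_mildAt hψ ht hm ha
      (fun τ hτ k => (hf τ hτ k).sub_real (isRealDist_matDiv (hW τ hτ).1 k)) i
  refine exists_quadratic_fixedPoint hq hA hsmall
    (fun u => (∀ t, 0 < t → ∀ i, RealBlocks ψ (comp (u t) i)) ∧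
      ((∀ j, Tendsto (fun t => A t j) atTop (𝓝 0)) → ∀ j, Tendsto (fun t => u t j) atTop (𝓝 0)))
    ⟨?_, fun h => h⟩ ?_ ?_
  -- The linear part is the iteration step applied to the zero path, so it inherits the block
  -- properties from there.
  · have h0 : AdmPath q (0 : ℝ → ℤ → Fld n p) :=
      (hA.sub hq hA).congr fun t _ j => by simp
    have h1 := hstep 0 h0 fun t _ i => by
      have e : comp ((0 : ℝ → ℤ → Fld n p) t) i = 0 := by
        funext j
        simp [comp, unscale]
      rw [e]
      exact realBlocks_zero
    rwa [quadDuhamel_zero_zero, sub_zero] at h1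
  · intro u hu hP
    refine ⟨hstep u hu hP.1, fun h j => ?_⟩
    have := (h j).sub (tendsto_quadDuhamel_zero (H := H) (M := M) hq hu (hP.2 h) j)
    simpa using this
  · intro w u hP hlim
    refine ⟨fun t ht i => ?_, fun h j => ?_⟩
    · refine RealBlocks.of_tendsto (fun N => (hP N).1 t ht i) fun k => tendsto_comp ?_ i
      rw [tendsto_iff_edist_tendsto_0]
      refine tendsto_of_tendsto_of_tendsto_of_le_of_le tendsto_const_nhds hlim (fun _ => zero_le)
        fun m => ?_
      rw [edist_comm, edist_eq_enorm_sub]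
      exact enorm_le_pathNorm hq (u - w m) ht k
    · exact tendsto_zero_of_pathNorm_limit hq (fun m => (hP m).2 h) hlim j

theorem exists_pairing_bound (hn : 3 ≤ n) (hpn : p < n) (hψ : IsLittlewoodPaley ψ) :
    ∃ c : ℤ → ℝ, Summable c ∧ (∀ k, 0 ≤ c k) ∧ ∀ (x : ℤ → LpC n p) (k : ℤ) (φ : 𝓢(Space n, ℂ)),
      convLp (fatSym ψ k) (unscale x k) = unscale x k →
      ‖emb (unscale x k) φ‖ ≤ c k * testNorm φ * ‖x k‖ := by
  obtain ⟨c, hc, hcs, h⟩ := exists_tame (p := p) hn hpn (hψ.isAnnular_fat 0)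
  refine ⟨c, hcs, hc, fun x k φ hfat => ?_⟩
  have h1 := h k (x k) φ
  rw [← fatSym_eq_comp, ← convLp_real_smul] at h1
  change eLpNorm (convLp (fatSym ψ k) (unscale x k)) 2 (testMeasure φ) ≤ _ at h1
  rw [hfat] at h1
  rw [(isRep_emb _ φ).2]
  refine (norm_integral_le_integral_norm _).trans ?_
  have h2 : ∫⁻ y, ‖unscale x k y * φ y‖ₑ ≤ ENNReal.ofReal (c k * testNorm φ * ‖x k‖) := by
    simp only [enorm_mul]
    refine (lintegral_mul_test_le (Lp.memLp (unscale x k)).1 φ).trans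
      ((mul_le_mul_left h1 _).trans_eq ?_)
    rw [ENNReal.ofReal_mul (mul_nonneg (hc k) (testNorm_nonneg φ)), ENNReal.ofReal_mul (hc k),
      ofReal_norm, mul_right_comm, mul_assoc (ENNReal.ofReal (c k)), testNorm_half_mul]
  exact (integral_norm_le_of_lintegral (mul_nonneg (mul_nonneg (hc k) (testNorm_nonneg φ))
    (norm_nonneg _)) ((Lp.memLp (unscale x k)).1.mul φ.continuous.aestronglyMeasurable) h2).2

/-- Weak-* continuity at 0, including q = ∞: each block converges and the pairings are dominated by
a summable sequence, with no ℓ^q smallness of tails. Moment-free test functions are needed because a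
and the realization of its blocks may differ by a polynomial. -/
theorem tendsto_pairing_initial (hn : 3 ≤ n) (hpn : p < n) (hψ : IsLittlewoodPaley ψ) (hq : 1 ≤ q)
    {a : VDist n} (ha : ∀ i, IsRealModPoly (a i)) {x₀ : ℤ → Fld n p} {B : ℝ}
    (hB : ∀ k, ‖x₀ k‖ ≤ B) (hx₀ : ∀ i, BlocksOf ψ (n / p - 1) (fun j => x₀ j i) (a i))
    {u : ℝ → ℤ → Fld n p} (hu : AdmPath q u) (hr : ∀ t, 0 < t → ∀ i, RealBlocks ψ (comp (u t) i))
    (hlim : ∀ j, Tendsto (fun t => u t j) (𝓝[>] 0) (𝓝 (x₀ j))) {T : ℝ → VDist n}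
    (hT : ∀ t, 0 < t → ∀ i φ, HasSum (fun k => emb (comp (u t) i k) φ) (T t i φ))
    {φ : 𝓢(Space n, ℂ)} (hφ : MomentFree φ) (i : Fin n) :
    Tendsto (fun t => T t i φ) (𝓝[>] 0) (𝓝 (a i φ)) := by
  have hr₀ : ∀ i, RealBlocks ψ (comp x₀ i) := fun i =>
    realBlocks_of_blocks hψ (ha i) (blocksOf_iff_unscale.1 (hx₀ i))
  obtain ⟨T₀, -, -, hb₀, hT₀, -⟩ := exists_realization_field hn hpn hψ hB hr₀
  rw [← ((hb₀ i).eqModPoly hψ (hx₀ i)).apply_eq hφ, ← (hT₀ i φ).tsum_eq]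
  obtain ⟨c, hcs, hc, h⟩ := exists_pairing_bound (p := p) hn hpn hψ
  set D := (pathNorm q (Ioi 0) u).toReal
  have key : Tendsto (fun t => ∑' k, emb (comp (u t) i k) φ) (𝓝[>] 0)
      (𝓝 (∑' k, emb (comp x₀ i k) φ)) := by
    refine tendsto_tsum_of_dominated_convergence (bound := fun k => c k * testNorm φ * D)
      ((hcs.mul_right _).mul_right _) (fun k => ?_) ?_
    · exact ((pairLp φ).continuous.tendsto _).comp (tendsto_comp (hlim k) i)
    · filter_upwards [self_mem_nhdsWithin] with t ht k
      refine (h (fun j => u t j i) k φ ((hr t ht i).fat k)).trans ?_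
      have := hc k
      have := testNorm_nonneg φ
      gcongr
      exact norm_comp_le (hu.norm_le hq ht) i k
  refine key.congr' ?_
  filter_upwards [self_mem_nhdsWithin] with t ht
  exact (hT t ht i φ).tsum_eq

end Solution

/-! ### Mild solutions -/

section Theorem

variable {p : ℝ} [hp : Fact (1 ≤ ENNReal.ofReal p)] {ψ : Space n → ℝ} {q : ℝ≥0∞}
  {H : DuhamelKernel (Fld n p)} {M : BilinearBlocks (Fld n p)}

theorem AdmPath.add {V : Type*} [NormedAddCommGroup V] (hq : 1 ≤ q) {u v : ℝ → ℤ → V}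
    (hu : AdmPath q u) (hv : AdmPath q v) : AdmPath q (u + v) := by
  have h := hu.sub hq ((hu.sub hq hu).sub hq hv)
  rwa [sub_self, zero_sub, sub_neg_eq_add] at h

theorem quadConst_nonneg {V : Type*} [NormedAddCommGroup V] [NormedSpace ℝ V]
    (H : DuhamelKernel V) (M : BilinearBlocks V) : 0 ≤ quadConst H M :=
  mul_nonneg H.C_pos.le (sq_nonneg _)

theorem heat_zero (T : TDist n) : heat 0 T = T := by
  rw [heat_eq_FM, heatSym_zero, FM_one]

/-- Smallness of a quantity that is controlled by the data. -/
theorem mul_le_one_of_small {K Q m c : ℝ} (hK : 0 ≤ K) (hQ : 0 < Q) (hm : 0 ≤ m) (hc : 0 ≤ c)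
    (hmc : m * c ≤ Q) {x D : ℝ≥0∞} (hx : x ≤ ENNReal.ofReal c * D)
    (hD : D ≤ ENNReal.ofReal (1 / ((K + 1) * Q))) :
    ENNReal.ofReal m * ENNReal.ofReal K * x ≤ 1 := by
  have hε : 0 ≤ 1 / ((K + 1) * Q) := by positivity
  calc ENNReal.ofReal m * ENNReal.ofReal K * x
      ≤ ENNReal.ofReal m * ENNReal.ofReal K *
          (ENNReal.ofReal c * ENNReal.ofReal (1 / ((K + 1) * Q))) := by
        gcongr
        exact hx.trans (by gcongr)
    _ = ENNReal.ofReal (m * K * (c * (1 / ((K + 1) * Q)))) := by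
        rw [← ENNReal.ofReal_mul hm, ← ENNReal.ofReal_mul hc, ← ENNReal.ofReal_mul (by positivity)]
    _ ≤ 1 := by
        rw [ENNReal.ofReal_le_one]
        have : m * K * (c * (1 / ((K + 1) * Q))) = (m * c) * K / ((K + 1) * Q) := by ring
        rw [this, div_le_one (by positivity)]
        nlinarith [mul_le_mul_of_nonneg_right hmc hK]

theorem admPath_linPart (hq : 1 ≤ q) {x₀ : ℤ → Fld n p} {F : ℝ → ℤ → Fld n p}
    (hx₀ : AdmPath q (heatPart ψ x₀)) (hF : AdmPath q F) : AdmPath q (linPart ψ H x₀ F) :=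
  hx₀.add hq (H.admPath_duhamel hq hF)

theorem pathNorm_linPart_le (hq : 1 ≤ q) {x₀ : ℤ → Fld n p} {F : ℝ → ℤ → Fld n p} {C : ℝ}
    {A B : ℝ≥0∞} (hC : 0 ≤ C) (hx₀ : pathNorm q (Ioi 0) (heatPart ψ x₀) ≤ ENNReal.ofReal C * A)
    (hF : pathNorm q (Ioi 0) F ≤ B) :
    pathNorm q (Ioi 0) (linPart ψ H x₀ F) ≤ ENNReal.ofReal (C + H.C) * (A + B) := by
  have h := H.pathNorm_duhamel_le hq (I := Ioi 0) (fun t ht => ht) (fun t _ s hs => hs.1) F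
  calc pathNorm q (Ioi 0) (linPart ψ H x₀ F)
      ≤ pathNorm q (Ioi 0) (heatPart ψ x₀) + pathNorm q (Ioi 0) (H.duhamel F) :=
        pathNorm_add_le hq _ _
    _ ≤ ENNReal.ofReal C * A + ENNReal.ofReal H.C * B := by
        gcongr
        exact h.trans (by gcongr)
    _ ≤ ENNReal.ofReal (C + H.C) * A + ENNReal.ofReal (C + H.C) * B := by
        gcongr
        · linarith [H.C_pos]
        · linarith
    _ = _ := (mul_add _ _ _).symm

/-- The solution path has the initial blocks as limits. -/
theorem tendsto_fixedPoint_initial (hψ : IsLittlewoodPaley ψ) (hq : 1 ≤ q) {a : VDist n}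
    {x₀ : ℤ → Fld n p} (hx₀ : ∀ i, BlocksOf ψ (n / p - 1) (fun j => x₀ j i) (a i))
    {F u : ℝ → ℤ → Fld n p} (hF : AdmPath q F) (hu : AdmPath q u)
    (hfix : ∀ t, 0 < t → ∀ j, u t j = linPart ψ H x₀ F t j - quadDuhamel H M u u t j) (j : ℤ) :
    Tendsto (fun t => u t j) (𝓝[>] 0) (𝓝 (x₀ j)) := by
  have h1 := tendsto_heatPart_initial hψ hx₀ j
  have h2 := tendsto_duhamel_initial H hq hF j
  have h3 := tendsto_duhamel_initial H hq (M.admPath_sum hq hu hu) j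
  have h := (h1.add h2).sub h3
  rw [add_zero, sub_zero] at h
  refine h.congr' ?_
  filter_upwards [self_mem_nhdsWithin] with t ht
  exact (hfix t ht j).symm

theorem MemTildeC.of_Ici {s r : ℝ} {v : ℝ → VDist n} (h : MemTildeC ψ (Ici 0) s r q v) :
    MemTildeC ψ (Ioi 0) s r q v where
  mem t ht := h.mem t (Ioi_subset_Ici_self ht)
  continuous t ht := (h.continuous t (Ioi_subset_Ici_self ht)).mono_left
    (nhdsWithin_mono _ Ioi_subset_Ici_self)
  bounded := by
    have : volume.restrict (Ioi (0 : ℝ)) = volume.restrict (Ici 0) :=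
      Measure.restrict_congr_set Ioi_ae_eq_Ici
    have h' := h.bounded
    rwa [tildeNorm, ← this] at h'

theorem MemTildeCZero.memTildeC {s r : ℝ} {v : ℝ → VDist n} (h : MemTildeCZero ψ s r q v) :
    MemTildeC ψ (Ioi 0) s r q v := by
  by_cases hq : q = ⊤
  · exact (h.2 hq).1
  · exact (h.1 hq).of_Ici

/-- The product of a field with itself is compatible with the bilinear operator on blocks. -/
theorem blocksOf_matDiv (hψ : IsLittlewoodPaley ψ)
    (hM : ∀ (j k l : ℤ) (u v : Fld n p) (i : Fin n), M.toFun j k l u v i =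
      (2 : ℝ) ^ (((n : ℝ) / p - 2) * (j : ℝ) - ((n : ℝ) / p - 1) * (k : ℝ) -
        ((n : ℝ) / p - 1) * (l : ℝ)) •
        ∑ m, convLp (derSym ψ m j) (prodBlk ψ k l (u i) (v m)))
    {y : ℤ → Fld n p} {B : ℝ} (hB : ∀ k, ‖y k‖ ≤ B) (hr : ∀ i, RealBlocks ψ (comp y i))
    {W : Fin n → Fin n → TDist n}
    (hW : ∀ k l φ, HasSum
      (fun ab : ℤ × ℤ => ∫ x, comp y k ab.1 x * comp y l ab.2 x * φ x) (W k l φ)) (i : Fin n) :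
    BlocksOf ψ (n / p - 3) (fun j => M.sum y y j i) (matDiv W i) :=
  blocksOf_sum hψ hM hB (fun i j => convLp_fat_of_unscale ((hr i).fat j)) hW i

/-- The blocks of a mild solution satisfy the fixed point equation. -/
theorem IsSolution.fixedPoint (hn : 3 ≤ n) (hpn : p < n) (hψ : IsLittlewoodPaley ψ)
    (hH : ∀ (j : ℤ) (σ : ℝ), H.toFun j σ = (4 : ℝ) ^ j • heatMat ψ leraySym j σ)
    (hM : ∀ (j k l : ℤ) (u v : Fld n p) (i : Fin n), M.toFun j k l u v i =
      (2 : ℝ) ^ (((n : ℝ) / p - 2) * (j : ℝ) - ((n : ℝ) / p - 1) * (k : ℝ) -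
        ((n : ℝ) / p - 1) * (l : ℝ)) •
        ∑ m, convLp (derSym ψ m j) (prodBlk ψ k l (u i) (v m)))
    (hq : 1 ≤ q) {a : VDist n} {x₀ : ℤ → Fld n p}
    (hx₀ : ∀ i, BlocksOf ψ (n / p - 1) (fun j => x₀ j i) (a i)) {f : ℝ → VDist n}
    {F : ℝ → ℤ → Fld n p} (hF : AdmPath q F)
    (hFf : ∀ t, 0 < t → ∀ i, BlocksOf ψ (n / p - 3) (fun j => F t j i) (f t i))
    {v : ℝ → VDist n} (hv : IsSolution ψ a f v) {y : ℝ → ℤ → Fld n p} (hy : AdmPath q y)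
    (hyv : ∀ t, 0 < t → ∀ i, BlocksOf ψ (n / p - 1) (fun j => y t j i) (v t i)) :
    ∀ t, 0 < t → ∀ j, y t j = linPart ψ H x₀ F t j - quadDuhamel H M y y t j := by
  obtain ⟨W, hWp, hmild⟩ := hv.mild
  have hr : ∀ t, 0 < t → ∀ i, RealBlocks ψ (comp (y t) i) := fun t ht i =>
    realBlocks_of_blocks hψ (hv.real t ht.le i) (blocksOf_iff_unscale.1 (hyv t ht i))
  have hB := fun t (ht : 0 < t) => hy.norm_le hq ht
  have hW : ∀ t, 0 < t → ∀ i,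
      BlocksOf ψ (n / p - 3) (fun j => M.sum (y t) (y t) j i) (matDiv (W t) i) := fun t ht =>
    blocksOf_matDiv hψ hM (hB t ht) (hr t ht)
      (hasSum_of_isProduct hn hpn hψ (hB t ht) (hr t ht) (hyv t ht) (hWp t ht))
  intro t ht j
  have key : ∀ i, y t j i = (linPart ψ H x₀ F - quadDuhamel H M y y) t j i := by
    intro i
    refine emb_injective (TDist.ext fun φ => ?_)
    rw [(emb_fixedPoint_step hψ hH hq hx₀ hF hFf hy hW ht.le j i φ).2,
      ← (hmild j t ht.le i φ).2, hyv t ht i j]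
    rfl
  exact funext key

/-- Two mild solutions coincide if both are small, or if one of them is small and `q < ∞`. -/
theorem IsSolution.eqModPoly (hn : 3 ≤ n) (hpn : p < n) (hψ : IsLittlewoodPaley ψ)
    (hH : ∀ (j : ℤ) (σ : ℝ), H.toFun j σ = (4 : ℝ) ^ j • heatMat ψ leraySym j σ)
    (hM : ∀ (j k l : ℤ) (u v : Fld n p) (i : Fin n), M.toFun j k l u v i =
      (2 : ℝ) ^ (((n : ℝ) / p - 2) * (j : ℝ) - ((n : ℝ) / p - 1) * (k : ℝ) -
        ((n : ℝ) / p - 1) * (l : ℝ)) •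
        ∑ m, convLp (derSym ψ m j) (prodBlk ψ k l (u i) (v m)))
    (hq : 1 ≤ q) {a : VDist n} {x₀ : ℤ → Fld n p}
    (hx₀ : ∀ i, BlocksOf ψ (n / p - 1) (fun j => x₀ j i) (a i)) {f : ℝ → VDist n}
    {F : ℝ → ℤ → Fld n p} (hF : AdmPath q F)
    (hFf : ∀ t, 0 < t → ∀ i, BlocksOf ψ (n / p - 3) (fun j => F t j i) (f t i))
    {u : ℝ → ℤ → Fld n p} (hu : AdmPath q u)
    (hfix : ∀ t, 0 < t → ∀ j, u t j = linPart ψ H x₀ F t j - quadDuhamel H M u u t j)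
    (hsmall : 8 * ENNReal.ofReal (quadConst H M) * pathNorm q (Ioi 0) u ≤ 1)
    {v : ℝ → VDist n} (hv : IsSolution ψ a f v) (hvm : MemTildeCZero ψ (n / p - 1) p q v)
    (hor : q ≠ ⊤ ∨ 2 * ENNReal.ofReal (quadConst H M) *
      (pathNorm q (Ioi 0) u + tildeNorm ψ (Ioi 0) (n / p - 1) p q v) ≤ 1)
    {T : ℝ → VDist n}
    (hT : ∀ t, 0 < t → ∀ i, BlocksOf ψ (n / p - 1) (fun j => u t j i) (T t i)) (hT₀ : T 0 = a)
    {t : ℝ} (ht : 0 ≤ t) (i : Fin n) : EqModPoly (v t i) (T t i) := by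
  obtain ⟨y, hy, hyn, hyv⟩ := exists_admPath_of_memTildeC hq hvm.memTildeC
  have hyfix := hv.fixedPoint hn hpn hψ hH hM hq hx₀ hF hFf hy hyv
  rcases ht.eq_or_lt with rfl | ht
  · rw [hT₀]
    exact hv.initial i
  suffices h : ∀ j, u t j = y t j by
    refine (hyv t ht i).eqModPoly hψ ?_
    simpa only [h] using hT t ht i
  by_cases hq' : q = ⊤
  · have hs := hor.resolve_left (not_not.2 hq')
    refine eq_of_pathNorm_eq_zero hq (I := Ioi 0) (pathNorm_sub_eq_zero_of_small hq hu hy hfix hyfix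
      (fun t ht => ht) (fun t _ s hs => hs.1) (le_trans ?_ hs)) ht
    gcongr
  -- The equation itself forces the blocks of both solutions to tend to those of a, so they share
  -- their limits at t = 0.
  · refine eq_of_initial_eq hq hq' hu hy hfix hyfix (fun j => ?_) hsmall ht
    have h1 := tendsto_fixedPoint_initial hψ hq hx₀ hF hu hfix j
    have h2 := tendsto_fixedPoint_initial hψ hq hx₀ hF hy hyfix j
    simpa using h1.sub h2

/-- A fixed point of the integral equation on blocks gives a mild solution. -/
theorem exists_isSolution (hn : 3 ≤ n) (hpn : p < n) (hψ : IsLittlewoodPaley ψ)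
    (hH : ∀ (j : ℤ) (σ : ℝ), H.toFun j σ = (4 : ℝ) ^ j • heatMat ψ leraySym j σ)
    (hM : ∀ (j k l : ℤ) (u v : Fld n p) (i : Fin n), M.toFun j k l u v i =
      (2 : ℝ) ^ (((n : ℝ) / p - 2) * (j : ℝ) - ((n : ℝ) / p - 1) * (k : ℝ) -
        ((n : ℝ) / p - 1) * (l : ℝ)) •
        ∑ m, convLp (derSym ψ m j) (prodBlk ψ k l (u i) (v m)))
    (hq : 1 ≤ q) {a : VDist n} (har : ∀ i, IsRealModPoly (a i)) (hdiv : DivFree a)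
    (ha : vBesovNorm ψ (n / p - 1) p q a < ⊤) {x₀ : ℤ → Fld n p}
    (hx₀ : ∀ i, BlocksOf ψ (n / p - 1) (fun j => x₀ j i) (a i)) {f : ℝ → VDist n}
    {F : ℝ → ℤ → Fld n p} (hF : AdmPath q F)
    (hFf : ∀ t, 0 < t → ∀ i, BlocksOf ψ (n / p - 3) (fun j => F t j i) (f t i))
    {u : ℝ → ℤ → Fld n p} (hu : AdmPath q u)
    (hfix : ∀ t, 0 < t → ∀ j, u t j = linPart ψ H x₀ F t j - quadDuhamel H M u u t j)
    (hr : ∀ t, 0 < t → ∀ i, RealBlocks ψ (comp (u t) i)) :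
    ∃ T : ℝ → VDist n, MemTildeCZero ψ (n / p - 1) p q T ∧ IsSolution ψ a f T ∧ T 0 = a ∧
      ∀ t, 0 < t → ∀ i, BlocksOf ψ (n / p - 1) (fun j => u t j i) (T t i) := by
  have hB := fun t (ht : 0 < t) => hu.norm_le hq ht
  have hex := fun t (ht : 0 < t) => exists_realization_field hn hpn hψ (hB t ht) (hr t ht)
  choose! S W hSr hSb hSs hSp _ hWs using hex
  classical
  -- At t = 0 the given representative a is kept, so no polynomial ambiguity enters the initial
  -- value; negative times play no role.
  let T : ℝ → VDist n := fun t => if 0 < t then S t else a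
  have hTS : ∀ t, 0 < t → T t = S t := fun t ht => if_pos ht
  have hT₀ : T 0 = a := if_neg (lt_irrefl _)
  have hTb : ∀ t, 0 < t → ∀ i, BlocksOf ψ (n / p - 1) (fun j => u t j i) (T t i) := fun t ht i => by
    rw [hTS t ht]
    exact hSb t ht i
  have hx₀n : (lqNorm q fun j => ‖x₀ j‖ₑ) < ⊤ := (le_vBesovNorm hq hx₀).trans_lt ha
  have hlim := tendsto_fixedPoint_initial hψ hq hx₀ hF hu hfix
  have hmild : ∀ t, 0 < t →
      MildAt ψ a (fun τ => f τ - matDiv (W τ)) t (comp (u t)) := fun t ht => by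
    have h := mildAt_fixedPoint_step hψ hH hq hx₀ hF hFf hu
      (fun t ht => blocksOf_matDiv hψ hM (hB t ht) (hr t ht) (hWs t ht)) ht.le
    have e : (linPart ψ H x₀ F - quadDuhamel H M u u) t = u t :=
      funext fun j => (hfix t ht j).symm
    rwa [e] at h
  have hblk : ∀ t, 0 < t → ∀ i j, block ψ j (T t i) = emb (comp (u t) i j) := fun t ht i j =>
    (blocksOf_iff_unscale.1 (hTb t ht i) j).symm
  refine ⟨T, ⟨fun hq' => ?_, fun hq' => ⟨memTildeC_of_admPath hq hu hTb, ?_, fun φ hφ i => ?_⟩⟩,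
    ⟨fun t ht i => ?_, fun t ht => ?_, fun i => ?_, W, fun t ht k l => ?_, fun j t ht i φ => ?_⟩,
    hT₀, hTb⟩
  · exact memTildeC_Ici_of_admPath hq hq' hu hTb hx₀n (by rwa [hT₀]) hlim
  · rwa [hT₀]
  · rw [hT₀]
    refine tendsto_pairing_initial hn hpn hψ hq har (B := (lqNorm q fun j => ‖x₀ j‖ₑ).toReal)
      (fun k => ?_) hx₀ hu hr hlim (fun t ht i φ => ?_) hφ i
    · rw [← toReal_enorm]
      exact ENNReal.toReal_mono hx₀n.ne (le_lqNorm hq (fun j => ‖x₀ j‖ₑ) k)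
    · rw [hTS t ht]
      exact hSs t ht i φ
  · rcases ht.eq_or_lt with rfl | ht
    · rw [hT₀]
      exact har i
    · rw [hTS t ht]
      exact (hSr t ht i).isRealModPoly
  · rcases ht.eq_or_lt with rfl | ht
    · rwa [hT₀]
    · exact divFree_of_mildAt hψ hdiv ht (hmild t ht) (hblk t ht)
  · rw [hT₀]
    exact EqModPoly.refl _
  · rw [hTS t ht]
    exact hSp t ht k l
  · rcases ht.eq_or_lt with rfl | ht
    · simp [hT₀, heat_zero]
    · rw [hblk t ht]
      exact hmild t ht j i φ

/-- Decay of the blocks of the linear part for decaying forces. -/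
theorem tendsto_linPart_zero (hq : 1 ≤ q) {s : ℝ} {x₀ : ℤ → Fld n p} {f : ℝ → VDist n}
    {F : ℝ → ℤ → Fld n p} (hF : AdmPath q F)
    (hFf : ∀ t, 0 < t → ∀ i, BlocksOf ψ s (fun j => F t j i) (f t i))
    (hx₀ : ∀ j, Tendsto (fun t => heatPart ψ x₀ t j) atTop (𝓝 0))
    (hf : Tendsto (fun t => vBesovNorm ψ s p q (f t)) atTop (𝓝 0)) (j : ℤ) :
    Tendsto (fun t => linPart ψ H x₀ F t j) atTop (𝓝 0) := by
  have h : Tendsto (fun t => F t j) atTop (𝓝 0) := by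
    rw [tendsto_zero_iff_enorm_tendsto_zero]
    refine tendsto_of_tendsto_of_tendsto_of_le_of_le' tendsto_const_nhds hf
      (Eventually.of_forall fun t => zero_le) ?_
    filter_upwards [eventually_gt_atTop 0] with t ht
    exact (le_lqNorm hq (fun j => ‖F t j‖ₑ) j).trans (le_vBesovNorm hq (hFf t ht))
  simpa [linPart] using (hx₀ j).add (H.tendsto_duhamel_zero hq hF j h)

end Theorem

end ForcedNS

end

/-! ### Choice of constants and conclusion. -/

open ForcedNS in
theorem proposition1p1 (n : ℕ) (hn : 3 ≤ n) (p : ℝ) (hp : 1 ≤ p) (hpn : p < n)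
    (q : ℝ≥0∞) (hq : 1 ≤ q) (ψ : Space n → ℝ) (hψ : IsLittlewoodPaley ψ) :
    ∃ ε C : ℝ, 0 < ε ∧ 0 < C ∧
      ∀ (a : VDist n) (f : ℝ → VDist n),
        (∀ i, IsRealModPoly (a i)) →
        vBesovNorm ψ (n / p - 1) p q a < ⊤ →
        DivFree a →
        (∀ t, 0 < t → ∀ i, IsRealModPoly (f t i)) →
        MemTildeC ψ (Ioi 0) (n / p - 3) p q f →
        vBesovNorm ψ (n / p - 1) p q a + tildeNorm ψ (Ioi 0) (n / p - 3) p q f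
          ≤ ENNReal.ofReal ε →
        ∃ u : ℝ → VDist n,
          MemTildeCZero ψ (n / p - 1) p q u ∧
          IsSolution ψ a f u ∧
          tildeNorm ψ (Ioi 0) (n / p - 1) p q u ≤ ENNReal.ofReal C *
            (vBesovNorm ψ (n / p - 1) p q a + tildeNorm ψ (Ioi 0) (n / p - 3) p q f) ∧
          (∀ v : ℝ → VDist n,
            MemTildeCZero ψ (n / p - 1) p q v →
            IsSolution ψ a f v →
            (q ≠ ⊤ ∨ tildeNorm ψ (Ioi 0) (n / p - 1) p q v ≤ ENNReal.ofReal C *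
              (vBesovNorm ψ (n / p - 1) p q a + tildeNorm ψ (Ioi 0) (n / p - 3) p q f)) →
            ∀ t, 0 ≤ t → ∀ i, EqModPoly (v t i) (u t i)) ∧
          (q ≠ ⊤ →
            Tendsto (fun t => vBesovNorm ψ (n / p - 3) p q (f t)) atTop (𝓝 0) →
            Tendsto (fun t => vBesovNorm ψ (n / p - 1) p q (u t)) atTop (𝓝 0)) := by
  have : Fact (1 ≤ ENNReal.ofReal p) := ⟨ENNReal.one_le_ofReal.2 hp⟩
  obtain ⟨H, hH⟩ := exists_duhamelKernel (p := p) hψ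
  obtain ⟨M, hM⟩ := exists_bilinearBlocks (p := p) hn hpn hψ
  obtain ⟨C₁, hC₁, hheat⟩ := exists_admPath_heatPart (p := p) (q := q) hψ hq
  have hK := quadConst_nonneg H M
  have hn0 : (0 : ℝ) < n := by exact_mod_cast (by omega : 0 < n)
  set K := quadConst H M
  set C₂ := C₁ + H.C
  have hC₂ : 0 < C₂ := add_pos hC₁ H.C_pos
  -- C₂ bounds the linear part by the data, 2 comes from the ball of the fixed point, and n from the
  -- passage from the maximum over components to their sum.
  set C : ℝ := n * (2 * C₂) with hC
  have hC0 : 0 < C := by positivity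
  -- Q dominates the three constants required: 8 C₂ for existence, 8 · 2C₂ for smallness of the
  -- solution in the uniqueness for q < ∞, and 2(2C₂ + C) for uniqueness under the estimate.
  set Q := 16 * C₂ + 2 * C with hQ
  have hQ0 : 0 < Q := by positivity
  -- K + 1 replaces K, which may vanish.
  refine ⟨1 / ((K + 1) * Q), C, by positivity, hC0, ?_⟩
  intro a f har ha hdiv hfr hf hsmall
  set D := vBesovNorm ψ (n / p - 1) p q a + tildeNorm ψ (Ioi 0) (n / p - 3) p q f
  obtain ⟨x₀, hx₀⟩ := exists_blocksOf_field (p := p) hq ha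
  obtain ⟨F, hF, hFn, hFf⟩ := exists_admPath_of_memTildeC (p := p) hq hf
  have hx₀n := le_vBesovNorm hq hx₀
  obtain ⟨hA₁, hA₁n, hA₁z⟩ := hheat x₀ (hx₀n.trans_lt ha)
  have hA : AdmPath q (linPart ψ H x₀ F) := admPath_linPart hq hA₁ hF
  have hAn : pathNorm q (Ioi 0) (linPart ψ H x₀ F) ≤ ENNReal.ofReal C₂ * D :=
    pathNorm_linPart_le hq hC₁.le (hA₁n.trans (by gcongr)) hFn
  have h8 : ENNReal.ofReal 8 = 8 := by simp
  have h2 : ENNReal.ofReal 2 = 2 := by simp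
  obtain ⟨u, hu, hfix, hun, hur, hudecay⟩ := exists_fixedPoint hn hpn hψ hH hM hq har hx₀ hfr hF hFf
    hA (h8 ▸ mul_le_one_of_small hK hQ0 (by norm_num) hC₂.le (by linarith) hAn hsmall)
  have hun' : pathNorm q (Ioi 0) u ≤ ENNReal.ofReal (2 * C₂) * D := by
    rw [ENNReal.ofReal_mul (by norm_num), h2, mul_assoc]
    exact hun.trans (by gcongr)
  obtain ⟨T, hTm, hTs, hT₀, hTb⟩ :=
    exists_isSolution hn hpn hψ hH hM hq har hdiv ha hx₀ hF hFf hu hfix hur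
  refine ⟨T, hTm, hTs, ?_, fun v hvm hvs hor t ht i => ?_, fun hq' hlim => ?_⟩
  · refine (tildeNorm_le hTb).trans ?_
    rw [hC, ENNReal.ofReal_mul hn0.le, ENNReal.ofReal_natCast, mul_assoc]
    gcongr
  · refine IsSolution.eqModPoly hn hpn hψ hH hM hq hx₀ hF hFf hu hfix
      (h8 ▸ mul_le_one_of_small hK hQ0 (by norm_num) (by positivity) (by linarith) hun' hsmall)
      hvs hvm (hor.imp_right fun hvn => ?_) hTb hT₀ ht i
    have hs := mul_le_one_of_small (m := 2) (c := 2 * C₂ + C) hK hQ0 (by norm_num) (by positivity)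
      (by linarith) (x := pathNorm q (Ioi 0) u + tildeNorm ψ (Ioi 0) (n / p - 1) p q v) (by
        rw [ENNReal.ofReal_add (by positivity) hC0.le, add_mul]
        gcongr) hsmall
    rwa [h2] at hs
  -- Every block decays and is dominated by its supremum in time, an ℓ^q sequence; for q < ∞ this
  -- gives decay of the norm.
  · refine tendsto_vBesovNorm_zero hq hq' (y := u) (d := fun j => ⨆ t ∈ Ioi (0 : ℝ), ‖u t j‖ₑ)
      ?_ hu.bounded ?_ (hudecay (tendsto_linPart_zero hq hF hFf hA₁z hlim))
    · filter_upwards [eventually_gt_atTop 0] with t ht using hTb t ht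
    · filter_upwards [eventually_gt_atTop 0] with t ht j
      exact le_iSup₂ (f := fun t (_ : t ∈ Ioi (0 : ℝ)) => ‖u t j‖ₑ) t ht
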